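/- Consider germs at $(\varepsilon,x,y)=(0,0,0)\in\mathbb C^3$ of holomorphic families of vector fields $v_\varepsilon=P_\varepsilon(x,y)\,\partial_x+Q_\varepsilon(x,y)\,\partial_y$ satisfying the reality condition $P_\varepsilon(x,y)=\overline{Q_{\bar\varepsilon}(\bar y,\bar x)}$ and $P_\varepsilon(x,y)=(\alpha(\varepsilon)+i\beta(\varepsilon))x+O(|(x,y)|^2)$, where $\alpha,\beta$ are germs of holomorphic functions, real for real $\varepsilon$, with $\alpha(0)=0$, $\beta(0)\ne0$ and $\alpha'(0)\neq 0$. (These are the complexifications, in the coordinates $x=a+ib$, $y=a-ib$, of the generic real analytic families unfolding a weak focus; the real plane is $\{y=\bar x\}$. The normalized case is $\alpha(\varepsilon)=\varepsilon$, $\beta\equiv1$.) The Poincaré map of such a family is the following germ of a holomorphic family $\mathcal P_\varepsilon:(\mathbb C,0)\to(\mathbb C,0)$. Blow up the origin, $(X,y)\mapsto(Xy,y)=(x,y)$. Let $\mathcal Q_\varepsilon$ be the holonomy of the blown-up foliation of $v_\varepsilon$ along the equator $\mathbb{RP}^1=\{|X|=1\}$ of the exceptional divisor, run through once from $X=1$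 in the sense of rotation of the real flow ($X=e^{i\varphi}$, $0\le\varphi\le2\pi$, if $\beta(0)>0$, and $X=e^{-i\varphi}$ if $\beta(0)<0$), on the cross-section $\Sigma=\{x=y\}$ parametrized by $x$. Then $\mathcal P_\varepsilon=\mathcal Q_\varepsilon\circ\mathcal Q_\varepsilon$. Let $v_\varepsilon$ and $w_\varepsilon$ be two such families, with Poincaré maps $\mathcal P_\varepsilon$ and $\widehat{\mathcal P}_\varepsilon$. The following are equivalent. (a) The families are analytically orbitally equivalent by a real change of coordinates: there are a germ of holomorphic diffeomorphism $h:(\mathbb C,0)\to(\mathbb C,0)$, real for real $\varepsilon$, a germ at the origin of a holomorphic family of local diffeomorphisms $\Psi_\varepsilon:(\mathbb C^2,0)\to(\mathbb C^2,0)$ that leaves the real plane $\{y=\bar x\}$ invariant for real $\varepsilon$, and a germ of holomorphic function $k_\varepsilon(x,y)$, positive at the points of the real plane for real $\varepsilon$ (that is, the orientation of the orbits by time is preserved), such that $D\Psi_\varepsilon\cdot v_\varepsilon=k_\varepsilon\cdot\bigl(w_{h(\varepsilon)}\circ\Psi_\varepsilon\bigr)$. (b) The families of Poincaré maps are analytically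 conjugate by a real conjugacy: there are a germ of holomorphic diffeomorphism $h:(\mathbb C,0)\to(\mathbb C,0)$, real for real $\varepsilon$, and a germ at the origin of a holomorphic family of local diffeomorphisms $\mathcal H_\varepsilon:(\mathbb C,0)\to(\mathbb C,0)$ that leaves the real line invariant for real $\varepsilon$, such that $\mathcal H_\varepsilon\circ\mathcal P_\varepsilon=\widehat{\mathcal P}_{h(\varepsilon)}\circ\mathcal H_\varepsilon$. -/

import Mathlib

open Filter Topology ComplexConjugate

noncomputable section

namespace WeakFocus

/-- A (representative of a) germ at the origin of a generic real analytic family unfolding a weak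
focus, in complexified form: `v_ε(x, y) = P_ε(x, y) ∂/∂x + Q_ε(x, y) ∂/∂y`, where points of
`ℂ × ℂ × ℂ` are triples `(ε, x, y)`.  It is the complexification, by `x = a + i b`, `y = a - i b`,
of the real family
`a' = α(ε) a - β(ε) b + ...`, `b' = β(ε) a + α(ε) b + ...`
with `α(0) = 0`, `β(0) ≠ 0` and `α'(0) ≠ 0` (genericity). The real plane is `{y = conj x}`. -/
structure GenericFamily where
  P : ℂ × ℂ × ℂ → ℂ
  Q : ℂ × ℂ × ℂ → ℂ
  α : ℂ → ℂ
  β : ℂ → ℂ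
  analyticAt_P : AnalyticAt ℂ P 0
  analyticAt_Q : AnalyticAt ℂ Q 0
  analyticAt_α : AnalyticAt ℂ α 0
  analyticAt_β : AnalyticAt ℂ β 0
  /-- The reality condition `P_ε(x, y) = conj (Q_{conj ε} (conj y, conj x))`. -/
  reality : ∀ᶠ p : ℂ × ℂ × ℂ in 𝓝 0, P p = conj (Q (conj p.1, conj p.2.2, conj p.2.1))
  /-- The origin is a singular point for every value of the parameter (for `Q` this follows from
  the reality condition). -/
  singular : ∀ᶠ ε : ℂ in 𝓝 0, P (ε, 0, 0) = 0
  /-- The linear part of `P_ε` at the origin is `(α(ε) + i β(ε)) x` (that of `Q_ε` is then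
  `(α(ε) - i β(ε)) y` by the reality condition). -/
  linearPart : ∀ᶠ ε : ℂ in 𝓝 0, HasFDerivAt (fun z : ℂ × ℂ => P (ε, z))
    ((α ε + Complex.I * β ε) • ContinuousLinearMap.fst ℂ ℂ ℂ) 0
  α_real : ∀ᶠ t : ℝ in 𝓝 0, (α (t : ℂ)).im = 0
  β_real : ∀ᶠ t : ℝ in 𝓝 0, (β (t : ℂ)).im = 0
  α_zero : α 0 = 0
  β_zero : β 0 ≠ 0
  generic : deriv α 0 ≠ 0

namespace GenericFamily

/-- The vector field `v_ε` at the point `(x, y)`. -/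
def field (F : GenericFamily) (p : ℂ × ℂ × ℂ) : ℂ × ℂ := (F.P p, F.Q p)

/-- The sense of rotation of the real trajectories about the origin:
`1` (counterclockwise) if `β(0) > 0` and `-1` if `β(0) < 0`. -/
def rotation (F : GenericFamily) : ℝ := Real.sign (F.β 0).re

/-- The equator `ℝP¹` of the exceptional divisor `ℂP¹`, run through once in the sense of rotation
of the real flow, in the affine coordinate `X = x / y`: the real direction `x = r exp(i θ)`,
`y = r exp(-i θ)` has `X = exp(2 i θ)`, so the equator is the circle `|X| = 1`. The direction of the
cross-section `{x = y}` is `X = 1`. -/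
def equator (F : GenericFamily) (φ : ℝ) : ℂ := Complex.exp (F.rotation * φ * Complex.I)

/-- `(X, y) = (equator φ, u φ)`, `0 ≤ φ ≤ 2π`, is the lift of the equator, starting from `X = 1`,
`y = s`, to a leaf of the foliation of `v_ε` after the blow-up `(X, y) ↦ (X y, y)`. A leaf of the
blown-up foliation either is contained in the exceptional divisor `{y = 0}` or is disjoint from it
and blows down to a leaf of `v_ε`; in that case the blown-down path `(x, y) = (X u, u)` is
everywhere tangent to `v_ε`, that is, `x' Q_ε(x, y) - y' P_ε(x, y) = 0`. -/
structure IsLift (F : GenericFamily) (ε s : ℂ) (u : ℝ → ℂ) : Prop where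
  init : u 0 = s
  leaf : (∀ φ ∈ Set.Icc 0 (2 * Real.pi), u φ = 0) ∨ (∀ φ ∈ Set.Icc 0 (2 * Real.pi), u φ ≠ 0)
  tangent : ∀ φ ∈ Set.Icc 0 (2 * Real.pi), ∃ x' y' : ℂ,
    HasDerivWithinAt (fun t => F.equator t * u t) x' (Set.Icc 0 (2 * Real.pi)) φ ∧
    HasDerivWithinAt u y' (Set.Icc 0 (2 * Real.pi)) φ ∧
    x' * F.Q (ε, F.equator φ * u φ, u φ) - y' * F.P (ε, F.equator φ * u φ, u φ) = 0

/-- The holonomy `(ε, s) ↦ 𝒬_ε(s)` along the equator, on the cross-section `Σ = {x = y}`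
parametrized by `x`: the endpoint of the lift of the equator starting from `s`. (For `(ε, s)` close
to the origin the lift exists and is unique; elsewhere the value plays no role.) -/
def holonomy (F : GenericFamily) (p : ℂ × ℂ) : ℂ :=
  Classical.epsilon (F.IsLift p.1 p.2) (2 * Real.pi)

/-- The family of complexified Poincaré maps `(ε, s) ↦ 𝒫_ε(s)` on `Σ`: the second iterate of the
holonomy along the equator. -/
def poincareMap (F : GenericFamily) (p : ℂ × ℂ) : ℂ := F.holonomy (p.1, F.holonomy p)

end GenericFamily

/-- A real analytic change of parameter fixing `0`: a germ at `0` of a holomorphic diffeomorphism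
that is real for real values of the parameter. -/
structure IsRealReparam (h : ℂ → ℂ) : Prop where
  analyticAt : AnalyticAt ℂ h 0
  map_zero : h 0 = 0
  deriv_ne : deriv h 0 ≠ 0
  real : ∀ᶠ t : ℝ in 𝓝 0, (h (t : ℂ)).im = 0

/-- The families `F` and `G` are analytically orbitally equivalent by a real change of coordinates
`(ε, (x, y)) ↦ (h(ε), Ψ_ε(x, y))`: with `v` and `w` the two families of vector fields,
`DΨ_ε · v_ε = k_ε · (w_{h(ε)} ∘ Ψ_ε)`, where `Ψ_ε` leaves the real plane `{y = conj x}` invariant for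
real `ε`, and the analytic factor `k` is positive at the real points (so that orbits are mapped to
orbits with their orientation by time). -/
def RealOrbitallyEquivalent (F G : GenericFamily) : Prop :=
  ∃ (h : ℂ → ℂ) (Ψ : ℂ × ℂ × ℂ → ℂ × ℂ) (k : ℂ × ℂ × ℂ → ℂ),
    IsRealReparam h ∧
    AnalyticAt ℂ Ψ 0 ∧
    (∀ᶠ ε : ℂ in 𝓝 0, Ψ (ε, 0, 0) = 0) ∧
    (fderiv ℂ (fun z : ℂ × ℂ => Ψ (0, z)) 0).IsInvertible ∧
    (∀ᶠ q : ℝ × ℂ in 𝓝 0,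
      (Ψ ((q.1 : ℂ), q.2, conj q.2)).2 = conj (Ψ ((q.1 : ℂ), q.2, conj q.2)).1) ∧
    AnalyticAt ℂ k 0 ∧
    (∀ᶠ q : ℝ × ℂ in 𝓝 0, 0 < (k ((q.1 : ℂ), q.2, conj q.2)).re ∧
      (k ((q.1 : ℂ), q.2, conj q.2)).im = 0) ∧
    ∀ᶠ p : ℂ × ℂ × ℂ in 𝓝 0,
      fderiv ℂ (fun z : ℂ × ℂ => Ψ (p.1, z)) p.2 (F.field p) = k p • G.field (h p.1, Ψ p)

/-- The germs of families `(ε, x) ↦ f_ε(x)` and `(ε, x) ↦ g_ε(x)` of maps fixing the origin are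
analytically conjugate by a real conjugacy `(ε, x) ↦ (h(ε), H_ε(x))`: `H_ε ∘ f_ε = g_{h(ε)} ∘ H_ε`,
where `H_ε` leaves the real line invariant for real `ε`. -/
def RealConjugate (f g : ℂ × ℂ → ℂ) : Prop :=
  ∃ (h : ℂ → ℂ) (H : ℂ × ℂ → ℂ),
    IsRealReparam h ∧
    AnalyticAt ℂ H 0 ∧
    (∀ᶠ ε : ℂ in 𝓝 0, H (ε, 0) = 0) ∧
    deriv (fun x : ℂ => H (0, x)) 0 ≠ 0 ∧
    (∀ᶠ q : ℝ × ℝ in 𝓝 0, (H ((q.1 : ℂ), (q.2 : ℂ))).im = 0) ∧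
    ∀ᶠ p : ℂ × ℂ in 𝓝 0, H (p.1, f p) = g (h p.1, H p)

end WeakFocus

end

/-! Over the equator X = exp(iφ) the blown-up foliation is a scalar equation u' = u · slope(ε, X,
u). Its denominator P/x - Q/y equals 2iβ(0) ≠ 0 at ε = 0, u = 0, for every X. Hence leaves close to
the divisor can be followed over several turns, uniquely and analytically in all data. Analyticity
is obtained by taking the whole path u = s exp v as an unknown in a space of continuous functions on
a compact set: superposition operators are analytic there, and at ε = s = 0 the integral operator no
longer depends on v, so the implicit function theorem gives an analytic fixed point
(`exists_analyticAt_fixedPoint`, `exists_transport`, `exists_leaf`). The Poincaré map is the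
displacement along a leaf over 4π (`Represents.poincareMap_eq`). Exchanging x and y reverses the
rotation and preserves the Poincaré map, so β(0) > 0 may be assumed for both families
(`exists_pos`).

From (a) to (b). Because k > 0 and both families turn the same way, the differential of Ψ at the
origin for ε = 0 is diag(a, conj a) (`Represents.exists_diagonal`), so Ψ acts on slopes near the
equator almost as a rotation (`exists_angle`). For real ε the image of a real leaf lies again over
the equator and is a real leaf of the second family (`Represents.exists_image_leaf`). The conjugacy
is: apply Ψ to a point of Σ, then slide along the leaf back to Σ. The conjugacy equation holds at
real points, and both sides are analytic, so it holds everywhere.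

From (b) to (a). Each family has two analytic invariant curves through the origin, exchanged by the
real structure (`exists_separatrix`); after a real change of coordinates they are the axes
(`Represents.exists_prepared`). By the first implication this changes the Poincaré map only by a
real conjugacy. An equivalence is then sought in the form (x, y) ↦ n · (x, y), which preserves the
slope X. Continuing the given conjugacy along leaves prescribes n over |x| = |y|, but two things are
not clear: that the result depends on X alone and not on the angle (only 𝒫 = 𝒬 ∘ 𝒬 is conjugated,
not 𝒬), and that it extends to a germ at the origin.

With invariant axes the double turn is multiplication of (x, y) by exp w, where w is a germ in (ε,
x, y) (`FolData.exists_doubleTurn`). For real ε ≠ 0 genericity puts the multiplier off the unit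
circle, so on each line x = Xy the conjugacy is determined order by order by its value at 0, and its
k-th Taylor coefficient is a polynomial of degree at most k in X (`exists_approx`,
`exists_continuation_coeff`). This settles single-valuedness, and each term becomes a homogeneous
polynomial in (x, y). The torus |x| = |y| = r lies over the equator, so the Cauchy formula on it
defines n as an analytic germ in (ε, x, y); it agrees with the continuation for real ε ≠ 0, hence
for all ε, including those without hyperbolicity (`torusMean_eq`, `exists_cauchy`). Orbital
equivalence now reduces to one scalar analytic equation, which holds over |X| = 1 and therefore
identically (`defect_eq_zero`, `eventually_eq_zero_of_circle`). -/

noncomputable section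

namespace WeakFocus

open scoped ContDiff

attribute [fun_prop] analyticAt_fst analyticAt_snd

/-! ### Analyticity of superposition operators on continuous functions -/

section Superposition

variable {K E F : Type*} [TopologicalSpace K] [CompactSpace K]
  [NormedAddCommGroup E] [NormedSpace ℂ E] [NormedAddCommGroup F] [NormedSpace ℂ F]

open Classical in
/-- The superposition (Nemytskii) operator `u ↦ f ∘ u` between spaces of continuous functions;
it takes the value `0` where `f ∘ u` is not continuous. -/
def superpose (K : Type*) [TopologicalSpace K] {E F : Type*} [TopologicalSpace E]
    [NormedAddCommGroup F] (f : E → F) (u : C(K, E)) : C(K, F) :=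
  if h : Continuous (fun k => f (u k)) then ⟨fun k => f (u k), h⟩ else 0

/-- The power series acting pointwise on continuous functions. -/
def superposeSeries (K : Type*) [TopologicalSpace K] [CompactSpace K]
    (p : FormalMultilinearSeries ℂ E F) : FormalMultilinearSeries ℂ C(K, E) C(K, F) := fun n =>
  MultilinearMap.mkContinuous
    { toFun := fun f => ⟨fun k => p n (fun i => f i k), by fun_prop⟩
      map_update_add' := by
        intro _ m i x y
        ext k
        have h : ∀ z : C(K, E), (fun j => (Function.update m i z) j k) =
            Function.update (fun j => m j k) i (z k) := by
          intro z; ext j; by_cases hj : j = i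
          · subst hj; simp
          · simp [hj]
        simp [h]
      map_update_smul' := by
        intro _ m i c x
        ext k
        have h : ∀ z : C(K, E), (fun j => (Function.update m i z) j k) =
            Function.update (fun j => m j k) i (z k) := by
          intro z; ext j; by_cases hj : j = i
          · subst hj; simp
          · simp [hj]
        simp [h] } ‖p n‖ (by
      intro m
      rw [ContinuousMap.norm_le _ (by positivity)]
      intro k
      refine ((p n).le_opNorm _).trans ?_
      gcongr with i
      exact (m i).norm_coe_le_norm k)

lemma norm_superposeSeries_le (p : FormalMultilinearSeries ℂ E F) (n : ℕ) :
    ‖superposeSeries K p n‖ ≤ ‖p n‖ :=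
  MultilinearMap.mkContinuous_norm_le _ (norm_nonneg _) _

/-- A function of small sup norm takes values in a ball on which `f` is analytic, hence continuous,
so the default value 0 of `superpose` does not occur near 0. -/
lemma eventually_superpose_apply [CompleteSpace F] {f : E → F} (hf : AnalyticAt ℂ f 0) :
    ∀ᶠ u in 𝓝 (0 : C(K, E)), ∀ k, superpose K f u k = f (u k) := by
  obtain ⟨r, hr, hc⟩ := Metric.eventually_nhds_iff_ball.1 hf.eventually_analyticAt
  filter_upwards [Metric.ball_mem_nhds _ hr] with u hu k
  have : Continuous (fun k => f (u k)) := by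
    rw [continuous_iff_continuousAt]
    intro k
    refine ContinuousAt.comp (g := f) (hc _ ?_).continuousAt u.continuous.continuousAt
    rw [mem_ball_zero_iff] at hu ⊢
    exact (u.norm_coe_le_norm k).trans_lt hu
  simp [superpose, this]

/-- The power series of `f` acts pointwise, and its terms have norm at most `‖p n‖`, so the series
of operators has at least the same radius of convergence. -/
lemma analyticAt_superpose [CompleteSpace F] {f : E → F} (hf : AnalyticAt ℂ f 0) :
    AnalyticAt ℂ (superpose K f) (0 : C(K, E)) := by
  obtain ⟨p, hp⟩ := hf
  obtain ⟨r, hp⟩ := hp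
  have hrad : p.radius ≤ (superposeSeries K p).radius :=
    FormalMultilinearSeries.radius_le_of_le (fun n => norm_superposeSeries_le p n)
  have h1 := (superposeSeries K p).hasFPowerSeriesOnBall
    ((hp.r_pos.trans_le hp.r_le).trans_le hrad)
  have h2 : AnalyticAt ℂ (superposeSeries K p).sum 0 := h1.analyticAt
  refine h2.congr ?_
  filter_upwards [eventually_superpose_apply (K := K) hp.analyticAt,
    Metric.eball_mem_nhds (0 : C(K, E)) hp.r_pos] with u hu hr
  ext k
  rw [hu k]
  have h3 : HasSum (fun n => superposeSeries K p n fun _ => u) ((superposeSeries K p).sum u) := by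
    refine (superposeSeries K p).hasSum ?_
    exact Metric.eball_subset_eball (hp.r_le.trans hrad) hr
  have h4 : HasSum (fun n => p n fun _ => u k) ((superposeSeries K p).sum u k) :=
    (ContinuousMap.hasSum_apply h3 k :)
  have h5 : u k ∈ Metric.eball (0 : E) r := by
    have := u.norm_coe_le_norm k
    simp only [Metric.mem_eball, edist_zero_right] at hr ⊢
    refine lt_of_le_of_lt ?_ hr
    simpa [enorm_le_iff_norm_le] using this
  have h6 := hp.hasSum h5
  rw [zero_add] at h6
  exact h4.unique h6

end Superposition

/-! ### Analytic fixed points from the implicit function theorem -/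

section FixedPoint

variable {E V : Type*} [NormedAddCommGroup E] [NormedSpace ℂ E] [CompleteSpace E]
  [NormedAddCommGroup V] [NormedSpace ℂ V] [CompleteSpace V]

/-- The fixed point of a family of analytic maps that is constant for one value of the parameter. -/
lemma exists_analyticAt_fixedPoint {T : E × V → V} {p₀ : E} {v₀ : V}
    (hT : AnalyticAt ℂ T (p₀, v₀)) (hc : ∀ v, T (p₀, v) = v₀) :
    ∃ S : E → V, AnalyticAt ℂ S p₀ ∧ S p₀ = v₀ ∧ (∀ᶠ p in 𝓝 p₀, T (p, S p) = S p) ∧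
      ∀ᶠ q in 𝓝 (p₀, v₀), T q = q.2 → S q.1 = q.2 := by
  have hf : AnalyticAt ℂ (fun q : E × V => T q - q.2) (p₀, v₀) := hT.sub analyticAt_snd
  -- At `p₀` the map is v ↦ v₀ - v, so its partial derivative is -id. No contraction or smallness
  -- estimate is needed.
  have hd : fderiv ℂ (fun q : E × V => T q - q.2) (p₀, v₀) ∘L .inr ℂ E V
      = -ContinuousLinearMap.id ℂ V := by
    have h1 : HasFDerivAt (fun v : V => T (p₀, v) - v)
        (fderiv ℂ (fun q : E × V => T q - q.2) (p₀, v₀) ∘L .inr ℂ E V) v₀ :=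
      hf.differentiableAt.hasFDerivAt.comp (f := fun v : V => (p₀, v)) v₀
        (hasFDerivAt_prodMk_right p₀ v₀)
    have h2 : HasFDerivAt (fun v : V => T (p₀, v) - v) (-ContinuousLinearMap.id ℂ V) v₀ := by
      simp only [hc]
      exact (hasFDerivAt_id v₀).const_sub v₀
    exact h1.unique h2
  have hi : (fderiv ℂ (fun q : E × V => T q - q.2) (p₀, v₀) ∘L .inr ℂ E V).IsInvertible := by
    rw [hd]
    exact ⟨ContinuousLinearEquiv.neg ℂ, by ext; simp⟩
  have hf' : ContDiffAt ℂ ω (fun q : E × V => T q - q.2) (p₀, v₀) := hf.contDiffAt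
  have h0 : T (p₀, v₀) - v₀ = 0 := by rw [hc, sub_self]
  refine ⟨hf'.implicitFunction (by simp) hi, ?_, hf'.implicitFunction_apply_self _ hi, ?_, ?_⟩
  · exact (hf'.contDiffAt_implicitFunction (by simp) hi).analyticAt
  · filter_upwards [hf'.eventually_apply_implicitFunction (by simp) hi] with p hp
    simp only [h0] at hp
    exact sub_eq_zero.1 hp
  · filter_upwards [hf'.eventually_apply_eq_iff_implicitFunction (by simp) hi] with q hq h
    refine hq.1 ?_
    simp only [h0, h, sub_self]

end FixedPoint

end WeakFocus

end

/-! ### Conjugate germs, integral operators, Hadamard's lemma, identity principle -/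

noncomputable section

namespace WeakFocus

section Conj

variable {E : Type*} [NormedAddCommGroup E] [NormedSpace ℂ E]

/-- The conjugate of a power series by a conjugate-linear isometric involution of the source and
complex conjugation of the target. -/
lemma analyticAt_conj_conj {f : E → ℂ} (hf : AnalyticAt ℂ f 0) (σ : E ≃ₗᵢ⋆[ℂ] E) :
    AnalyticAt ℂ (fun z => conj (f (σ z))) 0 := by
  obtain ⟨p, r, hp⟩ := hf
  let q : FormalMultilinearSeries ℂ E ℂ := fun n =>
    MultilinearMap.mkContinuous
      { toFun := fun m => conj (p n (fun i => σ (m i)))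
        map_update_add' := by
          intro _ m i x y
          have h : ∀ z : E, (fun j => σ (Function.update m i z j)) =
              Function.update (fun j => σ (m j)) i (σ z) := by
            intro z; ext j; by_cases hj : j = i
            · subst hj; simp
            · simp [hj]
          simp [h]
        map_update_smul' := by
          intro _ m i c x
          have h : ∀ z : E, (fun j => σ (Function.update m i z j)) =
              Function.update (fun j => σ (m j)) i (σ z) := by
            intro z; ext j; by_cases hj : j = i
            · subst hj; simp
            · simp [hj]
          simp [h, map_smulₛₗ] } ‖p n‖ (by
        intro m
        simp only [MultilinearMap.coe_mk, RCLike.norm_conj]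
        refine ((p n).le_opNorm _).trans (le_of_eq ?_)
        simp)
  have hq : ∀ n, ‖q n‖ ≤ ‖p n‖ := fun n => MultilinearMap.mkContinuous_norm_le _ (norm_nonneg _) _
  refine ⟨q, r, hp.r_le.trans (FormalMultilinearSeries.radius_le_of_le hq), hp.r_pos, ?_⟩
  intro y hy
  have hy' : σ y ∈ Metric.eball (0 : E) r := by
    simpa [Metric.mem_eball, edist_zero_right, enorm_eq_nnnorm] using hy
  have h := hp.hasSum hy'
  rw [zero_add] at h ⊢
  exact (Complex.hasSum_conj'.2 (by simpa using h) :)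

end Conj

section Integral

open MeasureTheory unitInterval

variable {L : Type*} [TopologicalSpace L] [CompactSpace L]

variable {G : Type*} [NormedAddCommGroup G] [NormedSpace ℂ G]

/-- The mean value over the unit interval, as a continuous linear map. -/
def meanCLM (G : Type*) [NormedAddCommGroup G] [NormedSpace ℂ G] :
    C(unitInterval, G) →L[ℂ] G :=
  LinearMap.mkContinuous
    { toFun := fun f => ∫ t in (0 : ℝ)..1, f (Set.projIcc 0 1 zero_le_one t)
      map_add' := fun f g => intervalIntegral.integral_add
        (Continuous.intervalIntegrable (by fun_prop) _ _)
        (Continuous.intervalIntegrable (by fun_prop) _ _)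
      map_smul' := fun c f => intervalIntegral.integral_smul c _ } 1 (by
    intro f
    have := intervalIntegral.norm_integral_le_of_norm_le_const (a := 0) (b := 1) (C := ‖f‖)
      (f := fun t => f (Set.projIcc 0 1 zero_le_one t)) (fun t _ => f.norm_coe_le_norm _)
    simpa using this)

lemma meanCLM_apply (f : C(unitInterval, G)) :
    meanCLM G f = ∫ t in (0 : ℝ)..1, f (Set.projIcc 0 1 zero_le_one t) := rfl

/-- The Volterra operator `f ↦ ∫₀ᵗ f(l, s) ds`. -/
def volterra (L : Type*) [TopologicalSpace L] [CompactSpace L] :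
    C(L × unitInterval, ℂ) →L[ℂ] C(L × unitInterval, ℂ) :=
  LinearMap.mkContinuous
    { toFun := fun f => ⟨fun p => ∫ s in (0 : ℝ)..1,
          ((p.2 : ℝ) : ℂ) * f (p.1, p.2 * Set.projIcc 0 1 zero_le_one s), by
        refine intervalIntegral.continuous_parametric_intervalIntegral_of_continuous' ?_ _ _
        fun_prop⟩
      map_add' := by
        intro f g
        ext p
        simp only [ContinuousMap.add_apply, mul_add, ContinuousMap.coe_mk]
        exact intervalIntegral.integral_add
          (Continuous.intervalIntegrable (by fun_prop) _ _)
          (Continuous.intervalIntegrable (by fun_prop) _ _)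
      map_smul' := by
        intro c f
        ext p
        simp only [ContinuousMap.smul_apply, ContinuousMap.coe_mk, RingHom.id_apply, smul_eq_mul]
        rw [← intervalIntegral.integral_const_mul]
        congr 1; ext s; ring } 1 (by
    intro f
    rw [ContinuousMap.norm_le _ (by positivity)]
    intro p
    have := intervalIntegral.norm_integral_le_of_norm_le_const (a := 0) (b := 1) (C := ‖f‖)
      (f := fun s => ((p.2 : ℝ) : ℂ) * f (p.1, p.2 * Set.projIcc 0 1 zero_le_one s))
      (fun t _ => by
        rw [norm_mul]
        have h1 : ‖((p.2 : ℝ) : ℂ)‖ ≤ 1 := by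
          rw [Complex.norm_real, Real.norm_eq_abs, abs_of_nonneg p.2.2.1]; exact p.2.2.2
        calc _ ≤ 1 * ‖f‖ := by
              gcongr
              exact f.norm_coe_le_norm _
          _ = ‖f‖ := one_mul _)
    simpa using this)

/-- The operator is defined by an integral over the fixed interval [0, 1], which makes the result
jointly continuous; the substitution s ↦ t s restores the usual form. -/
lemma volterra_apply (f : C(L × unitInterval, ℂ)) (l : L) (t : unitInterval) :
    volterra L f (l, t) = ∫ s in (0 : ℝ)..t, f (l, Set.projIcc 0 1 zero_le_one s) := by
  have h : volterra L f (l, t) = ∫ s in (0 : ℝ)..1,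
      ((t : ℝ) : ℂ) * f (l, t * Set.projIcc 0 1 zero_le_one s) := rfl
  rw [h, intervalIntegral.integral_const_mul]
  have h2 := intervalIntegral.smul_integral_comp_mul_left (a := 0) (b := 1)
    (fun s => f (l, Set.projIcc 0 1 zero_le_one s)) (t : ℝ)
  rw [mul_zero, mul_one] at h2
  rw [← h2, Complex.real_smul]
  congr 1
  refine intervalIntegral.integral_congr ?_
  intro s hs
  rw [Set.uIcc_of_le zero_le_one] at hs
  have h3 : (t : ℝ) * s ∈ Set.Icc (0 : ℝ) 1 := ⟨mul_nonneg t.2.1 hs.1, mul_le_one₀ t.2.2 hs.1 hs.2⟩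
  simp only [Set.projIcc_of_mem zero_le_one hs, Set.projIcc_of_mem zero_le_one h3]
  rfl

lemma hasDerivWithinAt_volterra (f : C(L × unitInterval, ℂ)) (l : L) {t : ℝ}
    (ht : t ∈ Set.Icc (0 : ℝ) 1) :
    HasDerivWithinAt (fun s => volterra L f (l, Set.projIcc 0 1 zero_le_one s))
      (f (l, Set.projIcc 0 1 zero_le_one t)) (Set.Icc 0 1) t := by
  have h1 : HasDerivAt (fun u => ∫ s in (0 : ℝ)..u, f (l, Set.projIcc 0 1 zero_le_one s))
      (f (l, Set.projIcc 0 1 zero_le_one t)) t :=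
    intervalIntegral.integral_hasDerivAt_right
      (Continuous.intervalIntegrable (by fun_prop) _ _)
      (Continuous.stronglyMeasurableAtFilter (by fun_prop) _ _)
      (Continuous.continuousAt (by fun_prop))
  refine h1.hasDerivWithinAt.congr_of_mem ?_ ht
  intro s hs
  rw [volterra_apply, Set.projIcc_of_mem zero_le_one hs]

end Integral

section Hadamard

variable {E Z F : Type*} [NormedAddCommGroup E] [NormedSpace ℂ E]
  [NormedAddCommGroup Z] [NormedSpace ℂ Z]
  [NormedAddCommGroup F] [NormedSpace ℂ F] [CompleteSpace F]

open unitInterval in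
/-- Hadamard's lemma for analytic maps. -/
lemma exists_analyticAt_hadamard {f : E × Z → F} (hf : AnalyticAt ℂ f 0) :
    ∃ D : E × Z → (Z →L[ℂ] F), AnalyticAt ℂ D 0 ∧
      (∀ᶠ p in 𝓝 (0 : E × Z), f p = f (p.1, 0) + D p p.2) ∧
      ∀ᶠ e in 𝓝 (0 : E), D (e, 0) = fderiv ℂ f (e, 0) ∘L .inr ℂ E Z := by
  let g : E × Z → (Z →L[ℂ] F) := fun p => fderiv ℂ f p ∘L .inr ℂ E Z
  have hg : AnalyticAt ℂ g 0 :=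
    ((ContinuousLinearMap.compL ℂ Z (E × Z) F).flip (.inr ℂ E Z)).analyticAt _ |>.comp hf.fderiv
  -- `A p` is the segment from (e, 0) to p. The quotient is the mean of the partial derivative over
  -- this segment, so it is analytic as a superposition operator between continuous linear maps.
  let A : (E × Z) →L[ℂ] C(unitInterval, E × Z) :=
    LinearMap.mkContinuous
      { toFun := fun p => ⟨fun t => (p.1, ((t : ℝ) : ℂ) • p.2), by fun_prop⟩
        map_add' := by intro p q; ext t <;> simp
        map_smul' := by
          intro c p; ext t
          · simp
          · simp [smul_comm c] } 1 (by
      intro p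
      rw [ContinuousMap.norm_le _ (by positivity)]
      intro t
      have h1 : ‖((t : ℝ) : ℂ)‖ ≤ 1 := by
        rw [Complex.norm_real, Real.norm_eq_abs, abs_of_nonneg t.2.1]; exact t.2.2
      rw [one_mul]
      refine norm_prod_le_iff.2 ⟨norm_fst_le p, ?_⟩
      change ‖((t : ℝ) : ℂ) • p.2‖ ≤ _
      rw [norm_smul]
      calc _ ≤ 1 * ‖p‖ := by gcongr; exact norm_snd_le p
        _ = _ := one_mul _)
  refine ⟨fun p => meanCLM _ (superpose unitInterval g (A p)), ?_, ?_, ?_⟩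
  · refine ((meanCLM (Z →L[ℂ] F)).analyticAt _).comp (g := meanCLM (Z →L[ℂ] F))
      (f := fun p => superpose unitInterval g (A p)) ?_
    refine AnalyticAt.comp (g := superpose unitInterval g) (f := A) ?_ (A.analyticAt _)
    rw [map_zero]
    exact analyticAt_superpose hg
  · obtain ⟨r, hr, hc⟩ := Metric.eventually_nhds_iff_ball.1 hf.eventually_analyticAt
    have hA : Tendsto A (𝓝 0) (𝓝 0) := by
      have := A.continuous.tendsto 0; rwa [map_zero] at this
    filter_upwards [hA.eventually (eventually_superpose_apply hg), Metric.ball_mem_nhds _ hr]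
      with p hp hpr
    rw [meanCLM_apply]
    have hmem : ∀ t ∈ Set.uIcc (0 : ℝ) 1, (p.1, (t : ℂ) • p.2) ∈ Metric.ball (0 : E × Z) r := by
      intro t ht
      rw [Set.uIcc_of_le zero_le_one] at ht
      rw [mem_ball_zero_iff] at hpr ⊢
      refine lt_of_le_of_lt (norm_prod_le_iff.2 ⟨norm_fst_le p, ?_⟩) hpr
      change ‖(t : ℂ) • p.2‖ ≤ _
      rw [norm_smul, Complex.norm_real, Real.norm_eq_abs, abs_of_nonneg ht.1]
      calc _ ≤ 1 * ‖p‖ := by gcongr; exacts [ht.2, norm_snd_le p]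
        _ = _ := one_mul _
    have hderiv : ∀ t ∈ Set.uIcc (0 : ℝ) 1,
        HasDerivAt (fun t : ℝ => f (p.1, (t : ℂ) • p.2)) (g (p.1, (t : ℂ) • p.2) p.2) t := by
      intro t ht
      have h1 := (hc _ (hmem t ht)).differentiableAt.hasFDerivAt
      have h2 : HasDerivAt (fun t : ℝ => (p.1, (t : ℂ) • p.2)) ((0 : E), p.2) t := by
        refine HasDerivAt.prodMk (hasDerivAt_const _ _) ?_
        simpa using ((hasDerivAt_id t).ofReal_comp.smul_const p.2)
      exact ((h1.restrictScalars ℝ).comp_hasDerivAt t h2 :)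
    have hcont : Continuous fun t : ℝ =>
        superpose unitInterval g (A p) (Set.projIcc 0 1 zero_le_one t) := by fun_prop
    have heq : ∀ t ∈ Set.uIcc (0 : ℝ) 1,
        superpose unitInterval g (A p) (Set.projIcc 0 1 zero_le_one t) p.2
          = g (p.1, (t : ℂ) • p.2) p.2 := by
      intro t ht
      rw [Set.uIcc_of_le zero_le_one] at ht
      rw [hp, Set.projIcc_of_mem zero_le_one ht]
      rfl
    have h3 := intervalIntegral.integral_eq_sub_of_hasDerivAt hderiv
      (((hcont.clm_apply continuous_const).continuousOn.congr
        (fun t ht => (heq t ht).symm)).intervalIntegrable)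
    rw [ContinuousLinearMap.intervalIntegral_apply (hcont.intervalIntegrable _ _),
      intervalIntegral.integral_congr heq, h3]
    simp
  · have hA : Tendsto (fun e : E => A (e, 0)) (𝓝 0) (𝓝 0) := by
      have : Continuous fun e : E => A (e, 0) := by fun_prop
      have := this.tendsto 0
      rwa [show ((0 : E), (0 : Z)) = 0 from rfl, map_zero] at this
    filter_upwards [hA.eventually (eventually_superpose_apply hg)] with e he
    rw [meanCLM_apply]
    have : ∀ t, superpose unitInterval g (A (e, 0)) t = g (e, 0) := by
      intro t
      rw [he]
      congr 1
      exact Prod.ext rfl (smul_zero _)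
    simp [this, g]

end Hadamard

section Identity

lemma prod_norm_lt_iff {E F : Type*} [NormedAddCommGroup E] [NormedAddCommGroup F] {p : E × F}
    {r : ℝ} : ‖p‖ < r ↔ ‖p.1‖ < r ∧ ‖p.2‖ < r := by
  rw [Prod.norm_def, max_lt_iff]

/-- An analytic function of one variable vanishing at the real points vanishes. -/
lemma eqOn_zero_ball_of_real {f : ℂ → ℂ} {r : ℝ} (hf : AnalyticOnNhd ℂ f (Metric.ball 0 r))
    (h0 : ∀ᶠ t : ℝ in 𝓝[≠] 0, f t = 0) {z : ℂ} (hz : z ∈ Metric.ball (0 : ℂ) r) : f z = 0 := by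
  have hr : 0 < r := dist_nonneg.trans_lt (Metric.mem_ball.1 hz)
  refine hf.eqOn_zero_of_preconnected_of_frequently_eq_zero
    (convex_ball _ _).isPreconnected (Metric.mem_ball_self hr) ?_ hz
  have : Tendsto (fun t : ℝ => (t : ℂ)) (𝓝[≠] 0) (𝓝[≠] 0) := by
    refine tendsto_nhdsWithin_iff.2 ⟨?_, ?_⟩
    · exact (Complex.continuous_ofReal.tendsto' 0 0 (by simp)).mono_left nhdsWithin_le_nhds
    · filter_upwards [self_mem_nhdsWithin] with t ht
      simpa using ht
  exact this.frequently h0.frequently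

/-- An analytic function of two variables vanishing at the real points vanishes. -/
lemma eventually_zero_of_real {f : ℂ × ℂ → ℂ} (hf : AnalyticAt ℂ f 0)
    (h0 : ∀ᶠ q : ℝ × ℝ in 𝓝 0, f (q.1, q.2) = 0) : ∀ᶠ p in 𝓝 0, f p = 0 := by
  obtain ⟨r, hr, hc⟩ := Metric.eventually_nhds_iff_ball.1 hf.eventually_analyticAt
  obtain ⟨s, hs, h0⟩ := Metric.eventually_nhds_iff_ball.1 h0
  have hmem : ∀ {a b : ℂ}, a ∈ Metric.ball (0 : ℂ) r → b ∈ Metric.ball (0 : ℂ) r →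
      (a, b) ∈ Metric.ball (0 : ℂ × ℂ) r := by
    intro a b ha hb
    rw [mem_ball_zero_iff] at *
    exact prod_norm_lt_iff.2 ⟨ha, hb⟩
  -- The variables are complexified one at a time: here the first is still real and the second
  -- becomes complex.
  have h1 : ∀ t : ℝ, |t| < min r s → ∀ z ∈ Metric.ball (0 : ℂ) r, f (t, z) = 0 := by
    intro t ht z hz
    have htr : (t : ℂ) ∈ Metric.ball (0 : ℂ) r := by
      simpa using ht.trans_le (min_le_left _ _)
    refine eqOn_zero_ball_of_real (f := fun z => f (t, z)) (r := r) ?_ ?_ hz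
    · intro w hw
      exact (hc _ (hmem htr hw)).comp₂ analyticAt_const analyticAt_id
    · have : ∀ᶠ u : ℝ in 𝓝 0, |u| < s := by
        filter_upwards [Metric.ball_mem_nhds (0 : ℝ) hs] with u hu
        simpa using hu
      filter_upwards [nhdsWithin_le_nhds this] with u hu
      refine h0 (t, u) ?_
      rw [mem_ball_zero_iff]
      exact prod_norm_lt_iff.2 ⟨ht.trans_le (min_le_right _ _), hu⟩
  filter_upwards [Metric.ball_mem_nhds _ hr] with p hp
  rw [mem_ball_zero_iff] at hp
  have hp2 := prod_norm_lt_iff.1 hp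
  refine eqOn_zero_ball_of_real (f := fun z => f (z, p.2)) (r := r) ?_ ?_
    (z := p.1) (by simpa using hp2.1)
  · intro w hw
    exact (hc _ (hmem hw (by simpa using hp2.2))).comp₂ analyticAt_id analyticAt_const
  · have : ∀ᶠ u : ℝ in 𝓝 0, |u| < min r s := by
      filter_upwards [Metric.ball_mem_nhds (0 : ℝ) (lt_min hr hs)] with u hu
      simpa using hu
    filter_upwards [nhdsWithin_le_nhds this] with u hu
    exact h1 u hu _ (by simpa using hp2.2)

end Identity

end WeakFocus

end

/-! ### The equation of the leaves over the equator, and uniqueness -/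

noncomputable section

namespace WeakFocus

/-- Analytic data of a family of foliations `P dy = Q dx` with `P = x p₁ + y p₂` and
`Q = x q₁ + y q₂`, rotating counterclockwise on the real plane. -/
structure FolData where
  p1 : ℂ × ℂ × ℂ → ℂ
  p2 : ℂ × ℂ × ℂ → ℂ
  q1 : ℂ × ℂ × ℂ → ℂ
  q2 : ℂ × ℂ × ℂ → ℂ
  b : ℝ
  analyticAt_p1 : AnalyticAt ℂ p1 0
  analyticAt_p2 : AnalyticAt ℂ p2 0
  analyticAt_q1 : AnalyticAt ℂ q1 0
  analyticAt_q2 : AnalyticAt ℂ q2 0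
  b_pos : 0 < b
  p1_zero : p1 0 = Complex.I * b
  p2_zero : p2 0 = 0
  q1_zero : q1 0 = 0
  q2_zero : q2 0 = -(Complex.I * b)
  real1 : ∀ᶠ p : ℂ × ℂ × ℂ in 𝓝 0, p1 p = conj (q2 (conj p.1, conj p.2.2, conj p.2.1))
  real2 : ∀ᶠ p : ℂ × ℂ × ℂ in 𝓝 0, p2 p = conj (q1 (conj p.1, conj p.2.2, conj p.2.1))

namespace FolData

variable (D : FolData)

/-- `Q / y` in the blow-up chart `(x, y) = (X u, u)`. -/
def num (ε X u : ℂ) : ℂ := X * D.q1 (ε, X * u, u) + D.q2 (ε, X * u, u)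

/-- `P / x - Q / y` in the blow-up chart `(x, y) = (X u, u)`. -/
def den (ε X u : ℂ) : ℂ :=
  D.p1 (ε, X * u, u) + X⁻¹ * D.p2 (ε, X * u, u) - X * D.q1 (ε, X * u, u) - D.q2 (ε, X * u, u)

/-- The leaves are the solutions of `u' = u * slope ε X u`, where `X = exp (i φ)`. -/
def slope (ε X u : ℂ) : ℂ := Complex.I * D.num ε X u / D.den ε X u

lemma I_mul_b_ne : Complex.I * (D.b : ℂ) ≠ 0 :=
  mul_ne_zero Complex.I_ne_zero (by exact_mod_cast D.b_pos.ne')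

lemma den_zero (X : ℂ) : D.den 0 X 0 = 2 * (Complex.I * D.b) := by
  have h : ((0 : ℂ), X * (0 : ℂ), (0 : ℂ)) = 0 := by simp
  simp only [den, h, D.q1_zero, D.q2_zero, D.p1_zero, D.p2_zero]; ring

lemma den_zero_ne (X : ℂ) : D.den 0 X 0 ≠ 0 := by
  rw [den_zero]; exact mul_ne_zero two_ne_zero D.I_mul_b_ne

lemma analyticAt_chart {f : ℂ × ℂ × ℂ → ℂ} (hf : AnalyticAt ℂ f 0) (X₀ : ℂ) :
    AnalyticAt ℂ (fun p : ℂ × ℂ × ℂ => f (p.1, p.2.1 * p.2.2, p.2.2)) (0, X₀, 0) := by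
  exact AnalyticAt.comp_of_eq (f := fun p : ℂ × ℂ × ℂ => (p.1, p.2.1 * p.2.2, p.2.2)) hf
    (by fun_prop) (by simp)

lemma analyticAt_num (X₀ : ℂ) :
    AnalyticAt ℂ (fun p : ℂ × ℂ × ℂ => D.num p.1 p.2.1 p.2.2) (0, X₀, 0) := by
  have h1 := analyticAt_chart D.analyticAt_q1 X₀
  have h2 := analyticAt_chart D.analyticAt_q2 X₀
  have hX : AnalyticAt ℂ (fun p : ℂ × ℂ × ℂ => p.2.1) (0, X₀, 0) := by fun_prop
  exact (hX.mul h1).add h2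

lemma analyticAt_den {X₀ : ℂ} (h0 : X₀ ≠ 0) :
    AnalyticAt ℂ (fun p : ℂ × ℂ × ℂ => D.den p.1 p.2.1 p.2.2) (0, X₀, 0) := by
  have h1 := analyticAt_chart D.analyticAt_q1 X₀
  have h2 := analyticAt_chart D.analyticAt_q2 X₀
  have h3 := analyticAt_chart D.analyticAt_p1 X₀
  have h4 := analyticAt_chart D.analyticAt_p2 X₀
  have hX : AnalyticAt ℂ (fun p : ℂ × ℂ × ℂ => p.2.1) (0, X₀, 0) := by fun_prop
  exact ((h3.add ((hX.inv h0).mul h4)).sub (hX.mul h1)).sub h2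

lemma analyticAt_slope {X₀ : ℂ} (h0 : X₀ ≠ 0) :
    AnalyticAt ℂ (fun p : ℂ × ℂ × ℂ => D.slope p.1 p.2.1 p.2.2) (0, X₀, 0) :=
  (analyticAt_const.mul (D.analyticAt_num X₀)).div (D.analyticAt_den h0) (D.den_zero_ne X₀)

/-- At ε = u = 0 the denominator is 2ib whatever X is. Local bounds for the analytic right-hand side
are glued over the compact circle, which gives one radius and one constant for all slopes. -/
lemma exists_lipschitz : ∃ δ > 0, ∃ K : NNReal, ∀ ε : ℂ, ‖ε‖ < δ →
    ∀ X ∈ Metric.sphere (0 : ℂ) 1,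
      LipschitzOnWith K (fun u => u * D.slope ε X u) (Metric.ball 0 δ) ∧
      ∀ u ∈ Metric.ball (0 : ℂ) δ, D.den ε X u ≠ 0 := by
  refine (isCompact_sphere (0 : ℂ) 1).induction_on
    (p := fun s => ∃ δ > 0, ∃ K : NNReal, ∀ ε : ℂ, ‖ε‖ < δ → ∀ X ∈ s,
      LipschitzOnWith K (fun u => u * D.slope ε X u) (Metric.ball 0 δ) ∧
      ∀ u ∈ Metric.ball (0 : ℂ) δ, D.den ε X u ≠ 0)
    ⟨1, one_pos, 0, by simp⟩ ?_ ?_ ?_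
  · rintro s t hst ⟨δ, hδ, K, h⟩
    exact ⟨δ, hδ, K, fun ε hε X hX => h ε hε X (hst hX)⟩
  · rintro s t ⟨δ, hδ, K, h⟩ ⟨δ', hδ', K', h'⟩
    refine ⟨min δ δ', lt_min hδ hδ', max K K', ?_⟩
    rintro ε hε X (hX | hX)
    · obtain ⟨h1, h2⟩ := h ε (hε.trans_le (min_le_left _ _)) X hX
      have hsub := Metric.ball_subset_ball (x := (0 : ℂ)) (min_le_left δ δ')
      exact ⟨(h1.mono hsub).weaken (le_max_left _ _), fun u hu => h2 u (hsub hu)⟩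
    · obtain ⟨h1, h2⟩ := h' ε (hε.trans_le (min_le_right _ _)) X hX
      have hsub := Metric.ball_subset_ball (x := (0 : ℂ)) (min_le_right δ δ')
      exact ⟨(h1.mono hsub).weaken (le_max_right _ _), fun u hu => h2 u (hsub hu)⟩
  · intro X₀ hX₀
    have h0 : X₀ ≠ 0 := by rintro rfl; simp at hX₀
    have hsnd : AnalyticAt ℂ (fun p : ℂ × ℂ × ℂ => p.2.2) (0, X₀, 0) := by fun_prop
    obtain ⟨K, t, ht, hL⟩ := ((hsnd.mul (D.analyticAt_slope h0)).contDiffAt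
      (n := 1)).exists_lipschitzOnWith
    have hd := (D.analyticAt_den h0).continuousAt.eventually_ne (D.den_zero_ne X₀)
    obtain ⟨δ, hδ, hsub⟩ := Metric.mem_nhds_iff.1 (inter_mem ht hd)
    refine ⟨Metric.ball X₀ δ, mem_nhdsWithin_of_mem_nhds (Metric.ball_mem_nhds _ hδ), δ, hδ, K, ?_⟩
    intro ε hε X hX
    have hmem : ∀ u ∈ Metric.ball (0 : ℂ) δ, (ε, X, u) ∈ Metric.ball ((0 : ℂ), X₀, (0 : ℂ)) δ := by
      intro u hu
      simp only [Metric.mem_ball, Prod.dist_eq, max_lt_iff] at hX hu ⊢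
      exact ⟨by simpa using hε, hX, hu⟩
    refine ⟨?_, fun u hu => (hsub (hmem u hu)).2⟩
    intro u hu u' hu'
    refine (hL (hsub (hmem u hu)).1 (hsub (hmem u' hu')).1).trans_eq ?_
    congr 1
    simp [Prod.edist_eq]

/-- A radius in which the leaves are determined by their initial values. -/
def rad : ℝ := Classical.choose D.exists_lipschitz

lemma rad_pos : 0 < D.rad := (Classical.choose_spec D.exists_lipschitz).1

/-- `w` parametrizes a piece of a leaf over the path `t ↦ exp (i θ t)` in the equator. -/
def IsSol (ε : ℂ) (c d : ℝ) (θ θ' : ℝ → ℝ) (w : ℝ → ℂ) : Prop :=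
  ∀ t ∈ Set.Icc c d, ‖w t‖ < D.rad ∧ HasDerivWithinAt θ (θ' t) (Set.Icc c d) t ∧
    HasDerivWithinAt w
      (θ' t * (w t * D.slope ε (Complex.exp (Complex.I * θ t)) (w t))) (Set.Icc c d) t

variable {D}

lemma exp_I_mem_sphere (t : ℝ) : Complex.exp (Complex.I * t) ∈ Metric.sphere (0 : ℂ) 1 := by
  rw [mul_comm, mem_sphere_zero_iff_norm]
  exact Complex.norm_exp_ofReal_mul_I t

lemma den_ne {ε X u : ℂ} (hε : ‖ε‖ < D.rad) (hX : X ∈ Metric.sphere (0 : ℂ) 1) (hu : ‖u‖ < D.rad) :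
    D.den ε X u ≠ 0 := by
  obtain ⟨K, hK⟩ := (Classical.choose_spec D.exists_lipschitz).2
  exact (hK ε hε X hX).2 u (by rw [mem_ball_zero_iff]; exact hu)

/-- Grönwall uniqueness, applied forwards and backwards from `t₀`. The bound on the speed θ' turns
the Lipschitz constant in u into one for the equation in time. -/
lemma IsSol.eqOn {ε : ℂ} {c d M t₀ : ℝ} {θ θ' : ℝ → ℝ} {w₁ w₂ : ℝ → ℂ} (hε : ‖ε‖ < D.rad)
    (h₁ : D.IsSol ε c d θ θ' w₁) (h₂ : D.IsSol ε c d θ θ' w₂)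
    (hM : ∀ t ∈ Set.Icc c d, |θ' t| ≤ M)
    (ht₀ : t₀ ∈ Set.Icc c d) (h0 : w₁ t₀ = w₂ t₀) : Set.EqOn w₁ w₂ (Set.Icc c d) := by
  obtain ⟨K, hK⟩ := (Classical.choose_spec D.exists_lipschitz).2
  let v : ℝ → ℂ → ℂ := fun t w => θ' t * (w * D.slope ε (Complex.exp (Complex.I * θ t)) w)
  have hv : ∀ t ∈ Set.Icc c d, LipschitzOnWith (M.toNNReal * K) (v t) (Metric.ball 0 D.rad) := by
    intro t ht x hx y hy
    have h1 := (hK ε hε _ (exp_I_mem_sphere (θ t))).1 hx hy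
    have h2 : edist (v t x) (v t y) = ‖θ' t‖ₑ * edist
        (x * D.slope ε (Complex.exp (Complex.I * θ t)) x)
        (y * D.slope ε (Complex.exp (Complex.I * θ t)) y) := by
      rw [edist_eq_enorm_sub, edist_eq_enorm_sub, ← mul_sub, enorm_mul]
      simp [enorm_eq_nnnorm]
    rw [h2, ENNReal.coe_mul, mul_assoc]
    gcongr
    rw [enorm_le_coe, ← NNReal.coe_le_coe, coe_nnnorm, Real.norm_eq_abs]
    exact (hM t ht).trans (Real.le_coe_toNNReal M)
  have hc1 : ContinuousOn w₁ (Set.Icc c d) := fun t ht => (h₁ t ht).2.2.continuousWithinAt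
  have hc2 : ContinuousOn w₂ (Set.Icc c d) := fun t ht => (h₂ t ht).2.2.continuousWithinAt
  intro t ht
  rcases le_total t₀ t with h | h
  · have hs : Set.Icc t₀ d ⊆ Set.Icc c d := Set.Icc_subset_Icc_left ht₀.1
    have hder : ∀ {w : ℝ → ℂ}, D.IsSol ε c d θ θ' w → ∀ s ∈ Set.Ico t₀ d,
        HasDerivWithinAt w (v s (w s)) (Set.Ici s) s := by
      intro w hw s hs'
      have hs2 := hs (Set.Ico_subset_Icc_self hs')
      refine (hw s hs2).2.2.mono_of_mem_nhdsWithin ?_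
      exact mem_of_superset (Icc_mem_nhdsGE hs'.2) (Set.Icc_subset_Icc_left hs2.1)
    exact ODE_solution_unique_of_mem_Icc_right
      (fun s hs' => hv s (hs (Set.Ico_subset_Icc_self hs')))
      (hc1.mono hs) (hder h₁)
      (fun s hs' => by simpa using (h₁ s (hs (Set.Ico_subset_Icc_self hs'))).1)
      (hc2.mono hs) (hder h₂)
      (fun s hs' => by simpa using (h₂ s (hs (Set.Ico_subset_Icc_self hs'))).1) h0 ⟨h, ht.2⟩
  · have hs : Set.Icc c t₀ ⊆ Set.Icc c d := Set.Icc_subset_Icc_right ht₀.2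
    have hder : ∀ {w : ℝ → ℂ}, D.IsSol ε c d θ θ' w → ∀ s ∈ Set.Ioc c t₀,
        HasDerivWithinAt w (v s (w s)) (Set.Iic s) s := by
      intro w hw s hs'
      have hs2 := hs (Set.Ioc_subset_Icc_self hs')
      refine (hw s hs2).2.2.mono_of_mem_nhdsWithin ?_
      exact mem_of_superset (Icc_mem_nhdsLE hs'.1) (Set.Icc_subset_Icc_right hs2.2)
    exact ODE_solution_unique_of_mem_Icc_left
      (fun s hs' => hv s (hs (Set.Ioc_subset_Icc_self hs')))
      (hc1.mono hs) (hder h₁)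
      (fun s hs' => by simpa using (h₁ s (hs (Set.Ioc_subset_Icc_self hs'))).1)
      (hc2.mono hs) (hder h₂)
      (fun s hs' => by simpa using (h₂ s (hs (Set.Ioc_subset_Icc_self hs'))).1) h0 ⟨ht.1, h⟩

lemma IsSol.comp {ε : ℂ} {c d c' d' : ℝ} {θ θ' f f' : ℝ → ℝ} {w : ℝ → ℂ}
    (h : D.IsSol ε c d θ θ' w) (hf : ∀ t ∈ Set.Icc c' d', HasDerivWithinAt f (f' t) (Set.Icc c' d') t)
    (hmaps : Set.MapsTo f (Set.Icc c' d') (Set.Icc c d)) :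
    D.IsSol ε c' d' (θ ∘ f) (fun t => θ' (f t) * f' t) (w ∘ f) := by
  intro t ht
  obtain ⟨h1, h2, h3⟩ := h (f t) (hmaps ht)
  refine ⟨h1, h2.comp t (hf t ht) hmaps, ?_⟩
  have := h3.scomp t (hf t ht) hmaps
  refine this.congr_deriv ?_
  simp only [Complex.real_smul, Function.comp_apply]
  push_cast; ring

end FolData

end WeakFocus

end

/-! ### Analytic dependence of transport along leaves -/

noncomputable section

set_option linter.unusedSectionVars false

namespace WeakFocus

section Superposition3

variable (K : Type*) [TopologicalSpace K] [CompactSpace K]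

/-- The pointwise exponential. -/
def expC (f : C(K, ℂ)) : C(K, ℂ) := ⟨fun k => Complex.exp (f k), by fun_prop⟩

variable {K} in
@[simp] lemma expC_apply (f : C(K, ℂ)) (k : K) : expC K f k = Complex.exp (f k) := rfl

-- The pointwise exponential is the exponential of the Banach algebra of continuous functions.
@[fun_prop] lemma analyticAt_expC (f : C(K, ℂ)) : AnalyticAt ℂ (expC K) f := by
  have h : expC K = NormedSpace.exp := by
    ext f k
    have h1 : (NormedSpace.exp f : C(K, ℂ)) k = NormedSpace.exp (f k) :=
      NormedSpace.map_exp (ContinuousMap.evalAlgHom ℂ ℂ k) (continuous_eval_const k) f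
    rw [h1, expC_apply, Complex.exp_eq_exp_ℂ]
  rw [h]
  exact NormedSpace.exp_analytic (𝕂 := ℂ) f

/-- A number and two functions as one vector-valued function. -/
def tripleCLM : (ℂ × C(K, ℂ) × C(K, ℂ)) →L[ℂ] C(K, ℂ × ℂ × ℂ) :=
  LinearMap.mkContinuous
    { toFun := fun p => ⟨fun k => (p.1, p.2.1 k, p.2.2 k), by fun_prop⟩
      map_add' := by intro p q; rfl
      map_smul' := by intro c p; rfl } 1 (by
    intro p
    rw [ContinuousMap.norm_le _ (by positivity), one_mul]
    intro k
    refine norm_prod_le_iff.2 ⟨norm_fst_le p, norm_prod_le_iff.2 ⟨?_, ?_⟩⟩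
    · exact (p.2.1.norm_coe_le_norm k).trans ((norm_fst_le p.2).trans (norm_snd_le p))
    · exact (p.2.2.norm_coe_le_norm k).trans ((norm_snd_le p.2).trans (norm_snd_le p)))

/-- The superposition operator of a function of three variables, the first being a number. -/
def sup3 (f : ℂ × ℂ × ℂ → ℂ) (p : ℂ × C(K, ℂ) × C(K, ℂ)) : C(K, ℂ) :=
  superpose K f (tripleCLM K p)

variable {K} {f : ℂ × ℂ × ℂ → ℂ}

lemma analyticAt_sup3 (hf : AnalyticAt ℂ f 0) : AnalyticAt ℂ (sup3 K f) 0 :=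
  (analyticAt_superpose hf).comp_of_eq ((tripleCLM K).analyticAt _) (map_zero _)

lemma eventually_sup3_apply (hf : AnalyticAt ℂ f 0) :
    ∀ᶠ p in 𝓝 (0 : ℂ × C(K, ℂ) × C(K, ℂ)), ∀ k, sup3 K f p k = f (p.1, p.2.1 k, p.2.2 k) :=
  ((tripleCLM K).continuous.tendsto' 0 0 (map_zero _)).eventually (eventually_superpose_apply hf)

lemma sup3_zero_right (f : ℂ × ℂ × ℂ → ℂ) (ε : ℂ) :
    sup3 K f (ε, 0, 0) = ContinuousMap.const K (f (ε, 0, 0)) := by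
  ext k
  have : Continuous fun k => f (tripleCLM K (ε, 0, 0) k) := continuous_const (y := f (ε, 0, 0))
  simp only [sup3, superpose, this, dif_pos]
  rfl

end Superposition3

section Transport

variable (L : Type*) [TopologicalSpace L] [CompactSpace L]

/-- Functions of the first variable. -/
def pullCLM : C(L, ℂ) →L[ℂ] C(L × unitInterval, ℂ) :=
  LinearMap.mkContinuous
    { toFun := fun f => ⟨fun p => f p.1, by fun_prop⟩
      map_add' := by intro p q; rfl
      map_smul' := by intro c p; rfl } 1 (by
    intro f
    rw [ContinuousMap.norm_le _ (by positivity), one_mul]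
    exact fun p => f.norm_coe_le_norm p.1)

lemma pullCLM_apply (f : C(L, ℂ)) (p : L × unitInterval) : pullCLM L f p = f p.1 := rfl

/-- The second variable. -/
def timeC : C(L × unitInterval, ℂ) := ⟨fun p => ((p.2 : ℝ) : ℂ), by fun_prop⟩

variable {L}

lemma timeC_apply (l : L) (t : unitInterval) : timeC L (l, t) = ((t : ℝ) : ℂ) := rfl

namespace FolData

variable (D : FolData)

/-- The parameters of a family of transports: the parameter of the foliation, the initial values,
the initial angles and the lengths of the paths. -/
abbrev Param (L : Type*) [TopologicalSpace L] [CompactSpace L] :=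
  ℂ × C(L, ℂ) × C(L, ℂ) × C(L, ℂ)

/-- The base point `exp (i (a + t b))` of the path in the equator. -/
def pathX (q : Param L) : C(L × unitInterval, ℂ) :=
  expC _ (Complex.I • (pullCLM L q.2.2.1 + timeC L * pullCLM L q.2.2.2))

/-- The inverse of `pathX`. -/
def pathY (q : Param L) : C(L × unitInterval, ℂ) :=
  expC _ (-(Complex.I • (pullCLM L q.2.2.1 + timeC L * pullCLM L q.2.2.2)))

/-- The point `(ε, X u, u)` of the path with `u = s exp v`. -/
def pathArg (q : Param L × C(L × unitInterval, ℂ)) : ℂ × C(L × unitInterval, ℂ) × C(L × unitInterval, ℂ) :=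
  (q.1.1, pathX q.1 * (pullCLM L q.1.2.1 * expC _ q.2), pullCLM L q.1.2.1 * expC _ q.2)

def numC (q : Param L × C(L × unitInterval, ℂ)) : C(L × unitInterval, ℂ) :=
  pathX q.1 * sup3 _ D.q1 (pathArg q) + sup3 _ D.q2 (pathArg q)

def denC (q : Param L × C(L × unitInterval, ℂ)) : C(L × unitInterval, ℂ) :=
  sup3 _ D.p1 (pathArg q) + pathY q.1 * sup3 _ D.p2 (pathArg q)
    - pathX q.1 * sup3 _ D.q1 (pathArg q) - sup3 _ D.q2 (pathArg q)

/-- The fixed points `v` of this operator give the solutions `u = s exp v` of the equation of the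
leaves. -/
def transportOp (q : Param L × C(L × unitInterval, ℂ)) : C(L × unitInterval, ℂ) :=
  volterra L (pullCLM L q.1.2.2.2 * (Complex.I • (numC D q * Ring.inverse (denC D q))))

variable {a₀ b₀ : C(L, ℂ)}

/-- With initial value 0 the path stays at the origin whatever `v` is. This is why the operator
becomes constant at the base parameter. -/
lemma pathArg_zero (v : C(L × unitInterval, ℂ)) :
    pathArg (((0, 0, a₀, b₀) : Param L), v) = 0 := by
  simp [pathArg]

lemma numC_zero (v : C(L × unitInterval, ℂ)) : numC D (((0, 0, a₀, b₀) : Param L), v)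
    = ContinuousMap.const _ (-(Complex.I * D.b)) := by
  have h := fun f => sup3_zero_right (K := L × unitInterval) f 0
  have h0 : ((0 : ℂ), (0 : C(L × unitInterval, ℂ)), (0 : C(L × unitInterval, ℂ))) = 0 := rfl
  have h1 : ((0 : ℂ), (0 : ℂ), (0 : ℂ)) = 0 := rfl
  rw [h0, h1] at h
  simp only [numC, pathArg_zero, h, D.q1_zero, D.q2_zero]
  ext k; simp

lemma denC_zero (v : C(L × unitInterval, ℂ)) : denC D (((0, 0, a₀, b₀) : Param L), v)
    = ContinuousMap.const _ (2 * (Complex.I * D.b)) := by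
  have h := fun f => sup3_zero_right (K := L × unitInterval) f 0
  have h0 : ((0 : ℂ), (0 : C(L × unitInterval, ℂ)), (0 : C(L × unitInterval, ℂ))) = 0 := rfl
  have h1 : ((0 : ℂ), (0 : ℂ), (0 : ℂ)) = 0 := rfl
  rw [h0, h1] at h
  simp only [denC, pathArg_zero, h, D.q1_zero, D.q2_zero, D.p1_zero, D.p2_zero]
  ext k; simp; ring

lemma analyticAt_pathX (q : Param L) : AnalyticAt ℂ (pathX (L := L)) q := by
  have h : ∀ f, AnalyticAt ℂ (pullCLM L) f := (pullCLM L).analyticAt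
  unfold pathX
  fun_prop

lemma analyticAt_pathY (q : Param L) : AnalyticAt ℂ (pathY (L := L)) q := by
  have h : ∀ f, AnalyticAt ℂ (pullCLM L) f := (pullCLM L).analyticAt
  unfold pathY
  fun_prop

lemma analyticAt_pathArg (q : Param L × C(L × unitInterval, ℂ)) : AnalyticAt ℂ (pathArg (L := L)) q := by
  have h : ∀ f, AnalyticAt ℂ (pullCLM L) f := (pullCLM L).analyticAt
  have h2 := analyticAt_pathX (L := L)
  unfold pathArg
  fun_prop

lemma analyticAt_sup3_pathArg {f : ℂ × ℂ × ℂ → ℂ} (hf : AnalyticAt ℂ f 0)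
    (v₀ : C(L × unitInterval, ℂ)) :
    AnalyticAt ℂ (fun q => sup3 _ f (pathArg (L := L) q)) ((0, 0, a₀, b₀), v₀) :=
  (analyticAt_sup3 hf).comp_of_eq (analyticAt_pathArg _) (pathArg_zero v₀)

lemma analyticAt_numC (v₀ : C(L × unitInterval, ℂ)) : AnalyticAt ℂ (numC D (L := L)) ((0, 0, a₀, b₀), v₀) := by
  have h2 := analyticAt_pathX (L := L)
  exact ((AnalyticAt.comp (h2 _) analyticAt_fst).mul (analyticAt_sup3_pathArg D.analyticAt_q1 _)).add
    (analyticAt_sup3_pathArg D.analyticAt_q2 _)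

lemma analyticAt_denC (v₀ : C(L × unitInterval, ℂ)) : AnalyticAt ℂ (denC D (L := L)) ((0, 0, a₀, b₀), v₀) := by
  have h2 := analyticAt_pathX (L := L)
  have h3 := analyticAt_pathY (L := L)
  exact (((analyticAt_sup3_pathArg D.analyticAt_p1 _).add
    ((AnalyticAt.comp (h3 _) analyticAt_fst).mul (analyticAt_sup3_pathArg D.analyticAt_p2 _))).sub
    ((AnalyticAt.comp (h2 _) analyticAt_fst).mul (analyticAt_sup3_pathArg D.analyticAt_q1 _))).sub
    (analyticAt_sup3_pathArg D.analyticAt_q2 _)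

lemma isUnit_const {K : Type*} [TopologicalSpace K] {c : ℂ} (hc : c ≠ 0) :
    IsUnit (ContinuousMap.const K c) := by
  refine IsUnit.of_mul_eq_one (ContinuousMap.const K c⁻¹) ?_
  ext k; simp [hc]

lemma isUnit_denC_zero (v₀ : C(L × unitInterval, ℂ)) : IsUnit (denC D (((0, 0, a₀, b₀) : Param L), v₀)) := by
  rw [denC_zero]
  exact isUnit_const (mul_ne_zero two_ne_zero D.I_mul_b_ne)

lemma analyticAt_transportOp (v₀ : C(L × unitInterval, ℂ)) :
    AnalyticAt ℂ (transportOp D (L := L)) ((0, 0, a₀, b₀), v₀) := by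
  have h1 := analyticAt_numC D (L := L) (a₀ := a₀) (b₀ := b₀) v₀
  have h2 : AnalyticAt ℂ (fun q => Ring.inverse (denC D (L := L) q)) ((0, 0, a₀, b₀), v₀) :=
    (analyticAt_inverse (D.isUnit_denC_zero (a₀ := a₀) (b₀ := b₀) v₀).unit).comp_of_eq
      (analyticAt_denC D _) rfl
  have h3 : AnalyticAt ℂ (fun q : Param L × C(L × unitInterval, ℂ) => pullCLM L q.1.2.2.2)
      ((0, 0, a₀, b₀), v₀) :=
    AnalyticAt.comp ((pullCLM L).analyticAt _) (by fun_prop)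
  exact AnalyticAt.comp ((volterra L).analyticAt _) (h3.mul ((h1.fun_mul h2).fun_const_smul))

variable {D} in
-- Writing u = s exp v turns the equation into v' = b · slope, with the right-hand side depending on
-- v only through u; at ε = s = 0 it is independent of v. Letting the initial values, angles and
-- lengths be functions on a compact space makes every conclusion uniform over that space.
lemma exists_transport (D : FolData) (a₀ b₀ : C(L, ℂ)) :
    ∃ V : Param L → C(L × unitInterval, ℂ), AnalyticAt ℂ V (0, 0, a₀, b₀) ∧
      (∀ᶠ q in 𝓝 ((0, 0, a₀, b₀) : Param L), transportOp D (q, V q) = V q) ∧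
      ∀ᶠ q in 𝓝 ((0, 0, a₀, b₀) : Param L), ∀ l, V q (l, 0) = 0 ∧ ∀ t ∈ Set.Icc (0 : ℝ) 1,
        HasDerivWithinAt
          (fun t : ℝ => q.2.1 l * Complex.exp (V q (l, Set.projIcc 0 1 zero_le_one t)))
          (q.2.2.2 l * (q.2.1 l * Complex.exp (V q (l, Set.projIcc 0 1 zero_le_one t)) *
            D.slope q.1 (Complex.exp (Complex.I * (q.2.2.1 l + t * q.2.2.2 l)))
              (q.2.1 l * Complex.exp (V q (l, Set.projIcc 0 1 zero_le_one t)))))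
          (Set.Icc 0 1) t := by
  set p₀ : Param L := (0, 0, a₀, b₀) with hp₀
  set v₀ := transportOp D (p₀, 0) with hv₀
  -- The base paths `a₀`, `b₀` may be long: only ε and the initial values have to be small.
  have hc : ∀ v, transportOp D (p₀, v) = v₀ := by
    intro v
    simp only [hv₀, transportOp, hp₀, numC_zero, denC_zero]
  obtain ⟨V, hV, hV0, hfix, -⟩ := exists_analyticAt_fixedPoint (D.analyticAt_transportOp v₀) hc
  refine ⟨V, hV, hfix, ?_⟩
  have hpair : ContinuousAt (fun q => (q, V q)) p₀ := continuousAt_id.prodMk hV.continuousAt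
  have hpair' : Tendsto (fun q => (q, V q)) (𝓝 p₀) (𝓝 (p₀, v₀)) := by
    rw [← hV0]
    exact hpair
  have harg : Tendsto (fun q => pathArg (q, V q)) (𝓝 p₀) (𝓝 0) := by
    have := (analyticAt_pathArg (L := L) (p₀, v₀)).continuousAt.tendsto.comp hpair'
    rwa [pathArg_zero] at this
  have hunit : ∀ᶠ q in 𝓝 p₀, IsUnit (denC D (q, V q)) :=
    hpair'.eventually ((D.analyticAt_denC v₀).continuousAt.eventually
      (Units.isOpen.mem_nhds (D.isUnit_denC_zero v₀)))
  filter_upwards [hfix, hunit, harg.eventually (eventually_sup3_apply D.analyticAt_p1),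
    harg.eventually (eventually_sup3_apply D.analyticAt_p2),
    harg.eventually (eventually_sup3_apply D.analyticAt_q1),
    harg.eventually (eventually_sup3_apply D.analyticAt_q2)] with q hq hu h1 h2 h3 h4 l
  refine ⟨?_, ?_⟩
  · rw [← hq, transportOp, volterra_apply]
    simp
  intro t ht
  set τ := Set.projIcc 0 1 zero_le_one t with hτ
  have hτt : ((τ : ℝ) : ℂ) = t := by rw [hτ, Set.projIcc_of_mem zero_le_one ht]
  set w := q.2.1 l * Complex.exp (V q (l, τ)) with hw
  have hX : pathX q (l, τ) = Complex.exp (Complex.I * (q.2.2.1 l + t * q.2.2.2 l)) := by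
    simp [pathX, pullCLM_apply, timeC_apply, hτt]
  have hY : pathY q (l, τ) = (Complex.exp (Complex.I * (q.2.2.1 l + t * q.2.2.2 l)))⁻¹ := by
    rw [← Complex.exp_neg]
    simp [pathY, pullCLM_apply, timeC_apply, hτt]
  have hnum : numC D (q, V q) (l, τ)
      = D.num q.1 (Complex.exp (Complex.I * (q.2.2.1 l + t * q.2.2.2 l))) w := by
    simp only [numC, ContinuousMap.add_apply, ContinuousMap.mul_apply, h3, h4, num, hX]
    simp [pathArg, hX, hw, pullCLM_apply]
  have hden : denC D (q, V q) (l, τ)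
      = D.den q.1 (Complex.exp (Complex.I * (q.2.2.1 l + t * q.2.2.2 l))) w := by
    simp only [denC, ContinuousMap.add_apply, ContinuousMap.sub_apply, ContinuousMap.mul_apply,
      h1, h2, h3, h4, den, hX, hY]
    simp [pathArg, hX, hw, pullCLM_apply]
  have hinv : Ring.inverse (denC D (q, V q)) (l, τ) = (denC D (q, V q) (l, τ))⁻¹ := by
    refine eq_inv_of_mul_eq_one_left ?_
    have := congrArg (fun f : C(L × unitInterval, ℂ) => f (l, τ)) (Ring.inverse_mul_cancel _ hu)
    simpa using this
  have hd := hasDerivWithinAt_volterra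
    (pullCLM L q.2.2.2 * (Complex.I • (numC D (q, V q) * Ring.inverse (denC D (q, V q))))) l ht
  change HasDerivWithinAt (fun s => transportOp D (q, V q) (l, _)) _ _ _ at hd
  rw [hq] at hd
  refine ((hd.cexp).const_mul (q.2.1 l)).congr_deriv ?_
  simp only [ContinuousMap.mul_apply, ContinuousMap.smul_apply, ← hτ, hinv, hnum, hden, slope,
    pullCLM_apply, smul_eq_mul, hw]
  ring

end FolData

end Transport

end WeakFocus

end

/-! ### Long leaves: existence, periodicity, real structure -/

noncomputable section

namespace WeakFocus

namespace FolData

variable (D : FolData)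

/-- The angles over which the leaves are followed: more than three turns in both directions. -/
abbrev angles : Set ℝ := Set.Icc (-20) 20

/-- Transport is applied with the compact space of all pairs of angles, so that the radius and the
bound do not depend on the endpoints. -/
lemma exists_path : ∃ r > 0, ∃ C ≥ 1, ∀ ε u : ℂ, ‖ε‖ < r → ‖u‖ < r → ∀ a ∈ angles, ∀ b ∈ angles,
    ∃ w : ℝ → ℂ, D.IsSol ε 0 1 (fun t => a + t * (b - a)) (fun _ => b - a) w ∧ w 0 = u ∧
      ∀ t ∈ Set.Icc (0 : ℝ) 1, ‖w t‖ ≤ C * ‖u‖ := by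
  let a₀ : C(↥angles × ↥angles, ℂ) := ⟨fun l => ((l.1 : ℝ) : ℂ), by fun_prop⟩
  let b₀ : C(↥angles × ↥angles, ℂ) := ⟨fun l => ((l.2 : ℝ) : ℂ) - ((l.1 : ℝ) : ℂ), by fun_prop⟩
  obtain ⟨V, hV, -, hsol⟩ := exists_transport D a₀ b₀
  have hbd : ∀ᶠ q in 𝓝 ((0, 0, a₀, b₀) : Param (↥angles × ↥angles)), ‖V q‖ < ‖V (0, 0, a₀, b₀)‖ + 1 :=
    hV.continuousAt.norm.eventually (gt_mem_nhds (by simp))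
  set M := ‖V (0, 0, a₀, b₀)‖ + 1 with hM
  have hM0 : 0 ≤ M := by positivity
  have hcont : Tendsto (fun p : ℂ × ℂ => ((p.1, ContinuousMap.const (↥angles × ↥angles) p.2, a₀, b₀) : Param (↥angles × ↥angles)))
      (𝓝 0) (𝓝 (0, 0, a₀, b₀)) := by
    have : Continuous (fun p : ℂ × ℂ => ((p.1, ContinuousMap.const (↥angles × ↥angles) p.2, a₀, b₀) : Param (↥angles × ↥angles))) := by
      have h := ContinuousMap.continuous_const' (X := ↥angles × ↥angles) (Y := ℂ)
      fun_prop
    exact this.tendsto' _ _ rfl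
  obtain ⟨r, hr, h⟩ := Metric.eventually_nhds_iff_ball.1 (hcont.eventually (hsol.and hbd))
  refine ⟨min r (D.rad / Real.exp M), lt_min hr (div_pos D.rad_pos (Real.exp_pos M)),
    Real.exp M, Real.one_le_exp hM0, ?_⟩
  intro ε u hε hu a ha b hb
  obtain ⟨h1, h2⟩ := h (ε, u) (by
    rw [mem_ball_zero_iff, prod_norm_lt_iff]
    exact ⟨hε.trans_le (min_le_left _ _), hu.trans_le (min_le_left _ _)⟩)
  obtain ⟨h3, h4⟩ := h1 (⟨a, ha⟩, ⟨b, hb⟩)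
  have hle : ∀ t ∈ Set.Icc (0 : ℝ) 1, ‖u * Complex.exp (V (ε, ContinuousMap.const (↥angles × ↥angles) u, a₀, b₀)
      ((⟨a, ha⟩, ⟨b, hb⟩), Set.projIcc 0 1 zero_le_one t))‖ ≤ Real.exp M * ‖u‖ := by
    intro t ht
    rw [norm_mul, mul_comm]
    gcongr
    rw [Complex.norm_exp]
    gcongr
    exact (Complex.re_le_norm _).trans ((ContinuousMap.norm_coe_le_norm _ _).trans h2.le)
  refine ⟨_, fun t ht => ⟨?_, ?_, (h4 t ht).congr_deriv ?_⟩, ?_, hle⟩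
  · refine (hle t ht).trans_lt ?_
    rw [mul_comm, ← lt_div_iff₀ (Real.exp_pos M)]
    exact hu.trans_le (min_le_right _ _)
  · simpa using (((hasDerivAt_id t).mul_const (b - a)).const_add a).hasDerivWithinAt
  · simp [a₀, b₀]
  · have : Set.projIcc (0 : ℝ) 1 zero_le_one 0 = 0 := by simp
    rw [this, h3]; simp

/-- `W` parametrizes, by the angle, a large piece of a leaf. -/
def IsLeaf (ε : ℂ) (W : ℝ → ℂ) : Prop := D.IsSol ε (-20) 20 (fun t => t) (fun _ => 1) W

variable {D}

lemma IsLeaf.comp {ε : ℂ} {W : ℝ → ℂ} (hW : D.IsLeaf ε W) {c d : ℝ} {f f' : ℝ → ℝ}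
    (hf : ∀ t ∈ Set.Icc c d, HasDerivWithinAt f (f' t) (Set.Icc c d) t)
    (hmaps : Set.MapsTo f (Set.Icc c d) angles) :
    D.IsSol ε c d f f' (W ∘ f) := by
  have := IsSol.comp hW hf hmaps
  simpa [Function.comp_def] using this

lemma path_mem {a b : ℝ} (ha : a ∈ angles) (hb : b ∈ angles) :
    Set.MapsTo (fun t => a + t * (b - a)) (Set.Icc (0 : ℝ) 1) angles := by
  intro t ht
  have := (convex_Icc (-20 : ℝ) 20) ha hb (sub_nonneg.2 ht.2) ht.1 (by ring)
  simp only [smul_eq_mul] at this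
  convert this using 1; ring

lemma hasDerivWithinAt_path (a b t : ℝ) (s : Set ℝ) :
    HasDerivWithinAt (fun t => a + t * (b - a)) (b - a) s t := by
  simpa using (((hasDerivAt_id t).mul_const (b - a)).const_add a).hasDerivWithinAt

lemma IsLeaf.path_eq {ε : ℂ} {W w : ℝ → ℂ} (hε : ‖ε‖ < D.rad) (hW : D.IsLeaf ε W) {a b : ℝ}
    (ha : a ∈ angles) (hb : b ∈ angles)
    (hw : D.IsSol ε 0 1 (fun t => a + t * (b - a)) (fun _ => b - a) w) (h0 : w 0 = W a) :
    w 1 = W b := by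
  have h1 := hW.comp (fun t _ => hasDerivWithinAt_path a b t _) (path_mem ha hb)
  have := IsSol.eqOn hε hw h1 (M := |b - a|) (fun _ _ => le_rfl) (t₀ := 0) (by simp) (by simpa)
    (x := 1) (by simp)
  simpa using this

variable (D) in
-- One path goes from `a` to -20 and a second from -20 to 20. By uniqueness the second path retraces
-- the first one, so it takes the value `u` at the angle `a`; the two bounds multiply.
lemma exists_leaf : ∃ r > 0, ∃ C ≥ 1, ∀ ε u : ℂ, ‖ε‖ < r → ‖u‖ < r → ∀ a ∈ angles,
    ∃ W : ℝ → ℂ, D.IsLeaf ε W ∧ W a = u ∧ ∀ b ∈ angles, ‖W b‖ ≤ C * ‖u‖ := by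
  obtain ⟨r, hr, C, hC, h⟩ := D.exists_path
  have hC0 : 0 < C := zero_lt_one.trans_le hC
  refine ⟨min D.rad (r / C), lt_min D.rad_pos (div_pos hr hC0), C * C,
    one_le_mul_of_one_le_of_one_le hC hC, ?_⟩
  intro ε u hε hu a ha
  have hrC : r / C ≤ r := div_le_self hr.le hC
  have hεr : ‖ε‖ < r := hε.trans_le ((min_le_right _ _).trans hrC)
  have hεD : ‖ε‖ < D.rad := hε.trans_le (min_le_left _ _)
  have hur : ‖u‖ < r / C := hu.trans_le (min_le_right _ _)
  obtain ⟨w₁, h1, h10, h1C⟩ := h ε u hεr (hur.trans_le hrC) a ha (-20) (by norm_num)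
  have hw1 : ‖w₁ 1‖ ≤ C * ‖u‖ := h1C 1 (by simp)
  obtain ⟨w₂, h2, h20, h2C⟩ := h ε (w₁ 1) hεr (hw1.trans_lt (by
    rw [mul_comm]; exact (lt_div_iff₀ hC0).1 hur)) (-20) (by norm_num) 20 (by norm_num)
  have hf : ∀ t : ℝ, HasDerivAt (fun t : ℝ => (t + 20) / 40) (1 / 40) t := fun t =>
    ((hasDerivAt_id t).add_const 20).div_const 40
  have hmap : Set.MapsTo (fun t : ℝ => (t + 20) / 40) angles (Set.Icc 0 1) := by
    intro t ht
    constructor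
    · have := ht.1; apply div_nonneg <;> linarith
    · have := ht.2; rw [div_le_one] <;> linarith
  have hW : D.IsLeaf ε (w₂ ∘ fun t => (t + 20) / 40) := by
    have := IsSol.comp h2 (fun t _ => (hf t).hasDerivWithinAt) hmap
    unfold IsLeaf
    convert! this using 1
    · ext t; simp only [Function.comp_apply]; ring
    · ext t; norm_num
  refine ⟨_, hW, ?_, ?_⟩
  · have hrev : D.IsSol ε 0 1 (fun t => -20 + t * (a - -20)) (fun _ => a - -20)
        (w₁ ∘ fun t => 1 - t) := by
      have := IsSol.comp h1 (f := fun t => 1 - t) (f' := fun _ => -1) (c' := 0) (d' := 1)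
        (fun t _ => by simpa using ((hasDerivAt_id t).const_sub 1).hasDerivWithinAt)
        (fun t ht => ⟨by linarith [ht.2], by linarith [ht.1]⟩)
      convert! this using 1
      · ext t; simp; ring
      · ext t; ring
    have := hW.path_eq hεD (by norm_num) ha hrev (by simp [h20])
    rw [← this]; simp [h10]
  · intro b hb
    refine (h2C _ (hmap hb)).trans ?_
    rw [mul_assoc]
    gcongr

/-- The equation depends on the angle only through exp(it), so a leaf shifted by full turns is again
a leaf; uniqueness does the rest. -/
lemma IsLeaf.shift {ε : ℂ} {W₁ W₂ : ℝ → ℂ} (hε : ‖ε‖ < D.rad) (h₁ : D.IsLeaf ε W₁)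
    (h₂ : D.IsLeaf ε W₂) (n : ℕ) {a : ℝ} (ha : a ∈ Set.Icc (-20) (20 - n * (2 * Real.pi)))
    (h0 : W₁ (a + n * (2 * Real.pi)) = W₂ a) {b : ℝ}
    (hb : b ∈ Set.Icc (-20) (20 - n * (2 * Real.pi))) : W₁ (b + n * (2 * Real.pi)) = W₂ b := by
  have hT : 0 ≤ n * (2 * Real.pi) := by positivity
  have hs1 : D.IsSol ε (-20) (20 - n * (2 * Real.pi)) (fun t => t) (fun _ => 1)
      (fun t => W₁ (t + n * (2 * Real.pi))) := by
    have := h₁.comp (f := fun t => t + n * (2 * Real.pi)) (f' := fun _ => 1) (c := -20)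
      (d := 20 - n * (2 * Real.pi))
      (fun t _ => ((hasDerivAt_id' t).add_const _).hasDerivWithinAt)
      (fun t ht => ⟨by linarith [ht.1], by linarith [ht.2]⟩)
    intro t ht
    obtain ⟨h3, -, h4⟩ := this t ht
    refine ⟨h3, (hasDerivAt_id t).hasDerivWithinAt, ?_⟩
    have hexp : Complex.exp (Complex.I * ((t + n * (2 * Real.pi) : ℝ) : ℂ))
        = Complex.exp (Complex.I * t) := by
      push_cast
      rw [mul_add, Complex.exp_add, show Complex.I * (n * (2 * (Real.pi : ℂ)))
        = n * (2 * Real.pi * Complex.I) by ring, Complex.exp_nat_mul_two_pi_mul_I, mul_one]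
    rw [hexp] at h4
    exact h4
  have hs2 : D.IsSol ε (-20) (20 - n * (2 * Real.pi)) (fun t => t) (fun _ => 1) W₂ :=
    h₂.comp (f := fun t => t) (fun t _ => (hasDerivAt_id t).hasDerivWithinAt)
      (fun t ht => ⟨ht.1, by linarith [ht.2]⟩)
  exact IsSol.eqOn hε hs1 hs2 (M := 1) (by simp) ha h0 hb

lemma IsLeaf.eqOn {ε : ℂ} {W₁ W₂ : ℝ → ℂ} (hε : ‖ε‖ < D.rad) (h₁ : D.IsLeaf ε W₁)
    (h₂ : D.IsLeaf ε W₂) {a : ℝ} (ha : a ∈ angles) (h0 : W₁ a = W₂ a) :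
    Set.EqOn W₁ W₂ angles :=
  IsSol.eqOn hε h₁ h₂ (M := 1) (by simp) ha h0

variable (D) in
/-- For real values of the parameter, the conjugate of a leaf is a leaf. -/
lemma exists_conj_leaf : ∃ r > 0, ∀ ε : ℂ, conj ε = ε → ‖ε‖ < r → ∀ W : ℝ → ℂ, D.IsLeaf ε W →
    (∀ t ∈ angles, ‖W t‖ < r) →
    D.IsLeaf ε (fun t => conj (Complex.exp (Complex.I * t) * W t)) := by
  obtain ⟨r, hr, h⟩ := Metric.eventually_nhds_iff_ball.1 (D.real1.and D.real2)
  refine ⟨min r D.rad, lt_min hr D.rad_pos, ?_⟩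
  intro ε hεc hε W hW hWr t ht
  obtain ⟨h1, h2, h3⟩ := hW t ht
  set X := Complex.exp (Complex.I * t) with hX
  have hXn : ‖X‖ = 1 := mem_sphere_zero_iff_norm.1 (exp_I_mem_sphere t)
  have hXc : conj X = X⁻¹ := by
    rw [Complex.inv_def, Complex.normSq_eq_norm_sq, hXn]; simp
  have hX0 : X ≠ 0 := Complex.exp_ne_zero _
  have hn : ‖conj (X * W t)‖ = ‖W t‖ := by rw [RCLike.norm_conj, norm_mul, hXn, one_mul]
  refine ⟨by rw [hn]; exact h1, h2, ?_⟩
  have hXd : HasDerivWithinAt (fun t : ℝ => Complex.exp (Complex.I * t)) (X * Complex.I)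
      angles t := by
    have : HasDerivAt (fun t : ℝ => Complex.I * (t : ℂ)) Complex.I t := by
      simpa using (Complex.ofRealCLM.hasDerivAt (x := t)).const_mul Complex.I
    exact this.cexp.hasDerivWithinAt
  have hd := (hXd.mul h3)
  have hd2 := Complex.conjCLE.toContinuousLinearMap.hasFDerivAt.comp_hasDerivWithinAt t hd
  refine HasDerivWithinAt.congr_deriv hd2 ?_
  set u := W t with hu
  set u' := conj (X * u) with hu'
  have e1 : conj u = X * u' := by
    rw [hu', map_mul, hXc, ← mul_assoc, mul_inv_cancel₀ hX0, one_mul]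
  have e2 : conj (X * u') = u := by rw [← e1, Complex.conj_conj]
  have e3 : conj u' = X * u := by rw [hu', Complex.conj_conj]
  have m1 : (ε, X * u, u) ∈ Metric.ball (0 : ℂ × ℂ × ℂ) r := by
    rw [mem_ball_zero_iff, prod_norm_lt_iff, prod_norm_lt_iff]
    refine ⟨hε.trans_le (min_le_left _ _), ?_, (hWr t ht).trans_le (min_le_left _ _)⟩
    simpa [hXn] using (hWr t ht).trans_le (min_le_left _ _)
  have m2 : (ε, X * u', u') ∈ Metric.ball (0 : ℂ × ℂ × ℂ) r := by
    rw [mem_ball_zero_iff, prod_norm_lt_iff, prod_norm_lt_iff]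
    refine ⟨hε.trans_le (min_le_left _ _), ?_,
      by rw [hn]; exact (hWr t ht).trans_le (min_le_left _ _)⟩
    rw [← e1]; simpa using (hWr t ht).trans_le (min_le_left _ _)
  have r1 := h _ m1
  have r2 := h _ m2
  simp only [hεc, e2, e3] at r1 r2
  rw [← hu', e1] at r1
  have k1 : conj (D.p1 (ε, X * u, u)) = D.q2 (ε, X * u', u') := by rw [r1.1, Complex.conj_conj]
  have k2 : conj (D.p2 (ε, X * u, u)) = D.q1 (ε, X * u', u') := by rw [r1.2, Complex.conj_conj]
  have k3 : conj (D.q2 (ε, X * u, u)) = D.p1 (ε, X * u', u') := r2.1.symm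
  have k4 : conj (D.q1 (ε, X * u, u)) = D.p2 (ε, X * u', u') := r2.2.symm
  -- Conjugation exchanges P/x and Q/y, so their difference changes sign.
  have hden : conj (D.den ε X u) = -D.den ε X u' := by
    simp only [den, map_sub, map_add, map_mul, map_inv₀, k1, k2, k3, k4, hXc, inv_inv]
    ring
  have hsum : conj (D.den ε X u + D.num ε X u) = D.num ε X u' := by
    have : D.den ε X u + D.num ε X u = D.p1 (ε, X * u, u) + X⁻¹ * D.p2 (ε, X * u, u) := by
      simp only [den, num]; ring
    rw [this]
    simp only [num, map_add, map_mul, map_inv₀, k1, k2, hXc, inv_inv]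
    ring
  change conj (X * Complex.I * u + X * (((1 : ℝ) : ℂ) * (u * D.slope ε X u)))
    = ((1 : ℝ) : ℂ) * (u' * D.slope ε X u')
  have hd0 : D.den ε X u ≠ 0 := den_ne (hε.trans_le (min_le_right _ _)) (exp_I_mem_sphere t) h1
  have hk : X * Complex.I * u + X * (((1 : ℝ) : ℂ) * (u * D.slope ε X u))
      = (X * u) * (Complex.I * (D.den ε X u + D.num ε X u) / D.den ε X u) := by
    rw [slope]; push_cast; field_simp
  rw [hk, map_mul, ← hu', map_div₀, map_mul, hsum, hden, Complex.conj_I, slope]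
  push_cast
  rw [neg_mul, neg_div_neg_eq, one_mul]

end FolData

end WeakFocus

end

/-! ### Reality, reversal of the rotation, factorization of the field -/

noncomputable section

namespace WeakFocus

/-- The antiholomorphic involution `(ε, x, y) ↦ (conj ε, conj y, conj x)`, which fixes the real
plane. -/
def realInv : (ℂ × ℂ × ℂ) ≃ₗᵢ⋆[ℂ] (ℂ × ℂ × ℂ) where
  toFun p := (conj p.1, conj p.2.2, conj p.2.1)
  invFun p := (conj p.1, conj p.2.2, conj p.2.1)
  map_add' p q := by simp
  map_smul' c p := by simp
  left_inv p := by simp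
  right_inv p := by simp
  norm_map' p := by
    change ‖(conj p.1, conj p.2.2, conj p.2.1)‖ = ‖p‖
    simp only [Prod.norm_def, RCLike.norm_conj, max_comm]

lemma realInv_apply (p : ℂ × ℂ × ℂ) : realInv p = (conj p.1, conj p.2.2, conj p.2.1) := rfl

@[simp] lemma realInv_realInv (p : ℂ × ℂ × ℂ) : realInv (realInv p) = p := by
  simp [realInv_apply]

lemma tendsto_realInv : Tendsto realInv (𝓝 0) (𝓝 0) :=
  realInv.continuous.tendsto' _ _ (map_zero _)

/-- Schwarz reflection for germs of functions of one variable. -/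
lemma eventually_conj_conj {f : ℂ → ℂ} (hf : AnalyticAt ℂ f 0)
    (h0 : ∀ᶠ t : ℝ in 𝓝 0, (f t).im = 0) : ∀ᶠ z in 𝓝 0, conj (f (conj z)) = f z := by
  let σ : ℂ ≃ₗᵢ⋆[ℂ] ℂ :=
    { toFun := conj, invFun := conj, map_add' := by simp, map_smul' := by simp
      left_inv := Complex.conj_conj, right_inv := Complex.conj_conj
      norm_map' := fun z => RCLike.norm_conj z }
  have h1 : AnalyticAt ℂ (fun z => conj (f (conj z))) 0 := analyticAt_conj_conj hf σ
  obtain ⟨r, hr, hc⟩ := Metric.eventually_nhds_iff_ball.1 (h1.fun_sub hf).eventually_analyticAt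
  filter_upwards [Metric.ball_mem_nhds _ hr] with z hz
  have := eqOn_zero_ball_of_real (f := fun z => conj (f (conj z)) - f z) hc (by
    filter_upwards [nhdsWithin_le_nhds h0] with t ht
    rw [Complex.conj_ofReal, Complex.conj_eq_iff_im.2 ht, sub_self]) hz
  exact sub_eq_zero.1 this

namespace GenericFamily

variable (F : GenericFamily)

/-- The same family in the coordinates `(y, x)`. -/
def swap : GenericFamily where
  P p := F.Q (p.1, p.2.2, p.2.1)
  Q p := F.P (p.1, p.2.2, p.2.1)
  α := F.α
  β ε := -F.β ε
  analyticAt_P := F.analyticAt_Q.comp_of_eq (f := fun p : ℂ × ℂ × ℂ => (p.1, p.2.2, p.2.1))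
    (by fun_prop) rfl
  analyticAt_Q := F.analyticAt_P.comp_of_eq (f := fun p : ℂ × ℂ × ℂ => (p.1, p.2.2, p.2.1))
    (by fun_prop) rfl
  analyticAt_α := F.analyticAt_α
  analyticAt_β := F.analyticAt_β.neg
  reality := by
    have h : Tendsto (fun p : ℂ × ℂ × ℂ => (conj p.1, conj p.2.1, conj p.2.2)) (𝓝 0) (𝓝 0) := by
      have : Continuous (fun p : ℂ × ℂ × ℂ => (conj p.1, conj p.2.1, conj p.2.2)) := by fun_prop
      exact this.tendsto' _ _ (by simp)
    filter_upwards [h.eventually F.reality] with p hp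
    simp only [hp, Complex.conj_conj]
  singular := by
    have h : Tendsto (fun ε : ℂ => ((conj ε, 0, 0) : ℂ × ℂ × ℂ)) (𝓝 0) (𝓝 0) := by
      have : Continuous (fun ε : ℂ => ((conj ε, 0, 0) : ℂ × ℂ × ℂ)) := by fun_prop
      exact this.tendsto' _ _ (by simp)
    filter_upwards [h.eventually F.reality, h.eventually
      ((continuous_fst.tendsto' (0 : ℂ × ℂ × ℂ) 0 rfl).eventually F.singular)] with ε h1 h2
    rw [h2] at h1
    simpa using h1.symm
  linearPart := by
    have hconj : Tendsto (fun ε : ℂ => conj ε) (𝓝 0) (𝓝 0) :=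
      Complex.continuous_conj.tendsto' _ _ (by simp)
    have hline : Tendsto (fun ε : ℂ => ((ε, 0) : ℂ × ℂ × ℂ)) (𝓝 0) (𝓝 0) := by
      have : Continuous (fun ε : ℂ => ((ε, 0) : ℂ × ℂ × ℂ)) := by fun_prop
      exact this.tendsto' _ _ rfl
    filter_upwards [hconj.eventually F.linearPart, eventually_conj_conj F.analyticAt_α F.α_real,
      eventually_conj_conj F.analyticAt_β F.β_real,
      hline.eventually F.analyticAt_Q.eventually_analyticAt,
      (hline.eventually (tendsto_realInv.eventually F.reality).eventually_nhds)] with ε h1 h2 h3 h4 h5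
    have hQ : HasFDerivAt (fun z : ℂ × ℂ => F.Q (ε, z))
        (fderiv ℂ F.Q (ε, 0) ∘L .inr ℂ ℂ (ℂ × ℂ)) 0 :=
      h4.differentiableAt.hasFDerivAt.comp (f := fun z : ℂ × ℂ => (ε, z)) (0 : ℂ × ℂ)
        (hasFDerivAt_prodMk_right ε (0 : ℂ × ℂ))
    set A := fderiv ℂ F.Q (ε, 0) ∘L .inr ℂ ℂ (ℂ × ℂ)
    let κ : (ℂ × ℂ) →L[ℝ] (ℂ × ℂ) :=
      ((Complex.conjCLE.toContinuousLinearMap).comp (.snd ℝ ℂ ℂ)).prod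
        ((Complex.conjCLE.toContinuousLinearMap).comp (.fst ℝ ℂ ℂ))
    have hP : HasFDerivAt (fun z : ℂ × ℂ => conj (F.P (conj ε, κ z)))
        (Complex.conjCLE.toContinuousLinearMap.comp
        ((((F.α (conj ε) + Complex.I * F.β (conj ε)) •
          ContinuousLinearMap.fst ℂ ℂ ℂ).restrictScalars ℝ).comp κ)) 0 := by
      have h6 := h1.restrictScalars ℝ
      have h7 : HasFDerivAt (fun z : ℂ × ℂ => F.P (conj ε, κ z)) _ 0 :=
        HasFDerivAt.comp (𝕜 := ℝ) (g := fun z : ℂ × ℂ => F.P (conj ε, z)) (f := κ) 0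
          (by rw [map_zero]; exact h6) κ.hasFDerivAt
      exact (Complex.conjCLE.toContinuousLinearMap.hasFDerivAt).comp (0 : ℂ × ℂ) h7
    have heq : (fun z : ℂ × ℂ => conj (F.P (conj ε, κ z))) =ᶠ[𝓝 0] fun z => F.Q (ε, z) := by
      have : Tendsto (fun z : ℂ × ℂ => (ε, z)) (𝓝 0) (𝓝 (ε, 0)) := by
        have : Continuous (fun z : ℂ × ℂ => (ε, z)) := by fun_prop
        exact this.tendsto' _ _ rfl
      filter_upwards [this.eventually h5] with z hz
      change conj (F.P (realInv (ε, z))) = _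
      rw [hz]
      change conj (conj (F.Q (realInv (realInv (ε, z))))) = _
      rw [realInv_realInv, Complex.conj_conj]
    have hAeq := (hP.congr_of_eventuallyEq heq.symm).unique (hQ.restrictScalars ℝ)
    have hsw := HasFDerivAt.comp (g := fun z : ℂ × ℂ => F.Q (ε, z))
      (f := fun z : ℂ × ℂ => (z.2, z.1)) (0 : ℂ × ℂ) hQ
      (ContinuousLinearEquiv.prodComm ℂ ℂ ℂ).toContinuousLinearMap.hasFDerivAt
    refine hsw.congr_fderiv ?_
    ext1
    · ext
      have := DFunLike.congr_fun hAeq ((0 : ℂ), (1 : ℂ))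
      simp only [ContinuousLinearMap.comp_apply, ContinuousLinearMap.coe_restrictScalars'] at this
      simp only [ContinuousLinearMap.comp_apply, ContinuousLinearMap.inl_apply]
      change A (0, 1) = _
      rw [← this]
      simp [κ, h2, h3]
    · ext
      have := DFunLike.congr_fun hAeq ((1 : ℂ), (0 : ℂ))
      simp only [ContinuousLinearMap.comp_apply, ContinuousLinearMap.coe_restrictScalars'] at this
      simp only [ContinuousLinearMap.comp_apply, ContinuousLinearMap.inr_apply]
      change A (1, 0) = _
      rw [← this]
      simp [κ]
  α_real := F.α_real
  β_real := by
    filter_upwards [F.β_real] with t ht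
    simp [ht]
  α_zero := F.α_zero
  β_zero := neg_ne_zero.2 F.β_zero
  generic := F.generic

lemma realOrbitallyEquivalent_swap : RealOrbitallyEquivalent F F.swap := by
  let e := ContinuousLinearEquiv.prodComm ℂ ℂ ℂ
  have he : ∀ z : ℂ × ℂ, HasFDerivAt (fun z : ℂ × ℂ => (z.2, z.1)) (e : ℂ × ℂ →L[ℂ] ℂ × ℂ) z :=
    fun z => e.toContinuousLinearMap.hasFDerivAt
  refine ⟨id, fun p => (p.2.2, p.2.1), fun _ => 1, ⟨analyticAt_id, rfl, by simp, by simp⟩,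
    by fun_prop, by simp, ?_, by simp, by fun_prop, by simp, ?_⟩
  · rw [(he 0).fderiv]; exact ContinuousLinearMap.isInvertible_equiv
  · refine Eventually.of_forall fun p => ?_
    rw [(he p.2).fderiv, one_smul]
    rfl

/-- In the coordinates (y, x) the slope becomes 1/X and the second coordinate of the path becomes x
= Xu. The sense of rotation also changes sign, so the new path of slopes is exactly the one
prescribed for the swapped family. -/
lemma isLift_swap {ε s : ℂ} {u : ℝ → ℂ} (h : F.IsLift ε s u) :
    F.swap.IsLift ε s (fun t => F.equator t * u t) := by
  have hrot : F.swap.rotation = -F.rotation := by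
    simp only [rotation, swap, Complex.neg_re]
    exact Real.sign_neg
  have heq : ∀ t, F.swap.equator t * F.equator t = 1 := by
    intro t
    rw [equator, equator, ← Complex.exp_add, hrot]
    push_cast
    rw [show -(F.rotation : ℂ) * t * Complex.I + F.rotation * t * Complex.I = 0 by ring,
      Complex.exp_zero]
  have hne : ∀ t, F.equator t ≠ 0 := fun t => Complex.exp_ne_zero _
  refine ⟨by simp [equator, h.1], ?_, ?_⟩
  · rcases h.leaf with h1 | h1
    · exact Or.inl fun t ht => by rw [h1 t ht, mul_zero]
    · exact Or.inr fun t ht => mul_ne_zero (hne t) (h1 t ht)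
  · intro t ht
    obtain ⟨x', y', hx, hy, ht'⟩ := h.tangent t ht
    refine ⟨y', x', ?_, hx, ?_⟩
    · simpa only [← mul_assoc, heq, one_mul] using hy
    · rw [← mul_assoc, heq, one_mul]
      change y' * F.P (ε, F.equator t * u t, u t) - x' * F.Q (ε, F.equator t * u t, u t) = 0
      linear_combination -ht'

/-- `D` represents the family of foliations of `F`, which turns counterclockwise. -/
structure Represents (D : FolData) (F : GenericFamily) : Prop where
  P_eq : ∀ᶠ p : ℂ × ℂ × ℂ in 𝓝 0, F.P p = p.2.1 * D.p1 p + p.2.2 * D.p2 p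
  Q_eq : ∀ᶠ p : ℂ × ℂ × ℂ in 𝓝 0, F.Q p = p.2.1 * D.q1 p + p.2.2 * D.q2 p
  rotation_eq : F.rotation = 1
  p1_eq : ∀ᶠ ε : ℂ in 𝓝 0, D.p1 (ε, 0, 0) = F.α ε + Complex.I * F.β ε
  p2_eq : ∀ᶠ ε : ℂ in 𝓝 0, D.p2 (ε, 0, 0) = 0

lemma β_zero_im : (F.β 0).im = 0 := by simpa using F.β_real.self_of_nhds

lemma β_zero_eq : F.β 0 = ((F.β 0).re : ℂ) := Complex.ext rfl (by simp [β_zero_im])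

lemma β_zero_re_ne : (F.β 0).re ≠ 0 := by
  intro h
  refine F.β_zero ?_
  rw [β_zero_eq, h, Complex.ofReal_zero]

/-- Hadamard's lemma gives P = x p₁ + y p₂. The coefficients of Q are defined from these by the real
structure, so the reality identities are exact and the factorization of Q follows from the reality
of the family. -/
lemma exists_represents (hβ : 0 < (F.β 0).re) : ∃ D, Represents D F := by
  obtain ⟨A, hA, hAeq, hA0⟩ := exists_analyticAt_hadamard F.analyticAt_P
  have hline : Tendsto (fun ε : ℂ => ((ε, 0) : ℂ × ℂ × ℂ)) (𝓝 0) (𝓝 0) := by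
    have : Continuous (fun ε : ℂ => ((ε, 0) : ℂ × ℂ × ℂ)) := by fun_prop
    exact this.tendsto' _ _ rfl
  have hA1 : ∀ᶠ ε : ℂ in 𝓝 0, A (ε, 0)
      = (F.α ε + Complex.I * F.β ε) • ContinuousLinearMap.fst ℂ ℂ ℂ := by
    filter_upwards [hA0, F.linearPart, hline.eventually F.analyticAt_P.eventually_analyticAt]
      with ε h1 h2 h3
    rw [h1]
    exact (h3.differentiableAt.hasFDerivAt.comp (f := fun z : ℂ × ℂ => (ε, z)) (0 : ℂ × ℂ)
      (hasFDerivAt_prodMk_right ε (0 : ℂ × ℂ))).unique h2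
  have happ : ∀ v : ℂ × ℂ, AnalyticAt ℂ (fun p => A p v) 0 := fun v =>
    ((ContinuousLinearMap.apply ℂ ℂ v).analyticAt _).comp hA
  have hAz : A 0 = (Complex.I * ((F.β 0).re : ℂ)) • ContinuousLinearMap.fst ℂ ℂ ℂ := by
    have := hA1.self_of_nhds
    rw [F.α_zero, zero_add] at this
    rw [← F.β_zero_eq]; exact this
  have hreal : ∀ p : ℂ × ℂ × ℂ, realInv (conj p.1, conj p.2.2, conj p.2.1) = p :=
    fun p => realInv_realInv p
  let D : FolData :=
    { p1 := fun p => A p (1, 0)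
      p2 := fun p => A p (0, 1)
      q1 := fun p => conj (A (realInv p) (0, 1))
      q2 := fun p => conj (A (realInv p) (1, 0))
      b := (F.β 0).re
      analyticAt_p1 := happ _
      analyticAt_p2 := happ _
      analyticAt_q1 := analyticAt_conj_conj (happ _) realInv
      analyticAt_q2 := analyticAt_conj_conj (happ _) realInv
      b_pos := hβ
      p1_zero := by simp [hAz]
      p2_zero := by simp [hAz]
      q1_zero := by simp [hAz]
      q2_zero := by simp [hAz]
      real1 := Eventually.of_forall fun p => by rw [hreal, Complex.conj_conj]
      real2 := Eventually.of_forall fun p => by rw [hreal, Complex.conj_conj] }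
  have hsing : ∀ᶠ p : ℂ × ℂ × ℂ in 𝓝 0, F.P (p.1, 0) = 0 :=
    (continuous_fst.tendsto' (0 : ℂ × ℂ × ℂ) 0 rfl).eventually F.singular
  have hP : ∀ᶠ p : ℂ × ℂ × ℂ in 𝓝 0, F.P p = p.2.1 * A p (1, 0) + p.2.2 * A p (0, 1) := by
    filter_upwards [hAeq, hsing] with p h1 h2
    rw [h1, h2, zero_add]
    have : p.2 = p.2.1 • ((1 : ℂ), (0 : ℂ)) + p.2.2 • ((0 : ℂ), (1 : ℂ)) := by
      ext <;> simp
    conv_lhs => rw [this, map_add, map_smul, map_smul]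
    rfl
  refine ⟨D, hP, ?_, Real.sign_of_pos hβ, ?_, ?_⟩
  · filter_upwards [tendsto_realInv.eventually hP, tendsto_realInv.eventually F.reality] with p h1 h2
    have h3 : F.Q p = conj (F.P (realInv p)) := by
      rw [h2, Complex.conj_conj]
      exact congrArg F.Q (realInv_realInv p).symm
    rw [h3, h1]
    simp only [map_add, map_mul]
    simp only [realInv_apply, Complex.conj_conj]
    rw [add_comm]
    rfl
  · filter_upwards [hA1] with ε h
    change A (ε, 0) (1, 0) = _
    simp [h]
  · filter_upwards [hA1] with ε h
    change A (ε, 0) (0, 1) = _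
    simp [h]

end GenericFamily

end WeakFocus

end

/-! ### Lifts of the equator are leaves -/

noncomputable section

namespace WeakFocus

namespace FolData

variable (D : FolData)

/-- Analytic transport along the leaves from variable angles to a fixed angle. -/
lemma exists_transportMap (a : ℝ) {b : ℝ} (hb : b ∈ angles) :
    ∃ E : ℂ × ℂ × ℂ → ℂ, AnalyticAt ℂ E (0, 0, (a : ℂ)) ∧ E (0, 0, (a : ℂ)) ≠ 0 ∧
      ∀ᶠ q : ℂ × ℂ × ℂ in 𝓝 (0, 0, (a : ℂ)), ∀ t : ℝ, q.2.2 = t → t ∈ angles →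
        ∀ W, D.IsLeaf q.1 W → W t = q.2.1 → W b = q.2.1 * E q := by
  let cst : ℂ →L[ℂ] C(Unit, ℂ) := ContinuousLinearMap.const ℂ Unit
  have hcst : ∀ z, AnalyticAt ℂ cst z := cst.analyticAt
  obtain ⟨V, hV, -, hsol⟩ := exists_transport D (cst a) (cst (b - a))
  -- The initial angle enters analytically, and may be complex; the length b - t is adjusted so that
  -- the path ends at the fixed angle. The interpretation by leaves is claimed only for real angles.
  let j : ℂ × ℂ × ℂ → Param Unit := fun q => (q.1, cst q.2.1, cst q.2.2, cst (b - q.2.2))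
  have hj : ∀ q, AnalyticAt ℂ j q := by
    intro q; simp only [j]; fun_prop
  have hj0 : j (0, 0, (a : ℂ)) = (0, 0, cst a, cst (b - a)) := by
    simp only [j, map_zero]
  have hVj : AnalyticAt ℂ (fun q => V (j q)) (0, 0, (a : ℂ)) := hV.comp_of_eq (hj _) hj0
  have hjt : Tendsto j (𝓝 (0, 0, (a : ℂ))) (𝓝 (0, 0, cst a, cst (b - a))) := by
    have := (hj (0, 0, (a : ℂ))).continuousAt.tendsto
    rwa [hj0] at this
  let ev : C(Unit × unitInterval, ℂ) →L[ℂ] ℂ := ContinuousMap.evalCLM ℂ ((), 1)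
  refine ⟨fun q => Complex.exp (ev (V (j q))), ?_, Complex.exp_ne_zero _, ?_⟩
  · exact ((ev.analyticAt _).comp hVj).cexp
  have hbd : ∀ᶠ q in 𝓝 ((0 : ℂ), (0 : ℂ), (a : ℂ)), ‖V (j q)‖ < ‖V (j (0, 0, (a : ℂ)))‖ + 1 :=
    hVj.continuousAt.norm.eventually (gt_mem_nhds (by simp))
  set M := ‖V (j (0, 0, (a : ℂ)))‖ + 1 with hM
  have hsmall : ∀ᶠ q : ℂ × ℂ × ℂ in 𝓝 (0, 0, (a : ℂ)), ‖q.1‖ < D.rad ∧ ‖q.2.1‖ * Real.exp M < D.rad := by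
    have h1 : ContinuousAt (fun q : ℂ × ℂ × ℂ => ‖q.1‖) (0, 0, (a : ℂ)) := by fun_prop
    have h2 : ContinuousAt (fun q : ℂ × ℂ × ℂ => ‖q.2.1‖ * Real.exp M) (0, 0, (a : ℂ)) := by
      fun_prop
    exact (h1.eventually (gt_mem_nhds (by simpa using D.rad_pos))).and
      (h2.eventually (gt_mem_nhds (by simpa using D.rad_pos)))
  filter_upwards [hjt.eventually hsol, hbd, hsmall] with q hq hqM hqs t hqt ht W hW hWt
  obtain ⟨h0, h1⟩ := hq ()
  have hw : D.IsSol q.1 0 1 (fun τ => t + τ * (b - t)) (fun _ => b - t)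
      (fun τ => q.2.1 * Complex.exp (V (j q) ((), Set.projIcc 0 1 zero_le_one τ))) := by
    intro τ hτ
    refine ⟨?_, hasDerivWithinAt_path t b τ _, (h1 τ hτ).congr_deriv ?_⟩
    · rw [norm_mul]
      refine lt_of_le_of_lt ?_ hqs.2
      gcongr
      rw [Complex.norm_exp]
      gcongr
      exact (Complex.re_le_norm _).trans ((ContinuousMap.norm_coe_le_norm _ _).trans hqM.le)
    · simp [j, cst, hqt]
  have h00 : V (j q) ((), 0) = 0 := h0
  have h01 : Set.projIcc (0 : ℝ) 1 zero_le_one 0 = 0 := by simp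
  have := hW.path_eq hqs.1 ht hb hw (by simp only [h01, h00, Complex.exp_zero, mul_one, hWt])
  rw [← this]
  have h11 : Set.projIcc (0 : ℝ) 1 zero_le_one 1 = 1 := by simp
  simp only [h11]
  rfl

variable {D}

lemma isLeaf_zero (ε : ℂ) : D.IsLeaf ε (fun _ => 0) := by
  intro t _
  refine ⟨by simpa using D.rad_pos, (hasDerivAt_id t).hasDerivWithinAt, ?_⟩
  simpa using hasDerivWithinAt_const t angles (0 : ℂ)

lemma IsLeaf.eq_zero {ε : ℂ} {W : ℝ → ℂ} (hε : ‖ε‖ < D.rad) (h : D.IsLeaf ε W) {a : ℝ}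
    (ha : a ∈ angles) (h0 : W a = 0) : ∀ t ∈ angles, W t = 0 :=
  fun _ ht => h.eqOn hε (isLeaf_zero ε) ha h0 ht

end FolData

lemma two_pi_mem : 2 * Real.pi ∈ FolData.angles :=
  ⟨by linarith [Real.pi_pos], by linarith [Real.pi_lt_d2]⟩

lemma zero_mem_angles : (0 : ℝ) ∈ FolData.angles := ⟨by norm_num, by norm_num⟩

lemma Icc_two_pi_subset : Set.Icc 0 (2 * Real.pi) ⊆ FolData.angles :=
  (convex_Icc (-20 : ℝ) 20).ordConnected.out zero_mem_angles two_pi_mem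

namespace GenericFamily

open FolData

variable {D : FolData} {F : GenericFamily}

lemma Represents.equator_eq (h : Represents D F) (t : ℝ) :
    F.equator t = Complex.exp (Complex.I * t) := by
  rw [equator, h.rotation_eq]; congr 1; push_cast; ring

lemma hasDerivAt_exp_I (t : ℝ) :
    HasDerivAt (fun t : ℝ => Complex.exp (Complex.I * t))
      (Complex.I * Complex.exp (Complex.I * t)) t := by
  have : HasDerivAt (fun t : ℝ => Complex.I * (t : ℂ)) Complex.I t := by
    simpa using (Complex.ofRealCLM.hasDerivAt (x := t)).const_mul Complex.I
  simpa [mul_comm] using this.cexp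

/-- The tangent vector of a leaf is proportional to the vector field. -/
lemma Represents.tangent_iff (h : Represents D F) : ∃ r > 0, r ≤ D.rad ∧ ∀ ε u : ℂ, ‖ε‖ < r →
    ‖u‖ < r → ∀ t : ℝ, ∀ y' : ℂ, u ≠ 0 ∨ (u = 0 ∧ y' = 0) →
    ((Complex.I * Complex.exp (Complex.I * t) * u + Complex.exp (Complex.I * t) * y') *
        F.Q (ε, Complex.exp (Complex.I * t) * u, u) -
        y' * F.P (ε, Complex.exp (Complex.I * t) * u, u) = 0 ↔
      y' = u * D.slope ε (Complex.exp (Complex.I * t)) u) := by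
  obtain ⟨r, hr, hPQ⟩ := Metric.eventually_nhds_iff_ball.1 (h.P_eq.and h.Q_eq)
  refine ⟨min r D.rad, lt_min hr D.rad_pos, min_le_right _ _, ?_⟩
  intro ε u hε hu t y' hy
  -- On the divisor P and Q both vanish and the tangency equation is void, so y' = 0 has to be
  -- supplied as a hypothesis.
  rcases hy with hu0 | ⟨rfl, rfl⟩
  swap
  · simp
  set X := Complex.exp (Complex.I * t) with hX
  have hX0 : X ≠ 0 := Complex.exp_ne_zero _
  have hXn : ‖X‖ = 1 := mem_sphere_zero_iff_norm.1 (exp_I_mem_sphere t)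
  have hm : (ε, X * u, u) ∈ Metric.ball (0 : ℂ × ℂ × ℂ) r := by
    rw [mem_ball_zero_iff, prod_norm_lt_iff, prod_norm_lt_iff, norm_mul, hXn, one_mul]
    have := hu.trans_le (min_le_left _ _)
    exact ⟨hε.trans_le (min_le_left _ _), this, this⟩
  obtain ⟨hP, hQ⟩ := hPQ _ hm
  have hd : D.den ε X u ≠ 0 :=
    den_ne (hε.trans_le (min_le_right _ _)) (exp_I_mem_sphere t) (hu.trans_le (min_le_right _ _))
  have hP' : F.P (ε, X * u, u) = X * u * (D.den ε X u + D.num ε X u) := by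
    rw [hP, den, num]; field_simp; ring
  have hQ' : F.Q (ε, X * u, u) = u * D.num ε X u := by
    rw [hQ, num]; ring
  rw [hP', hQ', FolData.slope]
  have : (Complex.I * X * u + X * y') * (u * D.num ε X u) -
      y' * (X * u * (D.den ε X u + D.num ε X u))
      = (X * u * D.den ε X u) * (u * (Complex.I * D.num ε X u / D.den ε X u) - y') := by
    field_simp; ring
  rw [this, mul_eq_zero, or_iff_right (mul_ne_zero (mul_ne_zero hX0 hu0) hd), sub_eq_zero, eq_comm]

/-- As long as a lift stays in the ball of radius `r₁` it solves the equation of the leaves, hence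
coincides with `W`, which is bounded by C‖s‖ < r₁. So the lift cannot reach the boundary of that
ball, and all lifts have the same endpoint. -/
lemma Represents.holonomy_eq (h : Represents D F) : ∃ r > 0, r ≤ D.rad ∧ ∀ ε s : ℂ, ‖ε‖ < r →
    ‖s‖ < r → ∀ W, D.IsLeaf ε W → W 0 = s → (∃ u, F.IsLift ε s u) ∧
      ∀ u, F.IsLift ε s u → u (2 * Real.pi) = W (2 * Real.pi) := by
  obtain ⟨r₁, hr₁, hrD, htan⟩ := h.tangent_iff
  obtain ⟨r₂, hr₂, C, hC, hex⟩ := D.exists_leaf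
  have hC0 : 0 < C := zero_lt_one.trans_le hC
  have hrC : r₁ / C ≤ r₁ := div_le_self hr₁.le hC
  refine ⟨min (r₁ / C) r₂, lt_min (div_pos hr₁ hC0) hr₂,
    (min_le_left _ _).trans (hrC.trans hrD), ?_⟩
  intro ε s hε hs W hW hW0
  have hεr : ‖ε‖ < r₁ := hε.trans_le ((min_le_left _ _).trans hrC)
  have hεD := hεr.trans_le hrD
  have hsC : C * ‖s‖ < r₁ := by
    rw [mul_comm, ← lt_div_iff₀ hC0]; exact hs.trans_le (min_le_left _ _)
  have hWC : ∀ t ∈ angles, ‖W t‖ ≤ C * ‖s‖ := by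
    obtain ⟨W', hW', h0, hb⟩ := hex ε s (hε.trans_le (min_le_right _ _))
      (hs.trans_le (min_le_right _ _)) 0 zero_mem_angles
    intro t ht
    rw [hW.eqOn hεD hW' zero_mem_angles (hW0.trans h0.symm) ht]
    exact hb t ht
  have hsub : Set.Icc 0 (2 * Real.pi) ⊆ angles := Icc_two_pi_subset
  have hpi : (0 : ℝ) < 2 * Real.pi := by positivity
  refine ⟨⟨W, hW0, ?_, ?_⟩, ?_⟩
  · by_cases hs0 : s = 0
    · exact Or.inl fun t ht => hW.eq_zero hεD zero_mem_angles (hW0.trans hs0) t (hsub ht)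
    · refine Or.inr fun t ht h0 => hs0 ?_
      rw [← hW0]
      exact hW.eq_zero hεD (hsub ht) h0 0 zero_mem_angles
  · intro t ht
    have hd := (hW t (hsub ht)).2.2.mono hsub
    refine ⟨Complex.I * Complex.exp (Complex.I * t) * W t + Complex.exp (Complex.I * t) *
      (((1 : ℝ) : ℂ) * (W t * D.slope ε (Complex.exp (Complex.I * t)) (W t))), _, ?_, hd, ?_⟩
    · simp only [h.equator_eq]
      exact (hasDerivAt_exp_I t).hasDerivWithinAt.fun_mul hd
    · simp only [h.equator_eq]
      rw [Complex.ofReal_one, one_mul]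
      refine (htan ε (W t) hεr ((hWC t (hsub ht)).trans_lt hsC) t _ ?_).2 rfl
      by_cases h0 : W t = 0
      · exact Or.inr ⟨h0, by rw [h0, zero_mul]⟩
      · exact Or.inl h0
  · intro u hu
    have hcont : ContinuousOn u (Set.Icc 0 (2 * Real.pi)) := fun t ht => by
      obtain ⟨-, y', -, hy, -⟩ := hu.tangent t ht
      exact hy.continuousWithinAt
    have hsol : ∀ d ∈ Set.Icc 0 (2 * Real.pi), (∀ t ∈ Set.Icc 0 d, ‖u t‖ < r₁) →
        Set.EqOn u W (Set.Icc 0 d) := by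
      intro d hd hlt
      have hdsub : Set.Icc 0 d ⊆ Set.Icc 0 (2 * Real.pi) := Set.Icc_subset_Icc_right hd.2
      have h1 : D.IsSol ε 0 d (fun t => t) (fun _ => 1) u := by
        intro t ht
        have ht' := hdsub ht
        refine ⟨(hlt t ht).trans_le hrD, (hasDerivAt_id t).hasDerivWithinAt, ?_⟩
        obtain ⟨x', y', hx, hy, he⟩ := hu.tangent t ht'
        have hxy := (uniqueDiffOn_Icc hpi t ht').eq_deriv _ hx (by
          simp only [h.equator_eq]
          exact (hasDerivAt_exp_I t).hasDerivWithinAt.fun_mul hy)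
        rw [hxy] at he
        simp only [h.equator_eq] at he
        -- The dichotomy in the definition of a lift is used here: a lift that touches the divisor
        -- is identically zero, so its derivative vanishes.
        have hy0 : u t ≠ 0 ∨ (u t = 0 ∧ y' = 0) := by
          rcases hu.leaf with hl | hl
          · refine Or.inr ⟨hl t ht', ?_⟩
            refine (uniqueDiffOn_Icc hpi t ht').eq_deriv _ hy ?_
            exact (hasDerivWithinAt_const t _ (0 : ℂ)).congr hl (hl t ht')
          · exact Or.inl (hl t ht')
        rw [(htan ε (u t) hεr (hlt t ht) t y' hy0).1 he] at hy
        simpa using hy.mono hdsub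
      have h2 : D.IsSol ε 0 d (fun t => t) (fun _ => 1) W :=
        hW.comp (f := fun t => t) (fun t _ => (hasDerivAt_id t).hasDerivWithinAt)
          (fun t ht => hsub (hdsub ht))
      exact IsSol.eqOn hεD h1 h2 (M := 1) (by simp) (t₀ := 0) ⟨le_rfl, hd.1⟩
        (hu.1.trans hW0.symm)
    -- First exit time argument: before `t₁` the lift equals `W`, so by continuity its norm at `t₁`
    -- is at most C‖s‖, which is less than r₁.
    have hall : ∀ t ∈ Set.Icc 0 (2 * Real.pi), ‖u t‖ < r₁ := by
      by_contra! hcon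
      set S := {t ∈ Set.Icc 0 (2 * Real.pi) | r₁ ≤ ‖u t‖} with hS
      have hSc : IsCompact S := by
        have : S = Set.Icc 0 (2 * Real.pi) ∩ (fun t => ‖u t‖) ⁻¹' Set.Ici r₁ := rfl
        rw [this]
        exact isCompact_Icc.of_isClosed_subset
          (hcont.norm.preimage_isClosed_of_isClosed isClosed_Icc isClosed_Ici)
          Set.inter_subset_left
      obtain ⟨t₁, ht₁, hmin⟩ := hSc.exists_isLeast hcon
      have hle : ∀ t ∈ Set.Ico 0 t₁, ‖u t‖ ≤ C * ‖s‖ := by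
        intro t ht
        have ht' : t ∈ Set.Icc 0 (2 * Real.pi) := ⟨ht.1, ht.2.le.trans ht₁.1.2⟩
        have := hsol t ht' (fun τ hτ => by
          by_contra! hge
          have := hmin ⟨⟨hτ.1, hτ.2.trans ht'.2⟩, hge⟩
          linarith [hτ.2, ht.2]) ⟨ht.1, le_rfl⟩
        rw [this]
        exact hWC t (hsub ht')
      have ht₁0 : 0 ≠ t₁ := by
        rintro rfl
        have := ht₁.2
        rw [hu.1] at this
        have h1 : ‖s‖ ≤ C * ‖s‖ := le_mul_of_one_le_left (norm_nonneg _) hC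
        linarith
      have hcl : t₁ ∈ closure (Set.Ico 0 t₁) := by
        rw [closure_Ico ht₁0]; exact ⟨ht₁.1.1, le_rfl⟩
      have := le_on_closure hle (f := fun t => ‖u t‖)
        (by rw [closure_Ico ht₁0]; exact hcont.norm.mono (Set.Icc_subset_Icc_right ht₁.1.2))
        continuousOn_const hcl
      have h2 : r₁ ≤ ‖u t₁‖ := ht₁.2
      linarith
    exact hsol (2 * Real.pi) ⟨hpi.le, le_rfl⟩ hall ⟨hpi.le, le_rfl⟩

end GenericFamily

end WeakFocus

end

/-! ### The Poincaré map as a double turn; composition of conjugacies -/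

noncomputable section

namespace WeakFocus

namespace GenericFamily

open FolData

variable {D : FolData} {F : GenericFamily}

lemma Represents.exists_holonomyMap (h : Represents D F) : ∃ E : ℂ × ℂ → ℂ, AnalyticAt ℂ E 0 ∧
    ∀ᶠ p : ℂ × ℂ in 𝓝 0, F.holonomy p = p.2 * E p ∧
      ∀ W, D.IsLeaf p.1 W → W 0 = p.2 → W (2 * Real.pi) = F.holonomy p := by
  obtain ⟨E, hE, -, hEq⟩ := D.exists_transportMap 0 two_pi_mem
  rw [Complex.ofReal_zero] at hE hEq
  obtain ⟨r, hr, -, hol⟩ := h.holonomy_eq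
  obtain ⟨r₂, hr₂, C, -, hex⟩ := D.exists_leaf
  have hj : Tendsto (fun p : ℂ × ℂ => (p.1, p.2, (0 : ℂ))) (𝓝 0) (𝓝 (0, 0, 0)) := by
    have : Continuous (fun p : ℂ × ℂ => (p.1, p.2, (0 : ℂ))) := by fun_prop
    exact this.tendsto' _ _ rfl
  refine ⟨fun p => E (p.1, p.2, 0), hE.comp_of_eq (f := fun p : ℂ × ℂ => (p.1, p.2, (0 : ℂ)))
    (by fun_prop) rfl, ?_⟩
  filter_upwards [hj.eventually hEq, Metric.ball_mem_nhds _ hr, Metric.ball_mem_nhds _ hr₂]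
    with p h1 h2 h3
  rw [mem_ball_zero_iff, prod_norm_lt_iff] at h2 h3
  have key : ∀ W, D.IsLeaf p.1 W → W 0 = p.2 → W (2 * Real.pi) = F.holonomy p := by
    intro W hW hW0
    obtain ⟨hu, huniq⟩ := hol p.1 p.2 h2.1 h2.2 W hW hW0
    -- Which lift is chosen by `Classical.epsilon` is irrelevant, since all lifts end at the same
    -- point.
    exact (huniq _ (Classical.epsilon_spec hu)).symm
  refine ⟨?_, key⟩
  obtain ⟨W, hW, hW0, -⟩ := hex p.1 p.2 h3.1 h3.2 0 zero_mem_angles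
  rw [← key W hW hW0]
  exact h1 0 (by simp) zero_mem_angles W hW hW0

lemma four_pi_mem : 4 * Real.pi ∈ FolData.angles :=
  ⟨by linarith [Real.pi_pos], by linarith [Real.pi_lt_d2]⟩

/-- The second holonomy starts again from the angle 0 at the point W(2π). By periodicity its leaf is
`W` shifted by one turn. -/
lemma Represents.poincareMap_eq (h : Represents D F) : ∀ᶠ p : ℂ × ℂ in 𝓝 0,
    ∀ W, D.IsLeaf p.1 W → W 0 = p.2 → W (4 * Real.pi) = F.poincareMap p := by
  obtain ⟨E, hE, hol⟩ := h.exists_holonomyMap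
  obtain ⟨r₂, hr₂, C, -, hex⟩ := D.exists_leaf
  have ht : Tendsto (fun p : ℂ × ℂ => (p.1, p.2 * E p)) (𝓝 0) (𝓝 0) := by
    have : ContinuousAt (fun p : ℂ × ℂ => (p.1, p.2 * E p)) 0 :=
      continuousAt_fst.prodMk (continuousAt_snd.mul hE.continuousAt)
    simpa [ContinuousAt] using! this
  filter_upwards [hol, ht.eventually hol, ht.eventually (Metric.ball_mem_nhds _ hr₂),
    Metric.ball_mem_nhds _ D.rad_pos] with p h1 h2 h3 h4 W hW hW0
  rw [dist_zero_right, prod_norm_lt_iff] at h3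
  rw [mem_ball_zero_iff, prod_norm_lt_iff] at h4
  obtain ⟨W₂, hW₂, hW₂0, -⟩ := hex p.1 (p.2 * E p) h3.1 h3.2 0 zero_mem_angles
  have e1 : W (2 * Real.pi) = p.2 * E p := (h1.2 W hW hW0).trans h1.1
  have e2 := hW.shift h4.1 hW₂ 1 (a := 0)
    ⟨by norm_num, by push_cast; linarith [Real.pi_lt_d2]⟩
    (by push_cast; rw [zero_add, one_mul, e1, hW₂0]) (b := 2 * Real.pi)
    ⟨by linarith [Real.pi_pos], by push_cast; linarith [Real.pi_lt_d2]⟩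
  have e3 := h2.2 W₂ hW₂ hW₂0
  have e4 : 2 * Real.pi + ((1 : ℕ) : ℝ) * (2 * Real.pi) = 4 * Real.pi := by push_cast; ring
  rw [e4] at e2
  rw [e2, e3, poincareMap, h1.1]

lemma Represents.analyticAt_poincareMap (h : Represents D F) :
    AnalyticAt ℂ F.poincareMap 0 ∧ (∀ᶠ ε : ℂ in 𝓝 0, F.poincareMap (ε, 0) = 0) := by
  obtain ⟨E, hE, hol⟩ := h.exists_holonomyMap
  have ha : AnalyticAt ℂ (fun p : ℂ × ℂ => p.2 * E p) 0 := by fun_prop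
  have hj : AnalyticAt ℂ (fun p : ℂ × ℂ => (p.1, p.2 * E p)) 0 := by fun_prop
  have hj0 : ((0 : ℂ × ℂ).1, (0 : ℂ × ℂ).2 * E 0) = 0 := by simp
  have ht : Tendsto (fun p : ℂ × ℂ => (p.1, p.2 * E p)) (𝓝 0) (𝓝 0) := by
    have := hj.continuousAt.tendsto
    rwa [hj0] at this
  constructor
  · refine (ha.comp_of_eq hj hj0).congr ?_
    filter_upwards [hol, ht.eventually hol] with p h1 h2
    rw [poincareMap, h1.1, h2.1]
    rfl
  · have hl : Tendsto (fun ε : ℂ => (ε, (0 : ℂ))) (𝓝 0) (𝓝 0) := by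
      have : Continuous (fun ε : ℂ => (ε, (0 : ℂ))) := by fun_prop
      exact this.tendsto' _ _ rfl
    filter_upwards [hl.eventually hol] with ε h1
    have e : F.holonomy (ε, 0) = 0 := by rw [h1.1, zero_mul]
    rw [poincareMap]
    simp only [e]

/-- Multiplication by the slope carries lifts of one family to lifts of the swapped one, and the
slope is 1 at both ends of the equator, so initial and final values are unchanged. -/
lemma Represents.holonomy_swap (h : Represents D F) : F.swap.holonomy =ᶠ[𝓝 0] F.holonomy := by
  obtain ⟨r, hr, -, hol⟩ := h.holonomy_eq
  obtain ⟨r₂, hr₂, C, -, hex⟩ := D.exists_leaf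
  filter_upwards [Metric.ball_mem_nhds _ hr, Metric.ball_mem_nhds _ hr₂] with p h2 h3
  rw [mem_ball_zero_iff, prod_norm_lt_iff] at h2 h3
  obtain ⟨W, hW, hW0, -⟩ := hex p.1 p.2 h3.1 h3.2 0 zero_mem_angles
  obtain ⟨⟨u, hu⟩, huniq⟩ := hol p.1 p.2 h2.1 h2.2 W hW hW0
  have h1 : F.holonomy p = W (2 * Real.pi) := huniq _ (Classical.epsilon_spec ⟨u, hu⟩)
  have hs : F.swap.IsLift p.1 p.2 (Classical.epsilon (F.swap.IsLift p.1 p.2)) :=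
    Classical.epsilon_spec ⟨_, F.isLift_swap hu⟩
  have hss : F.swap.swap = F := by
    cases F
    simp [swap]
  have h4 := F.swap.isLift_swap hs
  rw [hss] at h4
  have h5 := huniq _ h4
  have hsrot : F.swap.rotation = -1 := by
    rw [← h.rotation_eq]
    simp only [rotation, swap, Complex.neg_re]
    exact Real.sign_neg
  have e : F.swap.equator (2 * Real.pi) = 1 := by
    have : ((-1 : ℝ) : ℂ) * ((2 * Real.pi : ℝ) : ℂ) * Complex.I = -(2 * Real.pi * Complex.I) := by
      push_cast; ring
    rw [equator, hsrot, this, Complex.exp_neg, Complex.exp_two_pi_mul_I, inv_one]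
  rw [e, one_mul] at h5
  rw [h1, ← h5, holonomy]

lemma Represents.poincareMap_swap (h : Represents D F) :
    F.swap.poincareMap =ᶠ[𝓝 0] F.poincareMap := by
  obtain ⟨E, hE, hol⟩ := h.exists_holonomyMap
  have ht : Tendsto (fun p : ℂ × ℂ => (p.1, p.2 * E p)) (𝓝 0) (𝓝 0) := by
    have : ContinuousAt (fun p : ℂ × ℂ => (p.1, p.2 * E p)) 0 :=
      continuousAt_fst.prodMk (continuousAt_snd.mul hE.continuousAt)
    simpa [ContinuousAt] using! this
  filter_upwards [hol, h.holonomy_swap, ht.eventually h.holonomy_swap] with p h1 h2 h3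
  rw [poincareMap, poincareMap, h2, h1.1, h3]

end GenericFamily

/-- The composition of reparametrizations. -/
lemma IsRealReparam.comp {h₁ h₂ : ℂ → ℂ} (H₂ : IsRealReparam h₂) (H₁ : IsRealReparam h₁) :
    IsRealReparam (h₂ ∘ h₁) where
  analyticAt := H₂.analyticAt.comp_of_eq H₁.analyticAt H₁.map_zero
  map_zero := by simp [H₁.map_zero, H₂.map_zero]
  deriv_ne := by
    rw [deriv_comp_of_eq (x := 0) (y := 0) H₂.analyticAt.differentiableAt
      H₁.analyticAt.differentiableAt H₁.map_zero, H₁.map_zero]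
    exact mul_ne_zero H₂.deriv_ne H₁.deriv_ne
  real := by
    have ht : Tendsto (fun t : ℝ => (h₁ t).re) (𝓝 0) (𝓝 0) := by
      have : ContinuousAt (fun t : ℝ => (h₁ t).re) 0 := by
        refine Complex.continuous_re.continuousAt.comp ?_
        exact ContinuousAt.comp_of_eq H₁.analyticAt.continuousAt
          Complex.continuous_ofReal.continuousAt Complex.ofReal_zero
      simpa [ContinuousAt, H₁.map_zero] using this
    filter_upwards [H₁.real, ht.eventually H₂.real] with t h1 h2
    have : h₁ t = ((h₁ t).re : ℂ) := Complex.ext rfl (by simp [h1])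
    rw [Function.comp_apply, this]
    exact h2

lemma RealConjugate.congr {f f' g g' : ℂ × ℂ → ℂ} (h : RealConjugate f g) (hf : f' =ᶠ[𝓝 0] f)
    (hg : g' =ᶠ[𝓝 0] g) : RealConjugate f' g' := by
  obtain ⟨h, H, hh, hH, H0, Hd, Hr, hc⟩ := h
  refine ⟨h, H, hh, hH, H0, Hd, Hr, ?_⟩
  have ht : Tendsto (fun p : ℂ × ℂ => (h p.1, H p)) (𝓝 0) (𝓝 0) := by
    have : ContinuousAt (fun p : ℂ × ℂ => (h p.1, H p)) 0 :=
      (hh.analyticAt.continuousAt.comp_of_eq continuousAt_fst rfl).prodMk hH.continuousAt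
    have e : H 0 = 0 := H0.self_of_nhds
    simpa [ContinuousAt, e, hh.map_zero] using! this
  filter_upwards [hc, hf, ht.eventually hg] with p h1 h2 h3
  rw [h2, h3, h1]

lemma RealConjugate.trans {f g k : ℂ × ℂ → ℂ} (h₁ : RealConjugate f g) (h₂ : RealConjugate g k) :
    RealConjugate f k := by
  obtain ⟨h₁, H₁, hh₁, hH₁, H0₁, Hd₁, Hr₁, hc₁⟩ := h₁
  obtain ⟨h₂, H₂, hh₂, hH₂, H0₂, Hd₂, Hr₂, hc₂⟩ := h₂
  have e₁ : H₁ 0 = 0 := H0₁.self_of_nhds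
  have e₂ : H₂ 0 = 0 := H0₂.self_of_nhds
  have hj : AnalyticAt ℂ (fun p : ℂ × ℂ => (h₁ p.1, H₁ p)) 0 :=
    (hh₁.analyticAt.comp_of_eq analyticAt_fst rfl).prod hH₁
  have hj0 : (h₁ (0 : ℂ × ℂ).1, H₁ 0) = 0 := by simp [e₁, hh₁.map_zero]
  have ht : Tendsto (fun p : ℂ × ℂ => (h₁ p.1, H₁ p)) (𝓝 0) (𝓝 0) := by
    have := hj.continuousAt.tendsto
    rwa [hj0] at this
  have hh₁t : Tendsto h₁ (𝓝 0) (𝓝 0) := by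
    have := hh₁.analyticAt.continuousAt.tendsto
    rwa [hh₁.map_zero] at this
  refine ⟨h₂ ∘ h₁, fun p => H₂ (h₁ p.1, H₁ p), hh₂.comp hh₁, hH₂.comp_of_eq hj hj0, ?_, ?_, ?_, ?_⟩
  · filter_upwards [H0₁, hh₁t.eventually H0₂] with ε h3 h4
    rw [h3, h4]
  · have d1 : DifferentiableAt ℂ (fun x : ℂ => H₁ (0, x)) 0 :=
      DifferentiableAt.comp (g := H₁) (f := fun x : ℂ => ((0 : ℂ), x)) 0
        hH₁.differentiableAt (by fun_prop)
    have d2 : DifferentiableAt ℂ (fun x : ℂ => H₂ (0, x)) 0 :=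
      DifferentiableAt.comp (g := H₂) (f := fun x : ℂ => ((0 : ℂ), x)) 0
        hH₂.differentiableAt (by fun_prop)
    have := deriv_comp_of_eq (x := 0) (y := 0) (h₂ := fun x : ℂ => H₂ (0, x))
      (h := fun x : ℂ => H₁ (0, x)) d2 d1 e₁
    simp only [hh₁.map_zero]
    rw [Function.comp_def] at this
    rw [this, show H₁ ((0 : ℂ), (0 : ℂ)) = 0 from e₁]
    exact mul_ne_zero Hd₂ Hd₁
  · have hc : Tendsto (fun q : ℝ × ℝ => ((q.1 : ℂ), (q.2 : ℂ))) (𝓝 0) (𝓝 0) := by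
      have : Continuous (fun q : ℝ × ℝ => ((q.1 : ℂ), (q.2 : ℂ))) := by fun_prop
      exact this.tendsto' _ _ (by simp)
    have hre : Tendsto (fun q : ℝ × ℝ => ((h₁ q.1).re, (H₁ (q.1, q.2)).re)) (𝓝 0) (𝓝 0) := by
      have h3 : Tendsto (fun p : ℂ × ℂ => (p.1.re, p.2.re)) (𝓝 0) (𝓝 0) := by
        have : Continuous (fun p : ℂ × ℂ => (p.1.re, p.2.re)) := by fun_prop
        exact this.tendsto' _ _ (by simp)
      exact h3.comp (ht.comp hc)
    filter_upwards [Hr₁, (continuous_fst.tendsto' (0 : ℝ × ℝ) 0 rfl).eventually hh₁.real,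
      hre.eventually Hr₂] with q h3 h4 h5
    have e1 : h₁ q.1 = ((h₁ q.1).re : ℂ) := Complex.ext rfl (by simp [h4])
    have e2 : H₁ (q.1, q.2) = ((H₁ (q.1, q.2)).re : ℂ) := Complex.ext rfl (by simp [h3])
    change (H₂ (h₁ q.1, H₁ (q.1, q.2))).im = 0
    rw [e1, e2]
    exact h5
  · filter_upwards [hc₁, ht.eventually hc₂] with p h3 h4
    rw [h3]
    exact h4

end WeakFocus

end

/-! ### Composition of orbital equivalences -/

noncomputable section

namespace WeakFocus

lemma differentiableAt_slice {E Z F : Type*} [NormedAddCommGroup E] [NormedSpace ℂ E]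
    [NormedAddCommGroup Z] [NormedSpace ℂ Z] [NormedAddCommGroup F] [NormedSpace ℂ F]
    {f : E × Z → F} {p : E × Z} (hf : DifferentiableAt ℂ f p) :
    DifferentiableAt ℂ (fun z => f (p.1, z)) p.2 :=
  DifferentiableAt.comp (g := f) (f := fun z => (p.1, z)) p.2 hf (by fun_prop)

lemma realOrbitallyEquivalent_trans {F G K : GenericFamily} (hFG : RealOrbitallyEquivalent F G)
    (hGK : RealOrbitallyEquivalent G K) : RealOrbitallyEquivalent F K := by
  obtain ⟨h₁, Ψ₁, k₁, hh₁, hΨ₁, Ψ₁0, hi₁, Ψ₁r, hk₁, k₁p, e₁⟩ := hFG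
  obtain ⟨h₂, Ψ₂, k₂, hh₂, hΨ₂, Ψ₂0, hi₂, Ψ₂r, hk₂, k₂p, e₂⟩ := hGK
  have z₁ : Ψ₁ 0 = 0 := Ψ₁0.self_of_nhds
  have hj : AnalyticAt ℂ (fun p : ℂ × ℂ × ℂ => (h₁ p.1, Ψ₁ p)) 0 :=
    (hh₁.analyticAt.comp_of_eq analyticAt_fst rfl).prod hΨ₁
  have hj0 : (h₁ (0 : ℂ × ℂ × ℂ).1, Ψ₁ 0) = 0 := by simp [z₁, hh₁.map_zero]
  have ht : Tendsto (fun p : ℂ × ℂ × ℂ => (h₁ p.1, Ψ₁ p)) (𝓝 0) (𝓝 0) := by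
    have := hj.continuousAt.tendsto
    rwa [hj0] at this
  have hh₁t : Tendsto h₁ (𝓝 0) (𝓝 0) := by
    have := hh₁.analyticAt.continuousAt.tendsto
    rwa [hh₁.map_zero] at this
  have hc : Tendsto (fun q : ℝ × ℂ => ((q.1 : ℂ), q.2, conj q.2)) (𝓝 0) (𝓝 0) := by
    have : Continuous (fun q : ℝ × ℂ => ((q.1 : ℂ), q.2, conj q.2)) := by fun_prop
    exact this.tendsto' _ _ (by simp)
  have hre : Tendsto (fun q : ℝ × ℂ => ((h₁ q.1).re, (Ψ₁ (q.1, q.2, conj q.2)).1)) (𝓝 0)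
      (𝓝 0) := by
    have h3 : Tendsto (fun p : ℂ × ℂ × ℂ => (p.1.re, p.2.1)) (𝓝 0) (𝓝 0) := by
      have : Continuous (fun p : ℂ × ℂ × ℂ => (p.1.re, p.2.1)) := by fun_prop
      exact this.tendsto' _ _ (by simp)
    exact h3.comp (ht.comp hc)
  have real : ∀ᶠ q : ℝ × ℂ in 𝓝 0, (h₁ q.1, Ψ₁ (q.1, q.2, conj q.2)) =
      (((h₁ q.1).re : ℂ), (Ψ₁ (q.1, q.2, conj q.2)).1, conj (Ψ₁ (q.1, q.2, conj q.2)).1) := by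
    filter_upwards [Ψ₁r, (continuous_fst.tendsto' (0 : ℝ × ℂ) 0 rfl).eventually hh₁.real]
      with q h3 h4
    have e1 : h₁ q.1 = ((h₁ q.1).re : ℂ) := Complex.ext rfl (by simp [h4])
    rw [← h3, ← e1]
  refine ⟨h₂ ∘ h₁, fun p => Ψ₂ (h₁ p.1, Ψ₁ p), fun p => k₁ p * k₂ (h₁ p.1, Ψ₁ p), hh₂.comp hh₁,
    hΨ₂.comp_of_eq hj hj0, ?_, ?_, ?_, hk₁.mul (hk₂.comp_of_eq hj hj0), ?_, ?_⟩
  · filter_upwards [Ψ₁0, hh₁t.eventually Ψ₂0] with ε h3 h4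
    rw [h3]
    exact h4
  · have d1 : DifferentiableAt ℂ (fun z => Ψ₁ (0, z)) 0 := differentiableAt_slice
      hΨ₁.differentiableAt
    have d2 : DifferentiableAt ℂ (fun z => Ψ₂ (0, z)) 0 := differentiableAt_slice
      hΨ₂.differentiableAt
    have z₁' : Ψ₁ ((0 : ℂ), (0 : ℂ × ℂ)) = 0 := z₁
    have := fderiv_comp (𝕜 := ℂ) (g := fun z => Ψ₂ (0, z)) (f := fun z => Ψ₁ (0, z)) (0 : ℂ × ℂ)
      (by rw [z₁']; exact d2) d1
    simp only [hh₁.map_zero]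
    rw [Function.comp_def, z₁'] at this
    rw [this]
    exact hi₂.comp hi₁
  · filter_upwards [real, hre.eventually Ψ₂r] with q h3 h4
    simp only [h3]
    exact h4
  · filter_upwards [real, hre.eventually k₂p, k₁p] with q h3 h4 h5
    simp only [h3]
    constructor
    · rw [Complex.mul_re, h5.2, zero_mul, sub_zero]
      exact mul_pos h5.1 h4.1
    · rw [Complex.mul_im, h5.2, h4.2]
      ring
  · filter_upwards [e₁, ht.eventually e₂, hΨ₁.eventually_analyticAt,
      ht.eventually hΨ₂.eventually_analyticAt] with p h3 h4 h5 h6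
    have := fderiv_comp (𝕜 := ℂ) (g := fun z => Ψ₂ (h₁ p.1, z)) (f := fun z => Ψ₁ (p.1, z)) p.2
      (differentiableAt_slice (p := (h₁ p.1, Ψ₁ p)) h6.differentiableAt)
      (differentiableAt_slice h5.differentiableAt)
    rw [Function.comp_def] at this
    rw [this, ContinuousLinearMap.comp_apply, h3, map_smul, h4, smul_smul]
    rfl

lemma GenericFamily.swap_swap (F : GenericFamily) : F.swap.swap = F := by
  cases F
  simp [GenericFamily.swap]

lemma GenericFamily.realOrbitallyEquivalent_swap_left (F : GenericFamily) :
    RealOrbitallyEquivalent F.swap F := by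
  have := F.swap.realOrbitallyEquivalent_swap
  rwa [F.swap_swap] at this

end WeakFocus

end

/-! ### From orbital equivalence to conjugacy of the Poincaré maps -/

noncomputable section

namespace WeakFocus

namespace GenericFamily

open FolData

variable {D : FolData} {F : GenericFamily}

lemma Represents.chart_eq (h : Represents D F) : ∃ r > 0, r ≤ D.rad ∧ ∀ ε u : ℂ, ‖ε‖ < r →
    ‖u‖ < r → ∀ X ∈ Metric.sphere (0 : ℂ) 1,
      F.P (ε, X * u, u) = X * u * (D.den ε X u + D.num ε X u) ∧
      F.Q (ε, X * u, u) = u * D.num ε X u := by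
  obtain ⟨r, hr, hb⟩ := Metric.eventually_nhds_iff_ball.1 (h.P_eq.and h.Q_eq)
  refine ⟨min r D.rad, lt_min hr D.rad_pos, min_le_right _ _, ?_⟩
  intro ε u hε hu X hX
  have hX1 : ‖X‖ = 1 := by simpa using hX
  have hX0 : X ≠ 0 := by
    rintro rfl
    simp at hX1
  have hmem : (ε, X * u, u) ∈ Metric.ball (0 : ℂ × ℂ × ℂ) r := by
    rw [mem_ball_zero_iff, prod_norm_lt_iff, prod_norm_lt_iff, norm_mul, hX1, one_mul]
    exact ⟨hε.trans_le (min_le_left _ _), hu.trans_le (min_le_left _ _),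
      hu.trans_le (min_le_left _ _)⟩
  obtain ⟨h1, h2⟩ := hb _ hmem
  rw [h1, h2]
  simp only [den, num]
  constructor
  · field_simp
    ring
  · ring

/-- The leaves, blown down, are orbits of the vector field. -/
lemma Represents.exists_hasDerivWithinAt_leaf (h : Represents D F) : ∃ r > 0, r ≤ D.rad ∧
    ∀ ε : ℂ, ‖ε‖ < r → ∀ W, D.IsLeaf ε W → ∀ t ∈ angles, ‖W t‖ < r →
      HasDerivWithinAt (fun t : ℝ => (Complex.exp (Complex.I * t) * W t, W t))
        ((Complex.I / D.den ε (Complex.exp (Complex.I * t)) (W t)) •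
          F.field (ε, Complex.exp (Complex.I * t) * W t, W t)) angles t := by
  obtain ⟨r, hr, hrD, hc⟩ := h.chart_eq
  refine ⟨r, hr, hrD, fun ε hε W hW t ht hWt => ?_⟩
  obtain ⟨h1, -, h3⟩ := hW t ht
  obtain ⟨e1, e2⟩ := hc ε (W t) hε hWt _ (exp_I_mem_sphere t)
  have hd := den_ne (hε.trans_le hrD) (exp_I_mem_sphere t) h1
  have h4 := (hasDerivAt_exp_I t).hasDerivWithinAt.fun_mul h3
  refine (h4.prodMk h3).congr_deriv ?_
  simp only [field, e1, e2, FolData.slope, Prod.smul_mk, smul_eq_mul]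
  ext
  · simp only
    push_cast
    field_simp
  · simp only
    push_cast
    field_simp

/-- A curve tangent to the vector field along which `x = exp (i θ) y` is a piece of a leaf. -/
lemma Represents.exists_leaf_of_tangent (h : Represents D F) : ∃ r > 0, r ≤ D.rad ∧
    ∀ ε : ℂ, ‖ε‖ < r → ∀ (s : Set ℝ) (t : ℝ) (θ : ℝ → ℝ) (θ' : ℝ) (x y : ℝ → ℂ) (μ : ℂ),
      UniqueDiffWithinAt ℝ s t → t ∈ s →
      (∀ t ∈ s, x t = Complex.exp (Complex.I * θ t) * y t) → HasDerivWithinAt θ θ' s t →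
      HasDerivWithinAt (fun t => (x t, y t)) (μ • F.field (ε, x t, y t)) s t →
      ‖y t‖ < r → y t ≠ 0 →
      (θ' : ℂ) = -Complex.I * μ * D.den ε (Complex.exp (Complex.I * θ t)) (y t) ∧
      HasDerivWithinAt y (θ' * (y t * D.slope ε (Complex.exp (Complex.I * θ t)) (y t))) s t := by
  obtain ⟨r, hr, hrD, hc⟩ := h.chart_eq
  refine ⟨r, hr, hrD, fun ε hε s t θ θ' x y μ hs hts hx hθ hd hy hy0 => ?_⟩
  obtain ⟨e1, e2⟩ := hc ε (y t) hε hy _ (exp_I_mem_sphere (θ t))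
  have hdx : HasDerivWithinAt x (μ * F.P (ε, x t, y t)) s t := hd.fst
  have hdy : HasDerivWithinAt y (μ * F.Q (ε, x t, y t)) s t := hd.snd
  rw [hx t hts] at hdx hdy
  rw [e1] at hdx
  rw [e2] at hdy
  have hE := (hasDerivAt_exp_I (θ t)).scomp_hasDerivWithinAt t hθ
  have hdx2 : HasDerivWithinAt x _ s t := (hE.fun_mul hdy).congr hx (hx t hts)
  have hne := den_ne (hε.trans_le hrD) (exp_I_mem_sphere (θ t)) (hy.trans_le hrD)
  have heq := hs.eq_deriv _ hdx hdx2
  have hX : Complex.exp (Complex.I * θ t) ≠ 0 := Complex.exp_ne_zero _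
  simp only [Function.comp_apply, Complex.real_smul] at heq
  have key : (θ' : ℂ) = -Complex.I * μ * D.den ε (Complex.exp (Complex.I * θ t)) (y t) := by
    refine mul_left_cancel₀ (mul_ne_zero (mul_ne_zero hX hy0) Complex.I_ne_zero) ?_
    linear_combination (-1 : ℂ) * heq + (Complex.exp (Complex.I * θ t) * y t) * μ *
      D.den ε (Complex.exp (Complex.I * θ t)) (y t) * Complex.I_mul_I
  refine ⟨key, hdy.congr_deriv ?_⟩
  rw [key, FolData.slope]
  field_simp
  rw [Complex.I_sq]
  ring

lemma Represents.hasFDerivAt_field (h : Represents D F) :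
    HasFDerivAt (fun z : ℂ × ℂ => F.field (0, z))
      (((Complex.I * D.b) • ContinuousLinearMap.fst ℂ ℂ ℂ).prod
        ((-(Complex.I * D.b)) • ContinuousLinearMap.snd ℂ ℂ ℂ)) 0 := by
  have hj : Tendsto (fun z : ℂ × ℂ => ((0 : ℂ), z)) (𝓝 0) (𝓝 0) := by
    have : Continuous (fun z : ℂ × ℂ => ((0 : ℂ), z)) := by fun_prop
    exact this.tendsto' _ _ rfl
  have hs : ∀ {f : ℂ × ℂ × ℂ → ℂ}, AnalyticAt ℂ f 0 →
      HasFDerivAt (fun z : ℂ × ℂ => f (0, z)) (fderiv ℂ (fun z : ℂ × ℂ => f (0, z)) 0) 0 := by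
    intro f hf
    exact (differentiableAt_slice (p := ((0 : ℂ), (0 : ℂ × ℂ))) hf.differentiableAt).hasFDerivAt
  have z0 : ((0 : ℂ), (0 : ℂ × ℂ)) = 0 := rfl
  have hfst : HasFDerivAt (fun z : ℂ × ℂ => z.1) (ContinuousLinearMap.fst ℂ ℂ ℂ) 0 :=
    hasFDerivAt_fst
  have hsnd : HasFDerivAt (fun z : ℂ × ℂ => z.2) (ContinuousLinearMap.snd ℂ ℂ ℂ) 0 :=
    hasFDerivAt_snd
  refine HasFDerivAt.prodMk ?_ ?_
  · have := (hfst.mul (hs D.analyticAt_p1)).add (hsnd.mul (hs D.analyticAt_p2))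
    simp only [z0, D.p1_zero, D.p2_zero, Prod.fst_zero, Prod.snd_zero] at this
    exact (this.congr_of_eventuallyEq (hj.eventually h.P_eq)).congr_fderiv
      (by ext <;> simp)
  · have := (hfst.mul (hs D.analyticAt_q1)).add (hsnd.mul (hs D.analyticAt_q2))
    simp only [z0, D.q1_zero, D.q2_zero, Prod.fst_zero, Prod.snd_zero] at this
    exact (this.congr_of_eventuallyEq (hj.eventually h.Q_eq)).congr_fderiv
      (by ext <;> simp)

/-- An orbital equivalence that preserves the orientation of the orbits, between families with the
same sense of rotation, has a complex linear differential on the real plane. -/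
lemma Represents.exists_diagonal {D' : FolData} {G : GenericFamily} (hF : Represents D F)
    (hG : Represents D' G) {h : ℂ → ℂ} {Ψ : ℂ × ℂ × ℂ → ℂ × ℂ} {k : ℂ × ℂ × ℂ → ℂ}
    (hh : h 0 = 0) (hΨ : AnalyticAt ℂ Ψ 0) (Ψ0 : Ψ 0 = 0)
    (hi : (fderiv ℂ (fun z : ℂ × ℂ => Ψ (0, z)) 0).IsInvertible)
    (Ψr : ∀ᶠ q : ℝ × ℂ in 𝓝 0,
      (Ψ ((q.1 : ℂ), q.2, conj q.2)).2 = conj (Ψ ((q.1 : ℂ), q.2, conj q.2)).1)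
    (hk : AnalyticAt ℂ k 0) (kp : 0 < (k 0).re ∧ (k 0).im = 0)
    (he : ∀ᶠ p : ℂ × ℂ × ℂ in 𝓝 0,
      fderiv ℂ (fun z : ℂ × ℂ => Ψ (p.1, z)) p.2 (F.field p) = k p • G.field (h p.1, Ψ p)) :
    ∃ a : ℂ, a ≠ 0 ∧ fderiv ℂ (fun z : ℂ × ℂ => Ψ (0, z)) 0 (1, 0) = (a, 0) ∧
      fderiv ℂ (fun z : ℂ × ℂ => Ψ (0, z)) 0 (0, 1) = (0, conj a) := by
  set f : ℂ × ℂ → ℂ × ℂ := fun z => Ψ (0, z) with hf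
  set L := fderiv ℂ f 0 with hL
  have hj : Tendsto (fun z : ℂ × ℂ => ((0 : ℂ), z)) (𝓝 0) (𝓝 0) := by
    have : Continuous (fun z : ℂ × ℂ => ((0 : ℂ), z)) := by fun_prop
    exact this.tendsto' _ _ rfl
  have hfa : AnalyticAt ℂ f 0 :=
    hΨ.comp_of_eq (f := fun z : ℂ × ℂ => ((0 : ℂ), z)) (by fun_prop) rfl
  have hfd : HasFDerivAt f L 0 := hfa.differentiableAt.hasFDerivAt
  have hf0 : f 0 = 0 := Ψ0
  have hka : DifferentiableAt ℂ (fun z : ℂ × ℂ => k (0, z)) 0 :=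
    differentiableAt_slice (p := ((0 : ℂ), (0 : ℂ × ℂ))) hk.differentiableAt
  have hF0 : F.field (0, (0 : ℂ × ℂ)) = 0 := by
    have h1 := hF.P_eq.self_of_nhds
    have h2 := hF.Q_eq.self_of_nhds
    simp only [Prod.fst_zero, Prod.snd_zero, zero_mul, add_zero] at h1 h2
    exact Prod.ext h1 h2
  have hG0 : G.field (0, (0 : ℂ × ℂ)) = 0 := by
    have h1 := hG.P_eq.self_of_nhds
    have h2 := hG.Q_eq.self_of_nhds
    simp only [Prod.fst_zero, Prod.snd_zero, zero_mul, add_zero] at h1 h2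
    exact Prod.ext h1 h2
  have hl := hfa.fderiv.differentiableAt.hasFDerivAt.clm_apply hF.hasFDerivAt_field
  have hGd := hG.hasFDerivAt_field
  rw [← hf0] at hGd
  have hr := hka.hasFDerivAt.fun_smul (hGd.comp (0 : ℂ × ℂ) hfd)
  have heq : (fun z => fderiv ℂ f z (F.field (0, z))) =ᶠ[𝓝 0]
      fun z => k (0, z) • ((fun z => G.field (0, z)) ∘ f) z := by
    filter_upwards [hj.eventually he] with z hz
    simp only [hh] at hz
    exact hz
  -- Linearizing the equivalence at the origin gives L ∘ diag(ib, -ib) = k(0) diag(ib', -ib') ∘ L.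
  have huniq := (hl.congr_of_eventuallyEq heq.symm).unique hr
  rw [hF0, ← hL] at huniq
  have hb := D.b_pos
  have hb' := D'.b_pos
  have hk0 : k (0, (0 : ℂ × ℂ)) = ((k 0).re : ℂ) := Complex.ext rfl (by simpa using! kp.2)
  -- The off-diagonal entries of L are multiplied by this number up to a factor ±i. It is nonzero
  -- because k(0) > 0 and both families turn counterclockwise.
  have hpos : (D.b : ℂ) + (k 0).re * D'.b ≠ 0 := by
    have : 0 < D.b + (k 0).re * D'.b := add_pos hb (mul_pos kp.1 hb')
    exact_mod_cast this.ne'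
  have e1 := congrArg (fun A => A (1, 0)) huniq
  have e2 := congrArg (fun A => A (0, 1)) huniq
  simp [hf0, hG0, hk0] at e1 e2
  have s1 : L (Complex.I * D.b, 0) = (Complex.I * D.b) • L (1, 0) := by
    rw [← map_smul]
    simp
  have s2 : L (0, -(Complex.I * D.b)) = (-(Complex.I * D.b)) • L (0, 1) := by
    rw [← map_smul]
    simp
  rw [s1, Prod.ext_iff] at e1
  rw [s2, Prod.ext_iff] at e2
  simp only [Prod.smul_fst, Prod.smul_snd, smul_eq_mul] at e1 e2
  have L21 : (L (1, 0)).2 = 0 := by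
    refine (mul_eq_zero.1 (?_ : (Complex.I * (D.b + (k 0).re * D'.b)) * (L (1, 0)).2 = 0)).resolve_left
      (mul_ne_zero Complex.I_ne_zero hpos)
    linear_combination e1.2
  have L12 : (L (0, 1)).1 = 0 := by
    refine (mul_eq_zero.1 (?_ : (Complex.I * (D.b + (k 0).re * D'.b)) * (L (0, 1)).1 = 0)).resolve_left
      (mul_ne_zero Complex.I_ne_zero hpos)
    linear_combination -e2.1
  -- Invariance of the real plane, differentiated along the real points (t, t), links the two
  -- diagonal entries.
  have hLr : (L (1, 1)).2 = conj (L (1, 1)).1 := by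
    have hd : HasDerivAt (fun t : ℝ => f (t, t)) (L (1, 1)) 0 := by
      have hc : HasDerivAt (fun t : ℝ => ((t : ℂ), (t : ℂ))) (1, 1) 0 :=
        Complex.ofRealCLM.hasDerivAt.prodMk Complex.ofRealCLM.hasDerivAt
      exact (hfd.restrictScalars ℝ).comp_hasDerivAt_of_eq 0 hc
        (by rw [Complex.ofReal_zero]; rfl)
    have h1 : HasDerivAt (fun t : ℝ => (f (t, t)).2) (L (1, 1)).2 0 := hd.snd
    have h2 : HasDerivAt (fun t : ℝ => conj (f (t, t)).1) (conj (L (1, 1)).1) 0 :=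
      (Complex.conjCLE.toContinuousLinearMap.hasFDerivAt).comp_hasDerivAt 0 hd.fst
    refine h1.unique (h2.congr_of_eventuallyEq ?_)
    have ht : Tendsto (fun t : ℝ => ((0 : ℝ), (t : ℂ))) (𝓝 0) (𝓝 0) := by
      have : Continuous (fun t : ℝ => ((0 : ℝ), (t : ℂ))) := by fun_prop
      exact this.tendsto' _ _ (by simp)
    filter_upwards [ht.eventually Ψr] with t h3
    simpa [hf] using h3
  have hs : L (1, 1) = L (1, 0) + L (0, 1) := by
    rw [← map_add]
    simp
  rw [hs, Prod.fst_add, Prod.snd_add, L12, L21, zero_add, add_zero] at hLr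
  refine ⟨(L (1, 0)).1, ?_, Prod.ext rfl L21, Prod.ext L12 hLr⟩
  intro h0
  have hz : L (1, 0) = L 0 := by
    rw [map_zero]
    exact Prod.ext h0 L21
  have := hi.injective hz
  simp at this

end GenericFamily

end WeakFocus

end

noncomputable section

namespace WeakFocus

/-- Tube lemma over the compact circle of slopes. -/
lemma exists_forall_sphere {p : ℂ × ℂ × ℂ → Prop}
    (h : ∀ X ∈ Metric.sphere (0 : ℂ) 1, ∀ᶠ q in 𝓝 ((0 : ℂ), X, (0 : ℂ)), p q) :
    ∃ r > 0, ∀ ε u : ℂ, ‖ε‖ < r → ‖u‖ < r → ∀ X ∈ Metric.sphere (0 : ℂ) 1, p (ε, X, u) := by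
  have h1 : ∀ᶠ e in 𝓝 (0 : ℂ × ℂ), ∀ X ∈ Metric.sphere (0 : ℂ) 1, p (e.1, X, e.2) := by
    refine (isCompact_sphere (0 : ℂ) 1).eventually_forall_of_forall_eventually
      (P := fun (e : ℂ × ℂ) X => p (e.1, X, e.2)) ?_
    intro X hX
    have ht : Tendsto (fun z : (ℂ × ℂ) × ℂ => (z.1.1, z.2, z.1.2)) (𝓝 (0, X)) (𝓝 (0, X, 0)) := by
      have : Continuous (fun z : (ℂ × ℂ) × ℂ => (z.1.1, z.2, z.1.2)) := by fun_prop
      exact this.tendsto' _ _ rfl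
    exact ht.eventually (h X hX)
  obtain ⟨r, hr, hb⟩ := Metric.eventually_nhds_iff_ball.1 h1
  refine ⟨r, hr, fun ε u hε hu X hX => hb (ε, u) ?_ X hX⟩
  rw [mem_ball_zero_iff]
  exact prod_norm_lt_iff.2 ⟨hε, hu⟩

lemma ne_zero_of_mem_sphere {X : ℂ} (hX : X ∈ Metric.sphere (0 : ℂ) 1) : X ≠ 0 := by
  rintro rfl
  simp at hX

/-- A local change of coordinates with differential `diag (a, conj a)` in the blow-up chart:
`σ` is the increment of the angle and `m` the dilation. -/
lemma exists_angle {Ψ : ℂ × ℂ × ℂ → ℂ × ℂ} (hΨ : AnalyticAt ℂ Ψ 0)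
    (Ψ0 : ∀ᶠ ε : ℂ in 𝓝 0, Ψ (ε, 0, 0) = 0) {a : ℂ} (ha : a ≠ 0)
    (h1 : fderiv ℂ (fun z : ℂ × ℂ => Ψ (0, z)) 0 (1, 0) = (a, 0))
    (h2 : fderiv ℂ (fun z : ℂ × ℂ => Ψ (0, z)) 0 (0, 1) = (0, conj a)) :
    ∃ (σ m : ℂ × ℂ × ℂ → ℂ) (τ₀ : ℝ), τ₀ ∈ Set.Icc (-Real.pi) Real.pi ∧
      (∀ X ∈ Metric.sphere (0 : ℂ) 1, AnalyticAt ℂ σ (0, X, 0) ∧ AnalyticAt ℂ m (0, X, 0) ∧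
        σ (0, X, 0) = 0 ∧ m (0, X, 0) = conj a) ∧
      ∃ r > 0, ∀ ε u : ℂ, ‖ε‖ < r → ‖u‖ < r → ∀ X ∈ Metric.sphere (0 : ℂ) 1,
        m (ε, X, u) ≠ 0 ∧
        Ψ (ε, X * u, u) =
          (Complex.exp (Complex.I * (τ₀ + σ (ε, X, u))) * X * (u * m (ε, X, u)), u * m (ε, X, u)) := by
  obtain ⟨M, hM, hMeq, hM0⟩ := exists_analyticAt_hadamard hΨ
  have hca : conj a ≠ 0 := by simpa using ha
  have hM00 : M (0, 0) = fderiv ℂ (fun z : ℂ × ℂ => Ψ (0, z)) 0 := by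
    rw [hM0.self_of_nhds]
    have := fderiv_comp (𝕜 := ℂ) (g := Ψ) (f := fun z : ℂ × ℂ => ((0 : ℂ), z)) (0 : ℂ × ℂ)
      hΨ.differentiableAt (by fun_prop)
    rw [Function.comp_def] at this
    rw [this]
    congr 1
    exact (hasFDerivAt_prodMk_right (𝕜 := ℂ) (0 : ℂ) (0 : ℂ × ℂ)).fderiv.symm
  -- Dividing by u in the blow-up chart: Ψ(ε, Xu, u) = u · m'(ε, X, u), with m'(0, X, 0) = (aX, conj
  -- a).
  let m' : ℂ × ℂ × ℂ → ℂ × ℂ := fun q => M (q.1, q.2.1 * q.2.2, q.2.2) (q.2.1, 1)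
  have hm' : ∀ X : ℂ, AnalyticAt ℂ m' (0, X, 0) := by
    intro X
    have : AnalyticAt ℂ (fun q : ℂ × ℂ × ℂ => M (q.1, q.2.1 * q.2.2, q.2.2)) (0, X, 0) :=
      hM.comp_of_eq (f := fun q : ℂ × ℂ × ℂ => (q.1, q.2.1 * q.2.2, q.2.2)) (by fun_prop)
        (by simp)
    have hX : AnalyticAt ℂ (fun q : ℂ × ℂ × ℂ => (q.2.1, (1 : ℂ))) (0, X, 0) := by fun_prop
    exact ((ContinuousLinearMap.id ℂ (ℂ × ℂ →L[ℂ] ℂ × ℂ)).analyticAt_bilinear _).comp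
      (this.prod hX)
  have hm'0 : ∀ X : ℂ, m' (0, X, 0) = (a * X, conj a) := by
    intro X
    have e : (X, (1 : ℂ)) = X • ((1 : ℂ), (0 : ℂ)) + ((0 : ℂ), (1 : ℂ)) := by simp
    simp only [m', mul_zero]
    rw [show M ((0 : ℂ), (0 : ℂ), (0 : ℂ)) = _ from hM00, e, map_add, map_smul, h1, h2]
    simp [mul_comm]
  have hm1 : ∀ X : ℂ, AnalyticAt ℂ (fun q => (m' q).1) (0, X, 0) := fun X =>
    (ContinuousLinearMap.fst ℂ ℂ ℂ).analyticAt _ |>.comp (hm' X)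
  have hm2 : ∀ X : ℂ, AnalyticAt ℂ (fun q => (m' q).2) (0, X, 0) := fun X =>
    (ContinuousLinearMap.snd ℂ ℂ ℂ).analyticAt _ |>.comp (hm' X)
  set c := a / conj a with hc
  have hc0 : c ≠ 0 := div_ne_zero ha hca
  have hc1 : ‖c‖ = 1 := by
    rw [hc, norm_div, RCLike.norm_conj]
    exact div_self (norm_ne_zero_iff.2 ha)
  have hcτ : Complex.exp (Complex.I * (Complex.arg c : ℝ)) = c := by
    have := Complex.norm_mul_exp_arg_mul_I c
    rw [hc1, Complex.ofReal_one, one_mul] at this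
    rw [mul_comm]
    exact this
  -- The slope of the image is X · c · ρ with c = a / conj a of modulus one and ρ = 1 at u = ε = 0.
  -- The principal logarithm of ρ gives the angle increment σ, and arg c gives the constant τ₀.
  let ρ : ℂ × ℂ × ℂ → ℂ := fun q => (m' q).1 / (q.2.1 * (m' q).2 * c)
  have hρ : ∀ X ∈ Metric.sphere (0 : ℂ) 1, AnalyticAt ℂ ρ (0, X, 0) ∧ ρ (0, X, 0) = 1 := by
    intro X hX
    have hX0 := ne_zero_of_mem_sphere hX
    have hX' : AnalyticAt ℂ (fun q : ℂ × ℂ × ℂ => q.2.1) (0, X, 0) := by fun_prop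
    constructor
    · refine (hm1 X).div ((hX'.mul (hm2 X)).mul analyticAt_const) ?_
      simp only [hm'0]
      exact mul_ne_zero (mul_ne_zero hX0 hca) hc0
    · simp only [ρ, hm'0, hc]
      field_simp
  have hslit : (1 : ℂ) ∈ Complex.slitPlane := Complex.one_mem_slitPlane
  have hρl : ∀ X ∈ Metric.sphere (0 : ℂ) 1,
      AnalyticAt ℂ (fun q => -Complex.I * Complex.log (ρ q)) (0, X, 0) := fun X hX =>
    analyticAt_const.mul ((hρ X hX).1.clog (by rw [(hρ X hX).2]; exact hslit))
  refine ⟨fun q => -Complex.I * Complex.log (ρ q), fun q => (m' q).2, Complex.arg c,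
    ⟨(Complex.neg_pi_lt_arg c).le, Complex.arg_le_pi c⟩, ?_, ?_⟩
  · intro X hX
    refine ⟨hρl X hX, hm2 X, ?_, ?_⟩
    · simp only [(hρ X hX).2, Complex.log_one, mul_zero]
    · simp only [hm'0]
  · have hΨ' : ∀ᶠ q in 𝓝 (0 : ℂ × ℂ × ℂ), Ψ q = M q q.2 := by
      filter_upwards [hMeq, (continuous_fst.tendsto' (0 : ℂ × ℂ × ℂ) 0 rfl).eventually Ψ0]
        with q h3 h4
      have h4' : Ψ (q.1, (0 : ℂ × ℂ)) = 0 := h4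
      rw [h3, h4', zero_add]
    obtain ⟨r, hr, hb⟩ := exists_forall_sphere (p := fun q => (m' q).2 ≠ 0 ∧ ρ q ≠ 0 ∧
      Ψ (q.1, q.2.1 * q.2.2, q.2.2) = M (q.1, q.2.1 * q.2.2, q.2.2) (q.2.1 * q.2.2, q.2.2)) (by
        intro X hX
        have ht : Tendsto (fun q : ℂ × ℂ × ℂ => (q.1, q.2.1 * q.2.2, q.2.2)) (𝓝 (0, X, 0))
            (𝓝 0) := by
          have : Continuous (fun q : ℂ × ℂ × ℂ => (q.1, q.2.1 * q.2.2, q.2.2)) := by fun_prop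
          exact this.tendsto' _ _ (by simp)
        refine ((hm2 X).continuousAt.eventually_ne (by rw [hm'0]; exact hca)).and
          (((hρ X hX).1.continuousAt.eventually_ne (by rw [(hρ X hX).2]; exact one_ne_zero)).and
            (ht.eventually hΨ')))
    refine ⟨r, hr, fun ε u hε hu X hX => ?_⟩
    obtain ⟨b1, b2, b3⟩ := hb ε u hε hu X hX
    refine ⟨b1, ?_⟩
    simp only at b3 ⊢
    have hX0 := ne_zero_of_mem_sphere hX
    have e1 : M (ε, X * u, u) (X * u, u) = u • m' (ε, X, u) := by
      simp only [m']
      rw [← map_smul]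
      simp [mul_comm]
    have e2 : Complex.exp (Complex.I * ((Complex.arg c : ℝ) +
        -Complex.I * Complex.log (ρ (ε, X, u)))) = c * ρ (ε, X, u) := by
      have : Complex.I * (((Complex.arg c : ℝ) : ℂ) + -Complex.I * Complex.log (ρ (ε, X, u))) =
          Complex.I * (Complex.arg c : ℝ) + Complex.log (ρ (ε, X, u)) := by
        linear_combination (-Complex.log (ρ (ε, X, u))) * Complex.I_mul_I
      rw [this, Complex.exp_add, hcτ, Complex.exp_log b2]
    rw [b3, e1, e2]
    ext
    · simp only [Prod.smul_fst, smul_eq_mul, ρ]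
      field_simp
    · simp only [Prod.smul_snd, smul_eq_mul]

end WeakFocus

end

noncomputable section

namespace WeakFocus

namespace GenericFamily

open FolData

variable {D D' : FolData} {F G : GenericFamily}

lemma four_pi_subset : Set.Icc 0 (4 * Real.pi) ⊆ angles :=
  (convex_Icc (-20 : ℝ) 20).ordConnected.out zero_mem_angles four_pi_mem

/-- A leaf and its conjugate are both leaves; if they agree at one angle they agree at all, so being
real propagates along the leaf. -/
lemma IsLeaf.conj_eq (D : FolData) : ∃ r > 0, ∀ ε : ℂ, conj ε = ε → ‖ε‖ < r → ∀ W : ℝ → ℂ,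
    D.IsLeaf ε W → (∀ t ∈ angles, ‖W t‖ < r) → ∀ a ∈ angles,
    conj (Complex.exp (Complex.I * a) * W a) = W a →
    ∀ t ∈ angles, conj (Complex.exp (Complex.I * t) * W t) = W t := by
  obtain ⟨r, hr, hc⟩ := D.exists_conj_leaf
  refine ⟨min r D.rad, lt_min hr D.rad_pos, fun ε hεr hε W hW hb a ha h0 t ht => ?_⟩
  exact IsLeaf.eqOn (hε.trans_le (min_le_right _ _)) (hc ε hεr (hε.trans_le (min_le_left _ _)) W hW
    (fun t ht => (hb t ht).trans_le (min_le_left _ _))) hW ha h0 ht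

/-- The image of a real leaf under a real orbital equivalence is a real leaf. -/
lemma Represents.exists_image_leaf (hF : Represents D F) (hG : Represents D' G) {h : ℂ → ℂ}
    {Ψ : ℂ × ℂ × ℂ → ℂ × ℂ} {k : ℂ × ℂ × ℂ → ℂ} (hh : AnalyticAt ℂ h 0) (hh0 : h 0 = 0)
    (hΨ : AnalyticAt ℂ Ψ 0)
    (Ψr : ∀ᶠ q : ℝ × ℂ in 𝓝 0,
      (Ψ ((q.1 : ℂ), q.2, conj q.2)).2 = conj (Ψ ((q.1 : ℂ), q.2, conj q.2)).1)
    (hk : AnalyticAt ℂ k 0)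
    (he : ∀ᶠ p : ℂ × ℂ × ℂ in 𝓝 0,
      fderiv ℂ (fun z : ℂ × ℂ => Ψ (p.1, z)) p.2 (F.field p) = k p • G.field (h p.1, Ψ p))
    {σ m : ℂ × ℂ × ℂ → ℂ} {τ₀ : ℝ} (hτ₀ : τ₀ ∈ Set.Icc (-Real.pi) Real.pi)
    (hσ : ∀ X ∈ Metric.sphere (0 : ℂ) 1, AnalyticAt ℂ σ (0, X, 0) ∧ σ (0, X, 0) = 0)
    (hm : ∀ X ∈ Metric.sphere (0 : ℂ) 1, AnalyticAt ℂ m (0, X, 0))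
    {r₀ : ℝ} (hr₀ : 0 < r₀)
    (hΨσ : ∀ ε u : ℂ, ‖ε‖ < r₀ → ‖u‖ < r₀ → ∀ X ∈ Metric.sphere (0 : ℂ) 1, m (ε, X, u) ≠ 0 ∧
        Ψ (ε, X * u, u) =
          (Complex.exp (Complex.I * (τ₀ + σ (ε, X, u))) * X * (u * m (ε, X, u)), u * m (ε, X, u))) :
    ∃ r > 0, ∀ ε s : ℝ, |ε| < r → s ≠ 0 → ∀ W, D.IsLeaf ε W → W 0 = s →
      (∀ t ∈ angles, ‖W t‖ < r) → ∃ θ : ℝ → ℝ,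
        (∀ t ∈ angles, (θ t : ℂ) = t + τ₀ + σ (ε, Complex.exp (Complex.I * t), W t)) ∧
        (∀ t ∈ Set.Icc 0 (4 * Real.pi), θ t ∈ angles) ∧
        ∀ W', D'.IsLeaf (h ε) W' → W' (θ 0) = W 0 * m (ε, 1, W 0) →
          W' (θ (4 * Real.pi)) = W (4 * Real.pi) * m (ε, 1, W (4 * Real.pi)) := by
  obtain ⟨r₁, hr₁, hr₁D, hleaf⟩ := hF.exists_hasDerivWithinAt_leaf
  obtain ⟨r₂, hr₂, hr₂D, htan⟩ := hG.exists_leaf_of_tangent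
  obtain ⟨r₃, hr₃, hconj⟩ := IsLeaf.conj_eq D
  obtain ⟨r₄, hr₄, hreal⟩ := Metric.eventually_nhds_iff_ball.1 Ψr
  -- `B'`, `B` and `K` bound the denominator for `D'`, the inverse of the denominator for `D`, and
  -- `k`. Their product bounds the speed of the image angle, as uniqueness requires.
  set B' := ‖2 * (Complex.I * D'.b)‖ + 1 with hB'
  obtain ⟨r₅, hr₅, hden'⟩ := exists_forall_sphere (p := fun q => ‖D'.den q.1 q.2.1 q.2.2‖ < B') (by
    intro X hX
    refine (D'.analyticAt_den (ne_zero_of_mem_sphere hX)).continuousAt.norm.eventually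
      (gt_mem_nhds ?_)
    simp only [D'.den_zero, hB']
    linarith)
  set B := ‖(2 * (Complex.I * D.b))⁻¹‖ + 1 with hB
  set K := ‖k 0‖ + 1 with hK
  obtain ⟨r₆, hr₆, hall⟩ := exists_forall_sphere (p := fun q =>
      (AnalyticAt ℂ σ q ∧ ‖σ q‖ < 1) ∧ ‖q.2.2 * m q‖ < min r₂ r₅ ∧ ‖h q.1‖ < min r₂ r₅ ∧
      ‖(D.den q.1 q.2.1 q.2.2)⁻¹‖ < B ∧ (‖k (q.1, q.2.1 * q.2.2, q.2.2)‖ < K ∧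
      AnalyticAt ℂ Ψ (q.1, q.2.1 * q.2.2, q.2.2)) ∧
      fderiv ℂ (fun z : ℂ × ℂ => Ψ (q.1, z)) (q.2.1 * q.2.2, q.2.2)
        (F.field (q.1, q.2.1 * q.2.2, q.2.2)) = k (q.1, q.2.1 * q.2.2, q.2.2) •
          G.field (h q.1, Ψ (q.1, q.2.1 * q.2.2, q.2.2))) (by
    intro X hX
    have ht : Tendsto (fun q : ℂ × ℂ × ℂ => (q.1, q.2.1 * q.2.2, q.2.2)) (𝓝 (0, X, 0))
        (𝓝 0) := by
      have : Continuous (fun q : ℂ × ℂ × ℂ => (q.1, q.2.1 * q.2.2, q.2.2)) := by fun_prop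
      exact this.tendsto' _ _ (by simp)
    have hlt : 0 < min r₂ r₅ := lt_min hr₂ hr₅
    refine ((hσ X hX).1.eventually_analyticAt.and
      ((hσ X hX).1.continuousAt.norm.eventually (gt_mem_nhds (by simp [(hσ X hX).2])))).and
      (Eventually.and ?_ (Eventually.and ?_ (Eventually.and ?_ (Eventually.and ?_ (ht.eventually he)))))
    · have : ContinuousAt (fun q : ℂ × ℂ × ℂ => ‖q.2.2 * m q‖) (0, X, 0) :=
        ((by fun_prop : ContinuousAt (fun q : ℂ × ℂ × ℂ => q.2.2) (0, X, 0)).mul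
          (hm X hX).continuousAt).norm
      exact this.eventually (gt_mem_nhds (by simpa using hlt))
    · have : ContinuousAt (fun q : ℂ × ℂ × ℂ => ‖h q.1‖) (0, X, 0) :=
        (hh.continuousAt.comp_of_eq continuousAt_fst rfl).norm
      exact this.eventually (gt_mem_nhds (by simpa [hh0] using hlt))
    · refine ((D.analyticAt_den (ne_zero_of_mem_sphere hX)).continuousAt.inv₀
        (D.den_zero_ne X)).norm.eventually (gt_mem_nhds ?_)
      simp only [Pi.inv_apply, D.den_zero, hB]
      linarith
    · refine (ht.eventually (hk.continuousAt.norm.eventually (gt_mem_nhds ?_))).and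
        (ht.eventually hΨ.eventually_analyticAt)
      simp only [hK]
      linarith)
  set r := min (min (min r₀ r₁) (min r₃ r₄)) (min r₆ D.rad) with hr
  have hr0 : r ≤ r₀ := (min_le_left _ _).trans ((min_le_left _ _).trans (min_le_left _ _))
  have hr1 : r ≤ r₁ := (min_le_left _ _).trans ((min_le_left _ _).trans (min_le_right _ _))
  have hr3 : r ≤ r₃ := (min_le_left _ _).trans ((min_le_right _ _).trans (min_le_left _ _))
  have hr4 : r ≤ r₄ := (min_le_left _ _).trans ((min_le_right _ _).trans (min_le_right _ _))
  have hr6 : r ≤ r₆ := (min_le_right _ _).trans (min_le_left _ _)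
  have hrD : r ≤ D.rad := (min_le_right _ _).trans (min_le_right _ _)
  refine ⟨r, lt_min (lt_min (lt_min hr₀ hr₁) (lt_min hr₃ hr₄)) (lt_min hr₆ D.rad_pos), ?_⟩
  clear_value r B B' K
  intro ε s hε hs W hW hW0 hb
  have hεn : ‖(ε : ℂ)‖ < r := by simpa using hε
  have hWne : ∀ t ∈ angles, W t ≠ 0 := by
    intro t ht h0
    have := hW.eq_zero (hεn.trans_le hrD) ht h0 0 zero_mem_angles
    rw [hW0] at this
    exact hs (by exact_mod_cast this)
  have hWc : ∀ t ∈ angles, conj (Complex.exp (Complex.I * t) * W t) = W t :=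
    hconj ε (Complex.conj_ofReal ε) (hεn.trans_le hr3) W hW
      (fun t ht => (hb t ht).trans_le hr3) 0 zero_mem_angles (by simp [hW0])
  have hA := fun t (ht : t ∈ angles) => hall ε (W t) (hεn.trans_le hr6) ((hb t ht).trans_le hr6) _
    (exp_I_mem_sphere t)
  have hS := fun t (ht : t ∈ angles) => hΨσ ε (W t) (hεn.trans_le hr0) ((hb t ht).trans_le hr0) _
    (exp_I_mem_sphere t)
  -- The points of the leaf are real, so their images are real and have two coordinates of equal
  -- modulus. Thus exp(i(τ₀ + σ)) has modulus one and σ is real: the image stays over the equator.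
  have hσim : ∀ t ∈ angles, (σ (ε, Complex.exp (Complex.I * t), W t)).im = 0 := by
    intro t ht
    obtain ⟨h1, h2⟩ := hS t ht
    have hXn : ‖Complex.exp (Complex.I * t)‖ = 1 := by simp
    have h3 := hreal (ε, Complex.exp (Complex.I * t) * W t) (by
      rw [mem_ball_zero_iff]
      refine max_lt (hε.trans_le hr4) ?_
      rw [norm_mul, hXn, one_mul]
      exact (hb t ht).trans_le hr4)
    simp only [hWc t ht, h2] at h3
    have h4 := congrArg norm h3
    rw [RCLike.norm_conj, norm_mul (_ * _), norm_mul (Complex.exp _), hXn, mul_one, eq_comm,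
      mul_eq_right₀ (norm_ne_zero_iff.2 (mul_ne_zero (hWne t ht) h1)), Complex.norm_exp,
      Real.exp_eq_one_iff] at h4
    simpa using h4
  let θ : ℝ → ℝ := fun t => t + τ₀ + (σ (ε, Complex.exp (Complex.I * t), W t)).re
  have hθ : ∀ t ∈ angles, (θ t : ℂ) = t + τ₀ + σ (ε, Complex.exp (Complex.I * t), W t) := by
    intro t ht
    apply Complex.ext
    · simp [θ]
    · simp [hσim t ht]
  -- The image angle is within π + 1 of t, and 5π + 1 < 20.
  have hθmem : ∀ t ∈ Set.Icc 0 (4 * Real.pi), θ t ∈ angles := by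
    intro t ht
    have h1 := (Complex.abs_re_le_norm _).trans_lt (hA t (four_pi_subset ht)).1.2
    rw [abs_lt] at h1
    have h2 := Real.pi_lt_d2
    exact ⟨by linarith [ht.1, hτ₀.1], by linarith [ht.2, hτ₀.2]⟩
  have hθd : ∀ t ∈ angles, ∃ θ' : ℝ, HasDerivWithinAt θ θ' angles t := by
    intro t ht
    have h1 : HasDerivWithinAt (fun t : ℝ => ((ε : ℂ), Complex.exp (Complex.I * t), W t)) _ angles t :=
      (hasDerivWithinAt_const t angles (ε : ℂ)).prodMk
        ((hasDerivAt_exp_I t).hasDerivWithinAt.prodMk (hW t ht).2.2)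
    have h2 := ((hA t ht).1.1.differentiableAt.hasFDerivAt.restrictScalars
      ℝ).comp_hasDerivWithinAt t h1
    have h3 := (Complex.reCLM.hasFDerivAt).comp_hasDerivWithinAt t h2
    exact ⟨_, ((hasDerivWithinAt_id t angles).add_const τ₀).add h3⟩
  choose! θ' hθ' using hθd
  let x : ℝ → ℂ := fun t => (Ψ (ε, Complex.exp (Complex.I * t) * W t, W t)).1
  let y : ℝ → ℂ := fun t => (Ψ (ε, Complex.exp (Complex.I * t) * W t, W t)).2
  have hy : ∀ t ∈ angles, y t = W t * m (ε, Complex.exp (Complex.I * t), W t) := by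
    intro t ht
    simp only [y, (hS t ht).2]
  have hx : ∀ t ∈ angles, x t = Complex.exp (Complex.I * θ t) * y t := by
    intro t ht
    rw [hy t ht, hθ t ht]
    simp only [x, (hS t ht).2]
    rw [← Complex.exp_add]
    congr 2
    ring
  -- The image curve is tangent to the second field because the leaf is tangent to the first. Hence
  -- it is a leaf of the second family, parametrized by the angle θ.
  have hkey : ∀ t ∈ angles, |θ' t| ≤ B * K * B' ∧ ‖y t‖ < D'.rad ∧ HasDerivWithinAt y
      (θ' t * (y t * D'.slope (h ε) (Complex.exp (Complex.I * θ t)) (y t))) angles t := by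
    intro t ht
    obtain ⟨-, h1, h2, h3, ⟨h4, h5⟩, h6⟩ := hA t ht
    simp only at h1 h2 h3 h4 h5 h6
    have h7 := hleaf ε (hεn.trans_le hr1) W hW t ht ((hb t ht).trans_le hr1)
    have h8 := ((differentiableAt_slice h5.differentiableAt).hasFDerivAt.restrictScalars
      ℝ).comp_hasDerivWithinAt t h7
    simp only [ContinuousLinearMap.coe_restrictScalars', map_smul, h6, smul_smul] at h8
    have hyn : ‖y t‖ < min r₂ r₅ := by rwa [hy t ht]
    have hyr := hyn.trans_le (min_le_left _ _)
    obtain ⟨h9, h10⟩ := htan (h ε) (h2.trans_le (min_le_left _ _)) angles t θ (θ' t) x y _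
      (uniqueDiffOn_Icc (by norm_num) t ht) ht hx (hθ' t ht) h8 hyr
      (by rw [hy t ht]; exact mul_ne_zero (hWne t ht) (hS t ht).1)
    refine ⟨?_, hyr.trans_le hr₂D, h10⟩
    have h11 := hden' (h ε) (y t) (h2.trans_le (min_le_right _ _)) (hyn.trans_le (min_le_right _ _))
      _ (exp_I_mem_sphere (θ t))
    simp only at h11
    have h12 : |θ' t| = ‖(θ' t : ℂ)‖ := by simp
    rw [h12, h9, norm_mul, norm_mul, norm_mul, norm_neg, Complex.norm_I, one_mul, div_eq_mul_inv,
      norm_mul, Complex.norm_I, one_mul]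
    have hB0 : 0 ≤ B := (norm_nonneg _).trans h3.le
    have hK0 : 0 ≤ K := (norm_nonneg _).trans h4.le
    gcongr
  refine ⟨θ, hθ, hθmem, fun W' hW' h0 => ?_⟩
  have hsub := four_pi_subset
  have hsol : D'.IsSol (h ε) 0 (4 * Real.pi) θ θ' y := fun t ht =>
    ⟨(hkey t (hsub ht)).2.1, (hθ' t (hsub ht)).mono hsub, (hkey t (hsub ht)).2.2.mono hsub⟩
  have hsol' : D'.IsSol (h ε) 0 (4 * Real.pi) θ θ' (W' ∘ θ) :=
    IsLeaf.comp hW' (fun t ht => (hθ' t (hsub ht)).mono hsub) hθmem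
  have hpi : (0 : ℝ) ≤ 4 * Real.pi := by positivity
  have hhε : ‖h ε‖ < D'.rad := ((hA 0 zero_mem_angles).2.2.1.trans_le (min_le_left _ _)).trans_le hr₂D
  have heq := IsSol.eqOn hhε hsol' hsol (fun t ht => (hkey t (hsub ht)).1) (t₀ := 0)
    ⟨le_rfl, hpi⟩ (by
      rw [Function.comp_apply, h0, hy 0 zero_mem_angles]
      simp) (x := 4 * Real.pi) ⟨hpi, le_rfl⟩
  rw [Function.comp_apply, hy _ four_pi_mem] at heq
  rw [heq]
  have : Complex.exp (Complex.I * ((4 * Real.pi : ℝ) : ℂ)) = 1 := by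
    rw [Complex.exp_eq_one_iff]
    exact ⟨2, by push_cast; ring⟩
  rw [this]

/-- The Poincaré maps of real orbitally equivalent families are conjugate. -/
theorem Represents.realConjugate (hF : Represents D F) (hG : Represents D' G)
    (hFG : RealOrbitallyEquivalent F G) : RealConjugate F.poincareMap G.poincareMap := by
  obtain ⟨h, Ψ, k, hh, hΨ, Ψ0, hi, Ψr, hk, kp, he⟩ := hFG
  have kp0 : 0 < (k 0).re ∧ (k 0).im = 0 := by simpa using! kp.self_of_nhds
  obtain ⟨a, ha, hL1, hL2⟩ := hF.exists_diagonal hG hh.map_zero hΨ Ψ0.self_of_nhds hi Ψr hk kp0 he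
  obtain ⟨σ, m, τ₀, hτ₀, hσm, r₀, hr₀, hΨσ⟩ := exists_angle hΨ Ψ0 ha hL1 hL2
  obtain ⟨r, hr, himg⟩ := hF.exists_image_leaf hG hh.analyticAt hh.map_zero hΨ Ψr hk he hτ₀
    (fun X hX => ⟨(hσm X hX).1, (hσm X hX).2.2.1⟩) (fun X hX => (hσm X hX).2.1) hr₀ hΨσ
  have hτa : τ₀ ∈ angles := by
    have := Real.pi_lt_d2
    exact ⟨by linarith [hτ₀.1], by linarith [hτ₀.2]⟩
  obtain ⟨E, hE, hE0, htr⟩ := D'.exists_transportMap τ₀ zero_mem_angles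
  have h1s : (1 : ℂ) ∈ Metric.sphere (0 : ℂ) 1 := by simp
  obtain ⟨hσ, hm, hσ0, hm0⟩ := hσm 1 h1s
  have hi : ∀ {f : ℂ × ℂ × ℂ → ℂ}, AnalyticAt ℂ f (0, 1, 0) →
      AnalyticAt ℂ (fun p : ℂ × ℂ => f (p.1, 1, p.2)) 0 := fun hf =>
    hf.comp_of_eq (f := fun p : ℂ × ℂ => (p.1, (1 : ℂ), p.2)) (by fun_prop) rfl
  -- The image under Ψ of the point (s, s) of Σ has second coordinate `Y` and lies over the angle
  -- `T`, near τ₀ but in general not 0.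
  let Y : ℂ × ℂ → ℂ := fun p => p.2 * m (p.1, 1, p.2)
  let T : ℂ × ℂ → ℂ := fun p => τ₀ + σ (p.1, 1, p.2)
  have hY : AnalyticAt ℂ Y 0 := analyticAt_snd.mul (hi hm)
  have hT : AnalyticAt ℂ T 0 := analyticAt_const.add (hi hσ)
  let j : ℂ × ℂ → ℂ × ℂ × ℂ := fun p => (h p.1, Y p, T p)
  have hj : AnalyticAt ℂ j 0 := (hh.analyticAt.comp_of_eq analyticAt_fst rfl).prod (hY.prod hT)
  have hj0 : j 0 = (0, 0, (τ₀ : ℂ)) := by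
    simp only [j, Y, T, Prod.fst_zero, Prod.snd_zero, hh.map_zero, hσ0, zero_mul, add_zero]
  have hEj : AnalyticAt ℂ (fun p => E (j p)) 0 := hE.comp_of_eq hj hj0
  -- The conjugacy: transport of the image point along its leaf from the angle `T` back to the angle
  -- 0.
  let H : ℂ × ℂ → ℂ := fun p => Y p * E (j p)
  have hH : AnalyticAt ℂ H 0 := hY.mul hEj
  have hH0 : ∀ ε, H (ε, 0) = 0 := fun ε => by simp [H, Y]
  have hhH : AnalyticAt ℂ (fun p : ℂ × ℂ => (h p.1, H p)) 0 :=
    (hh.analyticAt.comp_of_eq analyticAt_fst rfl).prod hH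
  have hhH0 : (h (0 : ℂ × ℂ).1, H 0) = 0 := Prod.ext hh.map_zero (hH0 0)
  obtain ⟨hPF, hPF0⟩ := hF.analyticAt_poincareMap
  obtain ⟨hPG, hPG0⟩ := hG.analyticAt_poincareMap
  have hp : AnalyticAt ℂ (fun p : ℂ × ℂ => (p.1, F.poincareMap p)) 0 := analyticAt_fst.prod hPF
  have hp0 : ((0 : ℂ × ℂ).1, F.poincareMap 0) = 0 := Prod.ext rfl hPF0.self_of_nhds
  have hpt : Tendsto (fun p : ℂ × ℂ => (p.1, F.poincareMap p)) (𝓝 0) (𝓝 0) := by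
    have := hp.continuousAt.tendsto
    rwa [hp0] at this
  have hjt : Tendsto j (𝓝 0) (𝓝 (0, 0, (τ₀ : ℂ))) := by
    have := hj.continuousAt.tendsto
    rwa [hj0] at this
  have hhHt : Tendsto (fun p : ℂ × ℂ => (h p.1, H p)) (𝓝 0) (𝓝 0) := by
    have := hhH.continuousAt.tendsto
    rwa [hhH0] at this
  have hct : Tendsto (fun q : ℝ × ℝ => ((q.1 : ℂ), (q.2 : ℂ))) (𝓝 0) (𝓝 0) := by
    have : Continuous (fun q : ℝ × ℝ => ((q.1 : ℂ), (q.2 : ℂ))) := by fun_prop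
    exact this.tendsto' _ _ (by simp)
  have hrt : Tendsto (fun q : ℝ × ℝ => (q.1, (q.2 : ℂ))) (𝓝 0) (𝓝 0) := by
    have : Continuous (fun q : ℝ × ℝ => (q.1, (q.2 : ℂ))) := by fun_prop
    exact this.tendsto' _ _ (by simp)
  obtain ⟨r₂, hr₂, C, hC, hex⟩ := D.exists_leaf
  obtain ⟨r₃, hr₃, C', hC', hex'⟩ := D'.exists_leaf
  obtain ⟨r₄, hr₄, hcj⟩ := IsLeaf.conj_eq D'
  have hsmall : ∀ᶠ p : ℂ × ℂ in 𝓝 0, ‖p.1‖ < min r r₂ ∧ ‖p.2‖ < r₂ ∧ C * ‖p.2‖ < r ∧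
      ‖h p.1‖ < min r₃ (min r₄ D'.rad) ∧ ‖Y p‖ < r₃ ∧ C' * ‖Y p‖ < r₄ ∧ ‖σ (p.1, 1, p.2)‖ < 1 ∧
      (‖p.1‖ < r₀ ∧ ‖p.2‖ < r₀) := by
    have c1 : Tendsto (fun p : ℂ × ℂ => ‖p.1‖) (𝓝 0) (𝓝 0) :=
      continuous_fst.norm.tendsto' _ _ (by simp)
    have c2 : Tendsto (fun p : ℂ × ℂ => ‖p.2‖) (𝓝 0) (𝓝 0) :=
      continuous_snd.norm.tendsto' _ _ (by simp)
    have c3 : Tendsto (fun p : ℂ × ℂ => ‖h p.1‖) (𝓝 0) (𝓝 0) := by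
      have := (continuous_fst.tendsto (0 : ℂ × ℂ))
      have := (hh.analyticAt.continuousAt.norm.tendsto.comp this)
      simpa [hh.map_zero, Function.comp_def] using this
    have c4 : Tendsto (fun p => ‖Y p‖) (𝓝 0) (𝓝 0) := by
      simpa [Y] using hY.continuousAt.norm.tendsto
    have c5 : Tendsto (fun p : ℂ × ℂ => ‖σ (p.1, 1, p.2)‖) (𝓝 0) (𝓝 0) := by
      simpa [hσ0] using (hi hσ).continuousAt.norm.tendsto
    have c6 := c2.const_mul C
    have c7 := c4.const_mul C'
    rw [mul_zero] at c6 c7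
    filter_upwards [c1.eventually (gt_mem_nhds (lt_min hr hr₂)), c2.eventually (gt_mem_nhds hr₂),
      c6.eventually (gt_mem_nhds hr), c3.eventually (gt_mem_nhds (lt_min hr₃ (lt_min hr₄ D'.rad_pos))),
      c4.eventually (gt_mem_nhds hr₃), c7.eventually (gt_mem_nhds hr₄),
      c5.eventually (gt_mem_nhds one_pos), c1.eventually (gt_mem_nhds hr₀),
      c2.eventually (gt_mem_nhds hr₀)] with p h1 h2 h3 h4 h5 h6 h7 h8 h9
    exact ⟨h1, h2, h3, h4, h5, h6, h7, h8, h9⟩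
  -- Only for real parameters and real points does the image path lie over the equator, so the
  -- equations are proved there and extended afterwards by `eventually_zero_of_real`.
  have key : ∀ᶠ q : ℝ × ℝ in 𝓝 0, (H (q.1, q.2)).im = 0 ∧
      H (q.1, F.poincareMap (q.1, q.2)) - G.poincareMap (h q.1, H (q.1, q.2)) = 0 := by
    filter_upwards [hct.eventually hsmall, hct.eventually (hpt.eventually hsmall),
      hct.eventually (hjt.eventually htr), hct.eventually (hpt.eventually (hjt.eventually htr)),
      hct.eventually hF.poincareMap_eq, hct.eventually (hhHt.eventually hG.poincareMap_eq),
      hrt.eventually Ψr, (continuous_fst.tendsto' (0 : ℝ × ℝ) 0 rfl).eventually hh.real,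
      hct.eventually ((continuous_fst.tendsto' (0 : ℂ × ℂ) 0 rfl).eventually hPF0),
      hct.eventually (hhHt.eventually ((continuous_fst.tendsto' (0 : ℂ × ℂ) 0 rfl).eventually hPG0))]
      with q h1 h2 h3 h4 h5 h6 h7 h8 h9 h10
    obtain ⟨ε, s⟩ := q
    by_cases hs : s = 0
    · subst hs
      simp only [Complex.ofReal_zero, hH0, h9, Complex.zero_im, true_and] at h10 ⊢
      rw [h10, sub_zero]
    obtain ⟨a1, a2, a3, a4, a5, a6, a7, a8⟩ := h1
    obtain ⟨b1, b2, b3, b4, b5, b6, b7, b8⟩ := h2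
    simp only at a1 a2 a3 a4 a5 a6 a7 a8 b5 b6 b7 h3 h4 h5 h6 h7 h8
    rw [lt_min_iff] at a1 a4
    rw [lt_min_iff] at a4
    obtain ⟨W, hW, hW0, hWb⟩ := hex ε s a1.2 a2 0 zero_mem_angles
    obtain ⟨θ, hθ, hθm, hθW⟩ := himg ε s (by simpa using a1.1) hs W hW hW0
      (fun t ht => (hWb t ht).trans_lt a3)
    have hP : W (4 * Real.pi) = F.poincareMap (ε, s) := h5 W hW hW0
    have t0 : T (ε, s) = θ 0 := by
      rw [hθ 0 zero_mem_angles, hW0]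
      simp [T]
    have e4 : Complex.exp (Complex.I * ((4 * Real.pi : ℝ) : ℂ)) = 1 := by
      rw [Complex.exp_eq_one_iff]
      exact ⟨2, by push_cast; ring⟩
    -- After the double turn the slope is X = 1 again, so the angle attached to the point 𝒫(s) is
    -- the final angle minus 4π.
    have t1 : T (ε, F.poincareMap (ε, s)) = ((θ (4 * Real.pi) - 4 * Real.pi : ℝ) : ℂ) := by
      rw [Complex.ofReal_sub, hθ _ four_pi_mem, hP, e4]
      simp only [T]
      ring
    have hpi : (0 : ℝ) ≤ 4 * Real.pi := by positivity
    have hθ0 := hθm 0 ⟨le_rfl, hpi⟩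
    have hθ4 := hθm (4 * Real.pi) ⟨hpi, le_rfl⟩
    have hσ4 : |θ (4 * Real.pi) - 4 * Real.pi - τ₀| < 1 := by
      have : σ (ε, 1, F.poincareMap (ε, s)) = ((θ (4 * Real.pi) - 4 * Real.pi - τ₀ : ℝ) : ℂ) := by
        rw [Complex.ofReal_sub, ← t1]
        simp only [T]
        ring
      rwa [this, Complex.norm_real, Real.norm_eq_abs] at b7
    rw [abs_lt] at hσ4
    have hpi2 := Real.pi_lt_d2
    have ha : θ (4 * Real.pi) - 4 * Real.pi ∈ Set.Icc (-20) (20 - (2 : ℕ) * (2 * Real.pi)) :=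
      ⟨by linarith [hτ₀.1], by push_cast; linarith [hθ4.2]⟩
    obtain ⟨W', hW', hW'0, hW'b⟩ := hex' (h ε) (Y (ε, s)) a4.1 a5 (θ 0) hθ0
    obtain ⟨W₂, hW₂, hW₂0, -⟩ := hex' (h ε) (Y (ε, F.poincareMap (ε, s))) a4.1 b5
      (θ (4 * Real.pi) - 4 * Real.pi) ⟨ha.1, ha.2.trans (by push_cast; linarith)⟩
    have hH1 : H (ε, s) = W' 0 := (h3 (θ 0) t0 hθ0 W' hW' hW'0).symm
    have hH2 : H (ε, F.poincareMap (ε, s)) = W₂ 0 :=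
      (h4 _ t1 ⟨ha.1, ha.2.trans (by push_cast; linarith)⟩ W₂ hW₂ hW₂0).symm
    have hW'4 := hθW W' hW' (by rw [hW'0, hW0])
    rw [hP] at hW'4
    -- The leaf through the image of 𝒫(s) is the image leaf shifted by two turns, so its value at 0
    -- is W'(4π), the Poincaré map of H(s).
    have hsh := hW'.shift a4.2.2 hW₂ 2 ha (by
      rw [hW₂0]
      convert hW'4 using 2
      push_cast
      ring) (b := 0) ⟨by norm_num, by push_cast; linarith⟩
    constructor
    · have hr : conj (Complex.exp (Complex.I * θ 0) * W' (θ 0)) = W' (θ 0) := by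
        have e1 := (hΨσ ε s a8.1 a8.2 1 h1s).2
        rw [one_mul] at e1
        rw [Complex.conj_ofReal, e1, mul_one] at h7
        rw [hW'0, ← t0]
        exact h7.symm
      have := hcj (h ε) (Complex.conj_eq_iff_im.2 h8) a4.2.1 W' hW'
        (fun t ht => (hW'b t ht).trans_lt a6) (θ 0) hθ0 hr 0 zero_mem_angles
      simp only [Complex.ofReal_zero, mul_zero, Complex.exp_zero, one_mul] at this
      rw [hH1]
      exact Complex.conj_eq_iff_im.1 this
    · have e5 := h6 W' hW' hH1.symm
      rw [hH2, ← e5, ← hsh, sub_eq_zero]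
      congr 1
      push_cast
      ring
  refine ⟨h, H, hh, hH, Eventually.of_forall hH0, ?_, key.mono fun q hq => hq.1, ?_⟩
  · have hg : DifferentiableAt ℂ (fun x : ℂ => m (0, 1, x) * E (j (0, x))) 0 :=
      DifferentiableAt.comp (g := fun p : ℂ × ℂ => m (p.1, 1, p.2) * E (j p))
        (f := fun x : ℂ => ((0 : ℂ), x)) 0 ((hi hm).mul hEj).differentiableAt (by fun_prop)
    have hd : HasDerivAt (fun x : ℂ => H (0, x)) _ 0 :=
      ((hasDerivAt_id (0 : ℂ)).mul hg.hasDerivAt).congr_of_eventuallyEq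
        (Eventually.of_forall fun x => by simp [H, Y, mul_assoc])
    rw [hd.deriv]
    have e : j ((0 : ℂ), (0 : ℂ)) = _ := hj0
    simp only [id, one_mul, zero_mul, add_zero, hm0, e]
    exact mul_ne_zero (by simpa using ha) hE0
  · have hz := eventually_zero_of_real ((hH.comp_of_eq hp hp0).sub (hPG.comp_of_eq hhH hhH0))
      (key.mono fun q hq => hq.2)
    filter_upwards [hz] with p hp
    exact sub_eq_zero.1 hp

end GenericFamily

end WeakFocus

end

/-! ### The invariant curves through the origin -/

noncomputable section

namespace WeakFocus

/-- The average `f ↦ ∫₀¹ s f(t s) ds`. -/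
def averageCLM : C(unitInterval, ℂ) →L[ℂ] C(unitInterval, ℂ) :=
  LinearMap.mkContinuous
    { toFun := fun f => ⟨fun t => ∫ s in (0 : ℝ)..1,
          (s : ℂ) * f (t * Set.projIcc 0 1 zero_le_one s), by
        refine intervalIntegral.continuous_parametric_intervalIntegral_of_continuous' ?_ _ _
        fun_prop⟩
      map_add' := by
        intro f g
        ext t
        simp only [ContinuousMap.add_apply, ContinuousMap.coe_mk, mul_add]
        exact intervalIntegral.integral_add (Continuous.intervalIntegrable (by fun_prop) _ _)
          (Continuous.intervalIntegrable (by fun_prop) _ _)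
      map_smul' := by
        intro c f
        ext t
        simp only [ContinuousMap.smul_apply, ContinuousMap.coe_mk, smul_eq_mul, RingHom.id_apply]
        rw [← intervalIntegral.integral_const_mul]
        congr 1
        ext s
        ring } 1 (by
    intro f
    rw [ContinuousMap.norm_le _ (by positivity)]
    intro t
    have := intervalIntegral.norm_integral_le_of_norm_le_const (a := 0) (b := 1) (C := 1 * ‖f‖)
      (f := fun s : ℝ => (s : ℂ) * f (t * Set.projIcc 0 1 zero_le_one s)) (by
        intro s hs
        rw [Set.uIoc_of_le zero_le_one] at hs
        rw [norm_mul, Complex.norm_real, Real.norm_eq_abs, abs_of_nonneg hs.1.le]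
        gcongr
        · exact hs.2
        · exact f.norm_coe_le_norm _)
    simpa using this)

lemma averageCLM_apply (f : C(unitInterval, ℂ)) (t : unitInterval) :
    averageCLM f t = ∫ s in (0 : ℝ)..1, (s : ℂ) * f (t * Set.projIcc 0 1 zero_le_one s) := rfl

/-- For ζ the average of ω this says (t²ζ)' = tω, that is ω = 2ζ + tζ'. The weight s is chosen
because ζ ↦ 2ζ + tζ' is, up to a constant factor, the linear part of the equation of the invariant
curve. -/
lemma sq_mul_averageCLM (f : C(unitInterval, ℂ)) (t : unitInterval) :
    ((t : ℝ) : ℂ) ^ 2 * averageCLM f t =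
      ∫ s in (0 : ℝ)..t, (s : ℂ) * f (Set.projIcc 0 1 zero_le_one s) := by
  have h2 := intervalIntegral.smul_integral_comp_mul_left (a := 0) (b := 1)
    (fun s => (s : ℂ) * f (Set.projIcc 0 1 zero_le_one s)) (t : ℝ)
  rw [mul_zero, mul_one] at h2
  rw [← h2, Complex.real_smul, averageCLM_apply, pow_two, mul_assoc,
    ← intervalIntegral.integral_const_mul ((t : ℝ) : ℂ)]
  congr 1
  refine intervalIntegral.integral_congr ?_
  intro s hs
  rw [Set.uIcc_of_le zero_le_one] at hs
  have h3 : (t : ℝ) * s ∈ Set.Icc (0 : ℝ) 1 :=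
    ⟨mul_nonneg t.2.1 hs.1, mul_le_one₀ t.2.2 hs.1 hs.2⟩
  have h4 : t * Set.projIcc 0 1 zero_le_one s = Set.projIcc 0 1 zero_le_one ((t : ℝ) * s) := by
    rw [Set.projIcc_of_mem zero_le_one hs, Set.projIcc_of_mem zero_le_one h3]
    rfl
  simp only [h4]
  push_cast
  ring

lemma hasDerivWithinAt_sq_mul_averageCLM (f : C(unitInterval, ℂ)) :
    HasDerivWithinAt (fun t : ℝ => (t : ℂ) ^ 2 * averageCLM f (Set.projIcc 0 1 zero_le_one t))
      (f 1) (Set.Icc 0 1) 1 := by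
  have h1 : HasDerivAt (fun u : ℝ => ∫ s in (0 : ℝ)..u,
      (s : ℂ) * f (Set.projIcc 0 1 zero_le_one s)) (((1 : ℝ) : ℂ) * f (Set.projIcc 0 1 zero_le_one 1))
      1 :=
    intervalIntegral.integral_hasDerivAt_right
      (Continuous.intervalIntegrable (by fun_prop) _ _)
      (Continuous.stronglyMeasurableAtFilter (by fun_prop) _ _)
      (Continuous.continuousAt (by fun_prop))
  have h2 : Set.projIcc (0 : ℝ) 1 zero_le_one 1 = 1 := Set.projIcc_right _
  rw [h2, Complex.ofReal_one, one_mul] at h1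
  refine h1.hasDerivWithinAt.congr_of_mem ?_ (by simp)
  intro s hs
  have := sq_mul_averageCLM f ⟨s, hs⟩
  rw [Set.projIcc_of_mem zero_le_one hs]
  exact this

/-- Precomposition with `t ↦ τ t`. -/
def rescale (τ : unitInterval) (f : C(unitInterval, ℂ)) : C(unitInterval, ℂ) :=
  ⟨fun t => f (τ * t), by fun_prop⟩

lemma rescale_apply (τ : unitInterval) (f : C(unitInterval, ℂ)) (t : unitInterval) :
    rescale τ f t = f (τ * t) := rfl

lemma norm_rescale_le (τ : unitInterval) (f : C(unitInterval, ℂ)) : ‖rescale τ f‖ ≤ ‖f‖ := by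
  rw [ContinuousMap.norm_le _ (norm_nonneg _)]
  exact fun t => f.norm_coe_le_norm _

lemma averageCLM_rescale (τ : unitInterval) (f : C(unitInterval, ℂ)) :
    averageCLM (rescale τ f) = rescale τ (averageCLM f) := by
  ext t
  rw [rescale_apply, averageCLM_apply, averageCLM_apply]
  simp only [rescale_apply, mul_assoc]

namespace FolData

variable (D : FolData)

/-- The inclusion of the unit interval. -/
def idC : C(unitInterval, ℂ) := ⟨fun t => ((t : ℝ) : ℂ), by fun_prop⟩

/-- The arguments `(ε, η t ζ(t), η t)`. -/
def sepArg (q : (ℂ × ℂ) × C(unitInterval, ℂ)) : ℂ × C(unitInterval, ℂ) × C(unitInterval, ℂ) :=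
  (q.1.1, q.1.2 • (idC * averageCLM q.2), q.1.2 • idC)

/-- With `ζ` the average of `ω`, the fixed points `ω` of this operator satisfy
`(ω - ζ) (ζ q₁ + q₂) = ζ p₁ + p₂`. -/
def sepOp (q : (ℂ × ℂ) × C(unitInterval, ℂ)) : C(unitInterval, ℂ) :=
  q.2 + (Complex.I * D.b)⁻¹ • ((q.2 - averageCLM q.2) *
    (averageCLM q.2 * sup3 _ D.q1 (sepArg q) + sup3 _ D.q2 (sepArg q)) -
    (averageCLM q.2 * sup3 _ D.p1 (sepArg q) + sup3 _ D.p2 (sepArg q)))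

lemma sepArg_zero (v : C(unitInterval, ℂ)) : sepArg (0, v) = 0 :=
  Prod.ext rfl (Prod.ext (zero_smul ℂ (idC * averageCLM v)) (zero_smul ℂ idC))

/-- With x = ηtζ and y = ηt one has dx/dy = ζ + tζ' = ω - ζ. At ε = η = 0 the eigenvalues are ib and
-ib, so the correction term is exactly -ω and the operator is constant, as
`exists_analyticAt_fixedPoint` requires. -/
lemma sepOp_zero (v : C(unitInterval, ℂ)) : D.sepOp (0, v) = 0 := by
  have h := fun f => sup3_zero_right (K := unitInterval) f 0
  have h0 : ((0 : ℂ), (0 : C(unitInterval, ℂ)), (0 : C(unitInterval, ℂ))) = 0 := rfl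
  have h1 : ((0 : ℂ), (0 : ℂ), (0 : ℂ)) = 0 := rfl
  rw [h0, h1] at h
  have hb : (D.b : ℂ) ≠ 0 := by exact_mod_cast D.b_pos.ne'
  simp only [sepOp, sepArg_zero, h, D.p1_zero, D.p2_zero, D.q1_zero, D.q2_zero]
  ext t
  simp only [ContinuousMap.add_apply, ContinuousMap.smul_apply, ContinuousMap.sub_apply,
    ContinuousMap.mul_apply, ContinuousMap.const_apply, smul_eq_mul, ContinuousMap.zero_apply]
  field_simp
  ring

lemma analyticAt_sepOp (v : C(unitInterval, ℂ)) : AnalyticAt ℂ D.sepOp (0, v) := by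
  have hA : ∀ q, AnalyticAt ℂ (fun q : (ℂ × ℂ) × C(unitInterval, ℂ) => averageCLM q.2) q :=
    fun q => averageCLM.analyticAt _ |>.comp analyticAt_snd
  have harg : AnalyticAt ℂ sepArg (0, v) := by
    have := hA (0, v)
    unfold sepArg
    fun_prop
  have hs : ∀ {f : ℂ × ℂ × ℂ → ℂ}, AnalyticAt ℂ f 0 →
      AnalyticAt ℂ (fun q => sup3 unitInterval f (sepArg q)) (0, v) := fun hf =>
    (analyticAt_sup3 hf).comp_of_eq harg (sepArg_zero v)
  have h1 := hA (0, v)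
  have h2 := hs D.analyticAt_p1
  have h3 := hs D.analyticAt_p2
  have h4 := hs D.analyticAt_q1
  have h5 := hs D.analyticAt_q2
  unfold sepOp
  fun_prop

lemma eventually_sepOp : ∃ δ > 0, ∀ q : (ℂ × ℂ) × C(unitInterval, ℂ), ‖q‖ < δ → ∀ t,
    D.sepOp q t = q.2 t + (Complex.I * D.b)⁻¹ * ((q.2 t - averageCLM q.2 t) *
      (averageCLM q.2 t * D.q1 (q.1.1, q.1.2 * ((t : ℝ) * averageCLM q.2 t), q.1.2 * (t : ℝ)) +
        D.q2 (q.1.1, q.1.2 * ((t : ℝ) * averageCLM q.2 t), q.1.2 * (t : ℝ))) -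
      (averageCLM q.2 t * D.p1 (q.1.1, q.1.2 * ((t : ℝ) * averageCLM q.2 t), q.1.2 * (t : ℝ)) +
        D.p2 (q.1.1, q.1.2 * ((t : ℝ) * averageCLM q.2 t), q.1.2 * (t : ℝ)))) := by
  have ht : Tendsto sepArg (𝓝 0) (𝓝 0) := by
    have : Continuous sepArg := by
      unfold sepArg
      fun_prop
    exact this.tendsto' _ _ (sepArg_zero 0)
  obtain ⟨δ, hδ, h⟩ := Metric.eventually_nhds_iff_ball.1
    ((ht.eventually (eventually_sup3_apply (K := unitInterval) D.analyticAt_p1)).and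
    ((ht.eventually (eventually_sup3_apply (K := unitInterval) D.analyticAt_p2)).and
    ((ht.eventually (eventually_sup3_apply (K := unitInterval) D.analyticAt_q1)).and
    (ht.eventually (eventually_sup3_apply (K := unitInterval) D.analyticAt_q2)))))
  refine ⟨δ, hδ, fun q hq t => ?_⟩
  obtain ⟨h1, h2, h3, h4⟩ := h q (by rwa [mem_ball_zero_iff])
  simp only [sepOp, ContinuousMap.add_apply, ContinuousMap.smul_apply, ContinuousMap.sub_apply,
    ContinuousMap.mul_apply, smul_eq_mul, h1, h2, h3, h4]
  rfl

/-- The invariant curve `x = y Z(ε, y)` through the origin tangent to the `y`-axis. -/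
lemma exists_separatrix (hp : ∀ᶠ ε : ℂ in 𝓝 0, D.p2 (ε, 0, 0) = 0) :
    ∃ Z : ℂ × ℂ → ℂ, AnalyticAt ℂ Z 0 ∧ (∀ᶠ ε : ℂ in 𝓝 0, Z (ε, 0) = 0) ∧
      ∀ᶠ p : ℂ × ℂ in 𝓝 0,
        (Z p + p.2 * deriv (fun u => Z (p.1, u)) p.2) *
          (Z p * D.q1 (p.1, p.2 * Z p, p.2) + D.q2 (p.1, p.2 * Z p, p.2)) =
        Z p * D.p1 (p.1, p.2 * Z p, p.2) + D.p2 (p.1, p.2 * Z p, p.2) := by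
  obtain ⟨S, hS, hS0, hSfix, hSuniq⟩ := exists_analyticAt_fixedPoint (p₀ := (0 : ℂ × ℂ))
    (v₀ := (0 : C(unitInterval, ℂ))) (D.analyticAt_sepOp 0) D.sepOp_zero
  obtain ⟨δ, hδ, hop⟩ := D.eventually_sepOp
  obtain ⟨δ', hδ', huniq⟩ := Metric.eventually_nhds_iff_ball.1 hSuniq
  have hSt : Tendsto S (𝓝 0) (𝓝 0) := by
    have := hS.continuousAt.tendsto
    rwa [hS0] at this
  have hZ : AnalyticAt ℂ (fun p => averageCLM (S p) 1) 0 :=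
    (((ContinuousMap.evalCLM ℂ (1 : unitInterval)).comp averageCLM).analyticAt _).comp hS
  have hδδ : 0 < min δ δ' := lt_min hδ hδ'
  have hnear : ∀ᶠ p in 𝓝 (0 : ℂ × ℂ), ‖p‖ < min δ δ' ∧ ‖S p‖ < min δ δ' := by
    have h1 := hSt.eventually (Metric.ball_mem_nhds 0 hδδ)
    filter_upwards [Metric.ball_mem_nhds 0 hδδ, h1] with p h2 h3
    exact ⟨by simpa using h2, by simpa using h3⟩
  -- A dilated solution solves the equation with η dilated, so by uniqueness it is the solution
  -- there. Hence the functions S(ε, η) on the interval all come from the single function Z(ε, y).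
  have hscale : ∀ᶠ p in 𝓝 (0 : ℂ × ℂ), ∀ τ : unitInterval,
      rescale τ (S p) = S (p.1, p.2 * (τ : ℝ)) := by
    filter_upwards [hnear, hSfix] with p h1 h2 τ
    have hτ : ‖(((τ : ℝ) : ℂ))‖ ≤ 1 := by
      rw [Complex.norm_real, Real.norm_eq_abs, abs_of_nonneg τ.2.1]
      exact τ.2.2
    have hn : ‖((p.1, p.2 * ((τ : ℝ) : ℂ)), rescale τ (S p))‖ < min δ δ' := by
      rw [prod_norm_lt_iff, prod_norm_lt_iff, norm_mul]
      obtain ⟨h3, h4⟩ := prod_norm_lt_iff.1 h1.1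
      refine ⟨⟨h3, ?_⟩, (norm_rescale_le _ _).trans_lt h1.2⟩
      exact (mul_le_of_le_one_right (norm_nonneg _) hτ).trans_lt h4
    have hn1 : ‖(p, S p)‖ < δ :=
      (prod_norm_lt_iff.2 ⟨h1.1, h1.2⟩).trans_le (min_le_left _ _)
    refine (huniq ((p.1, p.2 * ((τ : ℝ) : ℂ)), rescale τ (S p)) ?_ ?_).symm
    · have : (((0 : ℂ × ℂ), (0 : C(unitInterval, ℂ)))) = 0 := rfl
      rw [this, mem_ball_zero_iff]
      exact hn.trans_le (min_le_right _ _)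
    · ext t
      rw [hop _ (hn.trans_le (min_le_left _ _))]
      have h5 := congrArg (fun f => f (τ * t)) h2
      rw [hop _ hn1] at h5
      simp only [averageCLM_rescale, rescale_apply]
      have e1 : p.2 * ((τ : ℝ) : ℂ) * (((t : ℝ) : ℂ) * averageCLM (S p) (τ * t)) =
          p.2 * ((((τ * t : unitInterval) : ℝ) : ℂ) * averageCLM (S p) (τ * t)) := by
        push_cast
        ring
      have e2 : p.2 * ((τ : ℝ) : ℂ) * ((t : ℝ) : ℂ) =
          p.2 * (((τ * t : unitInterval) : ℝ) : ℂ) := by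
        push_cast
        ring
      rw [e1, e2]
      exact h5
  refine ⟨fun p => averageCLM (S p) 1, hZ, ?_, ?_⟩
  · have hl : Tendsto (fun ε : ℂ => (ε, (0 : ℂ))) (𝓝 0) (𝓝 0) := by
      have : Continuous (fun ε : ℂ => (ε, (0 : ℂ))) := by fun_prop
      exact this.tendsto' _ _ rfl
    filter_upwards [hp, Metric.ball_mem_nhds 0 hδδ] with ε h1 h2
    rw [mem_ball_zero_iff] at h2
    have hn : ‖((ε, (0 : ℂ)), (0 : C(unitInterval, ℂ)))‖ < min δ δ' := by
      rw [prod_norm_lt_iff, prod_norm_lt_iff]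
      exact ⟨⟨h2, by simpa using hδδ⟩, by simpa using hδδ⟩
    -- Since p₂ vanishes at (ε, 0, 0), the zero function is a fixed point for η = 0.
    have : S (ε, 0) = 0 := by
      refine huniq ((ε, (0 : ℂ)), (0 : C(unitInterval, ℂ))) ?_ ?_
      · have : (((0 : ℂ × ℂ), (0 : C(unitInterval, ℂ)))) = 0 := rfl
        rw [this, mem_ball_zero_iff]
        exact hn.trans_le (min_le_right _ _)
      · ext t
        rw [hop _ (hn.trans_le (min_le_left _ _))]
        simp [h1]
    rw [this, map_zero, ContinuousMap.zero_apply]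
  · filter_upwards [hnear, hSfix, hscale, hZ.eventually_analyticAt] with p h1 h2 h3 h4
    have hn1 : ‖(p, S p)‖ < δ :=
      (prod_norm_lt_iff.2 ⟨h1.1, h1.2⟩).trans_le (min_le_left _ _)
    have h5 := congrArg (fun f => f 1) h2
    rw [hop _ hn1] at h5
    set Z : ℂ × ℂ → ℂ := fun p => averageCLM (S p) 1 with hZdef
    have hray : ∀ τ ∈ Set.Icc (0 : ℝ) 1,
        averageCLM (S p) (Set.projIcc 0 1 zero_le_one τ) = Z (p.1, p.2 * τ) := by
      intro τ hτ
      have := congrArg (fun f => averageCLM f 1) (h3 ⟨τ, hτ⟩)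
      simp only [averageCLM_rescale, rescale_apply, mul_one] at this
      rw [Set.projIcc_of_mem zero_le_one hτ]
      exact this
    have hd : HasDerivAt (fun u => Z (p.1, u)) (deriv (fun u => Z (p.1, u)) p.2) p.2 :=
      (differentiableAt_slice h4.differentiableAt).hasDerivAt
    have hd1 : HasDerivAt (fun τ : ℝ => p.2 * (τ : ℂ)) p.2 1 := by
      simpa using (Complex.ofRealCLM.hasDerivAt (x := 1)).const_mul p.2
    have hd2 : HasDerivAt (fun τ : ℝ => Z (p.1, p.2 * τ)) (p.2 * deriv (fun u => Z (p.1, u)) p.2)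
        1 := by
      have hd' : HasDerivAt (fun u => Z (p.1, u)) (deriv (fun u => Z (p.1, u)) p.2)
          (p.2 * ((1 : ℝ) : ℂ)) := by simpa using hd
      have := HasDerivAt.scomp (1 : ℝ) hd' hd1
      simpa [smul_eq_mul, Function.comp_def] using this
    have hd3 : HasDerivAt (fun τ : ℝ => (τ : ℂ) ^ 2) 2 1 := by
      simpa using (Complex.ofRealCLM.hasDerivAt (x := 1)).fun_pow 2
    have hd4 := (hd3.mul hd2).hasDerivWithinAt (s := Set.Icc 0 1)
    have hd5 := (hasDerivWithinAt_sq_mul_averageCLM (S p)).congr_of_mem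
      (f₁ := (fun τ : ℝ => (τ : ℂ) ^ 2) * fun τ : ℝ => Z (p.1, p.2 * τ)) (fun τ hτ => by
        rw [Pi.mul_apply, hray τ hτ]) (by simp)
    -- Differentiating τ² Z(ε, ητ) at τ = 1 in two ways gives 2Z + y ∂Z/∂y = ω(1), which turns the
    -- fixed point equation into the equation of the curve.
    have heq := (uniqueDiffOn_Icc zero_lt_one 1 (by simp)).eq_deriv _ hd4 hd5
    have hZ1 : Z (p.1, p.2 * ((1 : ℝ) : ℂ)) = Z p := by simp
    rw [hZ1] at heq
    have hZ2 : averageCLM (S p) 1 = Z p := rfl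
    have hb := D.I_mul_b_ne
    rw [hZ2] at h5
    have e1 : p.2 * (((1 : unitInterval) : ℝ) : ℂ) = p.2 := by simp
    have e2 : p.2 * ((((1 : unitInterval) : ℝ) : ℂ) * Z p) = p.2 * Z p := by simp
    simp only [e1, e2] at h5
    rw [add_eq_left, mul_eq_zero, or_iff_right (inv_ne_zero hb), sub_eq_zero, ← heq] at h5
    rw [← h5]
    push_cast
    ring

end FolData

end WeakFocus

end

/-! ### Real changes of coordinates and push-forward of families -/

noncomputable section

namespace WeakFocus

lemma fderiv_slice {E Z F : Type*} [NormedAddCommGroup E] [NormedSpace ℂ E]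
    [NormedAddCommGroup Z] [NormedSpace ℂ Z] [NormedAddCommGroup F] [NormedSpace ℂ F]
    {f : E × Z → F} {p : E × Z} (hf : DifferentiableAt ℂ f p) (v : Z) :
    fderiv ℂ (fun z => f (p.1, z)) p.2 v = fderiv ℂ f p (0, v) := by
  have h : HasFDerivAt (fun z => f (p.1, z)) (fderiv ℂ f p ∘L .inr ℂ E Z) p.2 :=
    hf.hasFDerivAt.comp (f := fun z => (p.1, z)) p.2 (hasFDerivAt_prodMk_right p.1 p.2)
  rw [h.fderiv]
  rfl

/-- The real structure `(x, y) ↦ (conj y, conj x)`. -/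
def planeInv : (ℂ × ℂ) →L[ℝ] (ℂ × ℂ) :=
  ((Complex.conjCLE.toContinuousLinearMap).comp (.snd ℝ ℂ ℂ)).prod
    ((Complex.conjCLE.toContinuousLinearMap).comp (.fst ℝ ℂ ℂ))

lemma planeInv_apply (z : ℂ × ℂ) : planeInv z = (conj z.2, conj z.1) := rfl

lemma realInv_eq (p : ℂ × ℂ × ℂ) : realInv p = (conj p.1, planeInv p.2) := rfl

/-- A real family of changes of coordinates tangent to the identity, with its inverse. -/
structure RealChart (Λ Φ : ℂ × ℂ × ℂ → ℂ × ℂ) : Prop where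
  analyticAt : AnalyticAt ℂ Λ 0
  analyticAt_symm : AnalyticAt ℂ Φ 0
  left_inv : ∀ᶠ p in 𝓝 0, Φ (p.1, Λ p) = p.2
  right_inv : ∀ᶠ p in 𝓝 0, Λ (p.1, Φ p) = p.2
  map_zero : ∀ᶠ ε : ℂ in 𝓝 0, Λ (ε, 0) = 0
  hasFDerivAt : ∀ᶠ ε : ℂ in 𝓝 0,
    HasFDerivAt (fun z => Λ (ε, z)) (ContinuousLinearMap.id ℂ (ℂ × ℂ)) 0
  real : ∀ᶠ p in 𝓝 0, Λ (realInv p) = planeInv (Λ p)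

lemma tendsto_line : Tendsto (fun ε : ℂ => ((ε, 0) : ℂ × ℂ × ℂ)) (𝓝 0) (𝓝 0) := by
  have : Continuous (fun ε : ℂ => ((ε, 0) : ℂ × ℂ × ℂ)) := by fun_prop
  exact this.tendsto' _ _ rfl

namespace RealChart

variable {Λ Φ : ℂ × ℂ × ℂ → ℂ × ℂ}

lemma analyticAt_pair {Λ : ℂ × ℂ × ℂ → ℂ × ℂ} (h : AnalyticAt ℂ Λ 0) :
    AnalyticAt ℂ (fun p : ℂ × ℂ × ℂ => (p.1, Λ p)) 0 := by
  fun_prop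

lemma tendsto_pair {Λ : ℂ × ℂ × ℂ → ℂ × ℂ} (h : AnalyticAt ℂ Λ 0) (h0 : Λ 0 = 0) :
    Tendsto (fun p : ℂ × ℂ × ℂ => (p.1, Λ p)) (𝓝 0) (𝓝 0) := by
  have := (analyticAt_pair h).continuousAt.tendsto
  rw [h0] at this
  exact this

lemma zero (h : RealChart Λ Φ) : Λ 0 = 0 := h.map_zero.self_of_nhds

lemma map_zero_symm (h : RealChart Λ Φ) : ∀ᶠ ε : ℂ in 𝓝 0, Φ (ε, 0) = 0 := by
  filter_upwards [h.map_zero, tendsto_line.eventually h.left_inv] with ε h1 h2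
  rwa [h1] at h2

lemma zero_symm (h : RealChart Λ Φ) : Φ 0 = 0 := h.map_zero_symm.self_of_nhds

lemma tendsto (h : RealChart Λ Φ) : Tendsto (fun p : ℂ × ℂ × ℂ => (p.1, Λ p)) (𝓝 0) (𝓝 0) :=
  tendsto_pair h.analyticAt h.zero

lemma tendsto_symm (h : RealChart Λ Φ) : Tendsto (fun p : ℂ × ℂ × ℂ => (p.1, Φ p)) (𝓝 0) (𝓝 0) :=
  tendsto_pair h.analyticAt_symm h.zero_symm

/-- The chain rule for the composition with the inverse. -/
lemma fderiv_symm_apply (h : RealChart Λ Φ) : ∀ᶠ p in 𝓝 0, ∀ v,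
    fderiv ℂ (fun z => Φ (p.1, z)) (Λ p) (fderiv ℂ (fun z => Λ (p.1, z)) p.2 v) = v := by
  filter_upwards [h.left_inv.eventually_nhds, h.analyticAt.eventually_analyticAt,
    h.tendsto.eventually h.analyticAt_symm.eventually_analyticAt] with p h1 h2 h3 v
  have := fderiv_comp (𝕜 := ℂ) (g := fun z => Φ (p.1, z)) (f := fun z => Λ (p.1, z)) p.2
    (differentiableAt_slice (p := (p.1, Λ p)) h3.differentiableAt)
    (differentiableAt_slice h2.differentiableAt)
  have heq : (fun z => Φ (p.1, z)) ∘ (fun z => Λ (p.1, z)) =ᶠ[𝓝 p.2] fun z => z := by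
    have : Continuous (fun z : ℂ × ℂ => (p.1, z)) := by fun_prop
    exact (this.tendsto p.2).eventually h1
  rw [heq.fderiv_eq, fderiv_fun_id] at this
  exact (DFunLike.congr_fun this v).symm

lemma symm (h : RealChart Λ Φ) : RealChart Φ Λ where
  analyticAt := h.analyticAt_symm
  analyticAt_symm := h.analyticAt
  left_inv := h.right_inv
  right_inv := h.left_inv
  map_zero := h.map_zero_symm
  hasFDerivAt := by
    filter_upwards [h.hasFDerivAt, tendsto_line.eventually h.fderiv_symm_apply, h.map_zero,
      tendsto_line.eventually h.analyticAt_symm.eventually_analyticAt] with ε h1 h2 h3 h4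
    have h5 : DifferentiableAt ℂ (fun z => Φ (ε, z)) 0 :=
      differentiableAt_slice (p := (ε, (0 : ℂ × ℂ))) h4.differentiableAt
    refine h5.hasFDerivAt.congr_fderiv ?_
    refine ContinuousLinearMap.ext fun v => ?_
    have := h2 v
    simp only [h3] at this
    rwa [h1.fderiv] at this
  real := by
    filter_upwards [h.tendsto_symm.eventually h.real, h.right_inv,
      (tendsto_realInv.comp h.tendsto_symm).eventually h.left_inv] with p h1 h2 h3
    simp only [Function.comp_apply] at h3
    rw [h1, h2] at h3
    exact h3

/-- A local inverse of a real family of maps tangent to the identity. -/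
lemma exists_of_hasFDerivAt (hΛ : AnalyticAt ℂ Λ 0) (h0 : ∀ᶠ ε : ℂ in 𝓝 0, Λ (ε, 0) = 0)
    (hd : ∀ᶠ ε : ℂ in 𝓝 0,
      HasFDerivAt (fun z => Λ (ε, z)) (ContinuousLinearMap.id ℂ (ℂ × ℂ)) 0)
    (hr : ∀ᶠ p in 𝓝 0, Λ (realInv p) = planeInv (Λ p)) : ∃ Φ, RealChart Λ Φ := by
  let g : ℂ × ℂ × ℂ → ℂ × ℂ × ℂ := fun p => (p.1, Λ p)
  have hg : AnalyticAt ℂ g 0 := analyticAt_pair hΛ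
  have hg0 : g 0 = 0 := Prod.ext rfl h0.self_of_nhds
  -- The zero section is fixed and Λ is tangent to the identity at ε = 0, so the derivative of (ε,
  -- z) ↦ (ε, Λ) is the identity and the inverse function theorem applies.
  have hgd : HasFDerivAt g
      ((ContinuousLinearEquiv.refl ℂ (ℂ × ℂ × ℂ)) : ℂ × ℂ × ℂ →L[ℂ] ℂ × ℂ × ℂ) 0 := by
    have h1 : HasFDerivAt Λ (fderiv ℂ Λ 0) 0 := hΛ.differentiableAt.hasFDerivAt
    refine ((hasFDerivAt_fst (𝕜 := ℂ) (E := ℂ) (F := ℂ × ℂ) (p := 0)).prodMk h1).congr_fderiv ?_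
    have h2 : ∀ v, fderiv ℂ Λ 0 (0, v) = v := by
      intro v
      rw [← fderiv_slice hΛ.differentiableAt]
      have := hd.self_of_nhds
      rw [Prod.fst_zero, Prod.snd_zero, this.fderiv]
      rfl
    have h3 : ∀ e, fderiv ℂ Λ 0 (e, 0) = 0 := by
      intro e
      have h4 : HasFDerivAt (fun ε : ℂ => Λ (ε, 0)) (fderiv ℂ Λ 0 ∘L .inl ℂ ℂ (ℂ × ℂ)) 0 :=
        h1.comp (f := fun ε : ℂ => (ε, (0 : ℂ × ℂ))) 0 (hasFDerivAt_prodMk_left 0 0)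
      have h5 := h4.congr_of_eventuallyEq (f₁ := fun _ => 0) (h0.mono fun ε h => h.symm)
      exact DFunLike.congr_fun (h5.unique (hasFDerivAt_const 0 0)) e
    refine ContinuousLinearMap.ext fun v => ?_
    have : v = (v.1, 0) + (0, v.2) := by simp
    rw [ContinuousLinearMap.prod_apply]
    refine Prod.ext rfl ?_
    change fderiv ℂ Λ 0 v = v.2
    conv_lhs => rw [this]
    rw [map_add, h2, h3, zero_add]
  have hgc := hg.contDiffAt (n := ⊤)
  have hn : (⊤ : WithTop ℕ∞) ≠ 0 := by simp
  let G := hgc.localInverse hgd hn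
  have hG : AnalyticAt ℂ G 0 := by
    have := hgc.to_localInverse hgd hn
    rw [hg0] at this
    exact this.analyticAt
  have hl : ∀ᶠ p in 𝓝 0, G (g p) = p :=
    (hgc.hasStrictFDerivAt' hgd hn).eventually_left_inverse
  have hri : ∀ᶠ p in 𝓝 0, g (G p) = p := by
    have := (hgc.hasStrictFDerivAt' hgd hn).eventually_right_inverse
    rwa [hg0] at this
  refine ⟨fun p => (G p).2, hΛ, ((ContinuousLinearMap.snd ℂ ℂ (ℂ × ℂ)).analyticAt _).comp hG, ?_, ?_,
    h0, hd, hr⟩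
  · filter_upwards [hl] with p h
    exact congrArg Prod.snd h
  · filter_upwards [hri] with p h
    have h1 : (g (G p)).1 = p.1 := by rw [h]
    have h2 : (g (G p)).2 = p.2 := by rw [h]
    change (G p).1 = p.1 at h1
    rw [← h1]
    exact h2

lemma realOrbitallyEquivalent (h : RealChart Λ Φ) {F G : GenericFamily}
    (he : ∀ᶠ p in 𝓝 0, fderiv ℂ (fun z => Λ (p.1, z)) p.2 (F.field p) = G.field (p.1, Λ p)) :
    RealOrbitallyEquivalent F G ∧ RealOrbitallyEquivalent G F := by
  have key : ∀ {Λ Φ : ℂ × ℂ × ℂ → ℂ × ℂ} {F G : GenericFamily}, RealChart Λ Φ →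
      (∀ᶠ p in 𝓝 0, fderiv ℂ (fun z => Λ (p.1, z)) p.2 (F.field p) = G.field (p.1, Λ p)) →
      RealOrbitallyEquivalent F G := by
    intro Λ Φ F G h he
    refine ⟨id, Λ, fun _ => 1, ⟨analyticAt_id, rfl, by simp, by simp⟩, h.analyticAt, h.map_zero,
      ?_, ?_, by fun_prop, by simp, ?_⟩
    · rw [h.hasFDerivAt.self_of_nhds.fderiv]
      exact ContinuousLinearMap.isInvertible_equiv (f := ContinuousLinearEquiv.refl ℂ (ℂ × ℂ))
    · have hc : Tendsto (fun q : ℝ × ℂ => ((q.1 : ℂ), q.2, conj q.2)) (𝓝 0) (𝓝 0) := by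
        have : Continuous (fun q : ℝ × ℂ => ((q.1 : ℂ), q.2, conj q.2)) := by fun_prop
        exact this.tendsto' _ _ (by simp)
      filter_upwards [hc.eventually h.real] with q hq
      rw [realInv_eq, planeInv_apply, planeInv_apply] at hq
      simp only [Complex.conj_ofReal, Complex.conj_conj] at hq
      exact congrArg Prod.snd hq
    · simpa using he
  refine ⟨key h he, key h.symm ?_⟩
  filter_upwards [h.tendsto_symm.eventually he, h.tendsto_symm.eventually h.fderiv_symm_apply,
    h.right_inv] with p h1 h2 h3
  simp only [h3] at h1 h2
  rw [← h1, h2]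

/-- The push-forward of a family of vector fields as a function. -/
def pushField (Λ Φ : ℂ × ℂ × ℂ → ℂ × ℂ) (F : GenericFamily) (p : ℂ × ℂ × ℂ) : ℂ × ℂ :=
  fderiv ℂ Λ (p.1, Φ p) (0, F.field (p.1, Φ p))

variable (F : GenericFamily)

lemma analyticAt_field : AnalyticAt ℂ F.field 0 := F.analyticAt_P.prod F.analyticAt_Q

lemma analyticAt_pushField (h : RealChart Λ Φ) : AnalyticAt ℂ (pushField Λ Φ F) 0 := by
  have hp := analyticAt_pair h.analyticAt_symm
  have hp0 : ((0 : ℂ × ℂ × ℂ).1, Φ 0) = 0 := Prod.ext rfl h.zero_symm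
  have h1 : AnalyticAt ℂ (fun p : ℂ × ℂ × ℂ => fderiv ℂ Λ (p.1, Φ p)) 0 :=
    h.analyticAt.fderiv.comp_of_eq hp hp0
  have h2 : AnalyticAt ℂ (fun p : ℂ × ℂ × ℂ => F.field (p.1, Φ p)) 0 :=
    (analyticAt_field F).comp_of_eq hp hp0
  exact ((ContinuousLinearMap.id ℂ (ℂ × ℂ × ℂ →L[ℂ] ℂ × ℂ)).analyticAt_bilinear _).comp
    (h1.prod (analyticAt_const.prod h2))

lemma field_realInv : ∀ᶠ p in 𝓝 0, F.field (realInv p) = planeInv (F.field p) := by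
  filter_upwards [F.reality, tendsto_realInv.eventually F.reality] with p h1 h2
  rw [GenericFamily.field, GenericFamily.field, planeInv_apply, h1, Complex.conj_conj, h2]
  refine Prod.ext ?_ rfl
  exact congrArg (fun q => conj (F.Q q)) (realInv_realInv p)

/-- The relation Λ(conj ε, conj y, conj x) = (conj Λ₂, conj Λ₁) is differentiated along real lines,
since conjugation is only real linear. -/
lemma fderiv_realInv (h : RealChart Λ Φ) : ∀ᶠ p in 𝓝 0, ∀ v,
    fderiv ℂ Λ (realInv p) (0, planeInv v) = planeInv (fderiv ℂ Λ p (0, v)) := by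
  filter_upwards [h.real.eventually_nhds, h.analyticAt.eventually_analyticAt,
    tendsto_realInv.eventually h.analyticAt.eventually_analyticAt] with p h1 h2 h3 v
  have hline : ∀ (q w : ℂ × ℂ × ℂ), HasDerivAt (fun s : ℝ => q + (s : ℂ) • w) w 0 := by
    intro q w
    have := ((Complex.ofRealCLM.hasDerivAt (x := 0)).smul_const w).const_add q
    simpa using this
  have hl0 : ∀ q w : ℂ × ℂ × ℂ, q = q + ((0 : ℝ) : ℂ) • w := by simp
  have d1 : HasDerivAt (fun s : ℝ => Λ (realInv p + (s : ℂ) • (0, planeInv v)))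
      (fderiv ℂ Λ (realInv p) (0, planeInv v)) 0 :=
    (h3.differentiableAt.hasFDerivAt.restrictScalars ℝ).comp_hasDerivAt_of_eq 0
      (hline (realInv p) (0, planeInv v)) (hl0 _ _)
  have d2 : HasDerivAt (fun s : ℝ => Λ (p + (s : ℂ) • (0, v))) (fderiv ℂ Λ p (0, v)) 0 :=
    (h2.differentiableAt.hasFDerivAt.restrictScalars ℝ).comp_hasDerivAt_of_eq 0
      (hline p (0, v)) (hl0 _ _)
  have d3 := planeInv.hasFDerivAt.comp_hasDerivAt 0 d2
  refine d1.unique (d3.congr_of_eventuallyEq ?_)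
  have ht : Tendsto (fun s : ℝ => p + (s : ℂ) • ((0 : ℂ), v)) (𝓝 0) (𝓝 p) := by
    have : Continuous (fun s : ℝ => p + (s : ℂ) • ((0 : ℂ), v)) := by fun_prop
    exact this.tendsto' _ _ (by simp)
  filter_upwards [ht.eventually h1] with s hs
  rw [Function.comp_apply, ← hs]
  congr 1
  simp [realInv_eq, planeInv_apply]

lemma pushField_realInv (h : RealChart Λ Φ) :
    ∀ᶠ p in 𝓝 0, pushField Λ Φ F (realInv p) = planeInv (pushField Λ Φ F p) := by
  filter_upwards [h.symm.real, h.tendsto_symm.eventually (field_realInv F),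
    h.tendsto_symm.eventually h.fderiv_realInv] with p h1 h2 h3
  have e : ((realInv p).1, Φ (realInv p)) = realInv (p.1, Φ p) := by
    rw [h1]
    rfl
  rw [pushField, e, h2, h3, pushField]

lemma field_line : ∀ᶠ ε : ℂ in 𝓝 0, F.field (ε, 0) = 0 := by
  have hc : Tendsto (fun ε : ℂ => conj ε) (𝓝 0) (𝓝 0) :=
    Complex.continuous_conj.tendsto' _ _ (by simp)
  filter_upwards [F.singular, hc.eventually F.singular,
    tendsto_line.eventually (tendsto_realInv.eventually F.reality)] with ε h1 h2 h3
  have h4 : F.P (conj ε, 0, 0) = conj (F.Q (ε, 0, 0)) := by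
    simpa [realInv_apply] using h3
  rw [h2, eq_comm, map_eq_zero] at h4
  exact Prod.ext h1 h4

/-- The push-forward of a family by a real change of coordinates tangent to the identity. -/
def push (h : RealChart Λ Φ) : GenericFamily where
  P p := (pushField Λ Φ F p).1
  Q p := (pushField Λ Φ F p).2
  α := F.α
  β := F.β
  analyticAt_P := (ContinuousLinearMap.fst ℂ ℂ ℂ).analyticAt _ |>.comp (h.analyticAt_pushField F)
  analyticAt_Q := (ContinuousLinearMap.snd ℂ ℂ ℂ).analyticAt _ |>.comp (h.analyticAt_pushField F)
  analyticAt_α := F.analyticAt_α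
  analyticAt_β := F.analyticAt_β
  reality := by
    filter_upwards [h.pushField_realInv F] with p hp
    change _ = conj (pushField Λ Φ F (realInv p)).2
    rw [hp, planeInv_apply, Complex.conj_conj]
  singular := by
    filter_upwards [field_line F, h.map_zero_symm] with ε h1 h2
    change (pushField Λ Φ F (ε, 0)).1 = 0
    simp only [pushField, h2, h1]
    have : ((0 : ℂ), (0 : ℂ × ℂ)) = 0 := rfl
    rw [this, _root_.map_zero]
    rfl
  linearPart := by
    have ha : AnalyticAt ℂ (fun p : ℂ × ℂ × ℂ => fderiv ℂ Λ (p.1, Φ p)) 0 :=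
      h.analyticAt.fderiv.comp_of_eq (analyticAt_pair h.analyticAt_symm) (Prod.ext rfl h.zero_symm)
    filter_upwards [F.linearPart, h.symm.hasFDerivAt, h.hasFDerivAt, field_line F, h.map_zero_symm,
      tendsto_line.eventually (analyticAt_field F).eventually_analyticAt,
      tendsto_line.eventually ha.eventually_analyticAt,
      tendsto_line.eventually h.analyticAt.eventually_analyticAt] with ε h1 h2 h3 h4 h5 h6 h7 h8
    have hf : HasFDerivAt (fun z => F.field (ε, z)) (fderiv ℂ (fun z => F.field (ε, z)) 0) 0 :=
      (differentiableAt_slice (p := (ε, (0 : ℂ × ℂ))) h6.differentiableAt).hasFDerivAt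
    have hA : DifferentiableAt ℂ (fun z => fderiv ℂ Λ (ε, Φ (ε, z))) 0 :=
      differentiableAt_slice (p := (ε, (0 : ℂ × ℂ))) h7.differentiableAt
    have hfΦ : HasFDerivAt (fun z => F.field (ε, Φ (ε, z)))
        (fderiv ℂ (fun z => F.field (ε, z)) 0 ∘L ContinuousLinearMap.id ℂ (ℂ × ℂ)) 0 :=
      HasFDerivAt.comp (g := fun z => F.field (ε, z)) (0 : ℂ × ℂ) (by rw [h5]; exact hf) h2
    have hin : HasFDerivAt (fun z => ((0 : ℂ), F.field (ε, Φ (ε, z)))) _ 0 :=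
      (hasFDerivAt_const (0 : ℂ) (0 : ℂ × ℂ)).prodMk hfΦ
    -- The field vanishes at the origin, so the derivative of the factor DΛ does not contribute; as
    -- DΛ is the identity there, α and β are unchanged.
    have hV := (hA.hasFDerivAt.clm_apply hin).fst
    refine hV.congr_fderiv (ContinuousLinearMap.ext fun v => ?_)
    have e1 : ∀ w, fderiv ℂ Λ (ε, 0) (0, w) = w := by
      intro w
      rw [← fderiv_slice h8.differentiableAt, h3.fderiv]
      rfl
    have e2 : ((0 : ℂ), (0 : ℂ × ℂ)) = 0 := rfl
    have e3 : (fderiv ℂ (fun z => F.field (ε, z)) 0 v).1 = (F.α ε + Complex.I * F.β ε) * v.1 := by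
      have h9 : HasFDerivAt (fun z => F.P (ε, z)) _ 0 := hf.fst
      exact DFunLike.congr_fun (h9.unique h1) v
    simp [h5, h4, e1, e2, e3]
  α_real := F.α_real
  β_real := F.β_real
  α_zero := F.α_zero
  β_zero := F.β_zero
  generic := F.generic

lemma field_push (h : RealChart Λ Φ) : (h.push F).field = pushField Λ Φ F := rfl

lemma realOrbitallyEquivalent_push (h : RealChart Λ Φ) :
    RealOrbitallyEquivalent F (h.push F) ∧ RealOrbitallyEquivalent (h.push F) F := by
  refine h.realOrbitallyEquivalent ?_
  filter_upwards [h.left_inv, h.analyticAt.eventually_analyticAt] with p h1 h2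
  rw [field_push, pushField, fderiv_slice h2.differentiableAt]
  simp only [h1]

end RealChart

end WeakFocus

end

/-! ### Normalization: the axes become invariant -/

noncomputable section

namespace WeakFocus

/-- Complex conjugation on `ℂ × ℂ`. -/
def conjPair : (ℂ × ℂ) ≃ₗᵢ⋆[ℂ] (ℂ × ℂ) where
  toFun p := (conj p.1, conj p.2)
  invFun p := (conj p.1, conj p.2)
  map_add' p q := by simp
  map_smul' c p := by simp
  left_inv p := by simp
  right_inv p := by simp
  norm_map' p := by
    change ‖(conj p.1, conj p.2)‖ = ‖p‖
    simp only [Prod.norm_def, RCLike.norm_conj]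

lemma conjPair_apply (p : ℂ × ℂ) : conjPair p = (conj p.1, conj p.2) := rfl

lemma tendsto_conj : Tendsto (fun ε : ℂ => conj ε) (𝓝 0) (𝓝 0) :=
  Complex.continuous_conj.tendsto' _ _ (by simp)

lemma tendsto_line₂ : Tendsto (fun ε : ℂ => (ε, (0 : ℂ))) (𝓝 0) (𝓝 0) := by
  have : Continuous (fun ε : ℂ => (ε, (0 : ℂ))) := by fun_prop
  exact this.tendsto' _ _ rfl

lemma hasDerivAt_mul_of_zero {Z : ℂ × ℂ → ℂ} (hZ : AnalyticAt ℂ Z 0)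
    (hZ0 : ∀ᶠ ε : ℂ in 𝓝 0, Z (ε, 0) = 0) :
    ∀ᶠ ε : ℂ in 𝓝 0, HasDerivAt (fun u => u * Z (ε, u)) 0 0 := by
  filter_upwards [hZ0, tendsto_line₂.eventually hZ.eventually_analyticAt] with ε h1 h2
  have h3 : HasDerivAt (fun u => Z (ε, u)) (deriv (fun u => Z (ε, u)) 0) 0 :=
    (differentiableAt_slice (p := (ε, (0 : ℂ))) h2.differentiableAt).hasDerivAt
  simpa [h1] using (hasDerivAt_id (0 : ℂ)).fun_mul h3

/-- The coordinates in which the curves `x = y Z(ε, y)` and `y = x conj Z(conj ε, conj x)` are the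
axes. -/
lemma exists_straightening {Z : ℂ × ℂ → ℂ} (hZ : AnalyticAt ℂ Z 0)
    (hZ0 : ∀ᶠ ε : ℂ in 𝓝 0, Z (ε, 0) = 0) : ∃ Λ Φ : ℂ × ℂ × ℂ → ℂ × ℂ, RealChart Λ Φ ∧
      ∀ p, (Λ p).1 = p.2.1 - p.2.2 * Z (p.1, p.2.2) := by
  let Zc : ℂ × ℂ → ℂ := fun q => conj (Z (conjPair q))
  have hZc : AnalyticAt ℂ Zc 0 := analyticAt_conj_conj hZ conjPair
  have hZc0 : ∀ᶠ ε : ℂ in 𝓝 0, Zc (ε, 0) = 0 := by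
    filter_upwards [tendsto_conj.eventually hZ0] with ε h
    simp [Zc, conjPair_apply, h]
  let Λ : ℂ × ℂ × ℂ → ℂ × ℂ := fun p =>
    (p.2.1 - p.2.2 * Z (p.1, p.2.2), p.2.2 - p.2.1 * Zc (p.1, p.2.1))
  have hΛ : AnalyticAt ℂ Λ 0 := by
    have h1 : AnalyticAt ℂ (fun p : ℂ × ℂ × ℂ => Z (p.1, p.2.2)) 0 :=
      hZ.comp_of_eq (f := fun p : ℂ × ℂ × ℂ => (p.1, p.2.2)) (by fun_prop) rfl
    have h2 : AnalyticAt ℂ (fun p : ℂ × ℂ × ℂ => Zc (p.1, p.2.1)) 0 :=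
      hZc.comp_of_eq (f := fun p : ℂ × ℂ × ℂ => (p.1, p.2.1)) (by fun_prop) rfl
    simp only [Λ]
    fun_prop
  obtain ⟨Φ, hΦ⟩ := RealChart.exists_of_hasFDerivAt hΛ (Eventually.of_forall fun ε => by simp [Λ]) (by
      filter_upwards [hasDerivAt_mul_of_zero hZ hZ0, hasDerivAt_mul_of_zero hZc hZc0] with ε h1 h2
      have h3 := HasFDerivAt.comp (g := fun u => u * Z (ε, u)) (f := fun z : ℂ × ℂ => z.2)
        (0 : ℂ × ℂ) h1.hasFDerivAt hasFDerivAt_snd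
      have h4 := HasFDerivAt.comp (g := fun u => u * Zc (ε, u)) (f := fun z : ℂ × ℂ => z.1)
        (0 : ℂ × ℂ) h2.hasFDerivAt hasFDerivAt_fst
      refine (((hasFDerivAt_fst (𝕜 := ℂ) (p := (0 : ℂ × ℂ))).sub h3).prodMk
        ((hasFDerivAt_snd (𝕜 := ℂ) (p := (0 : ℂ × ℂ))).sub h4)).congr_fderiv ?_
      ext <;> simp) (Eventually.of_forall fun p => by
      simp [Λ, Zc, realInv_apply, planeInv_apply, conjPair_apply])
  exact ⟨Λ, Φ, hΦ, fun p => rfl⟩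

namespace GenericFamily

open FolData

variable {D : FolData} {F : GenericFamily}

/-- Every family is equivalent to one for which the coordinate axes are invariant. -/
theorem Represents.exists_prepared (h : Represents D F) : ∃ F₁ : GenericFamily, F₁.β = F.β ∧
    RealOrbitallyEquivalent F F₁ ∧ RealOrbitallyEquivalent F₁ F ∧
      ∀ᶠ p : ℂ × ℂ × ℂ in 𝓝 0, F₁.P (p.1, 0, p.2.2) = 0 := by
  obtain ⟨Z, hZ, hZ0, hsep⟩ := D.exists_separatrix h.p2_eq
  obtain ⟨Λ, Φ, hc, hΛ1⟩ := exists_straightening hZ hZ0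
  refine ⟨hc.push F, rfl, (hc.realOrbitallyEquivalent_push F).1,
    (hc.realOrbitallyEquivalent_push F).2, ?_⟩
  have hpr : Tendsto (fun p : ℂ × ℂ × ℂ => (p.1, (0 : ℂ), p.2.2)) (𝓝 0) (𝓝 0) := by
    have : Continuous (fun p : ℂ × ℂ × ℂ => (p.1, (0 : ℂ), p.2.2)) := by fun_prop
    exact this.tendsto' _ _ rfl
  have h2 : Tendsto (fun p : ℂ × ℂ × ℂ => (p.1, p.2.2)) (𝓝 0) (𝓝 0) := by
    have : Continuous (fun p : ℂ × ℂ × ℂ => (p.1, p.2.2)) := by fun_prop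
    exact this.tendsto' _ _ rfl
  have ht := hc.tendsto_symm.comp hpr
  filter_upwards [hpr.eventually hc.right_inv, ht.eventually h.P_eq, ht.eventually h.Q_eq,
    (h2.comp ht).eventually hsep, ht.eventually hc.analyticAt.eventually_analyticAt,
    (h2.comp ht).eventually hZ.eventually_analyticAt] with p e1 e2 e3 e4 e5 e6
  simp only [Function.comp_apply] at e1 e2 e3 e4 e5 e6
  change (RealChart.pushField Λ Φ F (p.1, 0, p.2.2)).1 = 0
  set q := Φ (p.1, 0, p.2.2) with hq
  -- The first coordinate of Λ vanishes exactly on the invariant curve, so the preimage of a point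
  -- of {x = 0} lies on that curve; there the equation of the curve says that the field is tangent
  -- to it.
  have e7 : q.1 = q.2 * Z (p.1, q.2) := by
    have := hΛ1 (p.1, q)
    rw [e1] at this
    exact (sub_eq_zero.1 this.symm)
  rw [RealChart.pushField, ← hq]
  simp only
  rw [← fderiv_slice e5.differentiableAt]
  simp only
  have d1 : HasDerivAt (fun u => Z (p.1, u)) (deriv (fun u => Z (p.1, u)) q.2) q.2 :=
    (differentiableAt_slice (p := (p.1, q.2)) e6.differentiableAt).hasDerivAt
  have d2 := HasFDerivAt.comp (g := fun u => u * Z (p.1, u)) (f := fun z : ℂ × ℂ => z.2) q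
    ((hasDerivAt_id q.2).fun_mul d1).hasFDerivAt hasFDerivAt_snd
  have d3 := (hasFDerivAt_fst (𝕜 := ℂ) (p := q)).fun_sub d2
  have d4 : HasFDerivAt (fun z => (Λ (p.1, z)).1) _ q :=
    ((differentiableAt_slice (p := (p.1, q)) e5.differentiableAt).hasFDerivAt).fst
  have d5 := DFunLike.congr_fun (d4.unique (d3.congr_of_eventuallyEq
    (Eventually.of_forall fun z => hΛ1 (p.1, z)))) (F.field (p.1, q))
  refine Eq.trans d5 ?_
  have e8 : q = (q.2 * Z (p.1, q.2), q.2) := Prod.ext e7 rfl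
  rw [← e8] at e4
  rw [e7] at e2 e3
  simp only [field, e2, e3, sub_apply, ContinuousLinearMap.comp_apply,
    ContinuousLinearMap.coe_fst', ContinuousLinearMap.coe_snd',
    ContinuousLinearMap.toSpanSingleton_apply, smul_eq_mul, id]
  linear_combination (-q.2) * e4

/-- A family for which the coordinate axes are invariant is represented by diagonal data. -/
lemma exists_represents_diagonal (hβ : 0 < (F.β 0).re)
    (hax : ∀ᶠ p : ℂ × ℂ × ℂ in 𝓝 0, F.P (p.1, 0, p.2.2) = 0) :
    ∃ D : FolData, Represents D F ∧ (∀ p, D.p2 p = 0) ∧ (∀ p, D.q1 p = 0) := by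
  let f : (ℂ × ℂ) × ℂ → ℂ := fun q => F.P (q.1.1, q.2, q.1.2)
  have hf : AnalyticAt ℂ f 0 := F.analyticAt_P.comp_of_eq
    (f := fun q : (ℂ × ℂ) × ℂ => (q.1.1, q.2, q.1.2)) (by fun_prop) rfl
  obtain ⟨A, hA, hAeq, hA0⟩ := exists_analyticAt_hadamard hf
  let a : ℂ × ℂ × ℂ → ℂ := fun p => A ((p.1, p.2.2), p.2.1) 1
  have hσ : AnalyticAt ℂ (fun p : ℂ × ℂ × ℂ => A ((p.1, p.2.2), p.2.1)) 0 := hA.comp_of_eq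
    (f := fun p : ℂ × ℂ × ℂ => ((p.1, p.2.2), p.2.1)) (by fun_prop) rfl
  have ha : AnalyticAt ℂ a 0 := ((ContinuousLinearMap.apply ℂ ℂ (1 : ℂ)).analyticAt _).comp hσ
  have ht : Tendsto (fun p : ℂ × ℂ × ℂ => ((p.1, p.2.2), p.2.1)) (𝓝 0) (𝓝 0) := by
    have : Continuous (fun p : ℂ × ℂ × ℂ => ((p.1, p.2.2), p.2.1)) := by fun_prop
    exact this.tendsto' _ _ rfl
  have hP : ∀ᶠ p : ℂ × ℂ × ℂ in 𝓝 0, F.P p = p.2.1 * a p := by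
    filter_upwards [ht.eventually hAeq, hax] with p h1 h2
    change f ((p.1, p.2.2), p.2.1) = _
    have h3 : f ((p.1, p.2.2), 0) = 0 := h2
    rw [h1, h3, zero_add]
    have : p.2.1 = p.2.1 • (1 : ℂ) := by simp
    conv_lhs => rw [this, map_smul]
    simp [a]
  have ha0 : ∀ᶠ ε : ℂ in 𝓝 0, a (ε, 0, 0) = F.α ε + Complex.I * F.β ε := by
    have hl : Tendsto (fun ε : ℂ => ((ε, 0), (0 : ℂ))) (𝓝 0) (𝓝 (0 : (ℂ × ℂ) × ℂ)) := by
      have : Continuous (fun ε : ℂ => ((ε, (0 : ℂ)), (0 : ℂ))) := by fun_prop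
      exact this.tendsto' _ _ rfl
    filter_upwards [tendsto_line₂.eventually hA0, F.linearPart,
      hl.eventually hf.eventually_analyticAt] with ε h1 h2 h3
    have h4 : HasFDerivAt (fun x : ℂ => F.P (ε, x, 0))
        (((F.α ε + Complex.I * F.β ε) • ContinuousLinearMap.fst ℂ ℂ ℂ) ∘L .inl ℂ ℂ ℂ) 0 :=
      HasFDerivAt.comp (g := fun z : ℂ × ℂ => F.P (ε, z)) (f := fun x : ℂ => (x, (0 : ℂ))) 0 h2
        (hasFDerivAt_prodMk_left 0 0)
    have h5 : HasFDerivAt (fun x : ℂ => f ((ε, 0), x)) _ 0 :=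
      h3.differentiableAt.hasFDerivAt.comp (f := fun x : ℂ => ((ε, (0 : ℂ)), x)) 0
        (hasFDerivAt_prodMk_right _ _)
    have h6 := DFunLike.congr_fun (h5.unique h4) 1
    change A ((ε, 0), 0) 1 = _
    rw [h1]
    simpa using h6
  have ha00 : a 0 = Complex.I * ((F.β 0).re : ℂ) := by
    have := ha0.self_of_nhds
    rw [F.α_zero, zero_add] at this
    rw [← F.β_zero_eq]
    exact this
  let D : FolData :=
    { p1 := a
      p2 := fun _ => 0
      q1 := fun _ => 0
      q2 := fun p => conj (a (realInv p))
      b := (F.β 0).re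
      analyticAt_p1 := ha
      analyticAt_p2 := analyticAt_const
      analyticAt_q1 := analyticAt_const
      analyticAt_q2 := analyticAt_conj_conj ha realInv
      b_pos := hβ
      p1_zero := ha00
      p2_zero := rfl
      q1_zero := rfl
      q2_zero := by simp [ha00]
      real1 := Eventually.of_forall fun p => by
        change a p = conj (conj (a (realInv (realInv p))))
        rw [realInv_realInv, Complex.conj_conj]
      real2 := by simp }
  refine ⟨D, ⟨?_, ?_, Real.sign_of_pos hβ, ha0, Eventually.of_forall fun _ => rfl⟩,
    fun _ => rfl, fun _ => rfl⟩
  · filter_upwards [hP] with p h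
    rw [h]
    change _ = p.2.1 * a p + p.2.2 * 0
    ring
  · filter_upwards [tendsto_realInv.eventually hP, tendsto_realInv.eventually F.reality] with p h1 h2
    have h3 : F.Q p = conj (F.P (realInv p)) := by
      rw [h2, Complex.conj_conj]
      exact congrArg F.Q (realInv_realInv p).symm
    rw [h3, h1]
    change _ = p.2.1 * 0 + p.2.2 * conj (a (realInv p))
    simp [realInv_apply]

end GenericFamily

end WeakFocus

end

/-! ### Rigidity of conjugacies along lines, off the unit circle -/

noncomputable section

namespace WeakFocus

/-- The values of a multilinear map on the diagonal of a line are polynomial. -/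
lemma exists_coeff_multilinear {n : ℕ} (q : ContinuousMultilinearMap ℂ (fun _ : Fin n => ℂ × ℂ) ℂ) :
    ∃ c : ℕ → ℂ, ∀ X : ℂ, q (fun _ => (X, 1)) = ∑ a ∈ Finset.range (n + 1), c a * X ^ a := by
  let M : Finset (Fin n) → Fin n → ℂ × ℂ := fun s => s.piecewise (fun _ => (1, 0)) (fun _ => (0, 1))
  refine ⟨fun a => ∑ s : Finset (Fin n) with s.card = a, q (M s), fun X => ?_⟩
  have h1 : (fun _ : Fin n => (X, (1 : ℂ))) =
      (fun _ => X • ((1 : ℂ), (0 : ℂ))) + fun _ => ((0 : ℂ), (1 : ℂ)) := by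
    ext <;> simp
  have h2 : ∀ s : Finset (Fin n), q (s.piecewise (fun _ => X • ((1 : ℂ), (0 : ℂ)))
      (fun _ => ((0 : ℂ), (1 : ℂ)))) = q (M s) * X ^ s.card := by
    intro s
    have h3 : s.piecewise (fun _ => X • ((1 : ℂ), (0 : ℂ))) (fun _ => ((0 : ℂ), (1 : ℂ))) =
        s.piecewise (fun i => X • M s i) (M s) := by
      funext i
      by_cases hi : i ∈ s <;> simp [hi, M]
    rw [h3, q.map_piecewise_smul (fun _ => X) (M s) s, Finset.prod_const, smul_eq_mul, mul_comm]
  rw [h1, q.map_add_univ, Finset.sum_congr rfl fun s _ => h2 s,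
    ← Finset.sum_fiberwise_of_maps_to (t := Finset.range (n + 1)) (g := Finset.card)]
  · refine Finset.sum_congr rfl fun a _ => ?_
    rw [Finset.sum_mul]
    refine Finset.sum_congr rfl fun s hs => ?_
    rw [(Finset.mem_filter.1 hs).2]
  · intro s _
    rw [Finset.mem_range, Nat.lt_succ_iff]
    exact (Finset.card_le_univ s).trans_eq (Fintype.card_fin n)

/-- The Taylor coefficients along the lines through the origin are polynomials in the slope. -/
lemma exists_iteratedDeriv_line {p : ℂ × ℂ → ℂ} (hp : AnalyticAt ℂ p 0) (k : ℕ) :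
    ∃ c : ℕ → ℂ, ∀ X : ℂ, iteratedDeriv k (fun u => p (X * u, u)) 0 =
      ∑ a ∈ Finset.range (k + 1), c a * X ^ a := by
  obtain ⟨q, hq⟩ := hp
  obtain ⟨c, hc⟩ := exists_coeff_multilinear (q k)
  refine ⟨fun a => k.factorial * c a, fun X => ?_⟩
  let L : ℂ →L[ℂ] ℂ × ℂ := (X • ContinuousLinearMap.id ℂ ℂ).prod (ContinuousLinearMap.id ℂ ℂ)
  have h1 : HasFPowerSeriesAt (p ∘ L) (q.compContinuousLinearMap L) 0 :=
    HasFPowerSeriesAt.compContinuousLinearMap (by rwa [map_zero])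
  obtain ⟨r, hr⟩ := h1
  have h2 := hr.factorial_smul 1 k
  rw [← iteratedDeriv_eq_iteratedFDeriv] at h2
  have h3 : (q.compContinuousLinearMap L k fun _ => 1) = q k (fun _ => (X, 1)) := by
    simp only [FormalMultilinearSeries.compContinuousLinearMap_apply]
    congr 1
    funext i
    simp [L]
  rw [h3, hc] at h2
  have h4 : (fun u => p (X * u, u)) = p ∘ L := by
    funext u
    simp [L]
  rw [h4, ← h2, nsmul_eq_mul, Finset.mul_sum]
  exact Finset.sum_congr rfl fun a _ => (mul_assoc _ _ _).symm

lemma exists_eq_mul_of_zero {m : ℂ → ℂ} (hm : AnalyticAt ℂ m 0) (h0 : m 0 = 0) :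
    ∃ g, AnalyticAt ℂ g 0 ∧ ∀ᶠ u in 𝓝 0, m u = u * g u := by
  have h1 : ((1 : ℕ) : ℕ∞) ≤ analyticOrderAt m 0 := by
    rw [Nat.cast_one, Order.one_le_iff_ne_zero]
    exact hm.analyticOrderAt_ne_zero.2 h0
  obtain ⟨g, hg, h⟩ := (natCast_le_analyticOrderAt hm).1 h1
  refine ⟨g, hg, h.mono fun u hu => ?_⟩
  simpa using hu

section Conjugacy

variable {ι : Type*} {X : ι → ℂ} {f : ι → ℂ → ℂ} {w w' : ℂ × ℂ → ℂ} {c : ℂ}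

/-- Germs `u ↦ f i u` that conjugate the restrictions to the lines `x = X i y` of the maps
`(x, y) ↦ exp (w (x, y)) • (x, y)` and `exp (w' (x, y)) • (x, y)` with the same multiplier
off the unit circle coincide with a single germ of two variables, to every finite order. -/
lemma exists_approx (hw : AnalyticAt ℂ w 0) (hw' : AnalyticAt ℂ w' 0)
    (hexp : Complex.exp (w 0) = Complex.exp (w' 0)) (hre : (w 0).re ≠ 0)
    (hf : ∀ i, AnalyticAt ℂ (f i) 0) (hf0 : ∀ i, f i 0 = c)
    (hR : ∀ i, ∀ᶠ u in 𝓝 0, f i u * Complex.exp (w' (X i * u * f i u, u * f i u)) =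
      Complex.exp (w (X i * u, u)) * f i (u * Complex.exp (w (X i * u, u)))) (K : ℕ) :
    ∃ p : ℂ × ℂ → ℂ, AnalyticAt ℂ p 0 ∧
      ∀ i, ∃ d, AnalyticAt ℂ d 0 ∧ ∀ᶠ u in 𝓝 0, f i u = p (X i * u, u) + u ^ (K + 1) * d u := by
  induction K with
  | zero =>
    refine ⟨fun _ => c, analyticAt_const, fun i => ?_⟩
    obtain ⟨d, hd, h⟩ := exists_eq_mul_of_zero ((hf i).sub (analyticAt_const (v := c)))
      (by simp [hf0 i])
    refine ⟨d, hd, h.mono fun u hu => ?_⟩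
    simp only [Pi.sub_apply] at hu
    linear_combination hu
  | succ K ih =>
    obtain ⟨p, hp, hd⟩ := ih
    set μ := Complex.exp (w 0) with hμ
    have hμ0 : μ ≠ 0 := Complex.exp_ne_zero _
    -- Absence of resonance: |μ| ≠ 1, so no positive power of μ is 1.
    have hμK : μ ^ (K + 2) - μ ≠ 0 := by
      intro h
      have h1 : μ ^ (K + 1) = 1 := by
        refine mul_left_cancel₀ hμ0 ?_
        linear_combination h
      rw [hμ, ← Complex.exp_nat_mul] at h1
      have h2 := congrArg norm h1
      rw [Complex.norm_exp, norm_one, Real.exp_eq_one_iff] at h2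
      have h3 : (((K + 1 : ℕ) : ℂ) * w 0).re = ((K + 1 : ℕ) : ℝ) * (w 0).re := by
        rw [← Complex.ofReal_natCast, Complex.re_ofReal_mul]
      rw [h3, mul_eq_zero, or_iff_left hre] at h2
      exact absurd h2 (by positivity)
    -- The error of `p` in the conjugacy equation, computed in two variables. It is a genuine germ,
    -- so no formal series is needed.
    let E : ℂ × ℂ → ℂ := fun z => p z * Complex.exp (w' (z.1 * p z, z.2 * p z)) -
      Complex.exp (w z) * p (z.1 * Complex.exp (w z), z.2 * Complex.exp (w z))
    have hE : AnalyticAt ℂ E 0 := by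
      have h1 : AnalyticAt ℂ (fun z : ℂ × ℂ => w' (z.1 * p z, z.2 * p z)) 0 :=
        hw'.comp_of_eq (f := fun z : ℂ × ℂ => (z.1 * p z, z.2 * p z)) (by fun_prop) (by simp)
      have h2 : AnalyticAt ℂ (fun z : ℂ × ℂ => p (z.1 * Complex.exp (w z),
          z.2 * Complex.exp (w z))) 0 :=
        hp.comp_of_eq (f := fun z : ℂ × ℂ => (z.1 * Complex.exp (w z), z.2 * Complex.exp (w z)))
          (by fun_prop) (by simp)
      exact (hp.mul h1.cexp).sub (hw.cexp.mul h2)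
    -- Newton-like correction. On each line the error starts at order K + 1 with coefficient
    -- d(0)(μ^(K+2) - μ), so dividing by this factor cancels the term of order K + 1 on all lines at
    -- once.
    refine ⟨fun z => p z + (μ ^ (K + 2) - μ)⁻¹ * E z, hp.add (analyticAt_const.mul hE), fun i => ?_⟩
    obtain ⟨d, hda, hdi⟩ := hd i
    have hline : AnalyticAt ℂ (fun u : ℂ => (X i * u, u)) 0 := by fun_prop
    have hline0 : (X i * (0 : ℂ), (0 : ℂ)) = 0 := by simp
    have hpl : AnalyticAt ℂ (fun u => p (X i * u, u)) 0 := hp.comp_of_eq hline hline0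
    have hwl : AnalyticAt ℂ (fun u => w (X i * u, u)) 0 := hw.comp_of_eq hline hline0
    let g : ℂ × ℂ → ℂ := fun q => (p (X i * q.1, q.1) + q.2) *
      Complex.exp (w' (X i * q.1 * (p (X i * q.1, q.1) + q.2), q.1 * (p (X i * q.1, q.1) + q.2)))
    have hpq : AnalyticAt ℂ (fun q : ℂ × ℂ => p (X i * q.1, q.1)) 0 :=
      hp.comp_of_eq (f := fun q : ℂ × ℂ => (X i * q.1, q.1)) (by fun_prop) hline0
    have hg : AnalyticAt ℂ g 0 := by
      have hs : AnalyticAt ℂ (fun q : ℂ × ℂ => p (X i * q.1, q.1) + q.2) 0 := hpq.add analyticAt_snd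
      have h1 : AnalyticAt ℂ (fun q : ℂ × ℂ => w' (X i * q.1 * (p (X i * q.1, q.1) + q.2),
          q.1 * (p (X i * q.1, q.1) + q.2))) 0 :=
        hw'.comp_of_eq (f := fun q : ℂ × ℂ => (X i * q.1 * (p (X i * q.1, q.1) + q.2),
          q.1 * (p (X i * q.1, q.1) + q.2)))
          (((analyticAt_const.mul analyticAt_fst).mul hs).prod (analyticAt_fst.mul hs)) (by simp)
      exact (hpq.add analyticAt_snd).mul h1.cexp
    obtain ⟨G, hG, hGeq, hG0⟩ := exists_analyticAt_hadamard hg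
    have hG00 : G (0, 0) 1 = μ := by
      have h1 : HasFDerivAt (fun δ : ℂ => g (0, δ)) _ 0 :=
        hg.differentiableAt.hasFDerivAt.comp (f := fun δ : ℂ => ((0 : ℂ), δ)) 0
          (hasFDerivAt_prodMk_right _ _)
      have h2 : HasDerivAt (fun δ : ℂ => g (0, δ)) (1 * Complex.exp (w' 0)) 0 := by
        refine (((hasDerivAt_id (0 : ℂ)).const_add (p 0)).mul_const
          (Complex.exp (w' 0))).congr_of_eventuallyEq (Eventually.of_forall fun δ => ?_)
        simp [g]
        rfl
      have h3 := DFunLike.congr_fun (h1.unique h2.hasFDerivAt) 1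
      rw [hG0.self_of_nhds]
      refine h3.trans ?_
      simp [hexp]
    let δ : ℂ → ℂ := fun u => u ^ (K + 1) * d u
    have hδ : AnalyticAt ℂ δ 0 := (analyticAt_id.pow _).mul hda
    have hδ0 : δ 0 = 0 := by simp [δ]
    let Γ : ℂ → ℂ := fun u => G (u, δ u) 1
    have huδ : AnalyticAt ℂ (fun u => (u, δ u)) 0 := analyticAt_id.prod hδ
    have huδ0 : ((0 : ℂ), δ 0) = 0 := Prod.ext rfl hδ0
    have hΓ : AnalyticAt ℂ Γ 0 :=
      ((ContinuousLinearMap.apply ℂ ℂ (1 : ℂ)).analyticAt _).comp (hG.comp_of_eq huδ huδ0)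
    have hue : AnalyticAt ℂ (fun u => u * Complex.exp (w (X i * u, u))) 0 :=
      analyticAt_id.mul hwl.cexp
    have hue0 : (0 : ℂ) * Complex.exp (w (X i * 0, 0)) = 0 := zero_mul _
    -- By the exact equation for `f i`, the error on the line is -u^(K+1) k(u), with k(0) = d(0)(μ -
    -- μ^(K+2)).
    let k : ℂ → ℂ := fun u => d u * Γ u - Complex.exp (w (X i * u, u)) ^ (K + 2) *
      d (u * Complex.exp (w (X i * u, u)))
    have hk : AnalyticAt ℂ k 0 :=
      (hda.mul hΓ).sub ((hwl.cexp.pow _).mul (hda.comp_of_eq hue hue0))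
    have hk0 : k 0 = d 0 * (μ - μ ^ (K + 2)) := by
      have h1 : Γ 0 = μ := by
        rw [← hG00]
        simp only [Γ, hδ0]
      simp only [k, h1, hline0, ← hμ, zero_mul]
      ring
    obtain ⟨m, hm, hmeq⟩ := exists_eq_mul_of_zero
      (m := fun u => d u + (μ ^ (K + 2) - μ)⁻¹ * k u) (hda.add (analyticAt_const.mul hk)) (by
        rw [hk0]
        field_simp
        ring)
    refine ⟨m, hm, ?_⟩
    have hδt : Tendsto (fun u => (u, δ u)) (𝓝 0) (𝓝 0) := by
      have := huδ.continuousAt.tendsto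
      rwa [huδ0] at this
    have huet : Tendsto (fun u => u * Complex.exp (w (X i * u, u))) (𝓝 0) (𝓝 0) := by
      have := hue.continuousAt.tendsto
      rwa [hue0] at this
    filter_upwards [hdi, huet.eventually hdi, hδt.eventually hGeq, hmeq, hR i] with u h1 h2 h3 h4 h5
    have h6 : G (u, δ u) (δ u) = δ u * Γ u := by
      have : δ u = δ u • (1 : ℂ) := by simp
      conv_lhs => rw [this, map_smul]
      simp [Γ]
    have h7 : f i u * Complex.exp (w' (X i * u * f i u, u * f i u)) = g (u, δ u) := by
      simp only [g, δ, ← h1]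
    have h8 : g (u, 0) = p (X i * u, u) *
        Complex.exp (w' (X i * u * p (X i * u, u), u * p (X i * u, u))) := by
      simp only [g, add_zero]
    simp only [h6] at h3
    rw [h7, h3, h8, h2, mul_pow] at h5
    have h9 : E (X i * u, u) = -u ^ (K + 1) * k u := by
      simp only [E, k]
      rw [mul_assoc (X i) u (Complex.exp _)]
      rw [← mul_assoc (X i) u (Complex.exp _)] at h5 ⊢
      simp only [δ] at h5
      linear_combination h5
    rw [h9, h1]
    linear_combination u ^ (K + 1) * h4

/-- Up to order k the germs agree with the restrictions to lines of one germ of two variables, whose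
k-th Taylor coefficient along x = Xy is a polynomial of degree at most k in X. -/
lemma exists_iteratedDeriv_eq (hw : AnalyticAt ℂ w 0) (hw' : AnalyticAt ℂ w' 0)
    (hexp : Complex.exp (w 0) = Complex.exp (w' 0)) (hre : (w 0).re ≠ 0)
    (hf : ∀ i, AnalyticAt ℂ (f i) 0) (hf0 : ∀ i, f i 0 = c)
    (hR : ∀ i, ∀ᶠ u in 𝓝 0, f i u * Complex.exp (w' (X i * u * f i u, u * f i u)) =
      Complex.exp (w (X i * u, u)) * f i (u * Complex.exp (w (X i * u, u)))) (k : ℕ) :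
    ∃ a : ℕ → ℂ, ∀ i, iteratedDeriv k (f i) 0 = ∑ j ∈ Finset.range (k + 1), a j * X i ^ j := by
  obtain ⟨p, hp, hd⟩ := exists_approx hw hw' hexp hre hf hf0 hR k
  obtain ⟨a, ha⟩ := exists_iteratedDeriv_line hp k
  refine ⟨a, fun i => ?_⟩
  obtain ⟨d, hda, h⟩ := hd i
  have hpl : AnalyticAt ℂ (fun u => p (X i * u, u)) 0 :=
    hp.comp_of_eq (f := fun u : ℂ => (X i * u, u)) (by fun_prop) (by simp)
  have h1 : ((k + 1 : ℕ) : ℕ∞) ≤ analyticOrderAt (f i - fun u => p (X i * u, u)) 0 := by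
    refine (natCast_le_analyticOrderAt ((hf i).sub hpl)).2 ⟨d, hda, h.mono fun u hu => ?_⟩
    simp [hu]
  have h2 := (natCast_le_analyticOrderAt_iff_iteratedDeriv_eq_zero ((hf i).sub hpl)).1 h1 k
    (Nat.lt_succ_self k)
  rw [iteratedDeriv_sub (hf i).contDiffAt hpl.contDiffAt, sub_eq_zero] at h2
  rw [h2, ha]

end Conjugacy

end WeakFocus

end

/-! ### The double turn as a germ in (ε, x, y) -/

noncomputable section

namespace WeakFocus

namespace FolData

variable (D : FolData)

/-- The slope as a function of the point `(ε, x, y)`, when the axes are invariant. -/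
def rate (p : ℂ × ℂ × ℂ) : ℂ := Complex.I * D.q2 p / (D.p1 p - D.q2 p)

/-- The coordinate axes are invariant. -/
def Diagonal : Prop := (∀ p, D.p2 p = 0) ∧ ∀ p, D.q1 p = 0

variable {D}

lemma Diagonal.slope_eq (hD : D.Diagonal) (ε X u : ℂ) : D.slope ε X u = D.rate (ε, X * u, u) := by
  simp [slope, num, den, rate, hD.1, hD.2]

variable (D)

lemma p1_sub_q2_zero : D.p1 0 - D.q2 0 = 2 * (Complex.I * D.b) := by
  rw [D.p1_zero, D.q2_zero]
  ring

lemma p1_sub_q2_zero_ne : D.p1 0 - D.q2 0 ≠ 0 := by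
  rw [p1_sub_q2_zero]
  exact mul_ne_zero two_ne_zero D.I_mul_b_ne

lemma analyticAt_rate : AnalyticAt ℂ D.rate 0 :=
  (analyticAt_const.mul D.analyticAt_q2).div (D.analyticAt_p1.sub D.analyticAt_q2)
    D.p1_sub_q2_zero_ne

lemma rate_zero : D.rate 0 = -(Complex.I / 2) := by
  have hb : (D.b : ℂ) ≠ 0 := by exact_mod_cast D.b_pos.ne'
  rw [rate, p1_sub_q2_zero, D.q2_zero]
  field_simp

/-- The rotation factor `exp (4 π i t)`. -/
def turnC : C(Unit × unitInterval, ℂ) :=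
  ⟨fun k => Complex.exp (Complex.I * ((k.2 : ℝ) * (4 * Real.pi))), by fun_prop⟩

def turnArg (q : (ℂ × ℂ × ℂ) × C(Unit × unitInterval, ℂ)) :
    ℂ × C(Unit × unitInterval, ℂ) × C(Unit × unitInterval, ℂ) :=
  (q.1.1, q.1.2.1 • (turnC * expC _ q.2), q.1.2.2 • expC _ q.2)

/-- The fixed points `v` of this operator give the solutions `exp (4 π i t + v) x`, `exp v y`. -/
def turnOp (q : (ℂ × ℂ × ℂ) × C(Unit × unitInterval, ℂ)) : C(Unit × unitInterval, ℂ) :=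
  volterra Unit ((4 * Real.pi : ℂ) • sup3 _ D.rate (turnArg q))

lemma turnArg_axis (ε : ℂ) (v : C(Unit × unitInterval, ℂ)) : turnArg ((ε, 0, 0), v) = (ε, 0, 0) :=
  Prod.ext rfl (Prod.ext (zero_smul ℂ (turnC * expC _ v)) (zero_smul ℂ (expC _ v)))

lemma analyticAt_turnArg (q : (ℂ × ℂ × ℂ) × C(Unit × unitInterval, ℂ)) :
    AnalyticAt ℂ turnArg q := by
  have h1 : AnalyticAt ℂ (fun q : (ℂ × ℂ × ℂ) × C(Unit × unitInterval, ℂ) => expC _ q.2) q :=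
    AnalyticAt.comp_of_eq (f := fun q : (ℂ × ℂ × ℂ) × C(Unit × unitInterval, ℂ) => q.2)
      (analyticAt_expC (Unit × unitInterval) q.2) analyticAt_snd rfl
  unfold turnArg
  fun_prop

lemma volterra_const (z : ℂ) (t : unitInterval) :
    volterra Unit (ContinuousMap.const _ z) ((), t) = (t : ℝ) * z := by
  rw [volterra_apply]
  simp

/-- With invariant axes the slope function is `rate (ε, x, y)`, without explicit X. Following the
leaf by multiplying x by an extra exp(4πit), with x and y treated as independent, gives an exponent
w analytic at the origin of ℂ³ and not only over |x| = |y|. This is what makes the conjugacy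
equations on different lines restrictions of a single one. -/
lemma exists_doubleTurn (hD : D.Diagonal) : ∃ w : ℂ × ℂ × ℂ → ℂ, AnalyticAt ℂ w 0 ∧
    (∀ᶠ ε : ℂ in 𝓝 0, w (ε, 0, 0) = 4 * Real.pi * D.rate (ε, 0, 0)) ∧
    ∃ r > 0, ∀ ε u : ℂ, ‖ε‖ < r → ‖u‖ < r → ∀ φ ∈ Set.Icc (-(2 * Real.pi)) (2 * Real.pi), ∀ W, D.IsLeaf ε W →
      W φ = u → W (φ + 4 * Real.pi) =
        u * Complex.exp (w (ε, Complex.exp (Complex.I * φ) * u, u)) := by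
  set v₀ := volterra Unit ((4 * Real.pi : ℂ) • ContinuousMap.const _ (D.rate 0)) with hv₀
  have hT0 : ∀ v, D.turnOp (0, v) = v₀ := by
    intro v
    have h1 : turnArg (0, v) = (0, 0, 0) := turnArg_axis 0 v
    rw [turnOp, h1, sup3_zero_right]
    rfl
  have hT : AnalyticAt ℂ D.turnOp (0, v₀) := by
    have h1 : AnalyticAt ℂ (fun q => sup3 (Unit × unitInterval) D.rate (turnArg q)) (0, v₀) :=
      (analyticAt_sup3 D.analyticAt_rate).comp_of_eq (analyticAt_turnArg _) (turnArg_axis 0 v₀)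
    exact ((volterra Unit).analyticAt _).comp h1.fun_const_smul
  obtain ⟨S, hS, hS0, hfix, -⟩ := exists_analyticAt_fixedPoint hT hT0
  have hw : AnalyticAt ℂ (fun q => S q ((), 1)) 0 :=
    let ev : C(Unit × unitInterval, ℂ) →L[ℂ] ℂ := ContinuousMap.evalCLM ℂ ((), (1 : unitInterval))
    (ev.analyticAt _).comp hS
  have hax : Tendsto (fun ε : ℂ => ((ε, 0, 0) : ℂ × ℂ × ℂ)) (𝓝 0) (𝓝 0) := tendsto_line
  refine ⟨fun q => S q ((), 1), hw, ?_, ?_⟩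
  · filter_upwards [hax.eventually hfix] with ε h
    rw [← h, turnOp, turnArg_axis, sup3_zero_right]
    have : (4 * Real.pi : ℂ) • ContinuousMap.const (Unit × unitInterval) (D.rate (ε, 0, 0)) =
      ContinuousMap.const _ (4 * Real.pi * D.rate (ε, 0, 0)) := rfl
    rw [this, volterra_const]
    simp
  have harg : Tendsto (fun q => turnArg (q, S q)) (𝓝 0) (𝓝 0) := by
    have h1 : ContinuousAt (fun q => turnArg (q, S q)) 0 :=
      (analyticAt_turnArg _).continuousAt.comp_of_eq (continuousAt_id.prodMk hS.continuousAt) rfl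
    have h2 := h1.tendsto
    have h3 : turnArg (0, S 0) = 0 := turnArg_axis 0 _
    rwa [h3] at h2
  set M := ‖S 0‖ + 1 with hM
  have hbd : ∀ᶠ q in 𝓝 (0 : ℂ × ℂ × ℂ), ‖S q‖ < M :=
    hS.continuousAt.norm.eventually (gt_mem_nhds (by simp [hM]))
  obtain ⟨r, hr, hb⟩ := Metric.eventually_nhds_iff_ball.1
    (hfix.and (hbd.and (harg.eventually (eventually_sup3_apply D.analyticAt_rate))))
  refine ⟨min (min r D.rad) (D.rad * Real.exp (-M)), lt_min (lt_min hr D.rad_pos)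
    (mul_pos D.rad_pos (Real.exp_pos _)), fun ε u hε hu φ hφ W hW hWφ => ?_⟩
  have hε1 := hε.trans_le ((min_le_left _ _).trans (min_le_left _ _))
  have hε2 := hε.trans_le ((min_le_left _ _).trans (min_le_right _ _))
  have hu1 := hu.trans_le ((min_le_left _ _).trans (min_le_left _ _))
  have hu3 := hu.trans_le (min_le_right _ _)
  set X := Complex.exp (Complex.I * φ) with hX
  have hXn : ‖X‖ = 1 := mem_sphere_zero_iff_norm.1 (exp_I_mem_sphere φ)
  obtain ⟨h1, h2, h3⟩ := hb (ε, X * u, u) (by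
    rw [mem_ball_zero_iff, prod_norm_lt_iff, prod_norm_lt_iff, norm_mul, hXn, one_mul]
    exact ⟨hε1, hu1, hu1⟩)
  set v := S (ε, X * u, u) with hv
  have hφ1 : φ ∈ angles :=
    ⟨by linarith [hφ.1, Real.pi_lt_d2], by linarith [hφ.2, Real.pi_lt_d2]⟩
  -- The initial angle is at most 2π and a double turn follows; 6π < 20.
  have hφ2 : φ + 4 * Real.pi ∈ angles :=
    ⟨by linarith [hφ1.1, Real.pi_pos], by linarith [hφ.2, Real.pi_lt_d2]⟩
  have hsol : D.IsSol ε 0 1 (fun t => φ + t * (φ + 4 * Real.pi - φ)) (fun _ => φ + 4 * Real.pi - φ)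
      (fun t => u * Complex.exp (v ((), Set.projIcc 0 1 zero_le_one t))) := by
    intro t ht
    have hdv := hasDerivWithinAt_volterra ((4 * Real.pi : ℂ) • sup3 _ D.rate
      (turnArg ((ε, X * u, u), v))) () ht
    have h4 : volterra Unit ((4 * Real.pi : ℂ) • sup3 _ D.rate (turnArg ((ε, X * u, u), v))) = v := h1
    rw [h4] at hdv
    refine ⟨?_, hasDerivWithinAt_path _ _ _ _, ?_⟩
    · rw [norm_mul, Complex.norm_exp]
      have h5 : (v ((), Set.projIcc 0 1 zero_le_one t)).re ≤ M :=
        (Complex.re_le_norm _).trans ((v.norm_coe_le_norm _).trans h2.le)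
      calc ‖u‖ * Real.exp (v ((), Set.projIcc 0 1 zero_le_one t)).re
          ≤ ‖u‖ * Real.exp M := by gcongr
        _ < D.rad * Real.exp (-M) * Real.exp M := by gcongr
        _ = D.rad := by rw [mul_assoc, ← Real.exp_add]; simp
    · refine (hdv.cexp.const_mul u).congr_deriv ?_
      rw [hD.slope_eq]
      simp only [ContinuousMap.smul_apply, h3, smul_eq_mul]
      simp only [turnArg, ContinuousMap.smul_apply, ContinuousMap.mul_apply, expC_apply, smul_eq_mul]
      -- At time t the base point is exp(i(φ + 4πt)), that is, the initial slope times the rotation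
      -- factor.
      have h6 : (turnC ((), Set.projIcc 0 1 zero_le_one t)) * X =
          Complex.exp (Complex.I * ((φ + t * (φ + 4 * Real.pi - φ) : ℝ) : ℂ)) := by
        rw [turnC, hX, ContinuousMap.coe_mk, ← Complex.exp_add]
        simp only [Set.projIcc_of_mem zero_le_one ht]
        congr 1
        push_cast
        ring
      have h7 : X * u * (turnC ((), Set.projIcc 0 1 zero_le_one t) *
          Complex.exp (v ((), Set.projIcc 0 1 zero_le_one t))) =
          Complex.exp (Complex.I * ((φ + t * (φ + 4 * Real.pi - φ) : ℝ) : ℂ)) *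
          (u * Complex.exp (v ((), Set.projIcc 0 1 zero_le_one t))) := by
        rw [← h6]
        ring
      rw [h7]
      push_cast
      ring
  have h0 : (fun t : ℝ => u * Complex.exp (v ((), Set.projIcc 0 1 zero_le_one t))) 0 = W φ := by
    have h8 : v ((), 0) = 0 := by
      rw [← h1, turnOp, volterra_apply]
      simp
    have h9 : Set.projIcc (0 : ℝ) 1 zero_le_one 0 = 0 := Set.projIcc_left _
    simp only [h9, h8, Complex.exp_zero, mul_one, hWφ]
  have := hW.path_eq hε2 hφ1 hφ2 hsol h0
  have h9 : Set.projIcc (0 : ℝ) 1 zero_le_one 1 = 1 := Set.projIcc_right _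
  simp only [h9] at this
  exact this.symm

end FolData

end WeakFocus

end

/-! ### Continuation of a conjugacy along the leaves -/

noncomputable section

namespace WeakFocus

lemma ringInverse_apply {K : Type*} [TopologicalSpace K] {f : C(K, ℂ)} (hf : IsUnit f) (k : K) :
    Ring.inverse f k = (f k)⁻¹ := by
  refine eq_inv_of_mul_eq_one_left ?_
  have := congrArg (fun f : C(K, ℂ) => f k) (Ring.inverse_mul_cancel _ hf)
  simpa using this

section Transport

set_option linter.unusedSectionVars false

variable {L : Type*} [TopologicalSpace L] [CompactSpace L]

variable (L) in
/-- Evaluation at the end of the time interval. -/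
def endCLM : C(L × unitInterval, ℂ) →L[ℂ] C(L, ℂ) :=
  LinearMap.mkContinuous
    { toFun := fun f => ⟨fun l => f (l, 1), by fun_prop⟩
      map_add' := by intro p q; rfl
      map_smul' := by intro c p; rfl } 1 (by
    intro f
    rw [ContinuousMap.norm_le _ (by positivity), one_mul]
    exact fun p => f.norm_coe_le_norm _)

lemma endCLM_apply (f : C(L × unitInterval, ℂ)) (l : L) : endCLM L f l = f (l, 1) := rfl

/-- The complexification of a real function. -/
def ofRealC (φ : C(L, ℝ)) : C(L, ℂ) := ⟨fun l => φ l, by fun_prop⟩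

lemma ofRealC_apply (φ : C(L, ℝ)) (l : L) : ofRealC φ l = φ l := rfl

namespace FolData

variable (D : FolData)

/-- On the axis u = 0 the slope is constant, so the exponent is the length of the path times the
rate. This supplies the values of the continuation at u = 0. -/
lemma Diagonal.transportOp_axis {D : FolData} (hD : D.Diagonal) {ε : ℂ}
    (hε : D.p1 (ε, 0, 0) - D.q2 (ε, 0, 0) ≠ 0) (a b : C(L, ℂ)) (v : C(L × unitInterval, ℂ)) (l : L) :
    transportOp D (((ε, 0, a, b) : Param L), v) (l, 1) = b l * D.rate (ε, 0, 0) := by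
  have harg : pathArg (((ε, 0, a, b) : Param L), v) = (ε, 0, 0) := by simp [pathArg]
  have hq1 : D.q1 (ε, 0, 0) = 0 := hD.2 _
  have hp2 : D.p2 (ε, 0, 0) = 0 := hD.1 _
  have hn : numC D (((ε, 0, a, b) : Param L), v) = ContinuousMap.const _ (D.q2 (ε, 0, 0)) := by
    simp only [numC, harg, sup3_zero_right, hq1]
    ext k
    simp
  have hd : denC D (((ε, 0, a, b) : Param L), v) =
      ContinuousMap.const _ (D.p1 (ε, 0, 0) - D.q2 (ε, 0, 0)) := by
    simp only [denC, harg, sup3_zero_right, hq1, hp2]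
    ext k
    simp
  have hi : Ring.inverse (denC D (((ε, 0, a, b) : Param L), v)) =
      ContinuousMap.const _ (D.p1 (ε, 0, 0) - D.q2 (ε, 0, 0))⁻¹ := by
    ext k
    rw [ringInverse_apply (by rw [hd]; exact isUnit_const hε), hd]
    simp
  rw [transportOp, volterra_apply, hn, hi]
  simp [pullCLM_apply, rate, div_eq_mul_inv, mul_assoc]

/-- Analytic transport along the leaves between variable angles. -/
lemma exists_transportC (α β : C(L, ℝ)) (hα : ∀ l, α l ∈ angles) (hβ : ∀ l, β l ∈ angles) :
    ∃ E : ℂ × C(L, ℂ) → C(L, ℂ), AnalyticAt ℂ E 0 ∧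
      (∀ᶠ q in 𝓝 (0 : ℂ × C(L, ℂ)), ∀ l, ∀ W, D.IsLeaf q.1 W → W (α l) = q.2 l →
        W (β l) = q.2 l * E q l) ∧
      (D.Diagonal → ∀ᶠ ε : ℂ in 𝓝 0, ∀ l,
        E (ε, 0) l = Complex.exp ((β l - α l) * D.rate (ε, 0, 0))) := by
  set a := ofRealC α
  set b := ofRealC (β - α)
  obtain ⟨V, hV, hfix, hsol⟩ := exists_transport D a b
  let j : ℂ × C(L, ℂ) → Param L := fun q => (q.1, q.2, a, b)
  have hj : ∀ q, AnalyticAt ℂ j q := by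
    intro q; simp only [j]; fun_prop
  have hj0 : j 0 = (0, 0, a, b) := rfl
  have hVj : AnalyticAt ℂ (fun q => V (j q)) 0 := hV.comp_of_eq (hj _) hj0
  have hjt : Tendsto j (𝓝 0) (𝓝 (0, 0, a, b)) := (hj 0).continuousAt.tendsto
  refine ⟨fun q => expC L (endCLM L (V (j q))), ?_, ?_, ?_⟩
  · exact AnalyticAt.comp (g := expC L) (analyticAt_expC L _)
      (AnalyticAt.comp (g := endCLM L) ((endCLM L).analyticAt _) hVj)
  · have hbd : ∀ᶠ q in 𝓝 (0 : ℂ × C(L, ℂ)), ‖V (j q)‖ < ‖V (j 0)‖ + 1 :=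
      hVj.continuousAt.norm.eventually (gt_mem_nhds (by simp))
    set M := ‖V (j 0)‖ + 1 with hM
    have hsmall : ∀ᶠ q : ℂ × C(L, ℂ) in 𝓝 0, ‖q.1‖ < D.rad ∧ ‖q.2‖ * Real.exp M < D.rad := by
      have h1 : ContinuousAt (fun q : ℂ × C(L, ℂ) => ‖q.1‖) 0 := by fun_prop
      have h2 : ContinuousAt (fun q : ℂ × C(L, ℂ) => ‖q.2‖ * Real.exp M) 0 := by fun_prop
      exact (h1.eventually (gt_mem_nhds (by simpa using D.rad_pos))).and
        (h2.eventually (gt_mem_nhds (by simpa using D.rad_pos)))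
    filter_upwards [hjt.eventually hsol, hbd, hsmall] with q hq hqM hqs l W hW hWl
    obtain ⟨h0, h1⟩ := hq l
    have hw : D.IsSol q.1 0 1 (fun τ => α l + τ * (β l - α l)) (fun _ => β l - α l)
        (fun τ => q.2 l * Complex.exp (V (j q) (l, Set.projIcc 0 1 zero_le_one τ))) := by
      intro τ hτ
      refine ⟨?_, hasDerivWithinAt_path _ _ τ _, (h1 τ hτ).congr_deriv ?_⟩
      · rw [norm_mul]
        refine lt_of_le_of_lt ?_ hqs.2
        rw [Complex.norm_exp]
        gcongr
        · exact q.2.norm_coe_le_norm l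
        · exact (Complex.re_le_norm _).trans ((ContinuousMap.norm_coe_le_norm _ _).trans hqM.le)
      · simp [j, a, b, ofRealC_apply]
    have h00 : V (j q) (l, 0) = 0 := h0
    have h01 : Set.projIcc (0 : ℝ) 1 zero_le_one 0 = 0 := by simp
    have := hW.path_eq hqs.1 (hα l) (hβ l) hw (by simp only [h01, h00, Complex.exp_zero, mul_one, hWl])
    rw [← this]
    have h11 : Set.projIcc (0 : ℝ) 1 zero_le_one 1 = 1 := by simp
    simp only [h11]
    rfl
  · intro hD
    have hax : Tendsto (fun ε : ℂ => j (ε, 0)) (𝓝 0) (𝓝 (0, 0, a, b)) := by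
      have : Continuous fun ε : ℂ => j (ε, 0) := by fun_prop
      exact this.tendsto' _ _ rfl
    have hne : ∀ᶠ ε : ℂ in 𝓝 0, D.p1 (ε, 0, 0) - D.q2 (ε, 0, 0) ≠ 0 :=
      tendsto_line.eventually ((D.analyticAt_p1.sub D.analyticAt_q2).continuousAt.eventually_ne
        D.p1_sub_q2_zero_ne)
    filter_upwards [hax.eventually hfix, hne] with ε h1 h2 l
    rw [expC_apply, endCLM_apply, ← h1, hD.transportOp_axis h2]
    simp [b, ofRealC_apply]

end FolData

open FolData

/-- Continuation along the leaves of a map of the cross-section, divided by the identity. -/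
lemma exists_continuationC {D D' : FolData} (hD : D.Diagonal) (hD' : D'.Diagonal) {h : ℂ → ℂ}
    {H : ℂ × ℂ → ℂ} (hh : AnalyticAt ℂ h 0) (h0 : h 0 = 0) (hH : AnalyticAt ℂ H 0)
    (H0 : ∀ᶠ ε : ℂ in 𝓝 0, H (ε, 0) = 0) (Hd : deriv (fun x : ℂ => H (0, x)) 0 ≠ 0)
    (φ : C(L, ℝ)) (hφ : ∀ l, φ l ∈ angles) :
    ∃ N : ℂ × C(L, ℂ) → C(L, ℂ), AnalyticAt ℂ N 0 ∧
      (∀ᶠ q in 𝓝 (0 : ℂ × C(L, ℂ)), ∀ l, ∀ W W', D.IsLeaf q.1 W → W (φ l) = q.2 l →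
        D'.IsLeaf (h q.1) W' → W' 0 = H (q.1, W 0) → W' (φ l) = q.2 l * N q l) ∧
      ∃ c : ℂ → ℂ, ContinuousAt c 0 ∧ c 0 ≠ 0 ∧ ∀ᶠ ε : ℂ in 𝓝 0, ∀ l,
        N (ε, 0) l = c ε * Complex.exp (φ l * (D'.rate (h ε, 0, 0) - D.rate (ε, 0, 0))) := by
  obtain ⟨E₁, hE₁, hE₁l, hE₁0⟩ := D.exists_transportC φ 0 hφ (fun _ => zero_mem_angles)
  obtain ⟨E₂, hE₂, hE₂l, hE₂0⟩ := D'.exists_transportC 0 φ (fun _ => zero_mem_angles) hφ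
  obtain ⟨A, hA, hAeq, hA0⟩ := exists_analyticAt_hadamard hH
  -- Division by s: H(ε, s) = s η, with η(0) ≠ 0 because H is a local diffeomorphism. The third
  -- argument is a dummy, to match `sup3`.
  let η : ℂ × ℂ × ℂ → ℂ := fun p => A (p.1, p.2.1) 1
  have hη : AnalyticAt ℂ η 0 := by
    have h1 : AnalyticAt ℂ (fun p : ℂ × ℂ × ℂ => A (p.1, p.2.1)) 0 :=
      hA.comp_of_eq (f := fun p : ℂ × ℂ × ℂ => (p.1, p.2.1)) (by fun_prop) rfl
    have h2 : AnalyticAt ℂ (fun _ : ℂ × ℂ × ℂ => (1 : ℂ)) 0 := analyticAt_const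
    exact ((ContinuousLinearMap.id ℂ (ℂ →L[ℂ] ℂ)).analyticAt_bilinear _).comp (h1.prod h2)
  have hηH : ∀ᶠ p : ℂ × ℂ in 𝓝 0, H p = p.2 * η (p.1, p.2, 0) := by
    have ht : Tendsto (fun p : ℂ × ℂ => p.1) (𝓝 0) (𝓝 0) := continuous_fst.tendsto' _ _ rfl
    filter_upwards [hAeq, ht.eventually H0] with p h1 h2
    rw [h1, h2, zero_add]
    have := (A p).map_smul p.2 1
    simpa using this
  let S : ℂ × C(L, ℂ) → ℂ × C(L, ℂ) × C(L, ℂ) := fun q => (q.1, q.2 * E₁ q, 0)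
  have hS : AnalyticAt ℂ S 0 := by
    simp only [S]; fun_prop
  have hS0 : S 0 = 0 := by simp [S]
  let M : ℂ × C(L, ℂ) → C(L, ℂ) := fun q => sup3 L η (S q)
  have hM : AnalyticAt ℂ M 0 := (analyticAt_sup3 hη).comp_of_eq hS hS0
  -- Three stages: transport to the angle 0 in the first family, apply H, transport back to φ in the
  -- second family.
  let R : ℂ × C(L, ℂ) → ℂ × C(L, ℂ) := fun q => (h q.1, q.2 * E₁ q * M q)
  have hhf : AnalyticAt ℂ (fun q : ℂ × C(L, ℂ) => h q.1) 0 :=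
    hh.comp_of_eq analyticAt_fst rfl
  have hR : AnalyticAt ℂ R 0 := by
    simp only [R]; fun_prop
  have hR0 : R 0 = 0 := by simp [R, h0]
  have hSt : Tendsto S (𝓝 0) (𝓝 0) := by simpa [ContinuousAt, hS0] using hS.continuousAt
  have hRt : Tendsto R (𝓝 0) (𝓝 0) := by simpa [ContinuousAt, hR0] using hR.continuousAt
  have hER : AnalyticAt ℂ (fun q => E₂ (R q)) 0 := hE₂.comp_of_eq hR hR0
  refine ⟨fun q => E₁ q * M q * E₂ (R q), (hE₁.mul hM).mul hER, ?_, fun ε => η (ε, 0, 0), ?_, ?_, ?_⟩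
  · obtain ⟨r, hr, hb⟩ := Metric.eventually_nhds_iff_ball.1 hηH
    have hSr : ∀ᶠ q in 𝓝 (0 : ℂ × C(L, ℂ)), ‖S q‖ < r := by
      have := hS.continuousAt.norm
      exact this.eventually (gt_mem_nhds (by simpa [hS0] using hr))
    filter_upwards [hE₁l, hRt.eventually hE₂l, hSt.eventually (eventually_sup3_apply hη), hSr]
      with q h1 h2 h3 h4 l W W' hW hWl hW' hW'0
    have e1 : W 0 = q.2 l * E₁ q l := h1 l W hW hWl
    have e2 : H (q.1, W 0) = W 0 * η (q.1, W 0, 0) := by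
      refine hb (q.1, W 0) ?_
      rw [mem_ball_zero_iff, prod_norm_lt_iff]
      refine ⟨(norm_fst_le (S q)).trans_lt h4, ?_⟩
      have h5 := (norm_fst_le (S q).2).trans_lt ((norm_snd_le (S q)).trans_lt h4)
      have h6 := ((q.2 * E₁ q).norm_coe_le_norm l).trans_lt h5
      rwa [ContinuousMap.mul_apply, ← e1] at h6
    have e3 : M q l = η (q.1, W 0, 0) := by
      rw [e1]
      exact h3 l
    have := h2 l W' hW' (by
      change W' 0 = q.2 l * E₁ q l * M q l
      rw [hW'0, e2, e3, ← e1])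
    rw [this]
    change q.2 l * E₁ q l * M q l * E₂ (R q) l = q.2 l * (E₁ q l * M q l * E₂ (R q) l)
    ring
  · exact hη.continuousAt.comp_of_eq (f := fun ε : ℂ => (ε, (0 : ℂ), (0 : ℂ))) (by fun_prop) rfl
  · have h1 : A 0 = fderiv ℂ H 0 ∘L .inr ℂ ℂ ℂ := hA0.self_of_nhds
    have h2 : HasDerivAt (fun x : ℂ => H (0, x)) (A 0 1) 0 := by
      have h3 : HasDerivAt (fun x : ℂ => ((0 : ℂ), x)) ((0 : ℂ), (1 : ℂ)) 0 :=
        (hasDerivAt_const _ _).prodMk (hasDerivAt_id _)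
      have := (hH.differentiableAt.hasFDerivAt).comp_hasDerivAt_of_eq (0 : ℂ) h3 rfl
      rw [h1]
      exact this
    rw [h2.deriv] at Hd
    exact Hd
  · have hht : Tendsto h (𝓝 0) (𝓝 0) := by simpa [ContinuousAt, h0] using hh.continuousAt
    filter_upwards [hE₁0 hD, hht.eventually (hE₂0 hD')] with ε h1 h2 l
    have e1 : S (ε, 0) = (ε, 0, 0) := by simp [S]
    have e2 : R (ε, 0) = (h ε, 0) := by simp [R]
    change E₁ (ε, 0) l * sup3 L η (S (ε, 0)) l * E₂ (R (ε, 0)) l = _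
    rw [e1, e2, sup3_zero_right, h1, h2, ContinuousMap.const_apply, mul_right_comm,
      ← Complex.exp_add, mul_comm]
    congr 2
    simp
    ring

end Transport

end WeakFocus

end

noncomputable section

namespace WeakFocus

open FolData GenericFamily

set_option linter.unusedSectionVars false

lemma exists_ball_tendsto {E F : Type*} [SeminormedAddCommGroup E] [SeminormedAddCommGroup F]
    {f : E → F} (hf : Tendsto f (𝓝 0) (𝓝 0)) {ρ : ℝ} (hρ : 0 < ρ) :
    ∃ r > 0, ∀ x, ‖x‖ < r → ‖f x‖ < ρ := by
  obtain ⟨r, hr, h⟩ := Metric.eventually_nhds_iff_ball.1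
    (hf.eventually (Metric.ball_mem_nhds (0 : F) hρ))
  exact ⟨r, hr, fun x hx => mem_ball_zero_iff.1 (h x (mem_ball_zero_iff.2 hx))⟩

variable {L : Type*} [TopologicalSpace L] [CompactSpace L] {D D' : FolData} {F G : GenericFamily}
  {h : ℂ → ℂ} {H : ℂ × ℂ → ℂ} {φ : C(L, ℝ)} {N : ℂ × C(L, ℂ) → C(L, ℂ)} {w w' : ℂ × ℂ × ℂ → ℂ}

variable (L) in
/-- The constant functions. -/
def constC : ℂ →L[ℂ] C(L, ℂ) := ContinuousLinearMap.const ℂ L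

lemma norm_constC_le (z : ℂ) : ‖constC L z‖ ≤ ‖z‖ := by
  rw [ContinuousMap.norm_le _ (norm_nonneg z)]
  exact fun l => le_rfl

/-- The continuation of a conjugacy of the Poincaré maps commutes with the double turns. -/
lemma exists_continuation_relation (hF : Represents D F) (hG : Represents D' G)
    (hht : Tendsto h (𝓝 0) (𝓝 0)) (hHt : Tendsto H (𝓝 0) (𝓝 0))
    (hconj : ∀ᶠ p : ℂ × ℂ in 𝓝 0, H (p.1, F.poincareMap p) = G.poincareMap (h p.1, H p))
    (hφ : ∀ l, φ l ∈ Set.Icc (-(2 * Real.pi)) (2 * Real.pi))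
    (hN : ∀ᶠ q in 𝓝 (0 : ℂ × C(L, ℂ)), ∀ l, ∀ W W', D.IsLeaf q.1 W → W (φ l) = q.2 l →
        D'.IsLeaf (h q.1) W' → W' 0 = H (q.1, W 0) → W' (φ l) = q.2 l * N q l)
    (hw : ∃ r > 0, ∀ ε u : ℂ, ‖ε‖ < r → ‖u‖ < r → ∀ φ ∈ Set.Icc (-(2 * Real.pi)) (2 * Real.pi),
      ∀ W, D.IsLeaf ε W → W φ = u → W (φ + 4 * Real.pi) =
        u * Complex.exp (w (ε, Complex.exp (Complex.I * φ) * u, u)))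
    (hw' : ∃ r > 0, ∀ ε u : ℂ, ‖ε‖ < r → ‖u‖ < r → ∀ φ ∈ Set.Icc (-(2 * Real.pi)) (2 * Real.pi),
      ∀ W, D'.IsLeaf ε W → W φ = u → W (φ + 4 * Real.pi) =
        u * Complex.exp (w' (ε, Complex.exp (Complex.I * φ) * u, u))) :
    ∃ r > 0, ∀ ε u : ℂ, ‖ε‖ < r → ‖u‖ < r → u ≠ 0 → ∀ l,
      N (ε, constC L u) l * Complex.exp (w' (h ε,
        Complex.exp (Complex.I * φ l) * u * N (ε, constC L u) l, u * N (ε, constC L u) l)) =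
      Complex.exp (w (ε, Complex.exp (Complex.I * φ l) * u, u)) *
        N (ε, constC L (u * Complex.exp (w (ε, Complex.exp (Complex.I * φ l) * u, u)))) l := by
  obtain ⟨r₁, hr₁, C, hC, hex⟩ := D.exists_leaf
  obtain ⟨r₂, hr₂, C', hC', hex'⟩ := D'.exists_leaf
  obtain ⟨r₃, hr₃, hw⟩ := hw
  obtain ⟨r₄, hr₄, hw'⟩ := hw'
  obtain ⟨r₅, hr₅, hN⟩ := Metric.eventually_nhds_iff_ball.1 hN
  obtain ⟨r₆, hr₆, hconj⟩ := Metric.eventually_nhds_iff_ball.1 (hconj.and hF.poincareMap_eq)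
  obtain ⟨r₇, hr₇, hPG⟩ := Metric.eventually_nhds_iff_ball.1 hG.poincareMap_eq
  set ρ := min (min r₂ D'.rad) (min r₄ r₇) with hρ
  have hρ0 : 0 < ρ := lt_min (lt_min hr₂ D'.rad_pos) (lt_min hr₄ hr₇)
  have hC0 : 0 < C := zero_lt_one.trans_le hC
  have hC'0 : 0 < C' := zero_lt_one.trans_le hC'
  obtain ⟨r₈, hr₈, hh⟩ := exists_ball_tendsto hht hρ0
  obtain ⟨r₉, hr₉, hHs⟩ := exists_ball_tendsto hHt (div_pos hρ0 hC'0)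
  set σ := min (min (min r₁ D.rad) (min r₃ r₅)) (min r₆ (min r₈ r₉)) with hσ
  have hσ0 : 0 < σ := lt_min (lt_min (lt_min hr₁ D.rad_pos) (lt_min hr₃ hr₅))
    (lt_min hr₆ (lt_min hr₈ hr₉))
  refine ⟨σ / C, div_pos hσ0 hC0, fun ε u hε' hu' hu0 l => ?_⟩
  have hε : ‖ε‖ < σ := hε'.trans_le (div_le_self hσ0.le hC)
  have hCu : C * ‖u‖ < σ := by rwa [mul_comm, ← lt_div_iff₀ hC0]
  have hu : ‖u‖ < σ := hu'.trans_le (div_le_self hσ0.le hC)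
  simp only [hσ, lt_min_iff] at hε hCu hu
  obtain ⟨⟨⟨hε1, hεr⟩, hε3, hε5⟩, hε6, hε8, hε9⟩ := hε
  obtain ⟨⟨⟨hC1, hCr⟩, hC3, hC5⟩, hC6, hC8, hC9⟩ := hCu
  obtain ⟨⟨⟨hu1, hur⟩, hu3, hu5⟩, hu6, hu8, hu9⟩ := hu
  have hφl := hφ l
  have hφa : φ l ∈ angles :=
    ⟨by linarith [hφl.1, Real.pi_lt_d2], by linarith [hφl.2, Real.pi_lt_d2]⟩
  have hφ4 : φ l + 4 * Real.pi ∈ angles :=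
    ⟨by linarith [hφa.1, Real.pi_pos], by linarith [hφl.2, Real.pi_lt_d2]⟩
  have hsh : ∀ a ∈ Set.Icc (-(2 * Real.pi)) (2 * Real.pi),
      a ∈ Set.Icc (-20 : ℝ) (20 - (2 : ℕ) * (2 * Real.pi)) := by
    intro a ha
    push_cast
    exact ⟨by linarith [ha.1, Real.pi_lt_d2], by linarith [ha.2, Real.pi_lt_d2]⟩
  have h0m : (0 : ℝ) ∈ Set.Icc (-(2 * Real.pi)) (2 * Real.pi) :=
    ⟨by linarith [Real.pi_pos], by linarith [Real.pi_pos]⟩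
  have h4 : ∀ a : ℝ, a + (2 : ℕ) * (2 * Real.pi) = a + 4 * Real.pi := by
    intro a; push_cast; ring
  obtain ⟨W, hW, hWφ, hWb⟩ := hex ε u hε1 hu1 _ hφa
  have hs := hWb 0 zero_mem_angles
  have hhε := hh ε hε8
  have hHε := hHs (ε, W 0) (by rw [prod_norm_lt_iff]; exact ⟨hε9, hs.trans_lt hC9⟩)
  simp only [hρ, lt_min_iff] at hhε
  obtain ⟨⟨hh2, hhr⟩, hh4, hh7⟩ := hhε
  have hHρ : ‖H (ε, W 0)‖ < ρ := hHε.trans_le (div_le_self hρ0.le hC')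
  have hCH : C' * ‖H (ε, W 0)‖ < ρ := by rwa [mul_comm, ← lt_div_iff₀ hC'0]
  simp only [hρ, lt_min_iff] at hHρ hCH
  obtain ⟨⟨hH2, hHr⟩, hH4, hH7⟩ := hHρ
  obtain ⟨⟨hCH2, hCHr⟩, hCH4, hCH7⟩ := hCH
  obtain ⟨W', hW', hW'0, hW'b⟩ := hex' (h ε) (H (ε, W 0)) hh2 hH2 0 zero_mem_angles
  have hmem : ∀ z : ℂ, ‖z‖ < r₅ → (ε, constC L z) ∈ Metric.ball (0 : ℂ × C(L, ℂ)) r₅ := by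
    intro z hz
    rw [mem_ball_zero_iff, prod_norm_lt_iff]
    exact ⟨hε5, (norm_constC_le z).trans_lt hz⟩
  have e1 : W' (φ l) = u * N (ε, constC L u) l :=
    hN (ε, constC L u) (hmem u hu5) l W W' hW hWφ hW' hW'0
  have e2 := hw ε u hε3 hu3 _ hφl W hW hWφ
  set u₁ := u * Complex.exp (w (ε, Complex.exp (Complex.I * φ l) * u, u)) with hu₁
  have hu₁n : ‖u₁‖ ≤ C * ‖u‖ := e2 ▸ hWb _ hφ4
  obtain ⟨W₁, hW₁, hW₁φ, -⟩ := hex ε u₁ hε1 (hu₁n.trans_lt hC1) _ hφa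
  have e3 : W (4 * Real.pi) = W₁ 0 := by
    have := hW.shift hεr hW₁ 2 (hsh _ hφl) (by rw [h4, e2, hW₁φ]) (hsh _ h0m)
    rwa [h4, zero_add] at this
  have e4 : W (4 * Real.pi) = F.poincareMap (ε, W 0) :=
    (hconj (ε, W 0) (by
      rw [mem_ball_zero_iff, prod_norm_lt_iff]; exact ⟨hε6, hs.trans_lt hC6⟩)).2 W hW rfl
  have e5 : H (ε, F.poincareMap (ε, W 0)) = G.poincareMap (h ε, H (ε, W 0)) :=
    (hconj (ε, W 0) (by
      rw [mem_ball_zero_iff, prod_norm_lt_iff]; exact ⟨hε6, hs.trans_lt hC6⟩)).1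
  have e6 : W' (4 * Real.pi) = G.poincareMap (h ε, H (ε, W 0)) :=
    hPG (h ε, H (ε, W 0)) (by
      rw [mem_ball_zero_iff, prod_norm_lt_iff]; exact ⟨hh7, hH7⟩) W' hW' hW'0
  have e7 := hw' (h ε) _ hh4 ((hW'b _ hφa).trans_lt hCH4) _ hφl W' hW' rfl
  obtain ⟨W₁', hW₁', hW₁'φ, -⟩ := hex' (h ε) (W' (φ l + 4 * Real.pi)) hh2
    ((hW'b _ hφ4).trans_lt hCH2) _ hφa
  have e8 : W' (4 * Real.pi) = W₁' 0 := by
    have := hW'.shift hhr hW₁' 2 (hsh _ hφl) (by rw [h4, hW₁'φ]) (hsh _ h0m)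
    rwa [h4, zero_add] at this
  -- After the double turn, `W₁` and `W₁'` are again matched by H at the angle 0, because H
  -- conjugates the Poincaré maps; so the continuation applies to them too.
  have e9 : W₁' (φ l) = u₁ * N (ε, constC L u₁) l :=
    hN (ε, constC L u₁) (hmem u₁ (hu₁n.trans_lt hC5)) l W₁ W₁' hW₁ hW₁φ hW₁'
      (by rw [← e8, e6, ← e5, ← e4, e3])
  rw [hW₁'φ, e7, e1, hu₁] at e9
  refine mul_left_cancel₀ hu0 ?_
  rw [← mul_assoc, ← mul_assoc, mul_assoc _ u, ← e9]

/-- On the axis the rate is α/(2β) - i/2. Since α(0) = 0 and α'(0) ≠ 0, α has no other zero nearby: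
this is where genericity enters. -/
lemma rate_re {F : GenericFamily} (hF : Represents D F) :
    ∀ᶠ t : ℝ in 𝓝[≠] 0, (D.rate ((t : ℂ), 0, 0)).re ≠ 0 := by
  have ht : Tendsto (fun t : ℝ => (t : ℂ)) (𝓝 0) (𝓝 0) :=
    Complex.continuous_ofReal.tendsto' 0 0 Complex.ofReal_zero
  have hα : ∀ᶠ z : ℂ in 𝓝[≠] 0, F.α z ≠ F.α 0 :=
    F.analyticAt_α.differentiableAt.hasDerivAt.eventually_ne F.generic
  have hα' : ∀ᶠ t : ℝ in 𝓝[≠] 0, F.α t ≠ 0 := by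
    have ht' : Tendsto (fun t : ℝ => (t : ℂ)) (𝓝[≠] 0) (𝓝[≠] 0) :=
      tendsto_nhdsWithin_iff.2 ⟨ht.mono_left nhdsWithin_le_nhds, by
        filter_upwards [self_mem_nhdsWithin] with t h0
        simpa using h0⟩
    filter_upwards [ht'.eventually hα] with t h1
    rwa [F.α_zero] at h1
  have hβ : ∀ᶠ z : ℂ in 𝓝 0, F.β z ≠ 0 := F.analyticAt_β.continuousAt.eventually_ne F.β_zero
  have hr := (tendsto_line.comp ht).eventually D.real1
  filter_upwards [hα', nhdsWithin_le_nhds F.α_real, nhdsWithin_le_nhds F.β_real,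
    nhdsWithin_le_nhds (ht.eventually hβ), nhdsWithin_le_nhds hr,
    nhdsWithin_le_nhds (ht.eventually hF.p1_eq)] with t h1 h2 h3 h4 h5 h6
  replace h5 : D.p1 ((t : ℂ), 0, 0) = conj (D.q2 ((t : ℂ), 0, 0)) := by
    have h0 : conj ((0 : ℂ × ℂ).2) = (0 : ℂ) := map_zero _
    have h0' : conj ((0 : ℂ × ℂ).1) = (0 : ℂ) := map_zero _
    simp only [Function.comp_apply, Complex.conj_ofReal, h0, h0'] at h5
    exact h5
  have e1 : F.α t = ((F.α t).re : ℂ) := Complex.ext rfl (by simp [h2])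
  have e2 : F.β t = ((F.β t).re : ℂ) := Complex.ext rfl (by simp [h3])
  set a := (F.α t).re
  set b := (F.β t).re
  have ha : a ≠ 0 := fun h => h1 (by rw [e1, h, Complex.ofReal_zero])
  have hb : b ≠ 0 := fun h => h4 (by rw [e2, h, Complex.ofReal_zero])
  have h7 : D.q2 ((t : ℂ), 0, 0) = a - Complex.I * b := by
    have := congrArg conj h5
    rw [Complex.conj_conj, h6, e1, e2] at this
    rw [← this]
    simp
    ring
  have hb' : (b : ℂ) ≠ 0 := by exact_mod_cast hb
  have h8 : D.rate ((t : ℂ), 0, 0) = ((a / (2 * b) : ℝ) : ℂ) - Complex.I / 2 := by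
    rw [rate, h6, h7, e1, e2, add_sub_sub_cancel, div_eq_iff]
    · push_cast
      have h9 : (a : ℂ) / (2 * b) * (2 * b) = a := div_mul_cancel₀ _ (mul_ne_zero two_ne_zero hb')
      linear_combination (-Complex.I) * h9
    · rw [← two_mul]
      exact mul_ne_zero two_ne_zero (mul_ne_zero Complex.I_ne_zero hb')
  rw [h8, Complex.sub_re, Complex.ofReal_re]
  simp [ha, hb]

end WeakFocus

end

noncomputable section

namespace WeakFocus

open FolData GenericFamily

set_option linter.unusedSectionVars false

variable {L : Type*} [TopologicalSpace L] [CompactSpace L] {D D' : FolData} {F G : GenericFamily}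
  {h : ℂ → ℂ} {H : ℂ × ℂ → ℂ} {φ : C(L, ℝ)} {N : ℂ × C(L, ℂ) → C(L, ℂ)}

lemma eventually_analyticAt_slice {E Z V : Type*} [NormedAddCommGroup E] [NormedSpace ℂ E]
    [NormedAddCommGroup Z] [NormedSpace ℂ Z] [NormedAddCommGroup V] [NormedSpace ℂ V]
    [CompleteSpace V] {f : E × Z → V} (hf : AnalyticAt ℂ f 0) :
    ∀ᶠ e in 𝓝 (0 : E), AnalyticAt ℂ (fun z => f (e, z)) 0 := by
  have ht : Tendsto (fun e : E => (e, (0 : Z))) (𝓝 0) (𝓝 0) := by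
    have : Continuous fun e : E => (e, (0 : Z)) := by fun_prop
    exact this.tendsto' _ _ rfl
  filter_upwards [ht.eventually hf.eventually_analyticAt] with e he
  exact AnalyticAt.comp_of_eq (f := fun z : Z => (e, z)) he (by fun_prop) rfl

/-- The ambiguity in the exponent is a multiple of i/2, excluded by the bound on the distance. -/
lemma exp_rate_eq {z z' : ℂ} (h : Complex.exp (4 * Real.pi * z) = Complex.exp (4 * Real.pi * z'))
    (hz : ‖z - z'‖ < 1 / 2) : z = z' := by
  obtain ⟨n, hn⟩ := Complex.exp_eq_exp_iff_exists_int.1 h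
  have hπ : (Real.pi : ℂ) ≠ 0 := by exact_mod_cast Real.pi_ne_zero
  have h1 : z - z' = n * (Complex.I / 2) := by
    refine mul_left_cancel₀ (mul_ne_zero (by norm_num : (4 : ℂ) ≠ 0) hπ) ?_
    linear_combination hn
  rw [h1, norm_mul, norm_div, Complex.norm_I] at hz
  have h2 : |(n : ℝ)| < 1 := by
    simp only [Complex.norm_intCast, Complex.norm_ofNat] at hz
    linarith
  have h3 : n = 0 := by
    have : |n| < 1 := by exact_mod_cast h2
    exact Int.abs_lt_one_iff.1 this
  rw [h3] at h1
  simpa [sub_eq_zero] using h1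

/-- For real nonzero parameters the Taylor coefficients of the continuation are polynomials
in `exp (i φ)`. -/
lemma exists_continuation_coeff (hF : Represents D F) (hG : Represents D' G)
    (hD : D.Diagonal) (hD' : D'.Diagonal) (hh : Tendsto h (𝓝 0) (𝓝 0)) (hH : Tendsto H (𝓝 0) (𝓝 0))
    (hconj : ∀ᶠ p : ℂ × ℂ in 𝓝 0, H (p.1, F.poincareMap p) = G.poincareMap (h p.1, H p))
    (hφ : ∀ l, φ l ∈ Set.Icc (-(2 * Real.pi)) (2 * Real.pi))
    (hNa : AnalyticAt ℂ N 0)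
    (hN : ∀ᶠ q in 𝓝 (0 : ℂ × C(L, ℂ)), ∀ l, ∀ W W', D.IsLeaf q.1 W → W (φ l) = q.2 l →
        D'.IsLeaf (h q.1) W' → W' 0 = H (q.1, W 0) → W' (φ l) = q.2 l * N q l)
    {c : ℂ → ℂ} (hc : ContinuousAt c 0) (hc0 : c 0 ≠ 0)
    (hNc : ∀ᶠ ε : ℂ in 𝓝 0, ∀ l,
        N (ε, 0) l = c ε * Complex.exp (φ l * (D'.rate (h ε, 0, 0) - D.rate (ε, 0, 0)))) :
    ∀ᶠ t : ℝ in 𝓝[≠] 0, ∀ k, ∃ a : ℕ → ℂ, ∀ l : L,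
      iteratedDeriv k (fun u => N ((t : ℂ), constC L u) l) 0 =
        ∑ j ∈ Finset.range (k + 1), a j * Complex.exp (Complex.I * φ l) ^ j := by
  obtain ⟨w, hw, hw0, hwl⟩ := FolData.exists_doubleTurn D hD
  obtain ⟨w', hw', hw'0, hw'l⟩ := FolData.exists_doubleTurn D' hD'
  obtain ⟨r, hr, hrel⟩ := exists_continuation_relation hF hG hh hH hconj hφ hN hwl hw'l
  have ht : Tendsto (fun t : ℝ => (t : ℂ)) (𝓝 0) (𝓝 0) :=
    Complex.continuous_ofReal.tendsto' 0 0 Complex.ofReal_zero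
  -- Both rates tend to -i/2, whatever b and b' are.
  have hrate : ∀ᶠ ε : ℂ in 𝓝 0, ‖D.rate (ε, 0, 0) - D'.rate (h ε, 0, 0)‖ < 1 / 2 := by
    have h1 : Tendsto (fun ε : ℂ => D.rate (ε, 0, 0)) (𝓝 0) (𝓝 (-(Complex.I / 2))) := by
      rw [← D.rate_zero]
      exact D.analyticAt_rate.continuousAt.tendsto.comp tendsto_line
    have h2 : Tendsto (fun ε : ℂ => D'.rate (h ε, 0, 0)) (𝓝 0) (𝓝 (-(Complex.I / 2))) := by
      rw [← D'.rate_zero]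
      exact D'.analyticAt_rate.continuousAt.tendsto.comp (tendsto_line.comp hh)
    have h3 := (h1.sub h2).norm
    rw [sub_self, norm_zero] at h3
    exact h3.eventually (gt_mem_nhds (by norm_num))
  have hNs : AnalyticAt ℂ (fun p : ℂ × ℂ => N (p.1, constC L p.2)) 0 :=
    hNa.comp_of_eq (f := fun p : ℂ × ℂ => (p.1, constC L p.2))
      (analyticAt_fst.prod (((constC L).analyticAt _).comp_of_eq analyticAt_snd rfl)) (by simp)
  have hsm : ∀ᶠ ε : ℂ in 𝓝 0, ‖ε‖ < r := by
    filter_upwards [Metric.ball_mem_nhds (0 : ℂ) hr] with ε hε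
    simpa using hε
  have key := (eventually_analyticAt_slice hNs).and ((eventually_analyticAt_slice hw).and
    ((hh.eventually (eventually_analyticAt_slice hw')).and (hsm.and (hrate.and (hNc.and
    ((hc.eventually_ne hc0).and (hw0.and (hh.eventually hw'0))))))))
  filter_upwards [rate_re hF, nhdsWithin_le_nhds (ht.eventually key)] with t h1 h2 k
  obtain ⟨hNt, hwt, hw't, htr, hrt, hN0, hct, hw0, hw'0⟩ := h2
  have hf : ∀ l, AnalyticAt ℂ (fun u => N ((t : ℂ), constC L u) l) 0 := by
    intro l
    let ev : C(L, ℂ) →L[ℂ] ℂ := ContinuousMap.evalCLM ℂ l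
    exact AnalyticAt.comp (g := ev) (ev.analyticAt _) hNt
  have e0 : constC L 0 = 0 := map_zero _
  have hR : ∀ l, ∀ᶠ u in 𝓝[≠] (0 : ℂ), N ((t : ℂ), constC L u) l * Complex.exp (w' (h t,
        Complex.exp (Complex.I * φ l) * u * N ((t : ℂ), constC L u) l,
        u * N ((t : ℂ), constC L u) l)) =
      Complex.exp (w ((t : ℂ), Complex.exp (Complex.I * φ l) * u, u)) *
        N ((t : ℂ), constC L (u * Complex.exp (w ((t : ℂ), Complex.exp (Complex.I * φ l) * u, u)))) l := by
    intro l
    filter_upwards [self_mem_nhdsWithin, nhdsWithin_le_nhds (Metric.ball_mem_nhds (0 : ℂ) hr)]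
      with u hu hur
    exact hrel t u htr (by simpa using hur) hu l
  have hl : ∀ l, AnalyticAt ℂ (fun u => w ((t : ℂ), Complex.exp (Complex.I * φ l) * u, u)) 0 := by
    intro l
    exact hwt.comp_of_eq (f := fun u : ℂ => (Complex.exp (Complex.I * φ l) * u, u))
      (by fun_prop) (by simp)
  have hR' : ∀ l, ∀ᶠ u in 𝓝 (0 : ℂ), N ((t : ℂ), constC L u) l * Complex.exp (w' (h t,
        Complex.exp (Complex.I * φ l) * u * N ((t : ℂ), constC L u) l,
        u * N ((t : ℂ), constC L u) l)) =
      Complex.exp (w ((t : ℂ), Complex.exp (Complex.I * φ l) * u, u)) *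
        N ((t : ℂ), constC L (u * Complex.exp (w ((t : ℂ), Complex.exp (Complex.I * φ l) * u, u)))) l := by
    intro l
    have hfl := hf l
    have hwl := hl l
    have a1 : AnalyticAt ℂ (fun u => Complex.exp (w' (h t,
        Complex.exp (Complex.I * φ l) * u * N ((t : ℂ), constC L u) l,
        u * N ((t : ℂ), constC L u) l))) 0 :=
      (hw't.comp_of_eq (f := fun u : ℂ => (Complex.exp (Complex.I * φ l) * u *
        N ((t : ℂ), constC L u) l, u * N ((t : ℂ), constC L u) l))
        (((analyticAt_const.mul analyticAt_id).mul hfl).prod (analyticAt_id.mul hfl)) (by simp)).cexp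
    have a2 : AnalyticAt ℂ (fun u => N ((t : ℂ), constC L (u *
        Complex.exp (w ((t : ℂ), Complex.exp (Complex.I * φ l) * u, u)))) l) 0 :=
      hfl.comp_of_eq (f := fun u : ℂ => u *
        Complex.exp (w ((t : ℂ), Complex.exp (Complex.I * φ l) * u, u)))
        (analyticAt_id.mul hwl.cexp) (by simp)
    -- The relation was obtained by dividing by u, so it is known only for u ≠ 0; analyticity
    -- extends it to u = 0.
    exact ((hfl.mul a1).frequently_eq_iff_eventually_eq (hwl.cexp.mul a2)).1 (hR l).frequently
  -- At u = 0 the relation compares the multipliers of the two double turns, the common factor N(t,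
  -- 0) being nonzero.
  have hexp : ∀ l : L, Complex.exp (w ((t : ℂ), 0)) = Complex.exp (w' (h t, 0)) := by
    intro l
    have h3 := (hR' l).self_of_nhds
    simp only [mul_zero, zero_mul, e0] at h3
    rw [mul_comm] at h3
    refine (mul_right_cancel₀ ?_ h3).symm
    rw [hN0]
    exact mul_ne_zero hct (Complex.exp_ne_zero _)
  rcases isEmpty_or_nonempty L with hL | ⟨⟨l₀⟩⟩
  · exact ⟨0, fun l => isEmptyElim l⟩
  have hexp0 := hexp l₀
  have e1 : w ((t : ℂ), 0) = 4 * Real.pi * D.rate (t, 0, 0) := hw0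
  have e2 : w' (h t, 0) = 4 * Real.pi * D'.rate (h t, 0, 0) := hw'0
  -- Equal rates make the value of the continuation at u = 0 independent of the angle, as the
  -- rigidity statement requires.
  have hreq : D.rate (t, 0, 0) = D'.rate (h t, 0, 0) := by
    refine exp_rate_eq ?_ hrt
    rw [← e1, ← e2, hexp0]
  refine exists_iteratedDeriv_eq (w := fun z => w ((t : ℂ), z)) (w' := fun z => w' (h t, z))
    (c := c t) hwt hw't hexp0 ?_ hf (fun l => ?_) hR' k
  · rw [e1, show (4 * Real.pi : ℂ) = ((4 * Real.pi : ℝ) : ℂ) by push_cast; rfl, Complex.re_ofReal_mul]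
    exact mul_ne_zero (mul_ne_zero four_ne_zero Real.pi_ne_zero) h1
  · rw [e0, hN0, hreq]
    simp

end WeakFocus

end

/-! ### Cauchy formula on the torus over the equator -/

noncomputable section

namespace WeakFocus

open MeasureTheory

lemma integral_unitInterval (f : ℝ → ℂ) : ∫ t : unitInterval, f t = ∫ t in (0 : ℝ)..1, f t := by
  rw [intervalIntegral.integral_of_le zero_le_one, ← integral_Icc_eq_integral_Ioc,
    unitInterval.volume_def]
  exact integral_subtype_comap measurableSet_Icc f

/-- The Cauchy formula for monomials on the unit circle. -/
lemma integral_pow_div {ξ : ℂ} (hξ : ‖ξ‖ < 1) (j : ℕ) :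
    ∫ t : unitInterval, Complex.exp (Complex.I * (2 * Real.pi * (t : ℝ))) ^ j *
      (1 - ξ * Complex.exp (-(Complex.I * (2 * Real.pi * (t : ℝ)))))⁻¹ = ξ ^ j := by
  rw [integral_unitInterval fun t => Complex.exp (Complex.I * (2 * Real.pi * t)) ^ j *
      (1 - ξ * Complex.exp (-(Complex.I * (2 * Real.pi * t))))⁻¹]
  have hd : DiffContOnCl ℂ (fun z : ℂ => z ^ j) (Metric.ball 0 1) :=
    (Differentiable.pow differentiable_id j).diffContOnCl
  have h1 := hd.circleIntegral_sub_inv_smul (mem_ball_zero_iff.2 hξ)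
  have h2 : (∮ z in C(0, 1), (z - ξ)⁻¹ • z ^ j) = 2 * Real.pi * Complex.I *
      ∫ t in (0 : ℝ)..1, Complex.exp (Complex.I * (2 * Real.pi * t)) ^ j *
        (1 - ξ * Complex.exp (-(Complex.I * (2 * Real.pi * t))))⁻¹ := by
    have h3 := intervalIntegral.smul_integral_comp_mul_left (a := 0) (b := 1)
      (fun θ : ℝ => (deriv (circleMap 0 1) θ • ((circleMap 0 1 θ - ξ)⁻¹ • circleMap 0 1 θ ^ j) : ℂ))
      (2 * Real.pi)
    rw [mul_zero, mul_one] at h3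
    rw [circleIntegral, ← h3, Complex.real_smul, mul_assoc, Complex.ofReal_mul, Complex.ofReal_ofNat]
    congr 1
    rw [← intervalIntegral.integral_const_mul]
    refine intervalIntegral.integral_congr fun t _ => ?_
    simp only [deriv_circleMap, circleMap_zero, smul_eq_mul]
    have h4 : Complex.exp (Complex.I * (2 * Real.pi * t)) = Complex.exp ((2 * Real.pi * t : ℝ) * Complex.I) := by
      congr 1; push_cast; ring
    rw [Complex.exp_neg, h4]
    set z := Complex.exp ((2 * Real.pi * t : ℝ) * Complex.I) with hz
    have hz0 : z ≠ 0 := Complex.exp_ne_zero _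
    have hz1 : ‖z‖ = 1 := Complex.norm_exp_ofReal_mul_I _
    have h5 : z - ξ ≠ 0 := by
      intro h
      rw [sub_eq_zero] at h
      rw [← h, hz1] at hξ
      exact lt_irrefl _ hξ
    have h6 : 1 - ξ * z⁻¹ = (z - ξ) * z⁻¹ := by field_simp
    rw [h6, mul_inv, inv_inv]
    simp
    ring
  rw [h2] at h1
  exact mul_left_cancel₀ Complex.two_pi_I_ne_zero h1

/-- The parameter space of the distinguished boundary of a bidisk. -/
abbrev Torus : Type := unitInterval × unitInterval

/-- The mean value over the torus. -/
def torusMean : C(Torus, ℂ) →L[ℂ] ℂ :=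
  LinearMap.mkContinuous
    { toFun := fun f => ∫ l, f l
      map_add' := fun f g => integral_add
        (f.continuous.integrable_of_hasCompactSupport (HasCompactSupport.of_compactSpace _))
        (g.continuous.integrable_of_hasCompactSupport (HasCompactSupport.of_compactSpace _))
      map_smul' := fun c f => integral_smul c _ } 1 (by
    intro f
    have := norm_integral_le_of_norm_le_const (μ := (volume : Measure Torus)) (f := f) (C := ‖f‖)
      (ae_of_all _ fun l => f.norm_coe_le_norm l)
    simpa [mul_comm] using this)

lemma torusMean_apply (f : C(Torus, ℂ)) : torusMean f = ∫ l, f l := rfl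

/-- The coordinates `exp (2 π i t)` of the torus. -/
def torusX : C(Torus, ℂ) :=
  ⟨fun l => Complex.exp (Complex.I * (2 * Real.pi * (l.1 : ℝ))), by fun_prop⟩

def torusY : C(Torus, ℂ) :=
  ⟨fun l => Complex.exp (Complex.I * (2 * Real.pi * (l.2 : ℝ))), by fun_prop⟩

def torusXInv : C(Torus, ℂ) :=
  ⟨fun l => Complex.exp (-(Complex.I * (2 * Real.pi * (l.1 : ℝ)))), by fun_prop⟩

def torusYInv : C(Torus, ℂ) :=
  ⟨fun l => Complex.exp (-(Complex.I * (2 * Real.pi * (l.2 : ℝ)))), by fun_prop⟩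

/-- The Cauchy kernel of the unit bidisk. -/
def cauchyKernel (z : ℂ × ℂ) : C(Torus, ℂ) :=
  Ring.inverse (1 - z.1 • torusXInv) * Ring.inverse (1 - z.2 • torusYInv)

lemma analyticAt_cauchyKernel : AnalyticAt ℂ cauchyKernel 0 := by
  have h : ∀ (f : C(Torus, ℂ)) (g : ℂ × ℂ → ℂ), AnalyticAt ℂ g 0 → g 0 = 0 →
      AnalyticAt ℂ (fun z => Ring.inverse (1 - g z • f)) 0 := by
    intro f g hg hg0
    refine (analyticAt_inverse (𝕜 := ℂ) (1 : C(Torus, ℂ)ˣ)).comp_of_eq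
      (f := fun z => 1 - g z • f) (by fun_prop) ?_
    rw [hg0, zero_smul ℂ f, sub_zero, Units.val_one]
  exact (h _ _ analyticAt_fst rfl).mul (h _ _ analyticAt_snd rfl)

lemma norm_torusXInv_le : ‖torusXInv‖ ≤ 1 := by
  rw [ContinuousMap.norm_le _ zero_le_one]
  intro l
  simp [torusXInv, Complex.norm_exp]

lemma norm_torusYInv_le : ‖torusYInv‖ ≤ 1 := by
  rw [ContinuousMap.norm_le _ zero_le_one]
  intro l
  simp [torusYInv, Complex.norm_exp]

lemma isUnit_one_sub_smul {f : C(Torus, ℂ)} (hf : ‖f‖ ≤ 1) {z : ℂ} (hz : ‖z‖ < 1) :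
    IsUnit (1 - z • f) := by
  refine isUnit_one_sub_of_norm_lt_one ?_
  rw [norm_smul]
  calc ‖z‖ * ‖f‖ ≤ ‖z‖ * 1 := by gcongr
    _ < 1 := by rwa [mul_one]

lemma torusMean_cauchyKernel {z : ℂ × ℂ} (h1 : ‖z.1‖ < 1) (h2 : ‖z.2‖ < 1) (j k : ℕ) :
    torusMean (torusX ^ j * torusY ^ k * cauchyKernel z) = z.1 ^ j * z.2 ^ k := by
  rw [torusMean_apply, ← integral_pow_div h1 j, ← integral_pow_div h2 k, ← integral_prod_mul]
  refine integral_congr_ae (ae_of_all _ fun l => ?_)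
  simp only [cauchyKernel, ContinuousMap.mul_apply, ContinuousMap.pow_apply,
    ringInverse_apply (isUnit_one_sub_smul norm_torusXInv_le h1),
    ringInverse_apply (isUnit_one_sub_smul norm_torusYInv_le h2)]
  simp only [torusX, torusY, torusXInv, torusYInv, ContinuousMap.coe_mk, ContinuousMap.sub_apply,
    ContinuousMap.smul_apply, ContinuousMap.one_apply, smul_eq_mul]
  ring

end WeakFocus

end

noncomputable section

namespace WeakFocus

lemma iteratedDeriv_clm {V : Type*} [NormedAddCommGroup V] [NormedSpace ℂ V] [CompleteSpace V]
    (e : V →L[ℂ] ℂ) {A : ℂ → V} {z : ℂ} (hA : AnalyticAt ℂ A z) (k : ℕ) :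
    iteratedDeriv k (fun u => e (A u)) z = e (iteratedDeriv k A z) := by
  rw [iteratedDeriv_eq_iteratedFDeriv, iteratedDeriv_eq_iteratedFDeriv]
  have := e.iteratedFDeriv_comp_left (f := A) (x := z) (n := k) (hA.contDiffAt) le_rfl
  change iteratedFDeriv ℂ k (e ∘ A) z _ = _
  rw [this]
  rfl

/-- Multiplication by the powers of a function of small norm preserves the convergence of a
Taylor series. -/
lemma summable_pow_mul {V : Type*} [NormedRing V] [NormedAlgebra ℂ V] [CompleteSpace V]
    {m : ℕ → V} {s : V} {ρ : ℝ} (hρ : 0 < ρ) (hm : Summable fun k => ((ρ : ℂ) ^ k) • m k)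
    (hs : ‖s‖ < ρ) : Summable fun k => s ^ k * m k := by
  obtain ⟨B, hB⟩ := (Metric.isBounded_range_of_tendsto _ hm.tendsto_atTop_zero).exists_norm_le
  have hq : ‖s‖ / ρ < 1 := (div_lt_one hρ).2 hs
  have hq0 : 0 ≤ ‖s‖ / ρ := by positivity
  refine Summable.of_norm_bounded_eventually_nat
    (g := fun k => B * (‖s‖ / ρ) ^ k) ((summable_geometric_of_lt_one hq0 hq).mul_left B) ?_
  filter_upwards [eventually_gt_atTop 0] with k hk
  have h1 : ρ ^ k * ‖m k‖ ≤ B := by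
    have := hB _ ⟨k, rfl⟩
    simp only at this
    rwa [norm_smul, norm_pow, Complex.norm_real, Real.norm_eq_abs, abs_of_pos hρ] at this
  calc ‖s ^ k * m k‖ ≤ ‖s‖ ^ k * ‖m k‖ :=
        (norm_mul_le _ _).trans (by gcongr; exact norm_pow_le' s hk)
    _ = (ρ ^ k * ‖m k‖) * (‖s‖ / ρ) ^ k := by
        rw [div_pow]
        field_simp
    _ ≤ B * (‖s‖ / ρ) ^ k := by gcongr

/-- The angle on the blown-up torus. -/
def torusAngle : C(Torus, ℝ) :=
  ⟨fun l => 2 * Real.pi * ((l.1 : ℝ) - (l.2 : ℝ)), by fun_prop⟩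

/-- The points of the torus |x| = |y| = r have slope x/y of modulus one, so the distinguished
boundary of the bidisk lies entirely over the equator, where the continuation is defined. The angle
ranges over [-2π, 2π], so the same slope occurs at different angles. -/
lemma exp_torusAngle (l : Torus) :
    Complex.exp (Complex.I * torusAngle l) * torusY l = torusX l := by
  rw [torusY, torusX, ContinuousMap.coe_mk, ContinuousMap.coe_mk, ← Complex.exp_add]
  congr 1
  simp [torusAngle]
  ring

lemma norm_torusY (l : Torus) : ‖torusY l‖ = 1 := by
  simp [torusY, Complex.norm_exp]

lemma norm_torusY_le : ‖torusY‖ ≤ 1 := by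
  rw [ContinuousMap.norm_le _ zero_le_one]
  exact fun l => (norm_torusY l).le

/-- A family of germs on the lines through the origin whose Taylor coefficients are polynomials is
the restriction of a germ of two variables, given by the Cauchy formula. -/
lemma torusMean_eq {r ρ : ℝ} (hr : 0 < r) (hrρ : r < ρ) {A : ℂ → C(Torus, ℂ)} {M : C(Torus, ℂ)}
    (hA : DifferentiableOn ℂ A (Metric.ball 0 (2 * ρ)))
    (hM : ∀ l, M l = A (r * torusY l) l)
    (hcoef : ∀ k, ∃ a : ℕ → ℂ, ∀ l, iteratedDeriv k (fun u => A u l) 0 =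
      ∑ j ∈ Finset.range (k + 1), a j * Complex.exp (Complex.I * torusAngle l) ^ j)
    {u : ℂ} (hu : ‖u‖ < r) (l : Torus) :
    torusMean (M * cauchyKernel (Complex.exp (Complex.I * torusAngle l) * u / r, u / r)) = A u l := by
  have hρ : 0 < ρ := hr.trans hrρ
  set m : ℕ → C(Torus, ℂ) := fun k => (k.factorial : ℂ)⁻¹ • iteratedDeriv k A 0 with hm
  have hsum : ∀ z : ℂ, ‖z‖ < 2 * ρ → HasSum (fun k => z ^ k • m k) (A z) := by
    intro z hz
    have := Complex.hasSum_taylorSeries_on_ball hA (mem_ball_zero_iff.2 hz)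
    refine this.congr_fun ?_
    intro k
    simp only [hm, sub_zero]
    rw [smul_comm]
  have hA0 : AnalyticAt ℂ A 0 := hA.analyticAt (Metric.ball_mem_nhds _ (by linarith))
  have hml : ∀ k, ∃ a : ℕ → ℂ, ∀ l, m k l =
      ∑ j ∈ Finset.range (k + 1), a j * Complex.exp (Complex.I * torusAngle l) ^ j := by
    intro k
    obtain ⟨a, ha⟩ := hcoef k
    refine ⟨fun j => (k.factorial : ℂ)⁻¹ * a j, fun l => ?_⟩
    let ev : C(Torus, ℂ) →L[ℂ] ℂ := ContinuousMap.evalCLM ℂ l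
    have h1 : ev (iteratedDeriv k A 0) = _ := (iteratedDeriv_clm ev hA0 k).symm.trans (ha l)
    change (k.factorial : ℂ)⁻¹ * ev (iteratedDeriv k A 0) = _
    rw [h1, Finset.mul_sum]
    exact Finset.sum_congr rfl fun j _ => (mul_assoc _ _ _).symm
  choose a ha using hml
  have hrY : ‖(r : ℂ) • torusY‖ < ρ := by
    rw [norm_smul, Complex.norm_real, Real.norm_eq_abs, abs_of_pos hr]
    calc r * ‖torusY‖ ≤ r * 1 := by gcongr; exact norm_torusY_le
      _ < ρ := by rwa [mul_one]
  -- Substituting the function r · torusY for u: the series converges in sup norm since r < ρ,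
  -- strictly inside the disc of analyticity.
  have hs1 : Summable fun k => ((r : ℂ) • torusY) ^ k * m k := by
    refine summable_pow_mul hρ (hsum ρ ?_).summable hrY
    rw [Complex.norm_real, Real.norm_eq_abs, abs_of_pos hρ]
    linarith
  have hs2 : HasSum (fun k => ((r : ℂ) • torusY) ^ k * m k) M := by
    convert hs1.hasSum
    ext l'
    have h1 := (ContinuousMap.evalCLM ℂ l' : C(Torus, ℂ) →L[ℂ] ℂ).hasSum hs1.hasSum
    have h2 := (ContinuousMap.evalCLM ℂ l' : C(Torus, ℂ) →L[ℂ] ℂ).hasSum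
      (hsum (r * torusY l') (by
        rw [norm_mul, norm_torusY, mul_one, Complex.norm_real, Real.norm_eq_abs, abs_of_pos hr]
        linarith))
    rw [hM]
    exact h2.unique h1
  set X := Complex.exp (Complex.I * torusAngle l) with hX
  have hXn : ‖X‖ = 1 := mem_sphere_zero_iff_norm.1 (FolData.exp_I_mem_sphere _)
  set K := cauchyKernel (X * u / r, u / r) with hK
  have h3 := torusMean.hasSum (hs2.mul_right K)
  have h4 := (ContinuousMap.evalCLM ℂ l : C(Torus, ℂ) →L[ℂ] ℂ).hasSum
      (hsum u (hu.trans (by linarith)))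
  refine h3.unique ?_
  convert h4 using 2 with k
  swap
  · rfl
  change torusMean (((r : ℂ) • torusY) ^ k * m k * K) = u ^ k * m k l
  have hr0 : (r : ℂ) ≠ 0 := by exact_mod_cast hr.ne'
  -- On the torus X^j y^k = x^j y^(k-j). The degree bound j ≤ k makes both exponents nonnegative, so
  -- the Cauchy kernel reproduces each monomial.
  have h5 : ((r : ℂ) • torusY) ^ k * m k * K = ∑ j ∈ Finset.range (k + 1),
      (r ^ k * a k j) • (torusX ^ j * torusY ^ (k - j) * K) := by
    ext l'
    simp only [ContinuousMap.mul_apply, ContinuousMap.pow_apply, ContinuousMap.smul_apply,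
      ContinuousMap.sum_apply, ha, smul_eq_mul, Finset.mul_sum, Finset.sum_mul]
    refine Finset.sum_congr rfl fun j hj => ?_
    have hjk : j ≤ k := Nat.lt_succ_iff.1 (Finset.mem_range.1 hj)
    rw [← exp_torusAngle, mul_pow, mul_pow]
    have : torusY l' ^ k = torusY l' ^ j * torusY l' ^ (k - j) := by
      rw [← pow_add, Nat.add_sub_cancel' hjk]
    rw [this]
    ring
  have hu1 : ‖u / r‖ < 1 := by
    rw [norm_div, Complex.norm_real, Real.norm_eq_abs, abs_of_pos hr, div_lt_one hr]
    exact hu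
  have hu2 : ‖X * u / r‖ < 1 := by
    rw [mul_div_assoc, norm_mul, hXn, one_mul]
    exact hu1
  rw [h5, map_sum, ha, ← hX, Finset.mul_sum]
  refine Finset.sum_congr rfl fun j hj => ?_
  have hjk : j ≤ k := Nat.lt_succ_iff.1 (Finset.mem_range.1 hj)
  rw [map_smul, hK, torusMean_cauchyKernel hu2 hu1]
  have h6 : ∀ z : ℂ, z ^ k = z ^ j * z ^ (k - j) := by
    intro z
    rw [← pow_add, Nat.add_sub_cancel' hjk]
  rw [h6 u, h6 (r : ℂ), smul_eq_mul, div_pow, div_pow, mul_pow]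
  field_simp

/-- A holomorphic family of germs on the lines through the origin whose Taylor coefficients are
polynomials for real values of the parameter is given by a germ of three variables. -/
lemma exists_cauchy {N : ℂ × C(Torus, ℂ) → C(Torus, ℂ)} (hN : AnalyticAt ℂ N 0)
    (hcons : ∀ᶠ q in 𝓝 (0 : ℂ × C(Torus, ℂ)), ∀ l, q.2 l ≠ 0 → N q l = N (q.1, constC Torus (q.2 l)) l)
    (hcoef : ∀ᶠ t : ℝ in 𝓝[≠] 0, ∀ k, ∃ a : ℕ → ℂ, ∀ l,
      iteratedDeriv k (fun u => N ((t : ℂ), constC Torus u) l) 0 =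
        ∑ j ∈ Finset.range (k + 1), a j * Complex.exp (Complex.I * torusAngle l) ^ j) :
    ∃ n : ℂ × ℂ × ℂ → ℂ, AnalyticAt ℂ n 0 ∧ ∃ r > 0, ∀ ε u : ℂ, ‖ε‖ < r → ‖u‖ < r → ∀ l,
      n (ε, Complex.exp (Complex.I * torusAngle l) * u, u) = N (ε, constC Torus u) l := by
  obtain ⟨ρ', hρ', hb⟩ := Metric.eventually_nhds_iff_ball.1 (hN.eventually_analyticAt.and hcons)
  set ρ := ρ' / 2 with hρdef
  have hρ : 0 < ρ := by positivity
  set r := ρ / 2 with hr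
  have hr0 : 0 < r := by positivity
  have hrρ : r < ρ := by rw [hr]; linarith
  set s : C(Torus, ℂ) := (r : ℂ) • torusY with hs
  have hsn : ‖s‖ < ρ' := by
    rw [hs, norm_smul, Complex.norm_real, Real.norm_eq_abs, abs_of_pos hr0]
    calc r * ‖torusY‖ ≤ r * 1 := by gcongr; exact norm_torusY_le
      _ < ρ' := by rw [hr, hρdef]; linarith
  have hball : ∀ {ε : ℂ} {f : C(Torus, ℂ)}, ‖ε‖ < ρ' → ‖f‖ < ρ' →
      (ε, f) ∈ Metric.ball (0 : ℂ × C(Torus, ℂ)) ρ' := by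
    intro ε f h1 h2
    rw [mem_ball_zero_iff, prod_norm_lt_iff]
    exact ⟨h1, h2⟩
  have hrne : (r : ℂ) ≠ 0 := by exact_mod_cast hr0.ne'
  let n : ℂ × ℂ × ℂ → ℂ := fun p => torusMean (N (p.1, s) * cauchyKernel (p.2.1 / r, p.2.2 / r))
  have hn : AnalyticAt ℂ n 0 := by
    have h1 : AnalyticAt ℂ (fun p : ℂ × ℂ × ℂ => N (p.1, s)) 0 :=
      AnalyticAt.comp_of_eq (f := fun p : ℂ × ℂ × ℂ => (p.1, s))
        (hb (0, s) (hball (by simpa using hρ') hsn)).1 (by fun_prop) rfl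
    have h2 : AnalyticAt ℂ (fun p : ℂ × ℂ × ℂ => cauchyKernel (p.2.1 / r, p.2.2 / r)) 0 :=
      analyticAt_cauchyKernel.comp_of_eq (f := fun p : ℂ × ℂ × ℂ => (p.2.1 / r, p.2.2 / r))
        (by simp only [div_eq_mul_inv]; fun_prop) (by simp)
    exact AnalyticAt.comp (g := torusMean) (torusMean.analyticAt _) (h1.mul h2)
  obtain ⟨r₁, hr₁, hb₁⟩ := Metric.eventually_nhds_iff_ball.1 hn.eventually_analyticAt
  refine ⟨n, hn, min r r₁, lt_min hr0 hr₁, fun ε u hε hu l => ?_⟩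
  have hrr : r < ρ' := by rw [hr, hρdef]; linarith
  have hu1 := hu.trans_le (min_le_left _ _)
  have hu2 := hu.trans_le (min_le_right _ _)
  set X := Complex.exp (Complex.I * torusAngle l) with hX
  have hXn : ‖X‖ = 1 := mem_sphere_zero_iff_norm.1 (FolData.exp_I_mem_sphere _)
  have hXu : ‖X * u‖ < r₁ := by rwa [norm_mul, hXn, one_mul]
  -- The coefficient hypothesis is available only for real t ≠ 0.
  have hreal : ∀ᶠ t : ℝ in 𝓝[≠] 0, n ((t : ℂ), X * u, u) = N ((t : ℂ), constC Torus u) l := by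
    have hsm : ∀ᶠ t : ℝ in 𝓝 0, ‖(t : ℂ)‖ < ρ' := by
      filter_upwards [Metric.ball_mem_nhds (0 : ℝ) hρ'] with t ht
      rw [Complex.norm_real]
      simpa using ht
    filter_upwards [hcoef, nhdsWithin_le_nhds hsm] with t h1 h2
    refine torusMean_eq (A := fun u => N ((t : ℂ), constC Torus u)) hr0 hrρ ?_ ?_ h1 hu1 l
    · intro z hz
      rw [mem_ball_zero_iff, show 2 * ρ = ρ' by rw [hρdef]; ring] at hz
      have h3 : AnalyticAt ℂ (fun z => N ((t : ℂ), constC Torus z)) z :=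
        AnalyticAt.comp (f := fun z => ((t : ℂ), constC Torus z))
          (hb _ (hball h2 ((norm_constC_le z).trans_lt hz))).1
          (analyticAt_const.prod ((constC Torus).analyticAt _))
      exact h3.differentiableAt.differentiableWithinAt
    · intro l'
      refine (hb (t, s) (hball h2 hsn)).2 l' ?_
      have : torusY l' ≠ 0 := norm_ne_zero_iff.1 (by rw [norm_torusY]; exact one_ne_zero)
      exact mul_ne_zero hrne this
  -- Both sides are analytic in ε, so equality extends from small real nonzero values to all small
  -- ε, including ε = 0.
  have hz := eqOn_zero_ball_of_real
    (f := fun ε => n (ε, X * u, u) - N (ε, constC Torus u) l) (r := min r r₁) ?_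
    (hreal.mono fun t ht => sub_eq_zero.2 ht) (z := ε) (by simpa using hε)
  · exact sub_eq_zero.1 hz
  · intro e he
    rw [mem_ball_zero_iff] at he
    have h1 : AnalyticAt ℂ (fun ε => n (ε, X * u, u)) e :=
      AnalyticAt.comp (f := fun ε : ℂ => (ε, X * u, u)) (hb₁ (e, X * u, u) (by
        rw [mem_ball_zero_iff, prod_norm_lt_iff, prod_norm_lt_iff]
        exact ⟨he.trans_le (min_le_right _ _), hXu, hu2⟩)) (by fun_prop)
    let ev : C(Torus, ℂ) →L[ℂ] ℂ := ContinuousMap.evalCLM ℂ l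
    have h2 : AnalyticAt ℂ (fun ε => N (ε, constC Torus u)) e :=
      AnalyticAt.comp (f := fun ε : ℂ => (ε, constC Torus u)) (hb (e, constC Torus u)
        (hball ((he.trans_le (min_le_left _ _)).trans hrr)
          ((norm_constC_le u).trans_lt (hu1.trans hrr)))).1 (by fun_prop)
    exact h1.sub (AnalyticAt.comp (g := ev) (ev.analyticAt _) h2)

end WeakFocus

end

/-! ### The continuation as a germ in (ε, x, y) -/

noncomputable section

namespace WeakFocus

open FolData GenericFamily

variable {D D' : FolData} {F G : GenericFamily} {h : ℂ → ℂ} {H : ℂ × ℂ → ℂ}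

/-- A conjugacy of the Poincaré maps extends along the leaves to a germ of three variables. -/
lemma exists_continuation (hF : Represents D F) (hG : Represents D' G) (hD : D.Diagonal)
    (hD' : D'.Diagonal) (hh : AnalyticAt ℂ h 0) (h0 : h 0 = 0) (hH : AnalyticAt ℂ H 0)
    (H0 : ∀ᶠ ε : ℂ in 𝓝 0, H (ε, 0) = 0) (Hd : deriv (fun x : ℂ => H (0, x)) 0 ≠ 0)
    (hconj : ∀ᶠ p : ℂ × ℂ in 𝓝 0, H (p.1, F.poincareMap p) = G.poincareMap (h p.1, H p)) :
    ∃ n : ℂ × ℂ × ℂ → ℂ, AnalyticAt ℂ n 0 ∧ n 0 ≠ 0 ∧ ∃ r > 0, ∀ ε u : ℂ, ‖ε‖ < r → ‖u‖ < r →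
      ∀ φ ∈ Set.Icc 0 (2 * Real.pi), ∀ W W', D.IsLeaf ε W → W φ = u → D'.IsLeaf (h ε) W' →
        W' 0 = H (ε, W 0) → W' φ = u * n (ε, Complex.exp (Complex.I * φ) * u, u) := by
  have hpi := Real.pi_pos
  have hpi' := Real.pi_lt_d2
  have hH00 : H 0 = 0 := H0.self_of_nhds
  have hht : Tendsto h (𝓝 0) (𝓝 0) := by simpa [ContinuousAt, h0] using hh.continuousAt
  have hHt : Tendsto H (𝓝 0) (𝓝 0) := by simpa [ContinuousAt, hH00] using hH.continuousAt
  have hφ : ∀ l, torusAngle l ∈ Set.Icc (-(2 * Real.pi)) (2 * Real.pi) := by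
    intro l
    have h1 := l.1.2
    have h2 := l.2.2
    change 2 * Real.pi * ((l.1 : ℝ) - (l.2 : ℝ)) ∈ _
    constructor <;> nlinarith [h1.1, h1.2, h2.1, h2.2]
  have hφa : ∀ l, torusAngle l ∈ angles := fun l =>
    ⟨by linarith [(hφ l).1], by linarith [(hφ l).2]⟩
  obtain ⟨N, hNa, hN, c, hc, hc0, hNc⟩ :=
    exists_continuationC hD hD' hh h0 hH H0 Hd torusAngle hφa
  have hcoef := exists_continuation_coeff hF hG hD hD' hht hHt hconj hφ hNa hN hc hc0 hNc
  obtain ⟨ρ, hρ, hb⟩ := Metric.eventually_nhds_iff_ball.1 hN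
  obtain ⟨r₁, hr₁, C, hC, hex⟩ := D.exists_leaf
  obtain ⟨r₂, hr₂, C', hC', hex'⟩ := D'.exists_leaf
  have hC0 : 0 < C := zero_lt_one.trans_le hC
  obtain ⟨r₃, hr₃, hh₃⟩ := exists_ball_tendsto hht hr₂
  obtain ⟨r₄, hr₄, hH₄⟩ := exists_ball_tendsto hHt hr₂
  -- The value of N at a point of the torus depends only on the value of the initial function there,
  -- as both sides describe the same leaf; division by that value needs it to be nonzero.
  have hcons : ∀ᶠ q in 𝓝 (0 : ℂ × C(Torus, ℂ)), ∀ l, q.2 l ≠ 0 →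
      N q l = N (q.1, constC Torus (q.2 l)) l := by
    filter_upwards [Metric.ball_mem_nhds _ hρ, Metric.ball_mem_nhds _ hr₁,
      Metric.ball_mem_nhds _ hr₃, Metric.ball_mem_nhds _ (div_pos hr₄ hC0),
      Metric.ball_mem_nhds _ hr₄] with q q1 q2 q3 q4 q5 l hl
    have hq := q1
    rw [mem_ball_zero_iff, prod_norm_lt_iff] at q1 q2 q3 q4 q5
    have hle := q.2.norm_coe_le_norm l
    obtain ⟨W, hW, hWφ, hWb⟩ := hex q.1 (q.2 l) q2.1 (hle.trans_lt q2.2) _ (hφa l)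
    have hW0 : ‖W 0‖ < r₄ := by
      refine (hWb 0 zero_mem_angles).trans_lt ?_
      rw [mul_comm, ← lt_div_iff₀ hC0]
      exact hle.trans_lt q4.2
    obtain ⟨W', hW', hW'0, -⟩ := hex' (h q.1) (H (q.1, W 0)) (hh₃ _ q3.1)
      (hH₄ _ (by rw [prod_norm_lt_iff]; exact ⟨q5.1, hW0⟩)) 0 zero_mem_angles
    refine mul_left_cancel₀ hl ?_
    rw [← hb q hq l W W' hW hWφ hW' hW'0]
    refine hb (q.1, constC Torus (q.2 l)) ?_ l W W' hW hWφ hW' hW'0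
    rw [mem_ball_zero_iff, prod_norm_lt_iff]
    exact ⟨q1.1, (norm_constC_le _).trans_lt (hle.trans_lt q1.2)⟩
  obtain ⟨n, hn, r, hr, hnN⟩ := exists_cauchy hNa hcons hcoef
  refine ⟨n, hn, ?_, min r ρ, lt_min hr hρ, ?_⟩
  · have h1 := hnN 0 0 (by simpa using hr) (by simpa using hr) (0, 0)
    rw [mul_zero, _root_.map_zero, hNc.self_of_nhds] at h1
    change n 0 = _ at h1
    rw [h1]
    exact mul_ne_zero hc0 (Complex.exp_ne_zero _)
  · intro ε u hε hu φ hφ W W' hW hWφ hW' hW'0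
    have hmem : φ / (2 * Real.pi) ∈ unitInterval :=
      ⟨div_nonneg hφ.1 (by positivity), div_le_one_of_le₀ hφ.2 (by positivity)⟩
    -- The point of the torus with second parameter 0, which carries the angle φ itself.
    let l : Torus := (⟨φ / (2 * Real.pi), hmem⟩, 0)
    have hl : torusAngle l = φ := by
      change 2 * Real.pi * (φ / (2 * Real.pi) - ((0 : unitInterval) : ℝ)) = φ
      rw [Set.Icc.coe_zero, sub_zero]
      field_simp
    have h1 := hnN ε u (hε.trans_le (min_le_left _ _)) (hu.trans_le (min_le_left _ _)) l
    rw [hl] at h1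
    rw [h1, ← hl]
    refine hb (ε, constC Torus u) ?_ l W W' hW (by rw [hl, hWφ]; rfl) hW' hW'0
    rw [mem_ball_zero_iff, prod_norm_lt_iff]
    exact ⟨hε.trans_le (min_le_right _ _),
      (norm_constC_le _).trans_lt (hu.trans_le (min_le_right _ _))⟩

/-- An analytic germ that vanishes over the circle `|x| = |y|` vanishes. -/
lemma eventually_eq_zero_of_circle {S : ℂ × ℂ × ℂ → ℂ} (hS : AnalyticAt ℂ S 0)
    (h0 : ∃ r > 0, ∀ ε u : ℂ, ‖ε‖ < r → ‖u‖ < r → u ≠ 0 → ∀ φ ∈ Set.Icc 0 (2 * Real.pi),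
      S (ε, Complex.exp (Complex.I * φ) * u, u) = 0) : ∀ᶠ p in 𝓝 0, S p = 0 := by
  obtain ⟨r₁, hr₁, h0⟩ := h0
  obtain ⟨r₂, hr₂, hb⟩ := Metric.eventually_nhds_iff_ball.1 hS.eventually_analyticAt
  have hsmall : ∀ ε x y : ℂ, ‖ε‖ < min r₁ r₂ → ‖x‖ < min r₁ r₂ → ‖y‖ < min r₁ r₂ → y ≠ 0 →
      S (ε, x, y) = 0 := by
    intro ε x y hε hx hy hy0
    have hyn : 0 < ‖y‖ := norm_pos_iff.2 hy0
    -- For fixed y ≠ 0 the function is analytic in the slope X on a disc of radius greater than 1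
    -- and vanishes on the unit circle, hence at X = x/y.
    have hA : AnalyticOnNhd ℂ (fun X => S (ε, X * y, y)) (Metric.ball 0 (r₂ / ‖y‖)) := by
      intro X hX
      rw [mem_ball_zero_iff, lt_div_iff₀ hyn, ← norm_mul] at hX
      exact AnalyticAt.comp (f := fun X : ℂ => (ε, X * y, y)) (hb (ε, X * y, y) (by
        rw [mem_ball_zero_iff, prod_norm_lt_iff, prod_norm_lt_iff]
        exact ⟨hε.trans_le (min_le_right _ _), hX, hy.trans_le (min_le_right _ _)⟩)) (by fun_prop)
    have h1 : (1 : ℂ) ∈ Metric.ball (0 : ℂ) (r₂ / ‖y‖) := by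
      rw [mem_ball_zero_iff, norm_one, lt_div_iff₀ hyn, one_mul]
      exact hy.trans_le (min_le_right _ _)
    have hfreq : ∃ᶠ X in 𝓝[≠] (1 : ℂ), S (ε, X * y, y) = 0 := by
      have ht : Tendsto (fun φ : ℝ => Complex.exp (Complex.I * φ)) (𝓝[>] 0) (𝓝[≠] 1) := by
        refine tendsto_nhdsWithin_iff.2 ⟨?_, ?_⟩
        · have : Continuous fun φ : ℝ => Complex.exp (Complex.I * φ) := by fun_prop
          exact (this.tendsto' 0 1 (by simp)).mono_left nhdsWithin_le_nhds
        · filter_upwards [Ioo_mem_nhdsGT Real.two_pi_pos] with φ hφ h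
          have h' : Complex.exp (Complex.I * φ) = 1 := h
          obtain ⟨k, hk⟩ := Complex.exp_eq_one_iff.1 h'
          have h2 : φ = k * (2 * Real.pi) := by
            have h3 : (φ : ℂ) = ((k * (2 * Real.pi) : ℝ) : ℂ) := by
              refine mul_left_cancel₀ Complex.I_ne_zero ?_
              rw [hk]
              push_cast
              ring
            exact_mod_cast h3
          have h4 : (0 : ℝ) < k := by
            by_contra hneg
            have := hφ.1
            rw [h2] at this
            nlinarith [Real.two_pi_pos]
          have h5 : (k : ℝ) < 1 := by
            by_contra hneg
            have := hφ.2
            rw [h2] at this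
            nlinarith [Real.two_pi_pos]
          have h6 : 0 < k := by exact_mod_cast h4
          have h7 : k < 1 := by exact_mod_cast h5
          omega
      refine ht.frequently (Eventually.frequently ?_)
      filter_upwards [Ioo_mem_nhdsGT Real.two_pi_pos] with φ hφ
      exact h0 ε y (hε.trans_le (min_le_left _ _)) (hy.trans_le (min_le_left _ _)) hy0 φ
        (Set.Ioo_subset_Icc_self hφ)
    have := hA.eqOn_zero_of_preconnected_of_frequently_eq_zero (convex_ball _ _).isPreconnected h1
      hfreq (x := x / y) (by
        rw [mem_ball_zero_iff, norm_div]
        gcongr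
        exact hx.trans_le (min_le_right _ _))
    simpa [div_mul_cancel₀ _ hy0] using this
  filter_upwards [Metric.ball_mem_nhds _ (lt_min hr₁ hr₂)] with p hp
  rw [mem_ball_zero_iff, prod_norm_lt_iff, prod_norm_lt_iff] at hp
  obtain ⟨h1, h2, h3⟩ := hp
  rcases ne_or_eq p.2.2 0 with h4 | h4
  · exact hsmall _ _ _ h1 h2 h3 h4
  -- The axis y = 0 is reached by continuity.
  have hcont : Tendsto (fun y : ℂ => S (p.1, p.2.1, y)) (𝓝[≠] 0) (𝓝 (S p)) := by
    have h5 : AnalyticAt ℂ S (p.1, p.2.1, 0) := hb _ (by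
      rw [mem_ball_zero_iff, prod_norm_lt_iff, prod_norm_lt_iff]
      exact ⟨h1.trans_le (min_le_right _ _), h2.trans_le (min_le_right _ _), by simpa using hr₂⟩)
    have h6 : ContinuousAt (fun y : ℂ => S (p.1, p.2.1, y)) 0 :=
      h5.continuousAt.comp_of_eq (f := fun y : ℂ => (p.1, p.2.1, y)) (by fun_prop) rfl
    have h7 : p = (p.1, p.2.1, 0) := by rw [← h4]
    rw [h7]
    exact h6.tendsto.mono_left nhdsWithin_le_nhds
  refine tendsto_nhds_unique hcont (tendsto_const_nhds.congr' ?_)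
  filter_upwards [self_mem_nhdsWithin,
    nhdsWithin_le_nhds (Metric.ball_mem_nhds (0 : ℂ) (lt_min hr₁ hr₂))] with y hy0 hy
  exact (hsmall p.1 p.2.1 y h1 h2 (by simpa using hy) hy0).symm

end WeakFocus

end

/-! ### The scalar equation and the resulting orbital equivalence -/

noncomputable section

namespace WeakFocus

open FolData GenericFamily

variable {D D' : FolData} {F G : GenericFamily} {h : ℂ → ℂ} {H : ℂ × ℂ → ℂ} {n : ℂ × ℂ × ℂ → ℂ}

/-- The diagonal change of coordinates `(x, y) ↦ (x n, y n)`. -/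
def scaling (n : ℂ × ℂ × ℂ → ℂ) (p : ℂ × ℂ × ℂ) : ℂ × ℂ := (p.2.1 * n p, p.2.2 * n p)

lemma analyticAt_scaling {p : ℂ × ℂ × ℂ} (hn : AnalyticAt ℂ n p) : AnalyticAt ℂ (scaling n) p :=
  ((analyticAt_fst.comp analyticAt_snd).mul hn).prod ((analyticAt_snd.comp analyticAt_snd).mul hn)

lemma scaling_axis (n : ℂ × ℂ × ℂ → ℂ) (ε : ℂ) : scaling n (ε, 0, 0) = 0 := by
  simp [scaling]

lemma fderiv_scaling {p : ℂ × ℂ × ℂ} (hn : DifferentiableAt ℂ n p) (v : ℂ × ℂ) :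
    fderiv ℂ (fun z : ℂ × ℂ => scaling n (p.1, z)) p.2 v =
      (v.1 * n p + p.2.1 * fderiv ℂ n p (0, v), v.2 * n p + p.2.2 * fderiv ℂ n p (0, v)) := by
  have h1 : HasFDerivAt (fun z : ℂ × ℂ => n (p.1, z)) (fderiv ℂ n p ∘L .inr ℂ ℂ (ℂ × ℂ)) p.2 :=
    HasFDerivAt.comp (g := n) (f := fun z => (p.1, z)) p.2 hn.hasFDerivAt
      (hasFDerivAt_prodMk_right p.1 p.2)
  have h2 : HasFDerivAt (fun z : ℂ × ℂ => scaling n (p.1, z)) _ p.2 :=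
    (hasFDerivAt_fst.mul h1).prodMk (hasFDerivAt_snd.mul h1)
  rw [h2.fderiv]
  ext <;> simp <;> ring

lemma isInvertible_fderiv_scaling (hn : AnalyticAt ℂ n 0) (h0 : n 0 ≠ 0) :
    (fderiv ℂ (fun z : ℂ × ℂ => scaling n (0, z)) 0).IsInvertible := by
  have h1 : fderiv ℂ (fun z : ℂ × ℂ => scaling n (0, z)) 0 =
      n 0 • ContinuousLinearMap.id ℂ (ℂ × ℂ) := by
    refine ContinuousLinearMap.ext fun v => ?_
    refine (fderiv_scaling hn.differentiableAt v).trans ?_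
    simp only [Prod.fst_zero, Prod.snd_zero, zero_mul, add_zero]
    exact Prod.ext (mul_comm _ _) (mul_comm _ _)
  rw [h1]
  refine ContinuousLinearMap.IsInvertible.of_inverse
    (g := (n 0)⁻¹ • ContinuousLinearMap.id ℂ (ℂ × ℂ)) ?_ ?_ <;>
  · refine ContinuousLinearMap.ext fun v => ?_
    simp [smul_smul, h0]

/-- `P / x - Q / y`. -/
def gap (D : FolData) (p : ℂ × ℂ × ℂ) : ℂ := D.p1 p - D.q2 p

lemma analyticAt_gap (D : FolData) : AnalyticAt ℂ (gap D) 0 := D.analyticAt_p1.sub D.analyticAt_q2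

/-- The time factor of a diagonal change of coordinates. -/
def timeFactor (D D' : FolData) (h : ℂ → ℂ) (n : ℂ × ℂ × ℂ → ℂ) (p : ℂ × ℂ × ℂ) : ℂ :=
  gap D p / gap D' (h p.1, scaling n p)

lemma analyticAt_scalingArg (hh : AnalyticAt ℂ h 0) (hn : AnalyticAt ℂ n 0) :
    AnalyticAt ℂ (fun p : ℂ × ℂ × ℂ => (h p.1, scaling n p)) 0 :=
  (hh.comp_of_eq analyticAt_fst rfl).prod (analyticAt_scaling hn)

lemma scalingArg_zero (h0 : h 0 = 0) : (h (0 : ℂ × ℂ × ℂ).1, scaling n 0) = 0 :=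
  Prod.ext h0 (scaling_axis n 0)

lemma analyticAt_timeFactor (hh : AnalyticAt ℂ h 0) (h0 : h 0 = 0) (hn : AnalyticAt ℂ n 0) :
    AnalyticAt ℂ (timeFactor D D' h n) 0 := by
  refine (analyticAt_gap D).div ((analyticAt_gap D').comp_of_eq (analyticAt_scalingArg hh hn)
    (scalingArg_zero h0)) ?_
  change gap D' (h (0 : ℂ × ℂ × ℂ).1, scaling n 0) ≠ 0
  rw [scalingArg_zero h0]
  exact D'.p1_sub_q2_zero_ne

lemma timeFactor_zero (h0 : h 0 = 0) : timeFactor D D' h n 0 = ((D.b / D'.b : ℝ) : ℂ) := by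
  rw [timeFactor, scalingArg_zero h0, gap, gap, p1_sub_q2_zero, p1_sub_q2_zero]
  have h1 : (D'.b : ℂ) ≠ 0 := by exact_mod_cast D'.b_pos.ne'
  push_cast
  field_simp

/-- The scalar equation of a diagonal orbital equivalence. -/
def defect (D D' : FolData) (h : ℂ → ℂ) (n : ℂ × ℂ × ℂ → ℂ) (p : ℂ × ℂ × ℂ) : ℂ :=
  fderiv ℂ n p (0, (p.2.1 * D.p1 p, p.2.2 * D.q2 p)) + n p * D.q2 p -
    n p * (timeFactor D D' h n p * D'.q2 (h p.1, scaling n p))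

lemma analyticAt_defect (hh : AnalyticAt ℂ h 0) (h0 : h 0 = 0) (hn : AnalyticAt ℂ n 0) :
    AnalyticAt ℂ (defect D D' h n) 0 := by
  have h1 := D.analyticAt_p1
  have h2 := D.analyticAt_q2
  have h3 : AnalyticAt ℂ (fun p : ℂ × ℂ × ℂ => ((0 : ℂ), (p.2.1 * D.p1 p, p.2.2 * D.q2 p))) 0 := by
    fun_prop
  have h4 : AnalyticAt ℂ (fun p => fderiv ℂ n p (0, (p.2.1 * D.p1 p, p.2.2 * D.q2 p))) 0 :=
    ((ContinuousLinearMap.id ℂ ((ℂ × ℂ × ℂ) →L[ℂ] ℂ)).analyticAt_bilinear _).comp (hn.fderiv.prod h3)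
  have h5 : AnalyticAt ℂ (fun p : ℂ × ℂ × ℂ => D'.q2 (h p.1, scaling n p)) 0 :=
    D'.analyticAt_q2.comp_of_eq (analyticAt_scalingArg hh hn) (scalingArg_zero h0)
  exact (h4.add (hn.mul h2)).sub (hn.mul ((analyticAt_timeFactor hh h0 hn).mul h5))

/-- Where the scalar equation holds, the diagonal change of coordinates is an orbital equivalence. -/
lemma fderiv_scaling_eq {p : ℂ × ℂ × ℂ} (hn : DifferentiableAt ℂ n p)
    (hgap : gap D' (h p.1, scaling n p) ≠ 0) (hdef : defect D D' h n p = 0) :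
    fderiv ℂ (fun z : ℂ × ℂ => scaling n (p.1, z)) p.2 (p.2.1 * D.p1 p, p.2.2 * D.q2 p) =
      timeFactor D D' h n p • ((scaling n p).1 * D'.p1 (h p.1, scaling n p),
        (scaling n p).2 * D'.q2 (h p.1, scaling n p)) := by
  rw [fderiv_scaling hn]
  -- The change of coordinates preserves x/y, so the time factor is forced to be the ratio of the
  -- quantities P/x - Q/y. With this choice the first component of the equation follows from the
  -- second.
  have h1 : timeFactor D D' h n p * (D'.p1 (h p.1, scaling n p) - D'.q2 (h p.1, scaling n p)) =
      D.p1 p - D.q2 p := div_mul_cancel₀ _ hgap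
  rw [defect] at hdef
  refine Prod.ext ?_ ?_
  · simp only [Prod.smul_fst, smul_eq_mul]
    simp only [scaling] at h1 hdef ⊢
    linear_combination p.2.1 * hdef - p.2.1 * n p * h1
  · simp only [Prod.smul_snd, smul_eq_mul]
    simp only [scaling] at h1 hdef ⊢
    linear_combination p.2.2 * hdef

lemma field_eq (hF : Represents D F) (hD : D.Diagonal) :
    ∀ᶠ p in 𝓝 0, F.field p = (p.2.1 * D.p1 p, p.2.2 * D.q2 p) := by
  filter_upwards [hF.P_eq, hF.Q_eq] with p h1 h2
  rw [field, h1, h2, hD.1, hD.2]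
  simp

/-- A germ that continues along the leaves a map of cross-sections satisfies the scalar equation. -/
lemma defect_eq_zero (hF : Represents D F) (hD : D.Diagonal)
    (hD' : D'.Diagonal) (hht : Tendsto h (𝓝 0) (𝓝 0)) (hHt : Tendsto H (𝓝 0) (𝓝 0))
    (hn : AnalyticAt ℂ n 0)
    (hW : ∃ r > 0, ∀ ε u : ℂ, ‖ε‖ < r → ‖u‖ < r →
      ∀ φ ∈ Set.Icc 0 (2 * Real.pi), ∀ W W', D.IsLeaf ε W → W φ = u → D'.IsLeaf (h ε) W' →
        W' 0 = H (ε, W 0) → W' φ = u * n (ε, Complex.exp (Complex.I * φ) * u, u)) :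
    ∃ r > 0, ∀ ε u : ℂ, ‖ε‖ < r → ‖u‖ < r → u ≠ 0 → ∀ φ ∈ Set.Icc 0 (2 * Real.pi),
      defect D D' h n (ε, Complex.exp (Complex.I * φ) * u, u) = 0 := by
  obtain ⟨r₀, hr₀, hW⟩ := hW
  obtain ⟨r₁, hr₁, C, hC, hex⟩ := D.exists_leaf
  obtain ⟨r₂, hr₂, C', hC', hex'⟩ := D'.exists_leaf
  obtain ⟨r₃, hr₃, hh₃⟩ := exists_ball_tendsto hht (lt_min hr₂ D'.rad_pos)
  obtain ⟨r₄, hr₄, hH₄⟩ := exists_ball_tendsto hHt hr₂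
  obtain ⟨r₅, hr₅, hr₅D, hder⟩ := hF.exists_hasDerivWithinAt_leaf
  obtain ⟨r₆, hr₆, hb⟩ := Metric.eventually_nhds_iff_ball.1 (hn.eventually_analyticAt.and
    (field_eq hF hD))
  have hC0 : 0 < C := zero_lt_one.trans_le hC
  set σ := min (min (min r₀ r₁) (min r₃ r₄)) (min r₅ r₆) with hσ
  have hσ0 : 0 < σ := lt_min (lt_min (lt_min hr₀ hr₁) (lt_min hr₃ hr₄)) (lt_min hr₅ hr₆)
  refine ⟨σ / C, div_pos hσ0 hC0, fun ε u hε hu hu0 φ hφ => ?_⟩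
  replace hε : ‖ε‖ < σ := hε.trans_le (div_le_self hσ0.le hC)
  have hCu : C * ‖u‖ < σ := by rwa [mul_comm, ← lt_div_iff₀ hC0]
  replace hu : ‖u‖ < σ := hu.trans_le (div_le_self hσ0.le hC)
  simp only [hσ, lt_min_iff] at hε hCu hu
  obtain ⟨⟨⟨e0, e1⟩, e3, e4⟩, e5, e6⟩ := hε
  obtain ⟨⟨⟨c0, c1⟩, c3, c4⟩, c5, c6⟩ := hCu
  obtain ⟨⟨⟨u0, u1⟩, u3, u4⟩, u5, u6⟩ := hu
  have hφa : φ ∈ angles := Icc_two_pi_subset hφ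
  obtain ⟨W, hWl, hWφ, hWb⟩ := hex ε u e1 u1 φ hφa
  have hhε := hh₃ ε e3
  have hHε := hH₄ (ε, W 0) (by
    rw [prod_norm_lt_iff]
    exact ⟨e4, (hWb 0 zero_mem_angles).trans_lt c4⟩)
  obtain ⟨W', hWl', hW'0, -⟩ := hex' (h ε) (H (ε, W 0)) (hhε.trans_le (min_le_left _ _)) hHε 0
    zero_mem_angles
  have hsub : Set.Icc 0 (2 * Real.pi) ⊆ angles := Icc_two_pi_subset
  set X := Complex.exp (Complex.I * φ) with hX
  have hXn : ‖X‖ = 1 := mem_sphere_zero_iff_norm.1 (exp_I_mem_sphere φ)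
  set p : ℂ × ℂ × ℂ := (ε, X * u, u) with hp
  have hpb : p ∈ Metric.ball (0 : ℂ × ℂ × ℂ) r₆ := by
    rw [mem_ball_zero_iff, prod_norm_lt_iff, prod_norm_lt_iff]
    exact ⟨e6, by rwa [norm_mul, hXn, one_mul], u6⟩
  obtain ⟨hnp, hfp⟩ := hb p hpb
  -- W' = W · n along the leaf; differentiating this at φ and comparing with the equation satisfied
  -- by W' gives the scalar equation at the point.
  have heq : ∀ t ∈ Set.Icc 0 (2 * Real.pi),
      W' t = W t * n (ε, Complex.exp (Complex.I * t) * W t, W t) := fun t ht =>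
    hW ε (W t) e0 ((hWb t (hsub ht)).trans_lt c0) t ht W W' hWl rfl hWl' hW'0
  have hslope : ∀ (D : FolData) (x u : ℂ) (ε : ℂ), D.rate (ε, x, u) =
      Complex.I * D.q2 (ε, x, u) / gap D (ε, x, u) := fun _ _ _ _ => rfl
  have hgap : gap D p ≠ 0 := by
    have := den_ne (D := D) (e5.trans_le hr₅D) (exp_I_mem_sphere φ) (u5.trans_le hr₅D)
    simpa [den, hD.1, hD.2, gap, hp] using this
  have hden : D.den ε X u = gap D p := by
    simp [den, hD.1, hD.2, gap, hp]
  have hW'φ : W' φ = u * n p := by rw [heq φ hφ, hWφ]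
  have hsc : (h p.1, scaling n p) = (h ε, X * W' φ, W' φ) := by
    rw [hW'φ]
    simp only [scaling, hp, ← mul_assoc]
  have hgap' : gap D' (h p.1, scaling n p) ≠ 0 := by
    have := den_ne (D := D') (hhε.trans_le (min_le_right _ _)) (exp_I_mem_sphere φ)
      (hWl' φ hφa).1
    rw [hsc]
    simpa [den, hD'.1, hD'.2, gap] using this
  have hud : UniqueDiffWithinAt ℝ (Set.Icc 0 (2 * Real.pi)) φ :=
    uniqueDiffOn_Icc Real.two_pi_pos φ hφ
  have d1 := (hder ε e5 W hWl φ hφa (by rw [hWφ]; exact u5)).mono hsub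
  rw [hWφ, ← hX, hden, hfp] at d1
  have d2 : HasDerivWithinAt W (Complex.I / gap D p * (u * D.q2 p)) (Set.Icc 0 (2 * Real.pi)) φ :=
    d1.snd
  have d3 : HasDerivWithinAt (fun t : ℝ => n (ε, Complex.exp (Complex.I * t) * W t, W t))
      (Complex.I / gap D p * fderiv ℂ n p (0, (X * u * D.p1 p, u * D.q2 p)))
      (Set.Icc 0 (2 * Real.pi)) φ := by
    have h1 := (hasDerivWithinAt_const φ (Set.Icc 0 (2 * Real.pi)) ε).prodMk d1
    have h2 : HasFDerivAt n (fderiv ℂ n p) (ε, Complex.exp (Complex.I * φ) * W φ, W φ) := by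
      rw [hWφ]
      exact hnp.differentiableAt.hasFDerivAt
    have h3 := (h2.restrictScalars ℝ).comp_hasDerivWithinAt φ h1
    refine h3.congr_deriv ?_
    have h4 : ((0 : ℂ), (Complex.I / gap D p) • (p.2.1 * D.p1 p, p.2.2 * D.q2 p)) =
        (Complex.I / gap D p) • ((0 : ℂ), (X * u * D.p1 p, u * D.q2 p)) :=
      Prod.ext (by simp) rfl
    change fderiv ℂ n p ((0 : ℂ), (Complex.I / gap D p) • (p.2.1 * D.p1 p, p.2.2 * D.q2 p)) = _
    rw [h4, map_smul, smul_eq_mul]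
  have d4 := d2.fun_mul d3
  rw [hWφ, ← hX] at d4
  have d5 := ((hWl' φ hφa).2.2.mono hsub).congr (fun t ht => (heq t ht).symm) (heq φ hφ).symm
  have h6 := hud.eq_deriv _ d4 d5
  have h7 : D'.slope (h ε) X (W' φ) =
      Complex.I * D'.q2 (h p.1, scaling n p) / gap D' (h p.1, scaling n p) := by
    rw [hD'.slope_eq, hslope, hsc]
  rw [h7, hW'φ] at h6
  simp only [Complex.ofReal_one] at h6
  have h8 := mul_left_cancel₀ (mul_ne_zero hu0 Complex.I_ne_zero)
    (a := u * Complex.I)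
    (b := (D.q2 p * n p + fderiv ℂ n p (0, (X * u * D.p1 p, u * D.q2 p))) / gap D p)
    (c := n p * D'.q2 (h p.1, scaling n p) / gap D' (h p.1, scaling n p)) (by
      linear_combination h6)
  rw [div_eq_iff hgap] at h8
  rw [defect, timeFactor]
  linear_combination h8

end WeakFocus

end

noncomputable section

namespace WeakFocus

open FolData GenericFamily

variable {D D' : FolData} {F G : GenericFamily} {h : ℂ → ℂ} {H : ℂ × ℂ → ℂ} {n : ℂ × ℂ × ℂ → ℂ}

/-- The real point (z, conj z) has slope exp(2i arg z); a full turn is added if the argument is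
negative. -/
lemma exists_exp_mul_conj_eq (z : ℂ) :
    ∃ φ ∈ Set.Icc 0 (2 * Real.pi), Complex.exp (Complex.I * φ) * conj z = z := by
  have hpi := Real.pi_pos
  have h1 := Complex.norm_mul_exp_arg_mul_I z
  have h2 : Complex.exp (Complex.I * ((2 * z.arg : ℝ) : ℂ)) * conj z = z := by
    have h3 : conj z = ‖z‖ * Complex.exp (-(z.arg * Complex.I)) := by
      conv_lhs => rw [← h1]
      rw [map_mul, Complex.conj_ofReal, ← Complex.exp_conj, map_mul, Complex.conj_ofReal,
        Complex.conj_I, mul_neg]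
    rw [h3, mul_left_comm, ← Complex.exp_add]
    convert h1 using 3
    push_cast
    ring
  have hm := Complex.arg_mem_Ioc z
  rcases le_or_gt 0 z.arg with h4 | h4
  · exact ⟨2 * z.arg, ⟨by linarith, by linarith [hm.2]⟩, h2⟩
  · refine ⟨2 * z.arg + 2 * Real.pi, ⟨by linarith [hm.1], by linarith⟩, ?_⟩
    have h5 : Complex.exp (Complex.I * ((2 * z.arg + 2 * Real.pi : ℝ) : ℂ)) =
        Complex.exp (Complex.I * ((2 * z.arg : ℝ) : ℂ)) := by
      rw [Complex.ofReal_add, mul_add, Complex.exp_add]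
      have h6 : Complex.I * ((2 * Real.pi : ℝ) : ℂ) = 2 * Real.pi * Complex.I := by
        push_cast
        ring
      rw [h6, Complex.exp_two_pi_mul_I, mul_one]
    rw [h5, h2]

lemma tendsto_realPlane : Tendsto (fun q : ℝ × ℂ => ((q.1 : ℂ), q.2, conj q.2)) (𝓝 0) (𝓝 0) := by
  have : Continuous fun q : ℝ × ℂ => ((q.1 : ℂ), q.2, conj q.2) := by
    have := Complex.continuous_conj
    fun_prop
  exact this.tendsto' _ _ (by simp)

/-- The continuation of a real map of cross-sections is real on the real plane. -/
lemma scaling_real (hh : IsRealReparam h) (hH : Tendsto H (𝓝 0) (𝓝 0))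
    (Hr : ∀ᶠ q : ℝ × ℝ in 𝓝 0, (H ((q.1 : ℂ), (q.2 : ℂ))).im = 0)
    (hW : ∃ r > 0, ∀ ε u : ℂ, ‖ε‖ < r → ‖u‖ < r →
      ∀ φ ∈ Set.Icc 0 (2 * Real.pi), ∀ W W', D.IsLeaf ε W → W φ = u → D'.IsLeaf (h ε) W' →
        W' 0 = H (ε, W 0) → W' φ = u * n (ε, Complex.exp (Complex.I * φ) * u, u)) :
    ∀ᶠ q : ℝ × ℂ in 𝓝 0, (scaling n ((q.1 : ℂ), q.2, conj q.2)).2 =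
      conj (scaling n ((q.1 : ℂ), q.2, conj q.2)).1 := by
  have hht : Tendsto h (𝓝 0) (𝓝 0) := by
    simpa [ContinuousAt, hh.map_zero] using hh.analyticAt.continuousAt
  obtain ⟨r₀, hr₀, hW⟩ := hW
  obtain ⟨r₁, hr₁, C, hC, hex⟩ := D.exists_leaf
  obtain ⟨r₂, hr₂, C', hC', hex'⟩ := D'.exists_leaf
  have hC0 : 0 < C := zero_lt_one.trans_le hC
  have hC'0 : 0 < C' := zero_lt_one.trans_le hC'
  obtain ⟨r₅, hr₅, hc⟩ := GenericFamily.IsLeaf.conj_eq D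
  obtain ⟨r₆, hr₆, hc'⟩ := GenericFamily.IsLeaf.conj_eq D'
  obtain ⟨r₃, hr₃, hh₃⟩ := exists_ball_tendsto hht (lt_min hr₂ hr₆)
  obtain ⟨r₄, hr₄, hH₄⟩ := exists_ball_tendsto hH (lt_min hr₂ (div_pos hr₆ hC'0))
  obtain ⟨r₇, hr₇, hHr⟩ := Metric.eventually_nhds_iff_ball.1 Hr
  obtain ⟨r₈, hr₈, hhr⟩ := Metric.eventually_nhds_iff_ball.1 hh.real
  set σ := min (min (min r₀ r₁) (min r₃ r₄)) (min r₅ (min r₇ r₈)) with hσ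
  have hσ0 : 0 < σ := lt_min (lt_min (lt_min hr₀ hr₁) (lt_min hr₃ hr₄)) (lt_min hr₅ (lt_min hr₇ hr₈))
  filter_upwards [Metric.ball_mem_nhds (0 : ℝ × ℂ) (div_pos hσ0 hC0)] with q hq
  rw [mem_ball_zero_iff, prod_norm_lt_iff] at hq
  obtain ⟨t, z⟩ := q
  obtain ⟨hε, hu⟩ := hq
  simp only at hε hu ⊢
  have hu' : ‖conj z‖ < σ / C := by rwa [RCLike.norm_conj]
  clear hu
  set u := conj z with hudef
  replace hε : ‖t‖ < σ := hε.trans_le (div_le_self hσ0.le hC)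
  have hεc : ‖(t : ℂ)‖ < σ := by rwa [Complex.norm_real]
  have hCu : C * ‖u‖ < σ := by rwa [mul_comm, ← lt_div_iff₀ hC0]
  have hu : ‖u‖ < σ := hu'.trans_le (div_le_self hσ0.le hC)
  simp only [hσ, lt_min_iff] at hε hεc hCu hu
  obtain ⟨⟨⟨e0, e1⟩, e3, e4⟩, e5, e7, e8⟩ := hεc
  obtain ⟨⟨⟨c0, c1⟩, c3, c4⟩, c5, c7, c8⟩ := hCu
  obtain ⟨⟨⟨u0, u1⟩, u3, u4⟩, u5, u7, u8⟩ := hu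
  obtain ⟨φ, hφ, hX⟩ := exists_exp_mul_conj_eq z
  have hφa : φ ∈ angles := Icc_two_pi_subset hφ
  obtain ⟨W, hWl, hWφ, hWb⟩ := hex t u e1 u1 φ hφa
  have hW0n := hWb 0 zero_mem_angles
  have hhε := hh₃ t e3
  have hHε := hH₄ (t, W 0) (by
    rw [prod_norm_lt_iff]
    exact ⟨e4, hW0n.trans_lt c4⟩)
  obtain ⟨W', hWl', hW'0, hWb'⟩ := hex' (h t) (H (t, W 0)) (hhε.trans_le (min_le_left _ _))
    (hHε.trans_le (min_le_left _ _)) 0 zero_mem_angles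
  -- The leaf through a real point is real, so it meets Σ at a real value; H keeps it real, and the
  -- image leaf is real as well.
  have h1 := hc t (Complex.conj_ofReal t) e5 W hWl (fun s hs => (hWb s hs).trans_lt c5) φ hφa (by
    rw [hWφ, hudef, hX]) 0 zero_mem_angles
  have h2 : conj (W 0) = W 0 := by simpa using h1
  obtain ⟨s, hs⟩ := Complex.conj_eq_iff_real.1 h2
  have h3 : (H ((t : ℂ), (s : ℂ))).im = 0 := by
    refine hHr (t, s) ?_
    rw [mem_ball_zero_iff, prod_norm_lt_iff]
    refine ⟨hε.2.2.1, ?_⟩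
    have := hW0n.trans_lt c7
    rwa [hs, Complex.norm_real] at this
  have h4 : conj (h t) = h t := Complex.conj_eq_iff_im.2 (hhr t (by
    rw [mem_ball_zero_iff]
    exact hε.2.2.2))
  have h5 := hc' (h t) h4 (hhε.trans_le (min_le_right _ _)) W' hWl' (fun s hs => by
    refine (hWb' s hs).trans_lt ?_
    rw [mul_comm, ← lt_div_iff₀ hC'0]
    exact hHε.trans_le (min_le_right _ _)) 0 zero_mem_angles (by
    rw [hW'0, hs]
    simpa using Complex.conj_eq_iff_im.2 h3) φ hφa
  rw [hW t u e0 u0 φ hφ W W' hWl hWφ hWl' hW'0, ← mul_assoc, hX] at h5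
  exact h5.symm

/-- On the real plane P/x and Q/y are complex conjugate, so their difference is purely imaginary and
a ratio of two such differences is real. -/
lemma gap_real (D : FolData) : ∀ᶠ p : ℂ × ℂ × ℂ in 𝓝 0,
    conj p.1 = p.1 → p.2.2 = conj p.2.1 → (gap D p).re = 0 := by
  filter_upwards [D.real1] with p h1 h2 h3
  rw [h2, h3, Complex.conj_conj] at h1
  have h4 : (p.1, p.2.1, conj p.2.1) = p := by rw [← h3]
  rw [h4] at h1
  rw [gap, h1]
  simp

/-- The time factor is positive on the real plane. -/
lemma timeFactor_real (hh : IsRealReparam h) (hn : AnalyticAt ℂ n 0)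
    (hr : ∀ᶠ q : ℝ × ℂ in 𝓝 0, (scaling n ((q.1 : ℂ), q.2, conj q.2)).2 =
      conj (scaling n ((q.1 : ℂ), q.2, conj q.2)).1) :
    ∀ᶠ q : ℝ × ℂ in 𝓝 0, 0 < (timeFactor D D' h n ((q.1 : ℂ), q.2, conj q.2)).re ∧
      (timeFactor D D' h n ((q.1 : ℂ), q.2, conj q.2)).im = 0 := by
  have hk := analyticAt_timeFactor (D := D) (D' := D') hh.analyticAt hh.map_zero hn
  have hpos : ∀ᶠ p in 𝓝 0, 0 < (timeFactor D D' h n p).re := by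
    refine (Complex.continuous_re.continuousAt.comp hk.continuousAt).eventually (lt_mem_nhds ?_)
    rw [Function.comp_apply, timeFactor_zero hh.map_zero, Complex.ofReal_re]
    exact div_pos D.b_pos D'.b_pos
  have ht : Tendsto (fun p : ℂ × ℂ × ℂ => (h p.1, scaling n p)) (𝓝 0) (𝓝 0) := by
    have := (analyticAt_scalingArg hh.analyticAt hn).continuousAt
    rw [ContinuousAt, scalingArg_zero hh.map_zero] at this
    exact this
  have hfst : Tendsto (fun q : ℝ × ℂ => q.1) (𝓝 0) (𝓝 0) := continuous_fst.tendsto' _ _ rfl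
  filter_upwards [tendsto_realPlane.eventually hpos, tendsto_realPlane.eventually (gap_real D),
    (ht.comp tendsto_realPlane).eventually (gap_real D'), hr, hfst.eventually hh.real]
    with q h1 h2 h3 h4 h5
  refine ⟨h1, ?_⟩
  have h6 := h2 (Complex.conj_ofReal _) rfl
  have h7 := h3 (Complex.conj_eq_iff_im.2 h5) h4
  simp only [Function.comp_apply] at h7
  rw [timeFactor, Complex.div_im, h6, h7]
  simp

/-- For families with invariant axes a conjugacy of the Poincaré maps extends to an orbital
equivalence. -/
theorem realOrbitallyEquivalent_of_diagonal (hF : Represents D F) (hG : Represents D' G)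
    (hD : D.Diagonal) (hD' : D'.Diagonal) (hFG : RealConjugate F.poincareMap G.poincareMap) :
    RealOrbitallyEquivalent F G := by
  obtain ⟨h, H, hh, hH, H0, Hd, Hr, hconj⟩ := hFG
  have hH00 : H 0 = 0 := H0.self_of_nhds
  have hht : Tendsto h (𝓝 0) (𝓝 0) := by
    simpa [ContinuousAt, hh.map_zero] using hh.analyticAt.continuousAt
  have hHt : Tendsto H (𝓝 0) (𝓝 0) := by simpa [ContinuousAt, hH00] using hH.continuousAt
  obtain ⟨n, hn, hn0, hW⟩ := exists_continuation hF hG hD hD' hh.analyticAt hh.map_zero hH H0 Hd hconj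
  have hr := scaling_real hh hHt Hr hW
  have hdef := eventually_eq_zero_of_circle (analyticAt_defect hh.analyticAt hh.map_zero hn)
    (defect_eq_zero hF hD hD' hht hHt hn hW)
  have ht : Tendsto (fun p : ℂ × ℂ × ℂ => (h p.1, scaling n p)) (𝓝 0) (𝓝 0) := by
    have := (analyticAt_scalingArg hh.analyticAt hn).continuousAt
    rw [ContinuousAt, scalingArg_zero hh.map_zero] at this
    exact this
  refine ⟨h, scaling n, timeFactor D D' h n, hh, analyticAt_scaling hn,
    Eventually.of_forall (scaling_axis n), isInvertible_fderiv_scaling hn hn0, hr,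
    analyticAt_timeFactor hh.analyticAt hh.map_zero hn, timeFactor_real hh hn hr, ?_⟩
  have hgap : ∀ᶠ p in 𝓝 0, gap D' p ≠ 0 :=
    (analyticAt_gap D').continuousAt.eventually_ne D'.p1_sub_q2_zero_ne
  filter_upwards [hn.eventually_analyticAt, ht.eventually hgap, hdef, field_eq hF hD,
    ht.eventually (field_eq hG hD')] with p h1 h2 h3 h4 h5
  rw [h4, h5]
  exact fderiv_scaling_eq h1.differentiableAt h2 h3

/-- The case of counterclockwise rotation. -/
theorem realOrbitallyEquivalent_of_pos (hF : 0 < (F.β 0).re) (hG : 0 < (G.β 0).re)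
    (hFG : RealConjugate F.poincareMap G.poincareMap) : RealOrbitallyEquivalent F G := by
  obtain ⟨D, hD⟩ := F.exists_represents hF
  obtain ⟨D', hD'⟩ := G.exists_represents hG
  obtain ⟨F₁, hβ, h1, h2, hax⟩ := hD.exists_prepared
  obtain ⟨G₁, hβ', h1', h2', hax'⟩ := hD'.exists_prepared
  obtain ⟨E, hE, hEd⟩ := exists_represents_diagonal (by rwa [hβ]) hax
  obtain ⟨E', hE', hEd'⟩ := exists_represents_diagonal (by rwa [hβ']) hax'
  -- Preparation is an orbital equivalence, so by the implication already proved it changes the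
  -- Poincaré maps only by real conjugacies.
  have h3 : RealConjugate F₁.poincareMap G₁.poincareMap :=
    ((hE.realConjugate hD h2).trans hFG).trans (hD'.realConjugate hE' h1')
  exact realOrbitallyEquivalent_trans
    (realOrbitallyEquivalent_trans h1 (realOrbitallyEquivalent_of_diagonal hE hE' hEd hEd' h3)) h2'

/-- The families `F` and `F₁` are interchangeable. -/
lemma exists_pos (F : GenericFamily) : ∃ F₁ : GenericFamily, 0 < (F₁.β 0).re ∧
    RealOrbitallyEquivalent F F₁ ∧ RealOrbitallyEquivalent F₁ F ∧
    F.poincareMap =ᶠ[𝓝 0] F₁.poincareMap := by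
  rcases lt_or_gt_of_ne F.β_zero_re_ne with h | h
  · have hs : 0 < (F.swap.β 0).re := by
      simpa [swap] using h
    obtain ⟨D, hD⟩ := F.swap.exists_represents hs
    have h1 := hD.poincareMap_swap
    rw [swap_swap] at h1
    exact ⟨F.swap, hs, realOrbitallyEquivalent_swap F, realOrbitallyEquivalent_swap_left F, h1⟩
  · have h1 := realOrbitallyEquivalent_trans (realOrbitallyEquivalent_swap F)
      (realOrbitallyEquivalent_swap_left F)
    exact ⟨F, h, h1, h1, EventuallyEq.rfl⟩

end WeakFocus

end

theorem mainTheorem1 (F G : WeakFocus.GenericFamily) :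
    WeakFocus.RealOrbitallyEquivalent F G ↔
      WeakFocus.RealConjugate F.poincareMap G.poincareMap := by
  obtain ⟨F₁, hF, hF1, hF2, hFP⟩ := WeakFocus.exists_pos F
  obtain ⟨G₁, hG, hG1, hG2, hGP⟩ := WeakFocus.exists_pos G
  constructor
  · intro h
    obtain ⟨D, hD⟩ := F₁.exists_represents hF
    obtain ⟨D', hD'⟩ := G₁.exists_represents hG
    exact (hD.realConjugate hD' (WeakFocus.realOrbitallyEquivalent_trans
      (WeakFocus.realOrbitallyEquivalent_trans hF2 h) hG1)).congr hFP hGP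
  · intro h
    have h1 := WeakFocus.realOrbitallyEquivalent_of_pos hF hG (h.congr hFP.symm hGP.symm)
    exact WeakFocus.realOrbitallyEquivalent_trans
      (WeakFocus.realOrbitallyEquivalent_trans hF1 h1) hG2
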